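/- Let $k=\mathbb R$ or $k=\mathbb C$. **Algebra.** A super algebra is a finite-dimensional, unital, associative, $\mathbb Z/2$-graded $k$-algebra; homomorphisms are even. Bimodules between super algebras are finite-dimensional and $\mathbb Z/2$-graded, and intertwiners are even. An $A$-$B$-bimodule $M$ is *invertible* if there is a $B$-$A$-bimodule $N$ with $M\otimes_B N\cong A$ and $N\otimes_A M\cong B$; $A$ and $B$ are *Morita equivalent* if such an $M$ exists. For $\varphi\in\mathrm{Aut}(A)$ (even automorphisms) let $A_\varphi$ be the $A$-$A$-bimodule $A$ with left action by multiplication and right action $m\triangleleft a=m\varphi(a)$. $A$ is *Picard-surjective* if every invertible $A$-$A$-bimodule is isomorphic to $A_\varphi$ for some $\varphi\in\mathrm{Aut}(A)$. The first graded Hochschild cohomology $\mathrm{HH}^1(A)$ is the space of even derivations of $A$ modulo the inner derivations $[c,-]$, $c\in A_0$. The crossed module $\mathrm{AUT}(A)$ is $i:A_0^\times\to\mathrm{Aut}(A)$, $i(a)(b)=aba^{-1}$, with the evident action of $\mathrm{Aut}(A)$ on $A_0^\times$. **Super 2-vector bundles.** Let $X$ be a smooth manifold. A super algebra bundle is a smooth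 vector bundle with super algebra structures on its fibres, locally trivial as such; it is *of Morita class $A$* if around each point it has a local trivialization whose typical fibre is Morita equivalent to $A$. An $\mathcal A$-$\mathcal B$-bimodule bundle is a smooth vector bundle whose fibres are bimodules and which is, along local trivializations of $\mathcal A$ and $\mathcal B$, locally isomorphic to a fixed bimodule; it is invertible if there is a $\mathcal B$-$\mathcal A$-bimodule bundle inverse to it under the relative tensor product, up to smooth isomorphism. A *super 2-vector bundle* $\mathscr V=(\pi,\mathcal A,\mathcal M,\mu)$ over $X$ consists of a surjective submersion $\pi:Y\to X$, a super algebra bundle $\mathcal A$ over $Y$, an invertible bimodule bundle $\mathcal M$ over $Y^{[2]}=Y\times_XY$ whose fibre $\mathcal M_{y_1,y_2}$ is an $\mathcal A_{y_2}$-$\mathcal A_{y_1}$-bimodule, and smooth invertible intertwiners $\mu:\mathcal M_{y_2,y_3}\otimes_{\mathcal A_{y_2}}\mathcal M_{y_1,y_2}\to\mathcal M_{y_1,y_3}$ over $Y^{[3]}$ that are associative over $Y^{[4]}$. It is of Morita class $A$ if $\mathcal A$ is. A *1-morphism* $\mathscr V_1\to\mathscr V_2$ consists of a surjective submersion $\zeta:Z\to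 Y_1\times_XY_2$, a bimodule bundle $\mathcal P$ over $Z$ whose fibre at $z$ with $\zeta(z)=(y_1,y_2)$ is an $(\mathcal A_2)_{y_2}$-$(\mathcal A_1)_{y_1}$-bimodule, and smooth invertible intertwiners $\phi_{z,z'}:(\mathcal M_2)_{y_2,y_2'}\otimes\mathcal P_z\to\mathcal P_{z'}\otimes(\mathcal M_1)_{y_1,y_1'}$ over $Z\times_XZ$ that are compatible with $\mu_1$ and $\mu_2$ over $Z\times_XZ\times_XZ$. The composite of $\mathcal P:\mathscr V_1\to\mathscr V_2$ and $\mathcal Q:\mathscr V_2\to\mathscr V_3$ has the bimodule bundle $\mathcal Q\otimes_{\mathcal A_2}\mathcal P$ over $Z_P\times_{Y_2}Z_Q$ and the intertwiner $(\mathrm{id}\otimes\phi_P)\circ(\phi_Q\otimes\mathrm{id})$; the identity 1-morphism of $\mathscr V$ is given by $\mathcal M$ over $Y^{[2]}$ and $\mu^{-1}\circ\mu$. An invertible 2-morphism between 1-morphisms is a smooth invertible intertwiner of their bimodule bundles, over a surjective submersion to $Z\times_{Y_1\times_XY_2}Z'$, that commutes with the intertwiners $\phi$ and $\phi'$. Two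 super 2-vector bundles are *isomorphic* if there are 1-morphisms in both directions whose two composites admit invertible 2-morphisms to the identities. **Čech cohomology.** A cocycle with values in $\mathrm{AUT}(A)$ consists of an open cover $(U_\alpha)$ of $X$ and smooth maps $g_{\alpha\beta}:U_\alpha\cap U_\beta\to\mathrm{Aut}(A)$, $a_{\alpha\beta\gamma}:U_\alpha\cap U_\beta\cap U_\gamma\to A_0^\times$ with $$i(a_{\alpha\beta\gamma})\,g_{\beta\gamma}\,g_{\alpha\beta}=g_{\alpha\gamma},\qquad a_{\alpha\gamma\delta}\;g_{\gamma\delta}(a_{\alpha\beta\gamma})=a_{\alpha\beta\delta}\,a_{\beta\gamma\delta}.$$ Cocycles $(g,a)$ and $(g',a')$ are equivalent if, after restriction to a common refinement of the two covers, there are smooth maps $h_\alpha$ to $\mathrm{Aut}(A)$ and $e_{\alpha\beta}$ to $A_0^\times$ with $$i(e_{\alpha\beta})\,h_\beta\,g_{\alpha\beta}=g'_{\alpha\beta}\,h_\alpha,\qquad a'_{\alpha\beta\gamma}\;g'_{\beta\gamma}(e_{\alpha\beta})\;e_{\beta\gamma}=e_{\alpha\gamma}\;h_\gamma(a_{\alpha\beta\gamma}).$$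 The set of equivalence classes is $\check{\mathrm H}^1(X,\mathrm{AUT}(A))$. **Theorem.** Let $A$ be a Picard-surjective super algebra with $\mathrm{HH}^1(A)=0$, and let $X$ be a smooth manifold. Then isomorphism classes of super 2-vector bundles over $X$ of Morita class $A$ are in canonical bijection with $\check{\mathrm H}^1(X,\mathrm{AUT}(A))$. Precisely, for every cocycle $(g,a)$ on a countable open cover $(U_\alpha)$ the data $Y=\coprod_\alpha U_\alpha$, $\mathcal A=Y\times A$, $\mathcal M=A_{g_{\alpha\beta}}$ over $U_\alpha\cap U_\beta$, and $\mu(x\otimes y)=x\,g_{\beta\gamma}(y)\,a_{\alpha\beta\gamma}^{-1}$ over $U_\alpha\cap U_\beta\cap U_\gamma$ form a super 2-vector bundle of Morita class $A$, and there is exactly one bijection from $\check{\mathrm H}^1(X,\mathrm{AUT}(A))$ to the set of isomorphism classes that sends the class of each such cocycle to the class of this bundle. -/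

import Mathlib

open scoped Manifold ContDiff Topology TensorProduct

universe u

noncomputable section

namespace SuperTwoVect

/-! ## Super algebras, bimodules, Morita theory

The ground field `𝕜` is `ℝ` or `ℂ` (`RCLike 𝕜`). -/

section Algebra

/-- A super algebra: a finite-dimensional, `ℤ/2`-graded, unital, associative `𝕜`-algebra. -/
structure SAlg (𝕜 : Type) [RCLike 𝕜] : Type (u + 1) where
  carrier : Type u
  [ring : Ring carrier]
  [algebra : Algebra 𝕜 carrier]
  [finite : FiniteDimensional 𝕜 carrier]
  gr : ZMod 2 → Submodule 𝕜 carrier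
  isCompl : IsCompl (gr 0) (gr 1)
  one_mem : (1 : carrier) ∈ gr 0
  mul_mem : ∀ {i j : ZMod 2} {a b : carrier}, a ∈ gr i → b ∈ gr j → a * b ∈ gr (i + j)

attribute [instance] SAlg.ring SAlg.algebra SAlg.finite

variable {𝕜 : Type} [RCLike 𝕜]

instance : CoeSort (SAlg.{u} 𝕜) (Type u) := ⟨SAlg.carrier⟩

/-- A (super) `A`-`B`-bimodule: finitely generated (equivalently, finite-dimensional),
`ℤ/2`-graded, with commuting left action of `A` and right action of `B`.
`left a m` is `a ▹ m` and `right b m` is `m ◃ b`. -/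
structure SBimod (A B : SAlg.{u} 𝕜) : Type (u + 1) where
  carrier : Type u
  [addCommGroup : AddCommGroup carrier]
  [module : Module 𝕜 carrier]
  [finite : FiniteDimensional 𝕜 carrier]
  gr : ZMod 2 → Submodule 𝕜 carrier
  isCompl : IsCompl (gr 0) (gr 1)
  left : A →ₗ[𝕜] Module.End 𝕜 carrier
  right : B →ₗ[𝕜] Module.End 𝕜 carrier
  left_one : ∀ m, left 1 m = m
  left_mul : ∀ a a' m, left (a * a') m = left a (left a' m)
  right_one : ∀ m, right 1 m = m
  right_mul : ∀ b b' m, right (b * b') m = right b' (right b m)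
  left_right : ∀ a b m, left a (right b m) = right b (left a m)
  left_mem : ∀ {i j : ZMod 2} {a m}, a ∈ A.gr i → m ∈ gr j → left a m ∈ gr (i + j)
  right_mem : ∀ {i j : ZMod 2} {m b}, m ∈ gr i → b ∈ B.gr j → right b m ∈ gr (i + j)

attribute [instance] SBimod.addCommGroup SBimod.module SBimod.finite

instance {A B : SAlg.{u} 𝕜} : CoeSort (SBimod A B) (Type u) := ⟨SBimod.carrier⟩

/-- A homomorphism of super algebras (always even). -/
structure SAlgHom (A B : SAlg.{u} 𝕜) where
  toAlgHom : A →ₐ[𝕜] B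
  even : ∀ {i : ZMod 2} {a : A}, a ∈ A.gr i → toAlgHom a ∈ B.gr i

/-- The identity, for two super algebras that are (propositionally) the same. -/
def SAlgHom.ofEq {A B : SAlg.{u} 𝕜} (h : A = B) : SAlgHom A B := by
  subst h
  exact ⟨AlgHom.id 𝕜 A, fun h => h⟩

/-- The linear map `f` is an isomorphism of super algebras. -/
def IsSAlgIso {A B : SAlg.{u} 𝕜} (f : A →ₗ[𝕜] B) : Prop :=
  Function.Bijective f ∧ f 1 = 1 ∧ (∀ a a', f (a * a') = f a * f a') ∧
    ∀ (i : ZMod 2) (a : A), a ∈ A.gr i → f a ∈ B.gr i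

namespace SBimod

variable {A B C A' B' : SAlg.{u} 𝕜}

/-- An even intertwiner of bimodules. -/
structure Hom (M N : SBimod A B) where
  toLin : M →ₗ[𝕜] N
  even : ∀ {i : ZMod 2} {m : M}, m ∈ M.gr i → toLin m ∈ N.gr i
  map_left : ∀ a m, toLin (M.left a m) = N.left a (toLin m)
  map_right : ∀ b m, toLin (M.right b m) = N.right b (toLin m)

instance {M N : SBimod A B} : CoeFun (Hom M N) (fun _ => M → N) := ⟨fun f => f.toLin⟩

/-- Existence of an invertible even intertwiner. -/
def Isomorphic (M N : SBimod A B) : Prop :=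
  ∃ f : Hom M N, Function.Bijective f

/-- The identity bimodule `A`. -/
def self (A : SAlg.{u} 𝕜) : SBimod A A where
  carrier := A
  gr := A.gr
  isCompl := A.isCompl
  left := LinearMap.mul 𝕜 A
  right := (LinearMap.mul 𝕜 A).flip
  left_one := by simp
  left_mul := by simp [mul_assoc]
  right_one := by simp
  right_mul := by simp [mul_assoc]
  left_right := by simp [mul_assoc]
  left_mem := A.mul_mem
  right_mem := A.mul_mem

/-- The bimodule `M` with the left action restricted along `φ : A' → A`. -/
def twistL (φ : SAlgHom A' A) (M : SBimod A B) : SBimod A' B where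
  carrier := M
  gr := M.gr
  isCompl := M.isCompl
  left := M.left ∘ₗ φ.toAlgHom.toLinearMap
  right := M.right
  left_one := by simp [M.left_one]
  left_mul := by simp [M.left_mul]
  right_one := M.right_one
  right_mul := M.right_mul
  left_right := by simp [M.left_right]
  left_mem := fun ha hm => M.left_mem (φ.even ha) hm
  right_mem := M.right_mem

/-- The bimodule `M` with the right action restricted along `φ : B' → B`. -/
def twistR (M : SBimod A B) (φ : SAlgHom B' B) : SBimod A B' where
  carrier := M
  gr := M.gr
  isCompl := M.isCompl
  left := M.left
  right := M.right ∘ₗ φ.toAlgHom.toLinearMap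
  left_one := M.left_one
  left_mul := M.left_mul
  right_one := by simp [M.right_one]
  right_mul := by simp [M.right_mul]
  left_right := by simp [M.left_right]
  left_mem := M.left_mem
  right_mem := fun hm hb => M.right_mem hm (φ.even hb)

/-! ### The relative tensor product `M ⊗_B N` -/

/-- The relations `(m ◃ b) ⊗ n = m ⊗ (b ▹ n)`. -/
def tensorRel (M : SBimod A B) (N : SBimod B C) : Submodule 𝕜 (M ⊗[𝕜] N) :=
  Submodule.span 𝕜 {t | ∃ (m : M) (b : B) (n : N), t = M.right b m ⊗ₜ n - m ⊗ₜ N.left b n}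

/-- The span of the `m ⊗ n` with `m`, `n` homogeneous and `|m| + |n| = i`. -/
def tensorGr (M : SBimod A B) (N : SBimod B C) (i : ZMod 2) : Submodule 𝕜 (M ⊗[𝕜] N) :=
  Submodule.span 𝕜 {t | ∃ (j k : ZMod 2) (m : M) (n : N),
    j + k = i ∧ m ∈ M.gr j ∧ n ∈ N.gr k ∧ t = m ⊗ₜ n}

theorem exists_parity {V : Type u} [AddCommGroup V] [Module 𝕜 V] {gr : ZMod 2 → Submodule 𝕜 V}
    (h : IsCompl (gr 0) (gr 1)) :
    ∃ ε : V →ₗ[𝕜] V, ∀ (i : ZMod 2) (v : V), v ∈ gr i → ε v = (-1 : 𝕜) ^ i.val • v := by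
  refine ⟨LinearMap.ofIsCompl h (gr 0).subtype (-(gr 1).subtype), fun i v hv => ?_⟩
  fin_cases i
  · have := LinearMap.ofIsCompl_apply_left h (φ := (gr 0).subtype) (ψ := -(gr 1).subtype) ⟨v, hv⟩
    simpa [ZMod.val] using this
  · have := LinearMap.ofIsCompl_apply_right h (φ := (gr 0).subtype) (ψ := -(gr 1).subtype) ⟨v, hv⟩
    simpa [ZMod.val] using this

theorem exists_homogeneous {V : Type u} [AddCommGroup V] [Module 𝕜 V]
    {gr : ZMod 2 → Submodule 𝕜 V} (h : IsCompl (gr 0) (gr 1)) (v : V) :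
    ∃ v₀ ∈ gr 0, ∃ v₁ ∈ gr 1, v = v₀ + v₁ := by
  have hv : v ∈ gr 0 ⊔ gr 1 := by rw [h.sup_eq_top]; trivial
  obtain ⟨v₀, h₀, v₁, h₁, e⟩ := Submodule.mem_sup.1 hv
  exact ⟨v₀, h₀, v₁, h₁, e.symm⟩

theorem negOne_pow_val_add (i j : ZMod 2) :
    (-1 : 𝕜) ^ (i + j).val = (-1) ^ i.val * (-1) ^ j.val := by
  have h : ∀ i j : ZMod 2, (i + j).val % 2 = (i.val + j.val) % 2 := by decide
  rw [← pow_add, neg_one_pow_eq_pow_mod_two, h, ← neg_one_pow_eq_pow_mod_two]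

theorem tensor_isCompl (M : SBimod A B) (N : SBimod B C) :
    IsCompl ((tensorGr M N 0).map (tensorRel M N).mkQ)
      ((tensorGr M N 1).map (tensorRel M N).mkQ) := by
  obtain ⟨εM, hM⟩ := exists_parity M.isCompl
  obtain ⟨εN, hN⟩ := exists_parity N.isCompl
  obtain ⟨εB, hB⟩ := exists_parity B.isCompl
  have hR : ∀ b m, εM (M.right b m) = M.right (εB b) (εM m) := by
    have key : ∀ (i j : ZMod 2) (b : B) (m : M), b ∈ B.gr i → m ∈ M.gr j →
        εM (M.right b m) = M.right (εB b) (εM m) := by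
      intro i j b m hb hm
      rw [hM _ _ (M.right_mem hm hb), hB _ _ hb, hM _ _ hm, negOne_pow_val_add]
      simp [smul_smul, mul_comm]
    intro b m
    obtain ⟨b₀, hb₀, b₁, hb₁, rfl⟩ := exists_homogeneous B.isCompl b
    obtain ⟨m₀, hm₀, m₁, hm₁, rfl⟩ := exists_homogeneous M.isCompl m
    simp [key _ _ _ _ hb₀ hm₀, key _ _ _ _ hb₀ hm₁, key _ _ _ _ hb₁ hm₀, key _ _ _ _ hb₁ hm₁]
  have hL : ∀ b n, εN (N.left b n) = N.left (εB b) (εN n) := by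
    have key : ∀ (i j : ZMod 2) (b : B) (n : N), b ∈ B.gr i → n ∈ N.gr j →
        εN (N.left b n) = N.left (εB b) (εN n) := by
      intro i j b n hb hn
      rw [hN _ _ (N.left_mem hb hn), hB _ _ hb, hN _ _ hn, negOne_pow_val_add]
      simp [smul_smul, mul_comm]
    intro b n
    obtain ⟨b₀, hb₀, b₁, hb₁, rfl⟩ := exists_homogeneous B.isCompl b
    obtain ⟨n₀, hn₀, n₁, hn₁, rfl⟩ := exists_homogeneous N.isCompl n
    simp [key _ _ _ _ hb₀ hn₀, key _ _ _ _ hb₀ hn₁, key _ _ _ _ hb₁ hn₀, key _ _ _ _ hb₁ hn₁]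
  have hrel : tensorRel M N ≤ (tensorRel M N).comap (TensorProduct.map εM εN) := by
    refine Submodule.span_le.2 ?_
    rintro _ ⟨m, b, n, rfl⟩
    refine Submodule.subset_span ⟨εM m, εB b, εN n, ?_⟩
    simp [hR, hL]
  let ε := (tensorRel M N).mapQ (tensorRel M N) (TensorProduct.map εM εN) hrel
  have hε : ∀ (i : ZMod 2) x, x ∈ (tensorGr M N i).map (tensorRel M N).mkQ →
      ε x = (-1 : 𝕜) ^ i.val • x := by
    intro i x hx
    obtain ⟨t, ht, rfl⟩ := hx
    have : TensorProduct.map εM εN t = (-1 : 𝕜) ^ i.val • t := by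
      refine Submodule.span_induction ?_ ?_ ?_ ?_ ht
      · rintro _ ⟨j, k, m, n, rfl, hm, hn, rfl⟩
        rw [TensorProduct.map_tmul, hM _ _ hm, hN _ _ hn, negOne_pow_val_add,
          TensorProduct.smul_tmul_smul]
      · simp
      · intro x y _ _ hx hy
        rw [map_add, hx, hy, smul_add]
      · intro a x _ hx
        rw [map_smul, hx, smul_comm]
    simp only [ε, Submodule.mkQ_apply, Submodule.mapQ_apply, this, Submodule.Quotient.mk_smul]
  constructor
  · rw [Submodule.disjoint_def]
    intro x h₀ h₁
    have e₀ := hε 0 x h₀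
    have e₁ := hε 1 x h₁
    simp only [ZMod.val_zero, pow_zero, one_smul, ZMod.val_one, pow_one, neg_smul] at e₀ e₁
    rw [e₀] at e₁
    have h2 : (2 : 𝕜) • x = 0 := by rw [two_smul]; nth_rewrite 1 [e₁]; simp
    exact (smul_eq_zero.1 h2).resolve_left two_ne_zero
  · rw [codisjoint_iff, ← Submodule.map_sup]
    have : tensorGr M N 0 ⊔ tensorGr M N 1 = ⊤ := by
      rw [eq_top_iff, ← TensorProduct.span_tmul_eq_top, Submodule.span_le]
      rintro _ ⟨m, n, rfl⟩
      obtain ⟨m₀, hm₀, m₁, hm₁, rfl⟩ := exists_homogeneous M.isCompl m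
      obtain ⟨n₀, hn₀, n₁, hn₁, rfl⟩ := exists_homogeneous N.isCompl n
      have key : ∀ (i j k : ZMod 2) (m : M) (n : N), j + k = i → m ∈ M.gr j → n ∈ N.gr k →
          m ⊗ₜ[𝕜] n ∈ tensorGr M N i :=
        fun i j k m n h hm hn => Submodule.subset_span ⟨j, k, m, n, h, hm, hn, rfl⟩
      rw [TensorProduct.add_tmul, TensorProduct.tmul_add, TensorProduct.tmul_add]
      refine add_mem (add_mem ?_ ?_) (add_mem ?_ ?_)
      · exact Submodule.mem_sup_left (key 0 0 0 _ _ rfl hm₀ hn₀)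
      · exact Submodule.mem_sup_right (key 1 0 1 _ _ rfl hm₀ hn₁)
      · exact Submodule.mem_sup_right (key 1 1 0 _ _ rfl hm₁ hn₀)
      · exact Submodule.mem_sup_left (key 0 1 1 _ _ rfl hm₁ hn₁)
    rw [this, Submodule.map_top, Submodule.range_mkQ]

theorem tensorRel_le_left (M : SBimod A B) (N : SBimod B C) (a : A) :
    tensorRel M N ≤ (tensorRel M N).comap ((M.left a).rTensor N) := by
  refine Submodule.span_le.2 ?_
  rintro _ ⟨m, b, n, rfl⟩
  refine Submodule.subset_span ⟨M.left a m, b, n, ?_⟩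
  simp [M.left_right]

theorem tensorRel_le_right (M : SBimod A B) (N : SBimod B C) (c : C) :
    tensorRel M N ≤ (tensorRel M N).comap ((N.right c).lTensor M) := by
  refine Submodule.span_le.2 ?_
  rintro _ ⟨m, b, n, rfl⟩
  refine Submodule.subset_span ⟨m, b, N.right c n, ?_⟩
  simp [N.left_right]

/-- Linear maps out of the relative tensor product are determined on pure tensors. -/
theorem tensor_ext {M : SBimod A B} {N : SBimod B C} {V : Type u} [AddCommGroup V] [Module 𝕜 V]
    {f g : ((M ⊗[𝕜] N) ⧸ tensorRel M N) →ₗ[𝕜] V}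
    (h : ∀ m n, f (Submodule.Quotient.mk (m ⊗ₜ n)) = g (Submodule.Quotient.mk (m ⊗ₜ n))) :
    f = g := by
  refine Submodule.linearMap_qext _ (TensorProduct.ext' fun m n => ?_)
  simpa using h m n

/-- The relative tensor product `M ⊗_B N`, an `A`-`C`-bimodule with the total grading. -/
def tensor (M : SBimod A B) (N : SBimod B C) : SBimod A C where
  carrier := (M ⊗[𝕜] N) ⧸ tensorRel M N
  gr i := (tensorGr M N i).map (tensorRel M N).mkQ
  isCompl := tensor_isCompl M N
  left :=
    { toFun := fun a => (tensorRel M N).mapQ (tensorRel M N) ((M.left a).rTensor N)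
        (tensorRel_le_left M N a)
      map_add' := fun a b => tensor_ext fun m n => by simp
      map_smul' := fun a b => tensor_ext fun m n => by
        simp only [map_smul, Submodule.mapQ_apply, LinearMap.rTensor_tmul, LinearMap.smul_apply,
          RingHom.id_apply, ← Submodule.Quotient.mk_smul, TensorProduct.smul_tmul'] }
  right :=
    { toFun := fun c => (tensorRel M N).mapQ (tensorRel M N) ((N.right c).lTensor M)
        (tensorRel_le_right M N c)
      map_add' := fun a b => tensor_ext fun m n => by simp
      map_smul' := fun a b => tensor_ext fun m n => by simp }
  left_one := fun x => by
    refine LinearMap.congr_fun (g := LinearMap.id) (tensor_ext fun m n => ?_) x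
    simp [M.left_one]
  left_mul := fun a a' x => by
    refine LinearMap.congr_fun (g := ((tensorRel M N).mapQ (tensorRel M N) ((M.left a).rTensor N)
      (tensorRel_le_left M N a)) ∘ₗ ((tensorRel M N).mapQ (tensorRel M N) ((M.left a').rTensor N)
      (tensorRel_le_left M N a'))) (tensor_ext fun m n => ?_) x
    simp [M.left_mul]
  right_one := fun x => by
    refine LinearMap.congr_fun (g := LinearMap.id) (tensor_ext fun m n => ?_) x
    simp [N.right_one]
  right_mul := fun c c' x => by
    refine LinearMap.congr_fun (g := ((tensorRel M N).mapQ (tensorRel M N) ((N.right c').lTensor M)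
      (tensorRel_le_right M N c')) ∘ₗ ((tensorRel M N).mapQ (tensorRel M N)
      ((N.right c).lTensor M) (tensorRel_le_right M N c))) (tensor_ext fun m n => ?_) x
    simp [N.right_mul]
  left_right := fun a c x => by
    refine LinearMap.congr_fun (f := ((tensorRel M N).mapQ (tensorRel M N) ((M.left a).rTensor N)
      (tensorRel_le_left M N a)) ∘ₗ ((tensorRel M N).mapQ (tensorRel M N) ((N.right c).lTensor M)
      (tensorRel_le_right M N c))) (g := ((tensorRel M N).mapQ (tensorRel M N)
      ((N.right c).lTensor M) (tensorRel_le_right M N c)) ∘ₗ ((tensorRel M N).mapQ (tensorRel M N)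
      ((M.left a).rTensor N) (tensorRel_le_left M N a))) (tensor_ext fun m n => ?_) x
    simp
  left_mem := by
    rintro i j a _ ha ⟨t, ht, rfl⟩
    refine ⟨(M.left a).rTensor N t, ?_, by simp⟩
    refine Submodule.span_induction ?_ ?_ ?_ ?_ ht
    · rintro _ ⟨k, l, m, n, rfl, hm, hn, rfl⟩
      exact Submodule.subset_span
        ⟨i + k, l, M.left a m, n, add_assoc _ _ _, M.left_mem ha hm, hn, by simp⟩
    · simp
    · intro x y _ _ hx hy
      rw [map_add]
      exact add_mem hx hy
    · intro r x _ hx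
      rw [map_smul]
      exact Submodule.smul_mem _ _ hx
  right_mem := by
    rintro i j _ c ⟨t, ht, rfl⟩ hc
    refine ⟨(N.right c).lTensor M t, ?_, by simp⟩
    refine Submodule.span_induction ?_ ?_ ?_ ?_ ht
    · rintro _ ⟨k, l, m, n, rfl, hm, hn, rfl⟩
      exact Submodule.subset_span
        ⟨k, l + j, m, N.right c n, (add_assoc _ _ _).symm, hm, N.right_mem hn hc, by simp⟩
    · simp
    · intro x y _ _ hx hy
      rw [map_add]
      exact add_mem hx hy
    · intro r x _ hx
      rw [map_smul]
      exact Submodule.smul_mem _ _ hx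

/-- The class of `m ⊗ n` in `M ⊗_B N`. -/
def tmul {M : SBimod A B} {N : SBimod B C} (m : M) (n : N) : tensor M N :=
  (tensorRel M N).mkQ (m ⊗ₜ n)

/-- An `A`-`B`-bimodule `M` is invertible if `M ⊗_B N ≅ A` and `N ⊗_A M ≅ B` for some
`B`-`A`-bimodule `N`. -/
def Invertible (M : SBimod A B) : Prop :=
  ∃ N : SBimod B A, Isomorphic (tensor M N) (self A) ∧ Isomorphic (tensor N M) (self B)

end SBimod

/-- Morita equivalence of super algebras. -/
def MoritaEquivalent (A B : SAlg.{u} 𝕜) : Prop := ∃ M : SBimod A B, M.Invertible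

/-- The group `A₀ˣ` of even units. -/
def evenUnits (A : SAlg.{u} 𝕜) : Subgroup (A : Type u)ˣ where
  carrier := {a | (a : A) ∈ A.gr 0}
  one_mem' := A.one_mem
  mul_mem' := fun ha hb => by simpa using A.mul_mem ha hb
  inv_mem' := by
    intro a ha
    obtain ⟨b₀, h₀, b₁, h₁, e⟩ := SBimod.exists_homogeneous A.isCompl (↑a⁻¹ : A)
    have h1 : (1 : A) = a * b₀ + a * b₁ := by rw [← mul_add, ← e, Units.mul_inv]
    have m₀ : (a : A) * b₀ ∈ A.gr 0 := by simpa using A.mul_mem ha h₀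
    have m₁ : (a : A) * b₁ ∈ A.gr 1 := by simpa using A.mul_mem ha h₁
    have h2 : (a : A) * b₁ ∈ A.gr 0 := by
      have : (a : A) * b₁ = 1 - a * b₀ := by rw [h1]; abel
      rw [this]
      exact sub_mem A.one_mem m₀
    have h3 : (a : A) * b₁ = 0 := (Submodule.disjoint_def.1 A.isCompl.disjoint) _ h2 m₁
    have h4 : b₁ = 0 := by simpa using h3
    show (↑a⁻¹ : A) ∈ A.gr 0
    rw [e, h4, add_zero]
    exact h₀

/-- The group `Aut(A)` of even automorphisms. -/
def evenAut (A : SAlg.{u} 𝕜) : Subgroup (A ≃ₐ[𝕜] A) where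
  carrier := {φ | ∀ (i : ZMod 2) (a : A), φ a ∈ A.gr i ↔ a ∈ A.gr i}
  one_mem' := fun _ _ => Iff.rfl
  mul_mem' := fun {φ ψ} hφ hψ i a => (hφ i (ψ a)).trans (hψ i a)
  inv_mem' := fun {φ} hφ i a => by
    have := hφ i (φ⁻¹ a)
    rw [show φ (φ⁻¹ a) = a from φ.apply_symm_apply a] at this
    exact this.symm

/-- An even automorphism as a homomorphism of super algebras. -/
def evenAut.toHom {A : SAlg.{u} 𝕜} (φ : evenAut A) : SAlgHom A A :=
  ⟨φ.1.toAlgHom, fun {i a} h => (φ.2 i a).2 h⟩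

/-- The inner automorphism `i(a) : b ↦ a b a⁻¹`. -/
def innerAut {A : SAlg.{u} 𝕜} (a : evenUnits A) : evenAut A :=
  ⟨{ toFun := fun b => a.1 * b * ↑a.1⁻¹
     invFun := fun b => ↑a.1⁻¹ * b * a.1
     left_inv := fun b => by simp [mul_assoc]
     right_inv := fun b => by simp [mul_assoc]
     map_mul' := fun b c => by simp [mul_assoc]
     map_add' := fun b c => by simp [mul_add, add_mul]
     commutes' := fun r => by
      rw [← Algebra.commutes r (a.1 : A), mul_assoc, Units.mul_inv, mul_one] },
   fun i b => by
    have h1 : (a.1 : A) ∈ A.gr 0 := a.2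
    have h2 : (↑a.1⁻¹ : A) ∈ A.gr 0 := (a⁻¹).2
    show (a.1 : A) * b * ↑a.1⁻¹ ∈ A.gr i ↔ b ∈ A.gr i
    refine ⟨fun h => ?_, fun h => by simpa using A.mul_mem (A.mul_mem h1 h) h2⟩
    simpa [mul_assoc] using A.mul_mem (A.mul_mem h2 h) h1⟩

/-- The action of `Aut(A)` on `A₀ˣ` by evaluation. -/
def autAct {A : SAlg.{u} 𝕜} (φ : evenAut A) (a : evenUnits A) : evenUnits A :=
  ⟨Units.map (φ.1 : A →* A) a.1, (φ.2 0 a.1).2 a.2⟩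

/-- `A` is Picard-surjective if every invertible `A`-`A`-bimodule is isomorphic to `A_φ` for some
even automorphism `φ`. -/
def PicardSurjective (A : SAlg.{u} 𝕜) : Prop :=
  ∀ M : SBimod A A, M.Invertible →
    ∃ φ : evenAut A, SBimod.Isomorphic M ((SBimod.self A).twistR (evenAut.toHom φ))

/-- Hochschild `1`-cocycles of `A` with coefficients in `A`, in the graded sense: even linear maps
`f : A → A` with `a f(b) - f(ab) + f(a) b = 0`. -/
def hochschildZ1 (A : SAlg.{u} 𝕜) : Submodule 𝕜 (A →ₗ[𝕜] A) where
  carrier := {f | (∀ (i : ZMod 2), ∀ a ∈ A.gr i, f a ∈ A.gr i) ∧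
    ∀ a b, a * f b - f (a * b) + f a * b = 0}
  zero_mem' := by simp
  add_mem' := by
    rintro f g ⟨hf, hf'⟩ ⟨hg, hg'⟩
    refine ⟨fun i a ha => add_mem (hf i a ha) (hg i a ha), fun a b => ?_⟩
    have := congrArg₂ (· + ·) (hf' a b) (hg' a b)
    simp only [add_zero] at this
    rw [← this]
    simp only [LinearMap.add_apply, mul_add, add_mul]
    abel
  smul_mem' := by
    rintro c f ⟨hf, hf'⟩
    refine ⟨fun i a ha => Submodule.smul_mem _ _ (hf i a ha), fun a b => ?_⟩
    have := congrArg (c • ·) (hf' a b)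
    simpa [smul_add, smul_sub] using this

/-- The differential of an even Hochschild `0`-cochain `c ∈ A₀`: the map `b ↦ b c - c b`. -/
def hochschildD0 (A : SAlg.{u} 𝕜) : A.gr 0 →ₗ[𝕜] hochschildZ1 A :=
  LinearMap.codRestrict (hochschildZ1 A)
    (((LinearMap.mul 𝕜 A).flip - LinearMap.mul 𝕜 A) ∘ₗ (A.gr 0).subtype) (by
      rintro ⟨c, hc⟩
      refine ⟨fun i a ha => ?_, fun a b => ?_⟩
      · have h1 := A.mul_mem ha hc
        have h2 := A.mul_mem hc ha
        rw [add_zero] at h1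
        rw [zero_add] at h2
        simpa using sub_mem h1 h2
      · simp [mul_sub, sub_mul, mul_assoc])

/-- The first graded Hochschild cohomology `HH¹(A)`: even derivations modulo inner ones
(as an additive group). -/
abbrev HH1 (A : SAlg.{u} 𝕜) : Type u :=
  hochschildZ1 A ⧸ (LinearMap.range (hochschildD0 A)).toAddSubgroup

end Algebra

/-! ## Manifolds and spaces embedded in manifolds -/

section Spaces

/-- A smooth manifold: finite-dimensional, without boundary, Hausdorff, second countable. -/
structure Mfd : Type (u + 1) where
  E : Type
  H : Type
  carrier : Type u
  [normE : NormedAddCommGroup E]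
  [spaceE : NormedSpace ℝ E]
  [finE : FiniteDimensional ℝ E]
  [topH : TopologicalSpace H]
  I : ModelWithCorners ℝ E H
  [boundaryless : I.Boundaryless]
  [top : TopologicalSpace carrier]
  [charted : ChartedSpace H carrier]
  [isManifold : IsManifold I ∞ carrier]
  [t2 : T2Space carrier]
  [secondCountable : SecondCountableTopology carrier]

attribute [instance] Mfd.normE Mfd.spaceE Mfd.finE Mfd.topH Mfd.boundaryless Mfd.top Mfd.charted
  Mfd.isManifold Mfd.t2 Mfd.secondCountable

instance : CoeSort Mfd.{u} (Type u) := ⟨Mfd.carrier⟩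

/-- The product manifold. -/
def Mfd.prod (M N : Mfd.{u}) : Mfd.{u} where
  E := M.E × N.E
  H := ModelProd M.H N.H
  carrier := M × N
  topH := inferInstanceAs (TopologicalSpace (ModelProd M.H N.H))
  charted := inferInstanceAs (ChartedSpace (ModelProd M.H N.H) (M × N))
  I := M.I.prod N.I

/-- A space `pt` embedded into a manifold `amb`, with the induced topology and smooth structure.
The manifolds themselves and all fibre products of manifolds along submersions (which are embedded
submanifolds of products) are of this form. -/
structure Space : Type (u + 1) where
  pt : Type u
  amb : Mfd.{u}
  j : pt → amb
  inj : Function.Injective j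

namespace Space

/-- The neighbourhood filter of the induced topology. -/
def nhds (B : Space.{u}) (b : B.pt) : Filter B.pt := Filter.comap B.j (𝓝 (B.j b))

/-- A map between embedded spaces is smooth around `b` if, near `b`, it extends to a smooth map
between the ambient manifolds. -/
def SmoothMapAt {B C : Space.{u}} (f : B.pt → C.pt) (b : B.pt) : Prop :=
  ∃ F : B.amb → C.amb, (∃ U ∈ 𝓝 (B.j b), ContMDiffOn B.amb.I C.amb.I ∞ F U) ∧
    ∀ᶠ b' in B.nhds b, C.j (f b') = F (B.j b')

/-- A scalar function on an embedded space is smooth around `b` if, near `b`, it extends to a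
smooth function on the ambient manifold. -/
def SmoothFunAt {𝕜 : Type} [RCLike 𝕜] (B : Space.{u}) (f : B.pt → 𝕜) (b : B.pt) : Prop :=
  ∃ F : B.amb → 𝕜, (∃ U ∈ 𝓝 (B.j b), ContMDiffOn B.amb.I 𝓘(ℝ, 𝕜) ∞ F U) ∧
    ∀ᶠ b' in B.nhds b, f b' = F (B.j b')

/-- Smoothness around `b` of a map into a finite-dimensional vector space (in coordinates). -/
def SmoothVecAt (𝕜 : Type) [RCLike 𝕜] (B : Space.{u}) {F : Type u} [AddCommGroup F] [Module 𝕜 F]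
    (f : B.pt → F) (b : B.pt) : Prop :=
  ∀ l : F →ₗ[𝕜] 𝕜, B.SmoothFunAt (fun b' => l (f b')) b

/-- The embedded space is an embedded submanifold: every point has an ambient neighbourhood with a
smooth retraction to the space. -/
def IsSubmanifold (B : Space.{u}) : Prop :=
  ∀ b : B.pt, ∃ r : B.amb → B.amb, ∃ U ∈ 𝓝 (B.j b), ContMDiffOn B.amb.I B.amb.I ∞ r U ∧
    (∀ x ∈ U, r x ∈ Set.range B.j) ∧ ∀ b' : B.pt, B.j b' ∈ U → r (B.j b') = B.j b'

/-- Surjective submersions: smooth surjections with smooth local sections through every point of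
the domain. -/
def IsSurjSubmersion {Z B : Space.{u}} (f : Z.pt → B.pt) : Prop :=
  (∀ z, SmoothMapAt f z) ∧ Function.Surjective f ∧
    ∀ z, ∃ σ : B.pt → Z.pt, SmoothMapAt σ (f z) ∧ σ (f z) = z ∧ ∀ᶠ b in B.nhds (f z), f (σ b) = b

/-- A manifold as an embedded space. -/
def ofMfd (M : Mfd.{u}) : Space.{u} := ⟨M, M, id, Function.injective_id⟩

/-- The fibre product of `f : B → L` and `g : C → L`, embedded into the product. -/
def fibProd (B C : Space.{u}) {L : Type u} (f : B.pt → L) (g : C.pt → L) : Space.{u} where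
  pt := {p : B.pt × C.pt // f p.1 = g p.2}
  amb := B.amb.prod C.amb
  j := fun p => (B.j p.1.1, C.j p.1.2)
  inj := fun _ _ h => Subtype.ext
    (Prod.ext (B.inj (congrArg Prod.fst h)) (C.inj (congrArg Prod.snd h)))

end Space

/-- `Y^[2]`: pairs of points with the same image under `π`. -/
def fib2 (Y : Mfd.{u}) {X : Type u} (π : Y → X) : Space.{u} :=
  (Space.ofMfd Y).fibProd (Space.ofMfd Y) π π

/-- `Y^[3]`: triples of points with the same image under `π`. -/
def fib3 (Y : Mfd.{u}) {X : Type u} (π : Y → X) : Space.{u} where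
  pt := {q : Y × Y × Y // π q.1 = π q.2.1 ∧ π q.2.1 = π q.2.2}
  amb := Y.prod (Y.prod Y)
  j := Subtype.val
  inj := Subtype.val_injective

end Spaces

/-! ## Bundles

A vector bundle over `B` is given by its fibres and by its smooth sections; `S s b` says that the
section `s` is smooth around `b`. Bundles are required to be locally trivial. -/

section Bundles

variable {𝕜 : Type} [RCLike 𝕜]

/-- A smoothness predicate for the sections of a family of vector spaces. -/
abbrev Sec (B : Space.{u}) (V : B.pt → Type u) : Type u := (∀ b, V b) → B.pt → Prop

/-- The pulled back family: its smooth sections are locally the combinations of pulled back smooth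
sections with smooth coefficients. -/
def pullSec (𝕜 : Type) [RCLike 𝕜] {B C : Space.{u}} {V : C.pt → Type u}
    [∀ c, AddCommGroup (V c)] [∀ c, Module 𝕜 (V c)] (f : B.pt → C.pt) (S : Sec C V) :
    Sec B (fun b => V (f b)) :=
  fun s b => ∃ (n : ℕ) (c : Fin n → B.pt → 𝕜) (σ : Fin n → ∀ x, V x),
    (∀ i, B.SmoothFunAt (c i) b) ∧ (∀ i, S (σ i) (f b)) ∧
      ∀ᶠ b' in B.nhds b, s b' = ∑ i, c i b' • σ i (f b')

/-- The family of relative tensor products: its smooth sections are locally the finite sums of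
`m ⊗ n` with `m`, `n` smooth. -/
def tensorSec {B : Space.{u}} {A₁ A₂ A₃ : B.pt → SAlg.{u} 𝕜}
    (M : ∀ b, SBimod (A₁ b) (A₂ b)) (N : ∀ b, SBimod (A₂ b) (A₃ b))
    (S : Sec B (fun b => (M b).carrier)) (T : Sec B (fun b => (N b).carrier)) :
    Sec B (fun b => ((M b).tensor (N b)).carrier) :=
  fun s b => ∃ (n : ℕ) (x : Fin n → ∀ b, M b) (y : Fin n → ∀ b, N b),
    (∀ i, S (x i) b) ∧ (∀ i, T (y i) b) ∧
      ∀ᶠ b' in B.nhds b, s b' = ∑ i, SBimod.tmul (x i b') (y i b')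

/-- `ψ` is a local trivialization around `b₀`, with typical fibre `F`: near `b₀`, the maps
`ψ b : V b → F` are bijective and identify smooth sections with smooth `F`-valued functions. -/
def IsTriv {B : Space.{u}} {V : B.pt → Type u} [∀ b, AddCommGroup (V b)] [∀ b, Module 𝕜 (V b)]
    {F : Type u} [AddCommGroup F] [Module 𝕜 F] (S : Sec B V) (ψ : ∀ b, V b →ₗ[𝕜] F)
    (b₀ : B.pt) : Prop :=
  ∀ᶠ b in B.nhds b₀, Function.Bijective (ψ b) ∧
    ∀ s, S s b ↔ B.SmoothVecAt 𝕜 (fun b' => ψ b' (s b')) b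

/-- `α` is a local trivialization around `b₀` of a family of super algebras, by isomorphisms of
super algebras to a fixed super algebra `A₀`. -/
def IsAlgTriv {B : Space.{u}} {A : B.pt → SAlg.{u} 𝕜} (S : Sec B (fun b => (A b).carrier))
    {A₀ : SAlg.{u} 𝕜} (α : ∀ b, A b →ₗ[𝕜] A₀) (b₀ : B.pt) : Prop :=
  IsTriv S α b₀ ∧ ∀ᶠ b in B.nhds b₀, IsSAlgIso (α b)

/-- A super algebra bundle over `B`. -/
structure AlgBundle (𝕜 : Type) [RCLike 𝕜] (B : Space.{u}) : Type (u + 1) where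
  fib : B.pt → SAlg.{u} 𝕜
  smooth : Sec B (fun b => (fib b).carrier)
  locTriv : ∀ b₀, ∃ (A₀ : SAlg.{u} 𝕜) (α : ∀ b, fib b →ₗ[𝕜] A₀), IsAlgTriv smooth α b₀

/-- A super algebra bundle is of Morita class `A` if around every point there is a local
trivialization whose typical fibre is Morita equivalent to `A`. -/
def AlgBundle.OfMoritaClass {B : Space.{u}} (𝒜 : AlgBundle 𝕜 B) (A : SAlg.{u} 𝕜) : Prop :=
  ∀ b₀, ∃ (A₀ : SAlg.{u} 𝕜) (α : ∀ b, 𝒜.fib b →ₗ[𝕜] A₀),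
    IsAlgTriv 𝒜.smooth α b₀ ∧ MoritaEquivalent A₀ A

/-- For maps `t : B → BL`, `s : B → BR` and super algebra bundles `𝒜` over `BL`, `ℬ` over `BR`,
a `t^*𝒜`-`s^*ℬ`-bimodule bundle over `B`. Locally it is isomorphic to a fixed bimodule, along
local trivializations of `t^*𝒜` and `s^*ℬ`. -/
structure BimodBundle (B : Space.{u}) {BL BR : Space.{u}} (𝒜 : AlgBundle 𝕜 BL)
    (ℬ : AlgBundle 𝕜 BR) (t : B.pt → BL.pt) (s : B.pt → BR.pt) : Type (u + 1) where
  fib : ∀ b, SBimod (𝒜.fib (t b)) (ℬ.fib (s b))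
  smooth : Sec B (fun b => (fib b).carrier)
  locTriv : ∀ b₀, ∃ (A₀ B₀ : SAlg.{u} 𝕜) (M₀ : SBimod A₀ B₀)
    (α : ∀ b, 𝒜.fib (t b) →ₗ[𝕜] A₀) (β : ∀ b, ℬ.fib (s b) →ₗ[𝕜] B₀) (ψ : ∀ b, fib b →ₗ[𝕜] M₀),
    IsAlgTriv (pullSec 𝕜 t 𝒜.smooth) α b₀ ∧ IsAlgTriv (pullSec 𝕜 s ℬ.smooth) β b₀ ∧
    IsTriv smooth ψ b₀ ∧
    ∀ᶠ b in B.nhds b₀,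
      (∀ (i : ZMod 2) (m : fib b), m ∈ (fib b).gr i → ψ b m ∈ M₀.gr i) ∧
      (∀ a m, ψ b ((fib b).left a m) = M₀.left (α b a) (ψ b m)) ∧
      (∀ a m, ψ b ((fib b).right a m) = M₀.right (β b a) (ψ b m))

/-- A family of intertwiners is an invertible intertwiner of bundles: it is fibrewise bijective and
smooth together with its inverse. -/
def IsSmoothIso {B : Space.{u}} {A₁ A₂ : B.pt → SAlg.{u} 𝕜}
    {M N : ∀ b, SBimod (A₁ b) (A₂ b)} (S : Sec B (fun b => (M b).carrier))
    (T : Sec B (fun b => (N b).carrier)) (f : ∀ b, SBimod.Hom (M b) (N b)) : Prop :=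
  (∀ b, Function.Bijective (f b)) ∧ ∀ s b, S s b ↔ T (fun b' => f b' (s b')) b

/-- Invertibility of a bimodule bundle: there is a bimodule bundle `𝒩` in the other direction with
`ℳ ⊗ 𝒩 ≅ t^*𝒜` and `𝒩 ⊗ ℳ ≅ s^*ℬ` as bimodule bundles. -/
def BimodBundle.Invertible {B BL BR : Space.{u}} {𝒜 : AlgBundle 𝕜 BL} {ℬ : AlgBundle 𝕜 BR}
    {t : B.pt → BL.pt} {s : B.pt → BR.pt} (ℳ : BimodBundle B 𝒜 ℬ t s) : Prop :=
  ∃ 𝒩 : BimodBundle B ℬ 𝒜 s t,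
    (∃ ε : ∀ b, SBimod.Hom ((ℳ.fib b).tensor (𝒩.fib b)) (SBimod.self (𝒜.fib (t b))),
      IsSmoothIso (tensorSec ℳ.fib 𝒩.fib ℳ.smooth 𝒩.smooth) (pullSec 𝕜 t 𝒜.smooth) ε) ∧
    (∃ η : ∀ b, SBimod.Hom ((𝒩.fib b).tensor (ℳ.fib b)) (SBimod.self (ℬ.fib (s b))),
      IsSmoothIso (tensorSec 𝒩.fib ℳ.fib 𝒩.smooth ℳ.smooth) (pullSec 𝕜 s ℬ.smooth) η)

end Bundles

/-! ## Super 2-vector bundles -/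

section TwoVectorBundles

variable {𝕜 : Type} [RCLike 𝕜] {X : Mfd.{u}}

/-- The three projections `Y^[3] → Y^[2]`. -/
abbrev pr12 {Y X : Mfd.{u}} {π : Y → X} (q : (fib3 Y π).pt) : (fib2 Y π).pt :=
  ⟨(q.1.1, q.1.2.1), q.2.1⟩

/-- See `pr12`. -/
abbrev pr23 {Y X : Mfd.{u}} {π : Y → X} (q : (fib3 Y π).pt) : (fib2 Y π).pt :=
  ⟨(q.1.2.1, q.1.2.2), q.2.2⟩

/-- See `pr12`. -/
abbrev pr13 {Y X : Mfd.{u}} {π : Y → X} (q : (fib3 Y π).pt) : (fib2 Y π).pt :=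
  ⟨(q.1.1, q.1.2.2), q.2.1.trans q.2.2⟩

/-- A super 2-vector bundle `(π, 𝒜, ℳ, μ)` over `X`. The fibre of `ℳ` over `(y₁, y₂)` is an
`𝒜_{y₂}`-`𝒜_{y₁}`-bimodule, and `μ` is associative. -/
structure TwoVB (𝕜 : Type) [RCLike 𝕜] (X : Mfd.{u}) : Type (u + 1) where
  Y : Mfd.{u}
  π : Y → X
  π_surj : Function.Surjective π
  π_subm : Manifold.IsSubmersion Y.I X.I ∞ π
  𝒜 : AlgBundle 𝕜 (Space.ofMfd Y)
  ℳ : BimodBundle (fib2 Y π) 𝒜 𝒜 (fun p => p.1.2) (fun p => p.1.1)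
  ℳ_inv : ℳ.Invertible
  μ : ∀ q : (fib3 Y π).pt,
    SBimod.Hom ((ℳ.fib (pr23 q)).tensor (ℳ.fib (pr12 q))) (ℳ.fib (pr13 q))
  μ_iso : IsSmoothIso
    (tensorSec (fun q => ℳ.fib (pr23 q)) (fun q => ℳ.fib (pr12 q))
      (pullSec 𝕜 pr23 ℳ.smooth) (pullSec 𝕜 pr12 ℳ.smooth))
    (pullSec 𝕜 pr13 ℳ.smooth) μ
  μ_assoc : ∀ (y₁ y₂ y₃ y₄ : Y) (h₁₂ : π y₁ = π y₂) (h₂₃ : π y₂ = π y₃) (h₃₄ : π y₃ = π y₄)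
    (m₃₄ : ℳ.fib ⟨(y₃, y₄), h₃₄⟩) (m₂₃ : ℳ.fib ⟨(y₂, y₃), h₂₃⟩) (m₁₂ : ℳ.fib ⟨(y₁, y₂), h₁₂⟩),
    (μ ⟨(y₁, y₂, y₄), h₁₂, h₂₃.trans h₃₄⟩).toLin
        (SBimod.tmul ((μ ⟨(y₂, y₃, y₄), h₂₃, h₃₄⟩).toLin (SBimod.tmul m₃₄ m₂₃)) m₁₂) =
      (μ ⟨(y₁, y₃, y₄), h₁₂.trans h₂₃, h₃₄⟩).toLin
        (SBimod.tmul m₃₄ ((μ ⟨(y₁, y₂, y₃), h₁₂, h₂₃⟩).toLin (SBimod.tmul m₂₃ m₁₂)))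

/-- The bundle is of Morita class `A` if its super algebra bundle is. -/
def TwoVB.OfMoritaClass (V : TwoVB.{u} 𝕜 X) (A : SAlg.{u} 𝕜) : Prop := V.𝒜.OfMoritaClass A

/-- `μ` as an operation `ℳ_{y₂,y₃} × ℳ_{y₁,y₂} → ℳ_{y₁,y₃}`. -/
def TwoVB.mul (V : TwoVB.{u} 𝕜 X) {y₁ y₂ y₃ : V.Y} {h₁₂ : V.π y₁ = V.π y₂}
    {h₂₃ : V.π y₂ = V.π y₃} (m : V.ℳ.fib ⟨(y₂, y₃), h₂₃⟩) (n : V.ℳ.fib ⟨(y₁, y₂), h₁₂⟩) :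
    V.ℳ.fib ⟨(y₁, y₃), h₁₂.trans h₂₃⟩ :=
  (V.μ ⟨(y₁, y₂, y₃), h₁₂, h₂₃⟩).toLin (SBimod.tmul m n)

/-- `Y₁ ×_X Y₂`. -/
abbrev TwoVB.Y12 (V₁ V₂ : TwoVB.{u} 𝕜 X) : Space.{u} :=
  (Space.ofMfd V₁.Y).fibProd (Space.ofMfd V₂.Y) V₁.π V₂.π

section ZZ

variable {V₁ V₂ : TwoVB.{u} 𝕜 X} {Z : Space.{u}} (ζ : Z.pt → (V₁.Y12 V₂).pt)

/-- The composite map `Z → Y₁ ×_X Y₂ → X`. -/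
abbrev toX (z : Z.pt) : X := V₁.π (ζ z).1.1

theorem toX_eq (z : Z.pt) : toX ζ z = V₂.π (ζ z).1.2 := (ζ z).2

/-- `Z^[2] = Z ×_X Z`. -/
abbrev ZZ : Space.{u} := Z.fibProd Z (toX ζ) (toX ζ)

/-- The map `Z^[2] → Y₁^[2]`. -/
abbrev zz1 (q : (ZZ ζ).pt) : (fib2 V₁.Y V₁.π).pt :=
  ⟨((ζ q.1.1).1.1, (ζ q.1.2).1.1), q.2⟩

/-- The map `Z^[2] → Y₂^[2]`. -/
abbrev zz2 (q : (ZZ ζ).pt) : (fib2 V₂.Y V₂.π).pt :=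
  ⟨((ζ q.1.1).1.2, (ζ q.1.2).1.2), ((toX_eq ζ q.1.1).symm.trans q.2).trans (toX_eq ζ q.1.2)⟩

end ZZ

/-- A 1-morphism `(ζ, 𝒫, φ) : V₁ → V₂` (with `𝒫` denoted by `bim`) of super 2-vector bundles. In `φ_hom`, which says that
`φ` is compatible with `μ₁` and `μ₂`, elements of relative tensor products are written as finite
sums of pure tensors. -/
structure OneMor (V₁ V₂ : TwoVB.{u} 𝕜 X) : Type (u + 1) where
  Z : Space.{u}
  Z_mfd : Z.IsSubmanifold
  ζ : Z.pt → (V₁.Y12 V₂).pt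
  ζ_subm : Space.IsSurjSubmersion ζ
  bim : BimodBundle Z V₂.𝒜 V₁.𝒜 (fun z => (ζ z).1.2) (fun z => (ζ z).1.1)
  φ : ∀ q : (ZZ ζ).pt, SBimod.Hom ((V₂.ℳ.fib (zz2 ζ q)).tensor (bim.fib q.1.1))
    ((bim.fib q.1.2).tensor (V₁.ℳ.fib (zz1 ζ q)))
  φ_iso : IsSmoothIso
    (tensorSec (fun q => V₂.ℳ.fib (zz2 ζ q)) (fun q : (ZZ ζ).pt => bim.fib q.1.1)
      (pullSec 𝕜 (zz2 ζ) V₂.ℳ.smooth) (pullSec 𝕜 (fun q : (ZZ ζ).pt => q.1.1) bim.smooth))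
    (tensorSec (fun q : (ZZ ζ).pt => bim.fib q.1.2) (fun q => V₁.ℳ.fib (zz1 ζ q))
      (pullSec 𝕜 (fun q : (ZZ ζ).pt => q.1.2) bim.smooth) (pullSec 𝕜 (zz1 ζ) V₁.ℳ.smooth)) φ
  φ_hom : ∀ (z z' z'' : Z.pt) (h : toX ζ z = toX ζ z') (h' : toX ζ z' = toX ζ z'')
    (m' : V₂.ℳ.fib (zz2 ζ ⟨(z', z''), h'⟩)) (m : V₂.ℳ.fib (zz2 ζ ⟨(z, z'), h⟩)) (p : bim.fib z)
    (k l : ℕ) (p' : Fin k → bim.fib z') (n : Fin k → V₁.ℳ.fib (zz1 ζ ⟨(z, z'), h⟩))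
    (p'' : Fin k → Fin l → bim.fib z'')
    (n' : Fin k → Fin l → V₁.ℳ.fib (zz1 ζ ⟨(z', z''), h'⟩)),
    (φ ⟨(z, z'), h⟩).toLin (SBimod.tmul m p) = ∑ i, SBimod.tmul (p' i) (n i) →
    (∀ i, (φ ⟨(z', z''), h'⟩).toLin (SBimod.tmul m' (p' i)) =
      ∑ j, SBimod.tmul (p'' i j) (n' i j)) →
    (φ ⟨(z, z''), h.trans h'⟩).toLin (SBimod.tmul (V₂.mul m' m) p) =
      ∑ i, ∑ j, SBimod.tmul (p'' i j) (V₁.mul (n' i j) (n i))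

/-- The identity map between two fibres over (propositionally) the same point. -/
def BimodBundle.castFib {B BL BR : Space.{u}} {𝒜 : AlgBundle 𝕜 BL} {ℬ : AlgBundle 𝕜 BR}
    {t : B.pt → BL.pt} {s : B.pt → BR.pt} (ℳ : BimodBundle B 𝒜 ℬ t s) {b b' : B.pt}
    (h : b = b') (m : ℳ.fib b) : ℳ.fib b' := h ▸ m

section Composition

variable {V₁ V₂ : TwoVB.{u} 𝕜 X} (P : OneMor V₁ V₂) (Q : OneMor V₂ V₁)

/-- The space `Z_P ×_{Y₂} Z_Q` underlying the composition `Q ∘ P : V₁ → V₁`. -/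
abbrev compZ : Space.{u} := P.Z.fibProd Q.Z (fun z => (P.ζ z).1.2) (fun z => (Q.ζ z).1.1)

/-- The map from `Z_P ×_{Y₂} Z_Q` to `Y₁ ×_X Y₁`. -/
abbrev compζ (w : (compZ P Q).pt) : (fib2 V₁.Y V₁.π).pt :=
  ⟨((P.ζ w.1.1).1.1, (Q.ζ w.1.2).1.2),
    ((P.ζ w.1.1).2.trans (congrArg V₂.π w.2)).trans (Q.ζ w.1.2).2⟩

/-- The bimodule `𝒫_z` with the algebra `𝒜₂` at `ζ_P(z)` identified with the one at `ζ_Q(z')`,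
for `(z, z') ∈ Z_P ×_{Y₂} Z_Q`. -/
abbrev compP (w : (compZ P Q).pt) :
    SBimod (V₂.𝒜.fib (Q.ζ w.1.2).1.1) (V₁.𝒜.fib (P.ζ w.1.1).1.1) :=
  (P.bim.fib w.1.1).twistL (SAlgHom.ofEq (congrArg V₂.𝒜.fib w.2.symm))

/-- An invertible 2-morphism from the composition `Q ∘ P` to the identity 1-morphism of `V₁`,
defined over a surjective submersion `ρ` to
`(Z_P ×_{Y₂} Z_Q) ×_{Y₁ ×_X Y₁} Y₁^[2] = Z_P ×_{Y₂} Z_Q`: invertible intertwiners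
`ψ_w : 𝒬_{z'} ⊗ 𝒫_z → (ℳ₁)_{y₁,y₁'}`. The field `ψ_comm` says that they commute with the
intertwiner `(id ⊗ φ_P) ∘ (φ_Q ⊗ id)` of the composition and the intertwiner `μ₁⁻¹ ∘ μ₁` of the
identity 1-morphism, for all `w`, `v` over the same point of `X`. -/
structure CompIsoId : Type (u + 1) where
  W : Space.{u}
  W_mfd : W.IsSubmanifold
  ρ : W.pt → (compZ P Q).pt
  ρ_subm : Space.IsSurjSubmersion ρ
  ψ : ∀ w, SBimod.Hom ((Q.bim.fib (ρ w).1.2).tensor (compP P Q (ρ w))) (V₁.ℳ.fib (compζ P Q (ρ w)))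
  ψ_iso : IsSmoothIso
    (tensorSec (fun w => Q.bim.fib (ρ w).1.2) (fun w => compP P Q (ρ w))
      (pullSec 𝕜 (fun w => (ρ w).1.2) Q.bim.smooth) (pullSec 𝕜 (fun w => (ρ w).1.1) P.bim.smooth))
    (pullSec 𝕜 (fun w => compζ P Q (ρ w)) V₁.ℳ.smooth) ψ
  ψ_comm : ∀ (w v : W.pt) (hP : toX P.ζ (ρ w).1.1 = toX P.ζ (ρ v).1.1)
    (hQ : toX Q.ζ (ρ w).1.2 = toX Q.ζ (ρ v).1.2)
    (m : V₁.ℳ.fib (zz2 Q.ζ ⟨((ρ w).1.2, (ρ v).1.2), hQ⟩))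
    (x : Q.bim.fib (ρ w).1.2) (y : P.bim.fib (ρ w).1.1)
    (k l : ℕ) (x' : Fin k → Q.bim.fib (ρ v).1.2)
    (n : Fin k → V₂.ℳ.fib (zz1 Q.ζ ⟨((ρ w).1.2, (ρ v).1.2), hQ⟩))
    (y' : Fin k → Fin l → P.bim.fib (ρ v).1.1)
    (n' : Fin k → Fin l → V₁.ℳ.fib (zz1 P.ζ ⟨((ρ w).1.1, (ρ v).1.1), hP⟩)),
    (Q.φ ⟨((ρ w).1.2, (ρ v).1.2), hQ⟩).toLin (SBimod.tmul m x) = ∑ i, SBimod.tmul (x' i) (n i) →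
    (∀ i, (P.φ ⟨((ρ w).1.1, (ρ v).1.1), hP⟩).toLin
        (SBimod.tmul (V₂.ℳ.castFib
          (show zz1 Q.ζ ⟨((ρ w).1.2, (ρ v).1.2), hQ⟩ = zz2 P.ζ ⟨((ρ w).1.1, (ρ v).1.1), hP⟩ from
            Subtype.ext (Prod.ext (ρ w).2.symm (ρ v).2.symm)) (n i)) y) =
      ∑ j, SBimod.tmul (y' i j) (n' i j)) →
    V₁.mul m ((ψ w).toLin (SBimod.tmul x (show compP P Q (ρ w) from y))) =
      ∑ i, ∑ j, V₁.mul ((ψ v).toLin (SBimod.tmul (x' i) (show compP P Q (ρ v) from y' i j)))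
        (n' i j)

end Composition

/-- Two super 2-vector bundles are isomorphic if there are 1-morphisms in both directions whose
compositions are 2-isomorphic to the identity 1-morphisms. -/
def TwoVB.Isomorphic (V₁ V₂ : TwoVB.{u} 𝕜 X) : Prop :=
  ∃ (P : OneMor V₁ V₂) (Q : OneMor V₂ V₁), Nonempty (CompIsoId P Q) ∧ Nonempty (CompIsoId Q P)

/-- The set `h₀` of isomorphism classes of super 2-vector bundles over `X` of Morita class `A`. -/
def IsoClasses (A : SAlg.{u} 𝕜) (X : Mfd.{u}) : Type (u + 1) :=
  Quot (fun V W : {V : TwoVB.{u} 𝕜 X // V.OfMoritaClass A} => V.1.Isomorphic W.1)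

/-- The isomorphism class of a super 2-vector bundle of Morita class `A`. -/
def isoClass {A : SAlg.{u} 𝕜} {X : Mfd.{u}} (V : {V : TwoVB.{u} 𝕜 X // V.OfMoritaClass A}) :
    IsoClasses A X := Quot.mk _ V

end TwoVectorBundles

/-! ## Čech cohomology with values in the crossed module `AUT(A) = (i : A₀ˣ → Aut(A))` -/

section Cech

variable {𝕜 : Type} [RCLike 𝕜]

/-- A map `g : X → Aut(A)` is smooth on `U`. -/
def SmoothAutOn {A : SAlg.{u} 𝕜} (X : Mfd.{u}) (g : X → evenAut A) (U : Set X) : Prop :=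
  ∀ (l : A →ₗ[𝕜] 𝕜) (b : A), ContMDiffOn X.I 𝓘(ℝ, 𝕜) ∞ (fun x => l ((g x).1 b)) U

/-- A map `a : X → A₀ˣ` is smooth on `U`. -/
def SmoothUnitsOn {A : SAlg.{u} 𝕜} (X : Mfd.{u}) (a : X → evenUnits A) (U : Set X) : Prop :=
  ∀ l : A →ₗ[𝕜] 𝕜, ContMDiffOn X.I 𝓘(ℝ, 𝕜) ∞ (fun x => l ((a x).1 : A)) U

/-- A Čech 1-cocycle on `X` with values in `AUT(A)`, with respect to an open cover `U` of `X`.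
Only the values of `g α β` on `U α ∩ U β` and of `a α β γ` on `U α ∩ U β ∩ U γ` matter. -/
structure Cocycle (A : SAlg.{u} 𝕜) (X : Mfd.{u}) : Type (u + 1) where
  ι : Type u
  U : ι → Set X
  isOpen : ∀ α, IsOpen (U α)
  cover : ∀ x, ∃ α, x ∈ U α
  g : ι → ι → X → evenAut A
  a : ι → ι → ι → X → evenUnits A
  g_smooth : ∀ α β, SmoothAutOn X (g α β) (U α ∩ U β)
  a_smooth : ∀ α β γ, SmoothUnitsOn X (a α β γ) (U α ∩ U β ∩ U γ)
  cocycle_g : ∀ α β γ, ∀ x ∈ U α ∩ U β ∩ U γ,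
    innerAut (a α β γ x) * g β γ x * g α β x = g α γ x
  cocycle_a : ∀ α β γ δ, ∀ x ∈ U α ∩ U β ∩ U γ ∩ U δ,
    a α γ δ x * autAct (g γ δ x) (a α β γ x) = a α β δ x * a β γ δ x

/-- Two cocycles are equivalent if, on a common refinement `W` of the two open covers, they differ
by a coboundary `(h, e)`. -/
def Cocycle.Equivalent {A : SAlg.{u} 𝕜} {X : Mfd.{u}} (c c' : Cocycle A X) : Prop :=
  ∃ (κ : Type u) (W : κ → Set X) (r : κ → c.ι) (r' : κ → c'.ι)
    (h : κ → X → evenAut A) (e : κ → κ → X → evenUnits A),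
    (∀ k, IsOpen (W k)) ∧ (∀ x, ∃ k, x ∈ W k) ∧
    (∀ k, W k ⊆ c.U (r k)) ∧ (∀ k, W k ⊆ c'.U (r' k)) ∧
    (∀ k, SmoothAutOn X (h k) (W k)) ∧ (∀ k l, SmoothUnitsOn X (e k l) (W k ∩ W l)) ∧
    (∀ k l, ∀ x ∈ W k ∩ W l,
      innerAut (e k l x) * h l x * c.g (r k) (r l) x = c'.g (r' k) (r' l) x * h k x) ∧
    (∀ k l m, ∀ x ∈ W k ∩ W l ∩ W m,
      c'.a (r' k) (r' l) (r' m) x * autAct (c'.g (r' l) (r' m) x) (e k l x) * e l m x =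
        e k m x * autAct (h m x) (c.a (r k) (r l) (r m) x))

/-- The non-abelian Čech cohomology `Ȟ¹(X, AUT(A))`. -/
def CechH1 (X : Mfd.{u}) (A : SAlg.{u} 𝕜) : Type (u + 1) :=
  Quot (fun c c' : Cocycle A X => c.Equivalent c')

/-- The cohomology class of a cocycle. -/
def cechClass {A : SAlg.{u} 𝕜} {X : Mfd.{u}} (c : Cocycle A X) : CechH1 X A := Quot.mk _ c

/-- `V` is (up to obvious identifications) the super 2-vector bundle constructed from the cocycle
`c`: the surjective submersion is the disjoint union of the open sets `U α` (`idx y` is the index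
of the open set in which `y` lies), the super algebra bundle is the trivial bundle with fibre `A`
(via `τ`), the fibre of the bimodule bundle over `x ∈ U α ∩ U β` is `A_φ` for `φ = g α β x`
(via `θ`), and `μ` is `x ⊗ y ↦ x φ(y) a⁻¹`, for `φ = g β γ` and `a = a α β γ`. -/
def TwoVB.IsAssociatedTo {A : SAlg.{u} 𝕜} {X : Mfd.{u}} (V : TwoVB.{u} 𝕜 X) (c : Cocycle A X) :
    Prop :=
  ∃ (idx : V.Y → c.ι) (τ : ∀ y, V.𝒜.fib y →ₗ[𝕜] A) (θ : ∀ p, V.ℳ.fib p →ₗ[𝕜] A),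
    IsLocallyConstant idx ∧ IsLocalDiffeomorph V.Y.I X.I ∞ V.π ∧
    (∀ y, V.π y ∈ c.U (idx y)) ∧ (∀ α, ∀ x ∈ c.U α, ∃! y, idx y = α ∧ V.π y = x) ∧
    (∀ y, IsAlgTriv V.𝒜.smooth τ y) ∧ (∀ p, IsTriv V.ℳ.smooth θ p) ∧
    (∀ p (i : ZMod 2) (m : V.ℳ.fib p), m ∈ (V.ℳ.fib p).gr i → θ p m ∈ A.gr i) ∧
    (∀ p a m, θ p ((V.ℳ.fib p).left a m) = τ p.1.2 a * θ p m) ∧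
    (∀ p b m, θ p ((V.ℳ.fib p).right b m) =
      θ p m * (c.g (idx p.1.1) (idx p.1.2) (V.π p.1.1)).1 (τ p.1.1 b)) ∧
    ∀ (q : (fib3 V.Y V.π).pt) (m : V.ℳ.fib (pr23 q)) (n : V.ℳ.fib (pr12 q)),
      θ (pr13 q) ((V.μ q).toLin (SBimod.tmul m n)) =
        θ (pr23 q) m * (c.g (idx q.1.2.1) (idx q.1.2.2) (V.π q.1.1)).1 (θ (pr12 q) n) *
          ((c.a (idx q.1.1) (idx q.1.2.1) (idx q.1.2.2) (V.π q.1.1))⁻¹).1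

end Cech

end SuperTwoVect

end

noncomputable section

namespace SuperTwoVect

namespace Space

section Nhds

variable {B C D : Space.{u}}

theorem nhds_eq_induced (B : Space.{u}) (b : B.pt) :
    B.nhds b = @_root_.nhds B.pt (TopologicalSpace.induced B.j inferInstance) b :=
  (@nhds_induced _ _ _ B.j b).symm

theorem eventually_nhds {b : B.pt} {p : B.pt → Prop} (h : ∀ᶠ b' in B.nhds b, p b') :
    ∀ᶠ b' in B.nhds b, ∀ᶠ b'' in B.nhds b', p b'' := by
  simp only [nhds_eq_induced] at h ⊢
  exact @eventually_eventually_nhds _ (TopologicalSpace.induced B.j inferInstance) _ _ |>.2 h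

theorem self_of_nhds {b : B.pt} {p : B.pt → Prop} (h : ∀ᶠ b' in B.nhds b, p b') : p b := by
  rw [nhds_eq_induced] at h
  exact @Filter.Eventually.self_of_nhds _ (TopologicalSpace.induced B.j inferInstance) _ _ h

theorem eventually_comap {b : B.pt} {U : Set B.amb} (h : U ∈ 𝓝 (B.j b)) :
    ∀ᶠ b' in B.nhds b, B.j b' ∈ U := Filter.preimage_mem_comap h

theorem eventually_mem_nhds {b : B.pt} {U : Set B.amb} (h : U ∈ 𝓝 (B.j b)) :
    ∀ᶠ b' in B.nhds b, U ∈ 𝓝 (B.j b') :=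
  eventually_comap (U := {x | U ∈ 𝓝 x}) (eventually_mem_nhds_iff.2 h)

theorem nhds_ofMfd {M : Mfd.{u}} (x : M) : (ofMfd M).nhds x = 𝓝 x := Filter.comap_id

end Nhds

section SmoothMap

variable {B C D : Space.{u}}

theorem SmoothMapAt.tendsto {f : B.pt → C.pt} {b : B.pt} (hf : SmoothMapAt f b) :
    Filter.Tendsto f (B.nhds b) (C.nhds (f b)) := by
  obtain ⟨F, ⟨U, hU, hF⟩, he⟩ := hf
  rw [show C.nhds (f b) = Filter.comap C.j (𝓝 (C.j (f b))) from rfl, Filter.tendsto_comap_iff]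
  have h1 : Filter.Tendsto F (𝓝 (B.j b)) (𝓝 (C.j (f b))) := by
    rw [self_of_nhds he]
    exact (hF.continuousOn.continuousAt hU)
  exact (h1.comp Filter.tendsto_comap).congr' (he.mono fun _ h => h.symm)

theorem SmoothMapAt.eventually {f : B.pt → C.pt} {b : B.pt} (hf : SmoothMapAt f b) :
    ∀ᶠ b' in B.nhds b, SmoothMapAt f b' := by
  obtain ⟨F, ⟨U, hU, hF⟩, he⟩ := hf
  filter_upwards [eventually_mem_nhds hU, eventually_nhds he] with b' h1 h2
  exact ⟨F, ⟨U, h1, hF⟩, h2⟩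

theorem SmoothMapAt.congr {f g : B.pt → C.pt} {b : B.pt} (hf : SmoothMapAt f b)
    (h : ∀ᶠ b' in B.nhds b, f b' = g b') : SmoothMapAt g b := by
  obtain ⟨F, hF, he⟩ := hf
  exact ⟨F, hF, by filter_upwards [he, h] with b' h1 h2; rw [← h2, h1]⟩

theorem smoothMapAt_id (b : B.pt) : SmoothMapAt (fun x : B.pt => x) b :=
  ⟨id, ⟨Set.univ, Filter.univ_mem, contMDiffOn_id⟩, Filter.Eventually.of_forall fun _ => rfl⟩

theorem SmoothMapAt.comp {g : C.pt → D.pt} {f : B.pt → C.pt} {b : B.pt}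
    (hg : SmoothMapAt g (f b)) (hf : SmoothMapAt f b) : SmoothMapAt (fun x => g (f x)) b := by
  have ht := hf.tendsto
  obtain ⟨F, ⟨U, hU, hF⟩, he⟩ := hf
  obtain ⟨G, ⟨V, hV, hG⟩, hge⟩ := hg
  have h1 : F (B.j b) = C.j (f b) := (self_of_nhds he).symm
  have hc : Filter.Tendsto F (𝓝 (B.j b)) (𝓝 (C.j (f b))) := by
    rw [← h1]; exact hF.continuousOn.continuousAt hU
  refine ⟨G ∘ F, ⟨U ∩ F ⁻¹' V, Filter.inter_mem hU (hc hV), ?_⟩, ?_⟩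
  · exact hG.comp (hF.mono Set.inter_subset_left) Set.inter_subset_right
  · filter_upwards [he, ht.eventually hge] with b' h2 h3
    rw [h3, h2]; rfl

theorem smoothMapAt_ofMfd {M N : Mfd.{u}} {f : M → N} (hf : ContMDiff M.I N.I ∞ f) (x : M) :
    SmoothMapAt (B := ofMfd M) (C := ofMfd N) f x :=
  ⟨f, ⟨Set.univ, Filter.univ_mem, hf.contMDiffOn⟩, Filter.Eventually.of_forall fun _ => rfl⟩

theorem smoothMapAt_ofMfd_of_contMDiffOn {M N : Mfd.{u}} {f : M → N} {x : M} {U : Set M}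
    (hU : U ∈ 𝓝 x) (hf : ContMDiffOn M.I N.I ∞ f U) :
    SmoothMapAt (B := ofMfd M) (C := ofMfd N) f x :=
  ⟨f, ⟨U, hU, hf⟩, Filter.Eventually.of_forall fun _ => rfl⟩

theorem smoothMapAt_fst {L : Type u} {f : B.pt → L} {g : C.pt → L} (b : (B.fibProd C f g).pt) :
    SmoothMapAt (B := B.fibProd C f g) (C := B) (fun p => p.1.1) b :=
  ⟨Prod.fst, ⟨Set.univ, Filter.univ_mem,
    (contMDiff_fst (I := B.amb.I) (J := C.amb.I)).contMDiffOn⟩,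
    Filter.Eventually.of_forall fun _ => rfl⟩

theorem smoothMapAt_snd {L : Type u} {f : B.pt → L} {g : C.pt → L} (b : (B.fibProd C f g).pt) :
    SmoothMapAt (B := B.fibProd C f g) (C := C) (fun p => p.1.2) b :=
  ⟨Prod.snd, ⟨Set.univ, Filter.univ_mem,
    (contMDiff_snd (I := B.amb.I) (J := C.amb.I)).contMDiffOn⟩,
    Filter.Eventually.of_forall fun _ => rfl⟩

/-- A map into a space is smooth if it is so after the embedding into the ambient manifold. -/
theorem SmoothMapAt.mk_fibProd {L : Type u} {f : C.pt → L} {g : D.pt → L}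
    {p : B.pt → (C.fibProd D f g).pt} {b : B.pt} (h1 : SmoothMapAt (fun x => (p x).1.1) b)
    (h2 : SmoothMapAt (fun x => (p x).1.2) b) : SmoothMapAt p b := by
  obtain ⟨F, ⟨U, hU, hF⟩, he⟩ := h1
  obtain ⟨G, ⟨V, hV, hG⟩, hge⟩ := h2
  refine ⟨fun x => (F x, G x), ⟨U ∩ V, Filter.inter_mem hU hV, ?_⟩, ?_⟩
  · exact (hF.mono Set.inter_subset_left).prodMk (hG.mono Set.inter_subset_right)
  · filter_upwards [he, hge] with b' h3 h4
    exact Prod.ext h3 h4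

end SmoothMap

section SmoothFun

variable {𝕜 : Type} [RCLike 𝕜] {B C : Space.{u}} {b : B.pt}

theorem SmoothFunAt.congr {f g : B.pt → 𝕜} (hf : B.SmoothFunAt f b)
    (h : ∀ᶠ b' in B.nhds b, f b' = g b') : B.SmoothFunAt g b := by
  obtain ⟨F, hF, he⟩ := hf
  exact ⟨F, hF, by filter_upwards [he, h] with b' h1 h2; rw [← h2, h1]⟩

theorem SmoothFunAt.eventually {f : B.pt → 𝕜} (hf : B.SmoothFunAt f b) :
    ∀ᶠ b' in B.nhds b, B.SmoothFunAt f b' := by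
  obtain ⟨F, ⟨U, hU, hF⟩, he⟩ := hf
  filter_upwards [eventually_mem_nhds hU, eventually_nhds he] with b' h1 h2
  exact ⟨F, ⟨U, h1, hF⟩, h2⟩

theorem SmoothFunAt.tendsto {f : B.pt → 𝕜} (hf : B.SmoothFunAt f b) :
    Filter.Tendsto f (B.nhds b) (𝓝 (f b)) := by
  obtain ⟨F, ⟨U, hU, hF⟩, he⟩ := hf
  have h1 : Filter.Tendsto F (𝓝 (B.j b)) (𝓝 (f b)) := by
    rw [self_of_nhds he]
    exact (hF.continuousOn.continuousAt hU)
  exact (h1.comp Filter.tendsto_comap).congr' (he.mono fun _ h => h.symm)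

theorem SmoothFunAt.comp {f : C.pt → 𝕜} {p : B.pt → C.pt} (hf : C.SmoothFunAt f (p b))
    (hp : SmoothMapAt p b) : B.SmoothFunAt (fun x => f (p x)) b := by
  have ht := hp.tendsto
  obtain ⟨F, ⟨U, hU, hF⟩, he⟩ := hp
  obtain ⟨G, ⟨V, hV, hG⟩, hge⟩ := hf
  have h1 : F (B.j b) = C.j (p b) := (self_of_nhds he).symm
  have hc : Filter.Tendsto F (𝓝 (B.j b)) (𝓝 (C.j (p b))) := by
    rw [← h1]; exact hF.continuousOn.continuousAt hU
  refine ⟨G ∘ F, ⟨U ∩ F ⁻¹' V, Filter.inter_mem hU (hc hV), ?_⟩, ?_⟩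
  · exact hG.comp (hF.mono Set.inter_subset_left) Set.inter_subset_right
  · filter_upwards [he, ht.eventually hge] with b' h2 h3
    rw [h3, h2]; rfl

theorem smoothFunAt_const (c : 𝕜) : B.SmoothFunAt (fun _ => c) b :=
  ⟨fun _ => c, ⟨Set.univ, Filter.univ_mem, contMDiffOn_const⟩,
    Filter.Eventually.of_forall fun _ => rfl⟩

theorem SmoothFunAt.add {f g : B.pt → 𝕜} (hf : B.SmoothFunAt f b) (hg : B.SmoothFunAt g b) :
    B.SmoothFunAt (fun x => f x + g x) b := by
  obtain ⟨F, ⟨U, hU, hF⟩, he⟩ := hf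
  obtain ⟨G, ⟨V, hV, hG⟩, hge⟩ := hg
  refine ⟨fun x => F x + G x, ⟨U ∩ V, Filter.inter_mem hU hV,
    (hF.mono Set.inter_subset_left).add (hG.mono Set.inter_subset_right)⟩, ?_⟩
  filter_upwards [he, hge] with b' h1 h2
  rw [h1, h2]

theorem SmoothFunAt.mul {f g : B.pt → 𝕜} (hf : B.SmoothFunAt f b) (hg : B.SmoothFunAt g b) :
    B.SmoothFunAt (fun x => f x * g x) b := by
  obtain ⟨F, ⟨U, hU, hF⟩, he⟩ := hf
  obtain ⟨G, ⟨V, hV, hG⟩, hge⟩ := hg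
  have hm : ContMDiff 𝓘(ℝ, 𝕜 × 𝕜) 𝓘(ℝ, 𝕜) ∞ (fun p : 𝕜 × 𝕜 => p.1 * p.2) :=
    contDiff_mul.contMDiff
  refine ⟨fun x => F x * G x, ⟨U ∩ V, Filter.inter_mem hU hV, ?_⟩, ?_⟩
  · exact hm.comp_contMDiffOn ((hF.mono Set.inter_subset_left).prodMk_space
      (hG.mono Set.inter_subset_right))
  · filter_upwards [he, hge] with b' h1 h2
    rw [h1, h2]

theorem SmoothFunAt.inv {f : B.pt → 𝕜} (hf : B.SmoothFunAt f b) (h0 : f b ≠ 0) :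
    B.SmoothFunAt (fun x => (f x)⁻¹) b := by
  obtain ⟨F, ⟨U, hU, hF⟩, he⟩ := hf
  have hc : ContinuousAt F (B.j b) := hF.continuousOn.continuousAt hU
  have hne : F (B.j b) ≠ 0 := by rwa [← self_of_nhds he]
  have hi : ContMDiffOn 𝓘(ℝ, 𝕜) 𝓘(ℝ, 𝕜) ∞ (fun p : 𝕜 => p⁻¹) {0}ᶜ := by
    rw [contMDiffOn_iff_contDiffOn]
    intro x hx
    exact ((contDiffAt_inv 𝕜 hx).restrict_scalars ℝ).contDiffWithinAt
  refine ⟨fun x => (F x)⁻¹, ⟨U ∩ F ⁻¹' {0}ᶜ, Filter.inter_mem hU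
    (hc (isOpen_compl_singleton.mem_nhds hne)), ?_⟩, ?_⟩
  · exact hi.comp (hF.mono Set.inter_subset_left) Set.inter_subset_right
  · filter_upwards [he] with b' h1
    rw [h1]

variable (𝕜) in
/-- The functions that are smooth around `b` form an algebra. -/
def smoothAlg (b : B.pt) : Subalgebra 𝕜 (B.pt → 𝕜) where
  carrier := {f | B.SmoothFunAt f b}
  mul_mem' := SmoothFunAt.mul
  add_mem' := SmoothFunAt.add
  algebraMap_mem' := fun c => smoothFunAt_const c

theorem smoothFunAt_sum {ι : Type*} (s : Finset ι) {f : ι → B.pt → 𝕜}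
    (h : ∀ i ∈ s, B.SmoothFunAt (f i) b) : B.SmoothFunAt (fun x => ∑ i ∈ s, f i x) b := by
  have := Subalgebra.sum_mem (smoothAlg 𝕜 b) (f := f) (t := s) h
  have e : (fun x => ∑ i ∈ s, f i x) = ∑ i ∈ s, f i := by ext x; simp
  rw [e]; exact this

theorem smoothFunAt_prod {ι : Type*} (s : Finset ι) {f : ι → B.pt → 𝕜}
    (h : ∀ i ∈ s, B.SmoothFunAt (f i) b) : B.SmoothFunAt (fun x => ∏ i ∈ s, f i x) b := by
  have := Subalgebra.prod_mem (smoothAlg 𝕜 b) (f := f) (t := s) h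
  have e : (fun x => ∏ i ∈ s, f i x) = ∏ i ∈ s, f i := by ext x; simp
  rw [e]; exact this

theorem smoothFunAt_det {n : Type*} [Fintype n] [DecidableEq n] {M : B.pt → Matrix n n 𝕜}
    (h : ∀ i j, B.SmoothFunAt (fun x => M x i j) b) : B.SmoothFunAt (fun x => (M x).det) b := by
  simp only [Matrix.det_apply']
  exact smoothFunAt_sum _ fun σ _ => (smoothFunAt_const _).mul (smoothFunAt_prod _ fun i _ => h _ _)

theorem smoothFunAt_matrix_inv {n : Type*} [Fintype n] [DecidableEq n] {M : B.pt → Matrix n n 𝕜}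
    (h : ∀ i j, B.SmoothFunAt (fun x => M x i j) b) (h0 : (M b).det ≠ 0) (i j : n) :
    B.SmoothFunAt (fun x => (M x)⁻¹ i j) b := by
  simp only [Matrix.inv_def, Matrix.smul_apply, Ring.inverse_eq_inv', Matrix.adjugate_apply,
    smul_eq_mul]
  refine ((smoothFunAt_det h).inv h0).mul (smoothFunAt_det fun k l => ?_)
  by_cases hk : k = j
  · subst hk; simpa using smoothFunAt_const _
  · simpa [Matrix.updateRow_ne hk] using h k l

theorem smoothFunAt_ofMfd {M : Mfd.{u}} {f : M → 𝕜} {x : M} :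
    (ofMfd M).SmoothFunAt f x ↔ ∃ U ∈ 𝓝 x, ContMDiffOn M.I 𝓘(ℝ, 𝕜) ∞ f U := by
  constructor
  · rintro ⟨F, ⟨U, hU, hF⟩, he⟩
    rw [nhds_ofMfd] at he
    exact ⟨_, Filter.inter_mem hU he, (hF.mono Set.inter_subset_left).congr fun x hx => hx.2⟩
  · rintro ⟨U, hU, hf⟩
    exact ⟨f, ⟨U, hU, hf⟩, Filter.Eventually.of_forall fun _ => rfl⟩

theorem contMDiffOn_of_smoothFunAt {M : Mfd.{u}} {f : M → 𝕜} {U : Set M}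
    (h : ∀ x ∈ U, (ofMfd M).SmoothFunAt f x) : ContMDiffOn M.I 𝓘(ℝ, 𝕜) ∞ f U := by
  intro x hx
  obtain ⟨V, hV, hf⟩ := smoothFunAt_ofMfd.1 (h x hx)
  exact (hf.contMDiffAt hV).contMDiffWithinAt

end SmoothFun

section SmoothVec

variable {𝕜 : Type} [RCLike 𝕜] {B C : Space.{u}} {b : B.pt}
  {F G : Type u} [AddCommGroup F] [Module 𝕜 F] [AddCommGroup G] [Module 𝕜 G]

theorem SmoothVecAt.congr {f g : B.pt → F} (hf : B.SmoothVecAt 𝕜 f b)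
    (h : ∀ᶠ b' in B.nhds b, f b' = g b') : B.SmoothVecAt 𝕜 g b :=
  fun l => (hf l).congr (h.mono fun _ e => by rw [e])

theorem SmoothVecAt.comp {f : C.pt → F} {p : B.pt → C.pt} (hf : C.SmoothVecAt 𝕜 f (p b))
    (hp : SmoothMapAt p b) : B.SmoothVecAt 𝕜 (fun x => f (p x)) b :=
  fun l => (hf l).comp hp

theorem smoothVecAt_const (v : F) : B.SmoothVecAt 𝕜 (fun _ => v) b :=
  fun _ => smoothFunAt_const _

theorem SmoothVecAt.add {f g : B.pt → F} (hf : B.SmoothVecAt 𝕜 f b) (hg : B.SmoothVecAt 𝕜 g b) :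
    B.SmoothVecAt 𝕜 (fun x => f x + g x) b :=
  fun l => by simpa using (hf l).add (hg l)

theorem SmoothVecAt.smul {c : B.pt → 𝕜} {f : B.pt → F} (hc : B.SmoothFunAt c b)
    (hf : B.SmoothVecAt 𝕜 f b) : B.SmoothVecAt 𝕜 (fun x => c x • f x) b :=
  fun l => by simpa using hc.mul (hf l)

theorem smoothVecAt_sum {ι : Type*} (s : Finset ι) {f : ι → B.pt → F}
    (h : ∀ i ∈ s, B.SmoothVecAt 𝕜 (f i) b) : B.SmoothVecAt 𝕜 (fun x => ∑ i ∈ s, f i x) b :=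
  fun l => by simpa using smoothFunAt_sum s fun i hi => h i hi l

theorem SmoothVecAt.map {f : B.pt → F} (hf : B.SmoothVecAt 𝕜 f b) (L : F →ₗ[𝕜] G) :
    B.SmoothVecAt 𝕜 (fun x => L (f x)) b :=
  fun l => hf (l ∘ₗ L)

theorem SmoothVecAt.eventually [FiniteDimensional 𝕜 F] {f : B.pt → F}
    (hf : B.SmoothVecAt 𝕜 f b) : ∀ᶠ b' in B.nhds b, B.SmoothVecAt 𝕜 f b' := by
  let e := Module.finBasis 𝕜 F
  have h1 : ∀ᶠ b' in B.nhds b, ∀ i, B.SmoothFunAt (fun x => e.coord i (f x)) b' :=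
    Filter.eventually_all.2 fun i => (hf (e.coord i)).eventually
  filter_upwards [h1] with b' h2
  have : f = fun x => ∑ i, e.coord i (f x) • e i := by
    ext x; simp [e.sum_repr]
  rw [this]
  exact smoothVecAt_sum _ fun i _ => SmoothVecAt.smul (h2 i) (smoothVecAt_const _)

variable (𝕜) in
/-- Smoothness around `b` of a family of linear maps between fixed vector spaces. -/
def SmoothLinAt (B : Space.{u}) (L : B.pt → F →ₗ[𝕜] G) (b : B.pt) : Prop :=
  ∀ v, B.SmoothVecAt 𝕜 (fun x => L x v) b

theorem SmoothLinAt.apply [FiniteDimensional 𝕜 F] {L : B.pt → F →ₗ[𝕜] G} {f : B.pt → F}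
    (hL : B.SmoothLinAt 𝕜 L b) (hf : B.SmoothVecAt 𝕜 f b) :
    B.SmoothVecAt 𝕜 (fun x => L x (f x)) b := by
  let e := Module.finBasis 𝕜 F
  have : (fun x => L x (f x)) = fun x => ∑ i, e.coord i (f x) • L x (e i) := by
    ext x
    conv_lhs => rw [← e.sum_repr (f x), map_sum]
    simp only [map_smul, Module.Basis.coord_apply]
  rw [this]
  exact smoothVecAt_sum _ fun i _ => SmoothVecAt.smul (hf (e.coord i)) (hL _)

theorem SmoothLinAt.eventually [FiniteDimensional 𝕜 F] [FiniteDimensional 𝕜 G]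
    {L : B.pt → F →ₗ[𝕜] G} (hL : B.SmoothLinAt 𝕜 L b) :
    ∀ᶠ b' in B.nhds b, B.SmoothLinAt 𝕜 L b' := by
  let e := Module.finBasis 𝕜 F
  have h1 : ∀ᶠ b' in B.nhds b, ∀ i, B.SmoothVecAt 𝕜 (fun x => L x (e i)) b' :=
    Filter.eventually_all.2 fun i => (hL (e i)).eventually
  filter_upwards [h1] with b' h2 v
  have : (fun x => L x v) = fun x => ∑ i, e.coord i v • L x (e i) := by
    ext x
    conv_lhs => rw [← e.sum_repr v, map_sum]
    simp only [map_smul, Module.Basis.coord_apply]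
  rw [this]
  exact smoothVecAt_sum _ fun i _ => SmoothVecAt.smul (smoothFunAt_const _) (h2 i)

theorem smoothLinAt_endo [FiniteDimensional 𝕜 F] {K : B.pt → F →ₗ[𝕜] F}
    (hK : B.SmoothLinAt 𝕜 K b) (h0 : Function.Bijective (K b)) :
    (∀ᶠ x in B.nhds b, Function.Bijective (K x)) ∧
      ∀ f : B.pt → F, B.SmoothVecAt 𝕜 (fun x => K x (f x)) b → B.SmoothVecAt 𝕜 f b := by
  classical
  let e := Module.finBasis 𝕜 F
  let M : B.pt → Matrix _ _ 𝕜 := fun x => LinearMap.toMatrix e e (K x)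
  have hM : ∀ i j, B.SmoothFunAt (fun x => M x i j) b := fun i j => by
    simpa [M, LinearMap.toMatrix_apply] using hK (e j) (e.coord i)
  have hbij : ∀ x, Function.Bijective (K x) ↔ (M x).det ≠ 0 := fun x => by
    simp only [M, LinearMap.det_toMatrix]
    rw [← isUnit_iff_ne_zero, LinearMap.isUnit_iff_isUnit_det (K x) |>.symm,
      Module.End.isUnit_iff]
  have hd := (hbij b).1 h0
  have hev : ∀ᶠ x in B.nhds b, (M x).det ≠ 0 :=
    (smoothFunAt_det hM).tendsto (isOpen_compl_singleton.mem_nhds hd)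
  refine ⟨hev.mono fun x hx => (hbij x).2 hx, fun f hf => ?_⟩
  have key : ∀ᶠ x in B.nhds b,
      (∑ i, (∑ j, (M x)⁻¹ i j * e.coord j (K x (f x))) • e i) = f x := by
    filter_upwards [hev] with x hx
    have h1 : (M x)⁻¹.mulVec (e.repr (K x (f x))) = e.repr (f x) := by
      rw [← LinearMap.toMatrix_mulVec_repr e e (K x) (f x), Matrix.mulVec_mulVec,
        Matrix.nonsing_inv_mul _ (isUnit_iff_ne_zero.2 hx), Matrix.one_mulVec]
    conv_rhs => rw [← e.sum_repr (f x)]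
    refine Finset.sum_congr rfl fun i _ => ?_
    rw [← h1]; rfl
  refine SmoothVecAt.congr (smoothVecAt_sum _ fun i _ => SmoothVecAt.smul
    (smoothFunAt_sum _ fun j _ => ?_) (smoothVecAt_const _)) key
  exact (smoothFunAt_matrix_inv hM hd i j).mul (hf (e.coord j))

theorem SmoothLinAt.eventually_bijective [FiniteDimensional 𝕜 F] {L : B.pt → F →ₗ[𝕜] G}
    (hL : B.SmoothLinAt 𝕜 L b) (h0 : Function.Bijective (L b)) :
    ∀ᶠ x in B.nhds b, Function.Bijective (L x) := by
  let e := LinearEquiv.ofBijective (L b) h0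
  have h1 := (smoothLinAt_endo (K := fun x => e.symm.toLinearMap ∘ₗ L x)
    (fun v => (hL v).map e.symm.toLinearMap) (e.symm.bijective.comp h0)).1
  filter_upwards [h1] with x hx
  have : (L x : F → G) = e ∘ (e.symm.toLinearMap ∘ₗ L x) := by ext v; simp
  rw [this]
  exact e.bijective.comp hx

theorem SmoothLinAt.of_apply [FiniteDimensional 𝕜 F] {L : B.pt → F →ₗ[𝕜] G}
    (hL : B.SmoothLinAt 𝕜 L b) (h0 : Function.Bijective (L b)) {f : B.pt → F}
    (hf : B.SmoothVecAt 𝕜 (fun x => L x (f x)) b) : B.SmoothVecAt 𝕜 f b := by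
  let e := LinearEquiv.ofBijective (L b) h0
  exact (smoothLinAt_endo (K := fun x => e.symm.toLinearMap ∘ₗ L x)
    (fun v => (hL v).map e.symm.toLinearMap) (e.symm.bijective.comp h0)).2 f
    (hf.map e.symm.toLinearMap)

end SmoothVec

end Space

section Sections

variable {𝕜 : Type} [RCLike 𝕜] {B C D : Space.{u}}
  {V : B.pt → Type u} [∀ b, AddCommGroup (V b)] [∀ b, Module 𝕜 (V b)]
  {W : B.pt → Type u} [∀ b, AddCommGroup (W b)] [∀ b, Module 𝕜 (W b)]
  {F : Type u} [AddCommGroup F] [Module 𝕜 F]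
  {S : Sec B V} {T : Sec B W} {ψ : ∀ b, V b →ₗ[𝕜] F} {b₀ : B.pt}

theorem IsTriv.eventually (h : IsTriv S ψ b₀) : ∀ᶠ b in B.nhds b₀, IsTriv S ψ b :=
  Space.eventually_nhds h

theorem IsTriv.bijective (h : IsTriv S ψ b₀) : Function.Bijective (ψ b₀) :=
  (Space.self_of_nhds h).1

theorem IsTriv.smooth_iff (h : IsTriv S ψ b₀) (s : ∀ b, V b) :
    S s b₀ ↔ B.SmoothVecAt 𝕜 (fun b => ψ b (s b)) b₀ :=
  (Space.self_of_nhds h).2 s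

theorem IsTriv.exists_section (h : IsTriv S ψ b₀) (f : B.pt → F) :
    ∃ s : ∀ b, V b, ∀ᶠ b in B.nhds b₀, ψ b (s b) = f b := by
  classical
  refine ⟨fun b => if hb : Function.Bijective (ψ b) then
    (LinearEquiv.ofBijective (ψ b) hb).symm (f b) else 0, h.mono fun b hb => ?_⟩
  simp only [hb.1, dif_pos]
  exact (LinearEquiv.ofBijective (ψ b) hb.1).apply_symm_apply (f b)

theorem IsTriv.congr_smooth (h : IsTriv S ψ b₀) {s : ∀ b, V b} {f : B.pt → F}
    (hs : ∀ᶠ b in B.nhds b₀, ψ b (s b) = f b) :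
    S s b₀ ↔ B.SmoothVecAt 𝕜 f b₀ := by
  rw [h.smooth_iff]
  exact ⟨fun h1 => h1.congr hs, fun h1 => h1.congr (hs.mono fun _ e => e.symm)⟩

variable (𝕜) in
/-- Around `b₀`, the family is a vector bundle. -/
def IsVBAt (S : Sec B V) (b₀ : B.pt) : Prop :=
  ∃ (F : Type u) (_ : AddCommGroup F) (_ : Module 𝕜 F) (_ : FiniteDimensional 𝕜 F)
    (ψ : ∀ b, V b →ₗ[𝕜] F), IsTriv S ψ b₀

theorem IsTriv.isVBAt [FiniteDimensional 𝕜 F] (h : IsTriv S ψ b₀) : IsVBAt 𝕜 S b₀ :=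
  ⟨F, _, _, inferInstance, ψ, h⟩

namespace IsVBAt

theorem congr (h : IsVBAt 𝕜 S b₀) {s t : ∀ b, V b} (hs : S s b₀)
    (e : ∀ᶠ b in B.nhds b₀, s b = t b) : S t b₀ := by
  obtain ⟨F, _, _, _, ψ, hψ⟩ := h
  rw [hψ.smooth_iff] at hs ⊢
  exact hs.congr (e.mono fun _ e => by rw [e])

theorem zero (h : IsVBAt 𝕜 S b₀) : S (fun _ => 0) b₀ := by
  obtain ⟨F, _, _, _, ψ, hψ⟩ := h
  rw [hψ.smooth_iff]
  simpa using Space.smoothVecAt_const (0 : F)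

theorem add (h : IsVBAt 𝕜 S b₀) {s t : ∀ b, V b} (hs : S s b₀) (ht : S t b₀) :
    S (fun b => s b + t b) b₀ := by
  obtain ⟨F, _, _, _, ψ, hψ⟩ := h
  rw [hψ.smooth_iff] at hs ht ⊢
  simpa using hs.add ht

theorem smul (h : IsVBAt 𝕜 S b₀) {c : B.pt → 𝕜} {s : ∀ b, V b} (hc : B.SmoothFunAt c b₀)
    (hs : S s b₀) : S (fun b => c b • s b) b₀ := by
  obtain ⟨F, _, _, _, ψ, hψ⟩ := h
  rw [hψ.smooth_iff] at hs ⊢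
  simpa using Space.SmoothVecAt.smul hc hs

theorem sum (h : IsVBAt 𝕜 S b₀) {ι : Type*} (t : Finset ι) {s : ι → ∀ b, V b}
    (hs : ∀ i ∈ t, S (s i) b₀) : S (fun b => ∑ i ∈ t, s i b) b₀ := by
  classical
  induction t using Finset.induction_on with
  | empty => simpa using h.zero
  | insert i t hi ih =>
    simp only [Finset.sum_insert hi]
    exact h.add (hs i (Finset.mem_insert_self _ _))
      (ih fun j hj => hs j (Finset.mem_insert_of_mem hj))

theorem exists_extend (h : IsVBAt 𝕜 S b₀) (v : V b₀) : ∃ s : ∀ b, V b, s b₀ = v ∧ S s b₀ := by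
  obtain ⟨F, _, _, _, ψ, hψ⟩ := h
  obtain ⟨s, hs⟩ := hψ.exists_section (fun _ => ψ b₀ v)
  exact ⟨s, hψ.bijective.1 (Space.self_of_nhds hs),
    (hψ.congr_smooth hs).2 (Space.smoothVecAt_const _)⟩

/-- Smooth sections that span the fibre at `b₀` generate all smooth sections around `b₀`. -/
theorem exists_coeff (h : IsVBAt 𝕜 S b₀) {n : ℕ} {s : Fin n → ∀ b, V b}
    (hs : ∀ i, S (s i) b₀) (hspan : ⊤ ≤ Submodule.span 𝕜 (Set.range fun i => s i b₀))
    {t : ∀ b, V b} (ht : S t b₀) :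
    ∃ c : Fin n → B.pt → 𝕜, (∀ i, B.SmoothFunAt (c i) b₀) ∧
      ∀ᶠ b in B.nhds b₀, t b = ∑ i, c i b • s i b := by
  classical
  obtain ⟨F, _, _, _, ψ, hψ⟩ := h
  let T : (Fin n → 𝕜) →ₗ[𝕜] F := Fintype.linearCombination 𝕜 (fun i => ψ b₀ (s i b₀))
  have hT : LinearMap.range T = ⊤ := by
    rw [Fintype.range_linearCombination, eq_top_iff]
    have : (Set.range fun i => ψ b₀ (s i b₀)) = ψ b₀ '' Set.range (fun i => s i b₀) := by
      ext x; simp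
    rw [this, ← Submodule.map_span, eq_top_iff.2 hspan, Submodule.map_top,
      LinearMap.range_eq_top.2 hψ.bijective.2]
  obtain ⟨R, hR⟩ := LinearMap.exists_rightInverse_of_surjective T hT
  let K : B.pt → F →ₗ[𝕜] F := fun b =>
    ∑ i, (LinearMap.proj i ∘ₗ R).smulRight (ψ b (s i b))
  have hKv : ∀ b w, K b w = ∑ i, R w i • ψ b (s i b) := fun b w => by simp [K]
  have hK : B.SmoothLinAt 𝕜 K b₀ := fun w => by
    simp only [hKv]
    exact Space.smoothVecAt_sum _ fun i _ =>
      Space.SmoothVecAt.smul (Space.smoothFunAt_const _) ((hψ.smooth_iff _).1 (hs i))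
  have hK0 : K b₀ = LinearMap.id := by
    ext w
    rw [hKv, ← hR]
    simp [T, Fintype.linearCombination_apply]
  have hbij : Function.Bijective (K b₀) := by rw [hK0]; exact Function.bijective_id
  have hev := hK.eventually_bijective hbij
  let f : B.pt → F := fun b => if hb : Function.Bijective (K b) then
    (LinearEquiv.ofBijective (K b) hb).symm (ψ b (t b)) else 0
  have hf : ∀ᶠ b in B.nhds b₀, ψ b (t b) = K b (f b) := hev.mono fun b hb => by
    simp only [f, hb, dif_pos]
    exact ((LinearEquiv.ofBijective (K b) hb).apply_symm_apply _).symm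
  have hfs : B.SmoothVecAt 𝕜 f b₀ := hK.of_apply hbij (((hψ.smooth_iff _).1 ht).congr hf)
  refine ⟨fun i b => R (f b) i, fun i => hfs (LinearMap.proj i ∘ₗ R), ?_⟩
  filter_upwards [hf, hψ] with b h1 h2
  apply h2.1.1
  rw [h1, hKv]; simp

end IsVBAt

end Sections

section Pullback

variable {𝕜 : Type} [RCLike 𝕜] {B C D : Space.{u}}
  {V : C.pt → Type u} [∀ c, AddCommGroup (V c)] [∀ c, Module 𝕜 (V c)] {S : Sec C V}
  {F : Type u} [AddCommGroup F] [Module 𝕜 F] {ψ : ∀ b, V b →ₗ[𝕜] F}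

theorem pullSec_of {f : B.pt → C.pt} {b : B.pt} {σ : ∀ c, V c} (h : S σ (f b)) :
    pullSec 𝕜 f S (fun b => σ (f b)) b :=
  ⟨1, fun _ _ => 1, fun _ => σ, fun _ => Space.smoothFunAt_const _, fun _ => h,
    Filter.Eventually.of_forall fun _ => by simp⟩

theorem pullSec_comp {g : B.pt → C.pt} {f : D.pt → B.pt} {d : D.pt}
    (hf : Space.SmoothMapAt f d) (s : ∀ d, V (g (f d))) :
    pullSec 𝕜 f (pullSec 𝕜 g S) s d ↔ pullSec 𝕜 (fun d => g (f d)) S s d := by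
  constructor
  · rintro ⟨n, c, σ, hc, hσ, he⟩
    choose m c' σ' hc' hσ' he' using hσ
    have hs : ∀ᶠ d' in D.nhds d, s d' = ∑ x : (Σ i : Fin n, Fin (m i)),
        (c x.1 d' * c' x.1 x.2 (f d')) • σ' x.1 x.2 (g (f d')) := by
      filter_upwards [he, hf.tendsto.eventually (Filter.eventually_all.2 he')] with d' h1 h2
      rw [h1, Fintype.sum_sigma]
      refine Finset.sum_congr rfl fun i _ => ?_
      rw [h2 i, Finset.smul_sum]
      exact Finset.sum_congr rfl fun j _ => smul_smul _ _ _
    let e := (Fintype.equivFin (Σ i : Fin n, Fin (m i))).symm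
    refine ⟨_, fun k d' => c (e k).1 d' * c' (e k).1 (e k).2 (f d'),
      fun k => σ' (e k).1 (e k).2, fun k => (hc _).mul ((hc' _ _).comp hf), fun k => hσ' _ _, ?_⟩
    filter_upwards [hs] with d' h1
    rw [h1]
    exact (e.sum_comp (fun x : (Σ i : Fin n, Fin (m i)) =>
      (c x.1 d' * c' x.1 x.2 (f d')) • σ' x.1 x.2 (g (f d')))).symm
  · rintro ⟨n, c, σ, hc, hσ, he⟩
    exact ⟨n, c, fun i b => σ i (g b), hc, fun i => pullSec_of (hσ i), he⟩

theorem IsTriv.pull [FiniteDimensional 𝕜 F] {f : B.pt → C.pt} {b : B.pt} (h : IsTriv S ψ (f b))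
    (hf : Space.SmoothMapAt f b) : IsTriv (pullSec 𝕜 f S) (fun b => ψ (f b)) b := by
  have h1 := hf.tendsto.eventually h.eventually
  filter_upwards [h1, hf.eventually] with b' h2 h3
  refine ⟨h2.bijective, fun s => ⟨?_, fun hs => ?_⟩⟩
  · rintro ⟨n, c, σ, hc, hσ, he⟩
    refine (Space.smoothVecAt_sum Finset.univ fun i _ => Space.SmoothVecAt.smul (hc i)
      (((h2.smooth_iff _).1 (hσ i)).comp h3)).congr ?_
    filter_upwards [he] with b'' h4
    simp [h4]
  · let e := Module.finBasis 𝕜 F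
    choose σ hσ using fun i => h2.exists_section (fun _ => e i)
    refine ⟨_, fun i b => e.coord i (ψ (f b) (s b)), σ, fun i => hs (e.coord i), fun i =>
      (h2.congr_smooth (hσ i)).2 (Space.smoothVecAt_const _), ?_⟩
    filter_upwards [h3.tendsto.eventually (Filter.eventually_all.2 hσ),
      h3.tendsto.eventually h2] with b'' h4 h5
    apply h5.1.1
    simp only [map_sum, map_smul, h4, Module.Basis.coord_apply]
    exact (e.sum_repr _).symm

theorem IsVBAt.pull {f : B.pt → C.pt} {b : B.pt} (h : IsVBAt 𝕜 S (f b))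
    (hf : Space.SmoothMapAt f b) : IsVBAt 𝕜 (pullSec 𝕜 f S) b := by
  obtain ⟨F, _, _, _, ψ, hψ⟩ := h
  exact (hψ.pull hf).isVBAt

theorem pullSec_id {b : C.pt} (h : IsVBAt 𝕜 S b) (s : ∀ c, V c) :
    pullSec 𝕜 (fun c => c) S s b ↔ S s b := by
  obtain ⟨F, _, _, _, ψ, hψ⟩ := h
  rw [hψ.smooth_iff, (IsTriv.pull (f := fun c => c) hψ (Space.smoothMapAt_id b)).smooth_iff]

end Pullback

section Tensor

variable {𝕜 : Type} [RCLike 𝕜] {B : Space.{u}} {A₁ A₂ A₃ : B.pt → SAlg.{u} 𝕜}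
  {M : ∀ b, SBimod (A₁ b) (A₂ b)} {N : ∀ b, SBimod (A₂ b) (A₃ b)}
  {L : ∀ b, SBimod (A₁ b) (A₃ b)}
  {S : Sec B (fun b => (M b).carrier)} {T : Sec B (fun b => (N b).carrier)}
  {R : Sec B (fun b => (L b).carrier)}

namespace SBimod

variable {A₁ A₂ A₃ : SAlg.{u} 𝕜} {M : SBimod A₁ A₂} {N : SBimod A₂ A₃}

theorem tmul_add (m : M) (n n' : N) :
    tmul m (n + n') = tmul m n + tmul m n' := by
  simp only [tmul, TensorProduct.tmul_add, map_add]; rfl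

theorem add_tmul (m m' : M) (n : N) :
    tmul (m + m') n = tmul m n + tmul m' n := by
  simp only [tmul, TensorProduct.add_tmul, map_add]; rfl

theorem smul_tmul (c : 𝕜) (m : M) (n : N) : tmul (c • m) n = c • tmul m n := by
  simp only [tmul, ← TensorProduct.smul_tmul', map_smul]; rfl

theorem tmul_smul (c : 𝕜) (m : M) (n : N) : tmul m (c • n) = c • tmul m n := by
  simp only [tmul, TensorProduct.tmul_smul, map_smul]; rfl

theorem tmul_right (m : M) (b : A₂) (n : N) : tmul (M.right b m) n = tmul m (N.left b n) :=
  (Submodule.Quotient.eq _).2 (Submodule.subset_span ⟨m, b, n, rfl⟩)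

theorem left_tmul (a : A₁) (m : M) (n : N) :
    (tensor M N).left a (tmul m n) = tmul (M.left a m) n := rfl

theorem right_tmul (a : A₃) (m : M) (n : N) :
    (tensor M N).right a (tmul m n) = tmul m (N.right a n) := rfl

/-- The projection to the relative tensor product. -/
def tensorMk (M : SBimod A₁ A₂) (N : SBimod A₂ A₃) : M ⊗[𝕜] N →ₗ[𝕜] tensor M N :=
  (tensorRel M N).mkQ

theorem tensorMk_surjective : Function.Surjective (tensorMk M N) :=
  (tensorRel M N).mkQ_surjective

@[elab_as_elim]
theorem tensor_induction {p : tensor M N → Prop} (t : tensor M N) (h0 : p 0)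
    (ht : ∀ m n, p (tmul m n)) (hadd : ∀ x y, p x → p y → p (x + y)) : p t := by
  obtain ⟨x, rfl⟩ := tensorMk_surjective t
  induction x using TensorProduct.induction_on with
  | zero => rw [map_zero]; exact h0
  | tmul m n => exact ht m n
  | add x y hx hy => rw [map_add]; exact hadd _ _ hx hy

theorem exists_sum_tmul (t : tensor M N) :
    ∃ (k : ℕ) (m : Fin k → M) (n : Fin k → N), t = ∑ i, tmul (m i) (n i) := by
  induction t using tensor_induction with
  | h0 => exact ⟨0, Fin.elim0, Fin.elim0, by simp⟩
  | ht m n => exact ⟨1, fun _ => m, fun _ => n, by simp⟩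
  | hadd x y hx hy =>
    obtain ⟨k, m, n, rfl⟩ := hx
    obtain ⟨l, m', n', rfl⟩ := hy
    exact ⟨k + l, Fin.append m m', Fin.append n n', by simp [Fin.sum_univ_add]⟩

/-- The linear map out of the relative tensor product given by a balanced bilinear map. -/
def tensorLift {V : Type u} [AddCommGroup V] [Module 𝕜 V] (f : M →ₗ[𝕜] N →ₗ[𝕜] V)
    (h : ∀ m b n, f (M.right b m) n = f m (N.left b n)) : tensor M N →ₗ[𝕜] V :=
  (tensorRel M N).liftQ (TensorProduct.lift f) <|
    Submodule.span_le.2 <| by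
      rintro _ ⟨m, b, n, rfl⟩
      simp [h]

@[simp]
theorem tensorLift_tmul {V : Type u} [AddCommGroup V] [Module 𝕜 V] (f : M →ₗ[𝕜] N →ₗ[𝕜] V)
    (h : ∀ m b n, f (M.right b m) n = f m (N.left b n)) (m : M) (n : N) :
    tensorLift f h (tmul m n) = f m n := by
  exact TensorProduct.lift.tmul m n

theorem tmul_mem {i j : ZMod 2} {m : M} {n : N} (hm : m ∈ M.gr i) (hn : n ∈ N.gr j) :
    tmul m n ∈ (tensor M N).gr (i + j) :=
  ⟨_, Submodule.subset_span ⟨i, j, m, n, rfl, hm, hn, rfl⟩, rfl⟩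

theorem tensor_gr_induction {V : Type u} [AddCommGroup V] [Module 𝕜 V] {f : tensor M N →ₗ[𝕜] V}
    {G : ZMod 2 → Submodule 𝕜 V}
    (h : ∀ i j m n, m ∈ M.gr i → n ∈ N.gr j → f (tmul m n) ∈ G (i + j))
    {i : ZMod 2} {t : tensor M N} (ht : t ∈ (tensor M N).gr i) : f t ∈ G i := by
  obtain ⟨x, hx, rfl⟩ := ht
  have h2 : tensorGr M N i ≤ (G i).comap (f ∘ₗ tensorMk M N) := by
    refine Submodule.span_le.2 ?_
    rintro _ ⟨j, k, m, n, rfl, hm, hn, rfl⟩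
    exact h _ _ _ _ hm hn
  exact h2 hx

/-- The intertwiner out of the relative tensor product given by a balanced bilinear map. -/
def homLift {L : SBimod A₁ A₃} (f : M →ₗ[𝕜] N →ₗ[𝕜] L)
    (h : ∀ m b n, f (M.right b m) n = f m (N.left b n))
    (heven : ∀ i j m n, m ∈ M.gr i → n ∈ N.gr j → f m n ∈ L.gr (i + j))
    (hl : ∀ a m n, f (M.left a m) n = L.left a (f m n))
    (hr : ∀ a m n, f m (N.right a n) = L.right a (f m n)) : Hom (tensor M N) L where
  toLin := tensorLift f h
  even := fun ht => tensor_gr_induction (fun i j m n hm hn => by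
    rw [tensorLift_tmul]; exact heven i j m n hm hn) ht
  map_left := fun a t => by
    refine LinearMap.congr_fun (f := tensorLift f h ∘ₗ (tensor M N).left a)
      (g := L.left a ∘ₗ tensorLift f h) (tensor_ext fun m n => ?_) t
    change tensorLift f h (tmul (M.left a m) n) = L.left a (tensorLift f h (tmul m n))
    simp [hl]
  map_right := fun a t => by
    refine LinearMap.congr_fun (f := tensorLift f h ∘ₗ (tensor M N).right a)
      (g := L.right a ∘ₗ tensorLift f h) (tensor_ext fun m n => ?_) t
    change tensorLift f h (tmul m (N.right a n)) = L.right a (tensorLift f h (tmul m n))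
    simp [hr]

@[simp]
theorem homLift_tmul {L : SBimod A₁ A₃} (f : M →ₗ[𝕜] N →ₗ[𝕜] L) (h heven hl hr) (m : M) (n : N) :
    (homLift f h heven hl hr).toLin (tmul m n) = f m n := tensorLift_tmul f h m n

end SBimod

theorem tensorSec_tmul {b : B.pt} {x : ∀ b, M b} {y : ∀ b, N b} (hx : S x b) (hy : T y b) :
    tensorSec M N S T (fun b => SBimod.tmul (x b) (y b)) b :=
  ⟨1, fun _ => x, fun _ => y, fun _ => hx, fun _ => hy,
    Filter.Eventually.of_forall fun _ => by simp⟩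

/-- Fibrewise bijective intertwiners out of a relative tensor product form a smooth isomorphism to
a vector bundle if they preserve smoothness of pure tensors. -/
theorem isSmoothIso_tensorSec (hS : ∀ b, IsVBAt 𝕜 S b) (hT : ∀ b, IsVBAt 𝕜 T b)
    (hR : ∀ b, IsVBAt 𝕜 R b) (f : ∀ b, SBimod.Hom ((M b).tensor (N b)) (L b))
    (hbij : ∀ b, Function.Bijective (f b).toLin)
    (hf : ∀ b x y, S x b → T y b → R (fun b => (f b).toLin (SBimod.tmul (x b) (y b))) b) :
    IsSmoothIso (tensorSec M N S T) R f := by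
  have fwd : ∀ s b, tensorSec M N S T s b → R (fun b' => (f b').toLin (s b')) b := by
    rintro s b ⟨n, x, y, hx, hy, he⟩
    refine (hR b).congr ((hR b).sum Finset.univ fun i _ => hf b _ _ (hx i) (hy i)) ?_
    filter_upwards [he] with b' h1
    rw [h1, map_sum]
  refine ⟨hbij, fun s b => ⟨fwd s b, fun hs => ?_⟩⟩
  let e := Module.finBasis 𝕜 ((M b).tensor (N b))
  choose k m n hmn using fun i => SBimod.exists_sum_tmul (e i)
  choose x hx0 hx using fun i j => (hS b).exists_extend (m i j)
  choose y hy0 hy using fun i j => (hT b).exists_extend (n i j)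
  have hσ : ∀ i, R (fun b' => (f b').toLin (∑ j, SBimod.tmul (x i j b') (y i j b'))) b :=
    fun i => fwd _ b ⟨k i, x i, y i, hx i, hy i, Filter.Eventually.of_forall fun _ => rfl⟩
  obtain ⟨c, hc, hce⟩ := (hR b).exists_coeff hσ (by
    have : (Set.range fun i => (f b).toLin (∑ j, SBimod.tmul (x i j b) (y i j b))) =
        (f b).toLin '' Set.range e := by
      ext t; simp [hmn, hx0, hy0]
    rw [this, ← Submodule.map_span, e.span_eq, Submodule.map_top,
      LinearMap.range_eq_top.2 (hbij b).2]) hs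
  let E := (Fintype.equivFin (Σ i, Fin (k i))).symm
  refine ⟨_, fun l b' => c (E l).1 b' • x (E l).1 (E l).2 b', fun l => y (E l).1 (E l).2,
    fun l => (hS b).smul (hc _) (hx _ _), fun l => hy _ _, ?_⟩
  filter_upwards [hce] with b' h1
  apply (hbij b').1
  rw [h1, E.sum_comp (fun l : (Σ i, Fin (k i)) =>
    SBimod.tmul (c l.1 b' • x l.1 l.2 b') (y l.1 l.2 b')), Fintype.sum_sigma]
  simp only [SBimod.smul_tmul, map_sum, map_smul, Finset.smul_sum]

end Tensor

section Bundles

variable {𝕜 : Type} [RCLike 𝕜] {B C : Space.{u}}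

theorem IsAlgTriv.eventually {A : B.pt → SAlg.{u} 𝕜} {S : Sec B (fun b => (A b).carrier)}
    {A₀ : SAlg.{u} 𝕜} {α : ∀ b, A b →ₗ[𝕜] A₀} {b : B.pt} (h : IsAlgTriv S α b) :
    ∀ᶠ b' in B.nhds b, IsAlgTriv S α b' :=
  h.1.eventually.and (Space.eventually_nhds h.2)

theorem IsAlgTriv.pull {A : C.pt → SAlg.{u} 𝕜} {S : Sec C (fun b => (A b).carrier)}
    {A₀ : SAlg.{u} 𝕜} {α : ∀ b, A b →ₗ[𝕜] A₀} {f : B.pt → C.pt} {b : B.pt}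
    (h : IsAlgTriv S α (f b)) (hf : Space.SmoothMapAt f b) :
    IsAlgTriv (A := fun b => A (f b)) (pullSec 𝕜 f S) (fun b => α (f b)) b :=
  ⟨h.1.pull hf, hf.tendsto.eventually h.2⟩

/-- Local triviality of a family of bimodules, along local trivializations of the families of
algebras. -/
def LocBimod {A₁ A₂ : B.pt → SAlg.{u} 𝕜} (S₁ : Sec B (fun b => (A₁ b).carrier))
    (S₂ : Sec B (fun b => (A₂ b).carrier)) (M : ∀ b, SBimod (A₁ b) (A₂ b))
    (S : Sec B (fun b => (M b).carrier)) (b₀ : B.pt) : Prop :=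
  ∃ (A₀ B₀ : SAlg.{u} 𝕜) (M₀ : SBimod A₀ B₀)
    (α : ∀ b, A₁ b →ₗ[𝕜] A₀) (β : ∀ b, A₂ b →ₗ[𝕜] B₀) (ψ : ∀ b, M b →ₗ[𝕜] M₀),
    IsAlgTriv S₁ α b₀ ∧ IsAlgTriv S₂ β b₀ ∧ IsTriv S ψ b₀ ∧
    ∀ᶠ b in B.nhds b₀,
      (∀ (i : ZMod 2) (m : M b), m ∈ (M b).gr i → ψ b m ∈ M₀.gr i) ∧
      (∀ a m, ψ b ((M b).left a m) = M₀.left (α b a) (ψ b m)) ∧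
      (∀ a m, ψ b ((M b).right a m) = M₀.right (β b a) (ψ b m))

section Loc

variable {A₁ A₂ : C.pt → SAlg.{u} 𝕜} {S₁ : Sec C (fun b => (A₁ b).carrier)}
  {S₂ : Sec C (fun b => (A₂ b).carrier)} {M : ∀ b, SBimod (A₁ b) (A₂ b)}
  {S : Sec C (fun b => (M b).carrier)}

theorem LocBimod.pull {f : B.pt → C.pt} {b : B.pt} (h : LocBimod S₁ S₂ M S (f b))
    (hf : Space.SmoothMapAt f b) :
    LocBimod (A₁ := fun b => A₁ (f b)) (A₂ := fun b => A₂ (f b)) (pullSec 𝕜 f S₁)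
      (pullSec 𝕜 f S₂) (fun b => M (f b)) (pullSec 𝕜 f S) b := by
  obtain ⟨A₀, B₀, M₀, α, β, ψ, h1, h2, h3, h4⟩ := h
  exact ⟨A₀, B₀, M₀, fun b => α (f b), fun b => β (f b), fun b => ψ (f b), h1.pull hf, h2.pull hf,
    h3.pull hf, hf.tendsto.eventually h4⟩

theorem LocBimod.isVBAt {b : C.pt} (h : LocBimod S₁ S₂ M S b) : IsVBAt 𝕜 S b := by
  obtain ⟨A₀, B₀, M₀, α, β, ψ, h1, h2, h3, h4⟩ := h
  exact h3.isVBAt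

theorem LocBimod.isVBAt_left {b : C.pt} (h : LocBimod S₁ S₂ M S b) : IsVBAt 𝕜 S₁ b := by
  obtain ⟨A₀, B₀, M₀, α, β, ψ, h1, h2, h3, h4⟩ := h
  exact h1.1.isVBAt

theorem smooth_bilin {F G H : Type u} [AddCommGroup F] [Module 𝕜 F] [AddCommGroup G] [Module 𝕜 G]
    [AddCommGroup H] [Module 𝕜 H] [FiniteDimensional 𝕜 F] [FiniteDimensional 𝕜 G] {b : B.pt}
    (L : F →ₗ[𝕜] G →ₗ[𝕜] H) {f : B.pt → F} {g : B.pt → G} (hf : B.SmoothVecAt 𝕜 f b)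
    (hg : B.SmoothVecAt 𝕜 g b) : B.SmoothVecAt 𝕜 (fun x => L (f x) (g x)) b :=
  Space.SmoothLinAt.apply (L := fun x => L (f x)) (fun v => hf.map (L.flip v)) hg

theorem LocBimod.smooth_left {b : C.pt} (h : LocBimod S₁ S₂ M S b) {a : ∀ b, A₁ b} {m : ∀ b, M b}
    (ha : S₁ a b) (hm : S m b) : S (fun b => (M b).left (a b) (m b)) b := by
  obtain ⟨A₀, B₀, M₀, α, β, ψ, h1, h2, h3, h4⟩ := h
  rw [h3.smooth_iff] at hm ⊢
  rw [h1.1.smooth_iff] at ha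
  exact (smooth_bilin M₀.left ha hm).congr (h4.mono fun b' hb => (hb.2.1 _ _).symm)

theorem LocBimod.smooth_right {b : C.pt} (h : LocBimod S₁ S₂ M S b) {a : ∀ b, A₂ b} {m : ∀ b, M b}
    (ha : S₂ a b) (hm : S m b) : S (fun b => (M b).right (a b) (m b)) b := by
  obtain ⟨A₀, B₀, M₀, α, β, ψ, h1, h2, h3, h4⟩ := h
  rw [h3.smooth_iff] at hm ⊢
  rw [h2.1.smooth_iff] at ha
  exact (smooth_bilin M₀.right ha hm).congr (h4.mono fun b' hb => (hb.2.2 _ _).symm)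

end Loc

theorem AlgBundle.isVBAt (𝒜 : AlgBundle 𝕜 B) (b : B.pt) : IsVBAt 𝕜 𝒜.smooth b := by
  obtain ⟨A₀, α, h⟩ := 𝒜.locTriv b
  exact h.1.isVBAt

theorem BimodBundle.locBimod {BL BR : Space.{u}} {𝒜 : AlgBundle 𝕜 BL} {ℬ : AlgBundle 𝕜 BR}
    {t : B.pt → BL.pt} {s : B.pt → BR.pt} (ℳ : BimodBundle B 𝒜 ℬ t s) (b : B.pt) :
    LocBimod (A₁ := fun b => 𝒜.fib (t b)) (A₂ := fun b => ℬ.fib (s b)) (pullSec 𝕜 t 𝒜.smooth)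
      (pullSec 𝕜 s ℬ.smooth) ℳ.fib ℳ.smooth b := ℳ.locTriv b

theorem BimodBundle.isVBAt {BL BR : Space.{u}} {𝒜 : AlgBundle 𝕜 BL} {ℬ : AlgBundle 𝕜 BR}
    {t : B.pt → BL.pt} {s : B.pt → BR.pt} (ℳ : BimodBundle B 𝒜 ℬ t s) (b : B.pt) :
    IsVBAt 𝕜 ℳ.smooth b := (ℳ.locBimod b).isVBAt

/-- Pulled back bimodule bundles, with the algebra bundles pulled back in one step. -/
theorem BimodBundle.locBimod_pull {BL BR : Space.{u}} {𝒜 : AlgBundle 𝕜 BL} {ℬ : AlgBundle 𝕜 BR}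
    {t : B.pt → BL.pt} {s : B.pt → BR.pt} (ℳ : BimodBundle B 𝒜 ℬ t s) {f : C.pt → B.pt}
    (hf : ∀ c, Space.SmoothMapAt f c) (c : C.pt) :
    LocBimod (A₁ := fun c => 𝒜.fib (t (f c))) (A₂ := fun c => ℬ.fib (s (f c)))
      (pullSec 𝕜 (fun c => t (f c)) 𝒜.smooth) (pullSec 𝕜 (fun c => s (f c)) ℬ.smooth)
      (fun c => ℳ.fib (f c)) (pullSec 𝕜 f ℳ.smooth) c := by
  have h := (ℳ.locBimod (f c)).pull (hf c)
  have e1 : pullSec 𝕜 f (pullSec 𝕜 t 𝒜.smooth) = pullSec 𝕜 (fun c => t (f c)) 𝒜.smooth := by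
    funext s' c'; exact propext (pullSec_comp (V := fun x => (𝒜.fib x).carrier) (hf c') s')
  have e2 : pullSec 𝕜 f (pullSec 𝕜 s ℬ.smooth) = pullSec 𝕜 (fun c => s (f c)) ℬ.smooth := by
    funext s' c'; exact propext (pullSec_comp (V := fun x => (ℬ.fib x).carrier) (hf c') s')
  rwa [e1, e2] at h

/-- The pulled back bimodule bundle. -/
def BimodBundle.pull {BL BR : Space.{u}} {𝒜 : AlgBundle 𝕜 BL} {ℬ : AlgBundle 𝕜 BR}
    {t : B.pt → BL.pt} {s : B.pt → BR.pt} (ℳ : BimodBundle B 𝒜 ℬ t s) (f : C.pt → B.pt)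
    (hf : ∀ c, Space.SmoothMapAt f c) :
    BimodBundle C 𝒜 ℬ (fun c => t (f c)) (fun c => s (f c)) where
  fib c := ℳ.fib (f c)
  smooth := pullSec 𝕜 f ℳ.smooth
  locTriv c := ℳ.locBimod_pull hf c

/-- The pulled back super algebra bundle. -/
def AlgBundle.pull (𝒜 : AlgBundle 𝕜 B) (f : C.pt → B.pt) (hf : ∀ c, Space.SmoothMapAt f c) :
    AlgBundle 𝕜 C where
  fib c := 𝒜.fib (f c)
  smooth := pullSec 𝕜 f 𝒜.smooth
  locTriv c := by
    obtain ⟨A₀, α, h⟩ := 𝒜.locTriv (f c)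
    exact ⟨A₀, fun c => α (f c), h.pull (hf c)⟩

theorem isTriv_const {F : Type u} [AddCommGroup F] [Module 𝕜 F] (b : B.pt) :
    IsTriv (V := fun _ : B.pt => F) (fun s b => B.SmoothVecAt 𝕜 s b)
      (fun _ => (LinearMap.id : F →ₗ[𝕜] F)) b :=
  Filter.Eventually.of_forall fun _ => ⟨Function.bijective_id, fun _ => Iff.rfl⟩

/-- The trivial super algebra bundle. -/
def AlgBundle.const (B : Space.{u}) (A : SAlg.{u} 𝕜) : AlgBundle 𝕜 B where
  fib _ := A
  smooth s b := B.SmoothVecAt 𝕜 s b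
  locTriv b := ⟨A, fun _ => LinearMap.id, isTriv_const b, Filter.Eventually.of_forall fun _ =>
    ⟨Function.bijective_id, rfl, fun _ _ => rfl, fun _ _ h => h⟩⟩

end Bundles

section Parity

variable {𝕜 : Type} [RCLike 𝕜]

/-- The parity operator of a `ℤ/2`-graded vector space. -/
def parity {V : Type u} [AddCommGroup V] [Module 𝕜 V] {gr : ZMod 2 → Submodule 𝕜 V}
    (h : IsCompl (gr 0) (gr 1)) : V →ₗ[𝕜] V := (SBimod.exists_parity h).choose

section

variable {V W : Type u} [AddCommGroup V] [Module 𝕜 V] [AddCommGroup W] [Module 𝕜 W]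
  {gr : ZMod 2 → Submodule 𝕜 V} {gr' : ZMod 2 → Submodule 𝕜 W}

theorem parity_apply (h : IsCompl (gr 0) (gr 1)) {i : ZMod 2} {v : V} (hv : v ∈ gr i) :
    parity h v = (-1 : 𝕜) ^ i.val • v := (SBimod.exists_parity h).choose_spec i v hv

theorem parity_zero (h : IsCompl (gr 0) (gr 1)) {v : V} (hv : v ∈ gr 0) : parity h v = v := by
  simpa using parity_apply h hv

theorem parity_one (h : IsCompl (gr 0) (gr 1)) {v : V} (hv : v ∈ gr 1) : parity h v = -v := by
  simpa [ZMod.val_one] using parity_apply h hv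

theorem parity_parity (h : IsCompl (gr 0) (gr 1)) (v : V) : parity h (parity h v) = v := by
  obtain ⟨v₀, h₀, v₁, h₁, rfl⟩ := SBimod.exists_homogeneous h v
  simp [parity_zero h h₀, parity_one h h₁]

theorem mem_gr_zero_iff (h : IsCompl (gr 0) (gr 1)) {v : V} : v ∈ gr 0 ↔ parity h v = v := by
  refine ⟨parity_zero h, fun e => ?_⟩
  obtain ⟨v₀, h₀, v₁, h₁, rfl⟩ := SBimod.exists_homogeneous h v
  rw [map_add, parity_zero h h₀, parity_one h h₁, add_right_inj] at e
  have h2 : v₁ = 0 := by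
    have h3 : (2 : 𝕜) • v₁ = 0 := by rw [two_smul]; nth_rewrite 1 [← e]; simp
    exact (smul_eq_zero.1 h3).resolve_left two_ne_zero
  simpa [h2] using h₀

theorem mem_gr_one_iff (h : IsCompl (gr 0) (gr 1)) {v : V} : v ∈ gr 1 ↔ parity h v = -v := by
  refine ⟨parity_one h, fun e => ?_⟩
  obtain ⟨v₀, h₀, v₁, h₁, rfl⟩ := SBimod.exists_homogeneous h v
  rw [map_add, parity_zero h h₀, parity_one h h₁, neg_add, add_left_inj] at e
  have h2 : v₀ = 0 := by
    have h3 : (2 : 𝕜) • v₀ = 0 := by rw [two_smul]; nth_rewrite 1 [e]; simp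
    exact (smul_eq_zero.1 h3).resolve_left two_ne_zero
  simpa [h2] using h₁

theorem mem_gr_iff (h : IsCompl (gr 0) (gr 1)) {i : ZMod 2} {v : V} :
    v ∈ gr i ↔ parity h v = (-1 : 𝕜) ^ i.val • v := by
  have hi : i = 0 ∨ i = 1 := by revert i; decide
  rcases hi with rfl | rfl
  · rw [mem_gr_zero_iff h]; simp
  · rw [mem_gr_one_iff h]; simp [ZMod.val_one]

theorem even_iff_parity (h : IsCompl (gr 0) (gr 1)) (h' : IsCompl (gr' 0) (gr' 1))
    {f : V →ₗ[𝕜] W} :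
    (∀ (i : ZMod 2) (v : V), v ∈ gr i → f v ∈ gr' i) ↔ ∀ v, parity h' (f v) = f (parity h v) := by
  constructor
  · intro hf v
    obtain ⟨v₀, h₀, v₁, h₁, rfl⟩ := SBimod.exists_homogeneous h v
    simp [parity_zero h h₀, parity_one h h₁, parity_zero h' (hf _ _ h₀),
      parity_one h' (hf _ _ h₁)]
  · intro hf i v hv
    rw [mem_gr_iff h', hf, parity_apply h hv, map_smul]

end

/-- The parity automorphism of a super algebra. -/
def SAlg.par (A : SAlg.{u} 𝕜) : A →ₗ[𝕜] A := parity A.isCompl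

/-- The parity operator of a bimodule. -/
def SBimod.par {A B : SAlg.{u} 𝕜} (M : SBimod A B) : M →ₗ[𝕜] M := parity M.isCompl

theorem SAlg.mem_zero_iff {A : SAlg.{u} 𝕜} {a : A} : a ∈ A.gr 0 ↔ A.par a = a :=
  mem_gr_zero_iff A.isCompl

theorem SAlg.par_mul {A : SAlg.{u} 𝕜} (a b : A) : A.par (a * b) = A.par a * A.par b := by
  have key : ∀ (i j : ZMod 2) (a b : A), a ∈ A.gr i → b ∈ A.gr j →
      A.par (a * b) = A.par a * A.par b := by
    intro i j a b ha hb
    rw [par, parity_apply _ (A.mul_mem ha hb), parity_apply _ ha, parity_apply _ hb,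
      SBimod.negOne_pow_val_add]
    simp [smul_smul, mul_comm]
  obtain ⟨a₀, ha₀, a₁, ha₁, rfl⟩ := SBimod.exists_homogeneous A.isCompl a
  obtain ⟨b₀, hb₀, b₁, hb₁, rfl⟩ := SBimod.exists_homogeneous A.isCompl b
  simp [add_mul, mul_add, key _ _ _ _ ha₀ hb₀, key _ _ _ _ ha₀ hb₁, key _ _ _ _ ha₁ hb₀,
    key _ _ _ _ ha₁ hb₁]

namespace SBimod

variable {A B : SAlg.{u} 𝕜} (M : SBimod A B)

theorem par_par (m : M) : M.par (M.par m) = m := parity_parity _ m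

theorem par_left (a : A) (m : M) : M.par (M.left a m) = M.left (A.par a) (M.par m) := by
  have key : ∀ (i j : ZMod 2) (a : A) (m : M), a ∈ A.gr i → m ∈ M.gr j →
      M.par (M.left a m) = M.left (A.par a) (M.par m) := by
    intro i j a m ha hm
    rw [par, SAlg.par, parity_apply _ (M.left_mem ha hm), parity_apply _ ha, parity_apply _ hm,
      negOne_pow_val_add]
    simp [smul_smul, mul_comm]
  obtain ⟨a₀, ha₀, a₁, ha₁, rfl⟩ := exists_homogeneous A.isCompl a
  obtain ⟨m₀, hm₀, m₁, hm₁, rfl⟩ := exists_homogeneous M.isCompl m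
  simp [key _ _ _ _ ha₀ hm₀, key _ _ _ _ ha₀ hm₁, key _ _ _ _ ha₁ hm₀, key _ _ _ _ ha₁ hm₁]

theorem par_right (b : B) (m : M) : M.par (M.right b m) = M.right (B.par b) (M.par m) := by
  have key : ∀ (i j : ZMod 2) (b : B) (m : M), b ∈ B.gr i → m ∈ M.gr j →
      M.par (M.right b m) = M.right (B.par b) (M.par m) := by
    intro i j a m ha hm
    rw [par, SAlg.par, parity_apply _ (M.right_mem hm ha), parity_apply _ ha, parity_apply _ hm,
      negOne_pow_val_add]
    simp [smul_smul]
  obtain ⟨a₀, ha₀, a₁, ha₁, rfl⟩ := exists_homogeneous B.isCompl b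
  obtain ⟨m₀, hm₀, m₁, hm₁, rfl⟩ := exists_homogeneous M.isCompl m
  simp [key _ _ _ _ ha₀ hm₀, key _ _ _ _ ha₀ hm₁, key _ _ _ _ ha₁ hm₀, key _ _ _ _ ha₁ hm₁]

end SBimod

end Parity

section AlgIso

variable {𝕜 : Type} [RCLike 𝕜] {A B C : SAlg.{u} 𝕜}

namespace IsSAlgIso

theorem par {f : A →ₗ[𝕜] B} (h : IsSAlgIso f) (a : A) : B.par (f a) = f (A.par a) :=
  (even_iff_parity A.isCompl B.isCompl).1 h.2.2.2 a

/-- The linear equivalence underlying an isomorphism of super algebras. -/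
def equiv {f : A →ₗ[𝕜] B} (h : IsSAlgIso f) : A ≃ₗ[𝕜] B := LinearEquiv.ofBijective f h.1

@[simp] theorem equiv_apply {f : A →ₗ[𝕜] B} (h : IsSAlgIso f) (a : A) : h.equiv a = f a := rfl

theorem symm {f : A →ₗ[𝕜] B} (h : IsSAlgIso f) : IsSAlgIso h.equiv.symm.toLinearMap := by
  refine ⟨h.equiv.symm.bijective, ?_, fun a b => ?_, ?_⟩
  · exact h.equiv.symm_apply_eq.2 h.2.1.symm
  · refine h.equiv.symm_apply_eq.2 ?_
    rw [equiv_apply, h.2.2.1]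
    exact congrArg₂ (· * ·) (h.equiv.apply_symm_apply a).symm (h.equiv.apply_symm_apply b).symm
  · refine (even_iff_parity B.isCompl A.isCompl).2 fun b => ?_
    refine (h.equiv.symm_apply_eq.2 ?_).symm
    rw [equiv_apply]
    have := h.par (h.equiv.symm b)
    rw [show f (h.equiv.symm b) = b from h.equiv.apply_symm_apply b] at this
    exact this

theorem comp {f : A →ₗ[𝕜] B} {g : B →ₗ[𝕜] C} (hg : IsSAlgIso g) (hf : IsSAlgIso f) :
    IsSAlgIso (g ∘ₗ f) :=
  ⟨hg.1.comp hf.1, by simp [hf.2.1, hg.2.1], fun a b => by simp [hf.2.2.1, hg.2.2.1],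
    fun i a ha => hg.2.2.2 i _ (hf.2.2.2 i a ha)⟩

/-- The homomorphism of super algebras underlying an isomorphism. -/
def toHom {f : A →ₗ[𝕜] B} (h : IsSAlgIso f) : SAlgHom A B :=
  ⟨AlgHom.ofLinearMap f h.2.1 h.2.2.1, fun {i a} ha => h.2.2.2 i a ha⟩

/-- An isomorphism of a super algebra to itself as an even automorphism. -/
def toAut {f : A →ₗ[𝕜] A} (h : IsSAlgIso f) : evenAut A :=
  ⟨AlgEquiv.ofBijective (AlgHom.ofLinearMap f h.2.1 h.2.2.1) h.1, fun i a => by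
    refine ⟨fun ha => ?_, h.2.2.2 i a⟩
    have := h.symm.2.2.2 i _ ha
    rwa [show h.equiv.symm.toLinearMap (AlgEquiv.ofBijective
      (AlgHom.ofLinearMap f h.2.1 h.2.2.1) h.1 a) = a from h.equiv.symm_apply_apply a] at this⟩

end IsSAlgIso

theorem evenAut.isSAlgIso (φ : evenAut A) : IsSAlgIso (φ.1.toLinearMap : A →ₗ[𝕜] A) :=
  ⟨φ.1.bijective, map_one φ.1, map_mul φ.1, fun i a => (φ.2 i a).2⟩

theorem evenAut.par (φ : evenAut A) (a : A) : A.par (φ.1 a) = φ.1 (A.par a) :=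
  (evenAut.isSAlgIso φ).par a

end AlgIso

namespace SBimod

variable {𝕜 : Type} [RCLike 𝕜] {A B C D : SAlg.{u} 𝕜}

section Iso

theorem Isomorphic.refl (M : SBimod A B) : Isomorphic M M :=
  ⟨⟨LinearMap.id, fun h => h, fun _ _ => rfl, fun _ _ => rfl⟩, Function.bijective_id⟩

theorem Isomorphic.trans {M N L : SBimod A B} (h : Isomorphic M N) (h' : Isomorphic N L) :
    Isomorphic M L := by
  obtain ⟨f, hf⟩ := h
  obtain ⟨g, hg⟩ := h'
  exact ⟨⟨g.toLin ∘ₗ f.toLin, fun h => g.even (f.even h), fun a m => by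
    simp [f.map_left, g.map_left], fun a m => by simp [f.map_right, g.map_right]⟩, hg.comp hf⟩

/-- The inverse of a bijective intertwiner. -/
def Hom.inv {M N : SBimod A B} (f : Hom M N) (hf : Function.Bijective f.toLin) : Hom N M :=
  let e := LinearEquiv.ofBijective f.toLin hf
  { toLin := e.symm.toLinearMap
    even := by
      refine fun {i m} => (even_iff_parity N.isCompl M.isCompl).2 (fun n => ?_) i m
      refine (e.symm_apply_eq.2 ?_).symm
      have := (even_iff_parity M.isCompl N.isCompl).1 (fun i v => f.even) (e.symm n)
      rw [show f.toLin (e.symm n) = n from e.apply_symm_apply n] at this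
      exact this
    map_left := fun a n => e.symm_apply_eq.2 (by
      change _ = f.toLin (M.left a (e.symm n))
      rw [f.map_left, show f.toLin (e.symm n) = n from e.apply_symm_apply n])
    map_right := fun a n => e.symm_apply_eq.2 (by
      change _ = f.toLin (M.right a (e.symm n))
      rw [f.map_right, show f.toLin (e.symm n) = n from e.apply_symm_apply n]) }

theorem Hom.apply_inv {M N : SBimod A B} (f : Hom M N) (hf : Function.Bijective f.toLin) (n : N) :
    f.toLin ((f.inv hf).toLin n) = n :=
  (LinearEquiv.ofBijective f.toLin hf).apply_symm_apply n

theorem Hom.inv_apply {M N : SBimod A B} (f : Hom M N) (hf : Function.Bijective f.toLin) (m : M) :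
    (f.inv hf).toLin (f.toLin m) = m :=
  (LinearEquiv.ofBijective f.toLin hf).symm_apply_apply m

theorem Hom.inv_bijective {M N : SBimod A B} (f : Hom M N) (hf : Function.Bijective f.toLin) :
    Function.Bijective (f.inv hf).toLin := (LinearEquiv.ofBijective f.toLin hf).symm.bijective

theorem Isomorphic.symm {M N : SBimod A B} (h : Isomorphic M N) : Isomorphic N M := by
  obtain ⟨f, hf⟩ := h
  exact ⟨f.inv hf, f.inv_bijective hf⟩

/-- Pure tensors as a bilinear map. -/
def tmulL (M : SBimod A B) (N : SBimod B C) : M →ₗ[𝕜] N →ₗ[𝕜] tensor M N :=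
  (TensorProduct.mk 𝕜 M N).compr₂ (tensorMk M N)

@[simp] theorem tmulL_apply (M : SBimod A B) (N : SBimod B C) (m : M) (n : N) :
    tmulL M N m n = tmul m n := rfl

variable {A₀ B₀ C₀ : SAlg.{u} 𝕜}

theorem tensor_hom_ext {M : SBimod A B} {N : SBimod B C} {V : Type u} [AddCommGroup V] [Module 𝕜 V]
    {f g : tensor M N →ₗ[𝕜] V} (h : ∀ m n, f (tmul m n) = g (tmul m n)) : f = g :=
  tensor_ext h

/-- The map between relative tensor products induced by semilinear maps. -/
def tensorMap {M : SBimod A B} {N : SBimod B C} {M₀ : SBimod A₀ B₀} {N₀ : SBimod B₀ C₀}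
    (ψ : M →ₗ[𝕜] M₀) (χ : N →ₗ[𝕜] N₀) (β : B → B₀)
    (hψ : ∀ b m, ψ (M.right b m) = M₀.right (β b) (ψ m))
    (hχ : ∀ b n, χ (N.left b n) = N₀.left (β b) (χ n)) : tensor M N →ₗ[𝕜] tensor M₀ N₀ :=
  tensorLift ((tmulL M₀ N₀).compl₁₂ ψ χ) fun m b n => by simp [hψ, hχ, tmul_right]

@[simp] theorem tensorMap_tmul {M : SBimod A B} {N : SBimod B C} {M₀ : SBimod A₀ B₀}
    {N₀ : SBimod B₀ C₀} (ψ : M →ₗ[𝕜] M₀) (χ : N →ₗ[𝕜] N₀) (β : B → B₀) (hψ hχ) (m : M) (n : N) :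
    tensorMap ψ χ β hψ hχ (tmul m n) = tmul (ψ m) (χ n) := by
  simp [tensorMap]

/-- The equivalence between relative tensor products induced by semilinear equivalences. -/
def tensorEquiv {M : SBimod A B} {N : SBimod B C} {M₀ : SBimod A₀ B₀} {N₀ : SBimod B₀ C₀}
    (ψ : M ≃ₗ[𝕜] M₀) (χ : N ≃ₗ[𝕜] N₀) (β : B ≃ B₀)
    (hψ : ∀ b m, ψ (M.right b m) = M₀.right (β b) (ψ m))
    (hχ : ∀ b n, χ (N.left b n) = N₀.left (β b) (χ n)) : tensor M N ≃ₗ[𝕜] tensor M₀ N₀ :=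
  LinearEquiv.ofLinearMap (tensorMap ψ.toLinearMap χ.toLinearMap β hψ hχ)
    (tensorMap ψ.symm.toLinearMap χ.symm.toLinearMap β.symm
      (fun b m => ψ.symm_apply_eq.2 (by simp [hψ])) (fun b m => χ.symm_apply_eq.2 (by simp [hχ])))
    (tensor_hom_ext fun m n => by simp) (tensor_hom_ext fun m n => by simp)

@[simp] theorem tensorEquiv_tmul {M : SBimod A B} {N : SBimod B C} {M₀ : SBimod A₀ B₀}
    {N₀ : SBimod B₀ C₀} (ψ : M ≃ₗ[𝕜] M₀) (χ : N ≃ₗ[𝕜] N₀) (β : B ≃ B₀) (hψ hχ) (m : M) (n : N) :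
    tensorEquiv ψ χ β hψ hχ (tmul m n) = tmul (ψ m) (χ n) :=
  tensorMap_tmul ψ.toLinearMap χ.toLinearMap β hψ hχ m n

theorem Isomorphic.tensor_congr {M M' : SBimod A B} {N N' : SBimod B C} (h : Isomorphic M M')
    (h' : Isomorphic N N') : Isomorphic (tensor M N) (tensor M' N') := by
  obtain ⟨f, hf⟩ := h
  obtain ⟨g, hg⟩ := h'
  refine ⟨homLift ((tmulL M' N').compl₁₂ f.toLin g.toLin) (fun m b n => ?_) (fun i j m n hm hn => ?_)
    (fun a m n => ?_) (fun a m n => ?_), ?_⟩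
  · simp [f.map_right, g.map_left, tmul_right]
  · exact tmul_mem (f.even hm) (g.even hn)
  · simp [f.map_left, left_tmul]
  · simp [g.map_right, right_tmul]
  · exact (tensorEquiv (LinearEquiv.ofBijective f.toLin hf) (LinearEquiv.ofBijective g.toLin hg)
      (Equiv.refl B) (fun b m => f.map_right b m) (fun b m => g.map_left b m)).bijective

theorem isomorphic_self_tensor (M : SBimod A B) : Isomorphic (tensor (self A) M) M := by
  let f : Hom (tensor (self A) M) M := homLift M.left (fun m b n => M.left_mul m b n)
    (fun i j m n hm hn => M.left_mem hm hn)
    (fun a m n => M.left_mul a m n) (fun a m n => M.left_right m a n)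
  have hf : ∀ (a : self A) m, f.toLin (tmul a m) = M.left a m := fun a m => homLift_tmul _ _ _ _ _ a m
  let g : M →ₗ[𝕜] tensor (self A) M := tmulL (self A) M (1 : A)
  refine ⟨f, Function.bijective_iff_has_inverse.2 ⟨g, fun t => ?_, fun m => ?_⟩⟩
  · induction t using tensor_induction with
    | h0 => simp
    | ht a m =>
      refine (congrArg g (hf a m)).trans ((tmul_right (M := self A) (1 : A) a m).symm.trans ?_)
      exact congrArg (fun x : self A => tmul x m) (one_mul (M := A) a)
    | hadd x y hx hy => simp [hx, hy]
  · exact (hf _ m).trans (M.left_one m)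

theorem isomorphic_tensor_self (M : SBimod A B) : Isomorphic (tensor M (self B)) M := by
  let f : Hom (tensor M (self B)) M := homLift M.right.flip
    (fun m b n => (M.right_mul b n m).symm) (fun i j m n hm hn => M.right_mem hm hn)
    (fun a m n => (M.left_right a n m).symm) (fun a m n => M.right_mul n a m)
  have hf : ∀ m (b : self B), f.toLin (tmul m b) = M.right b m := fun m b => homLift_tmul _ _ _ _ _ m b
  let g : M →ₗ[𝕜] tensor M (self B) := (tmulL M (self B)).flip (1 : B)
  refine ⟨f, Function.bijective_iff_has_inverse.2 ⟨g, fun t => ?_, fun m => ?_⟩⟩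
  · induction t using tensor_induction with
    | h0 => simp
    | ht m b =>
      refine (congrArg g (hf m b)).trans ((tmul_right (N := self B) m b (1 : B)).trans ?_)
      exact congrArg (fun x : self B => tmul m x) (mul_one (M := B) b)
    | hadd x y hx hy => simp [hx, hy]
  · exact (hf m _).trans (M.right_one m)

/-- The associator, from left to right. -/
def assocHom (M : SBimod A B) (N : SBimod B C) (L : SBimod C D) :
    tensor (tensor M N) L →ₗ[𝕜] tensor M (tensor N L) :=
  tensorLift (tensorLift ((LinearMap.llcomp 𝕜 L (tensor N L) (tensor M (tensor N L))).compl₁₂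
      (tmulL M (tensor N L)) (tmulL N L)) fun m b n => by
        ext l
        simp [tmul_right, left_tmul]) fun t c l => by
    induction t using tensor_induction with
    | h0 => simp
    | ht m n => simp [right_tmul, tmul_right]
    | hadd x y hx hy => simp [hx, hy]

@[simp] theorem assocHom_tmul (M : SBimod A B) (N : SBimod B C) (L : SBimod C D) (m : M) (n : N)
    (l : L) : assocHom M N L (tmul (tmul m n) l) = tmul m (tmul n l) := by
  simp [assocHom]

/-- Tensoring on the left with a fixed element. -/
def assocAux (M : SBimod A B) (N : SBimod B C) (L : SBimod C D) (m : M) :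
    tensor N L →ₗ[𝕜] tensor (tensor M N) L :=
  tensorLift ((tmulL (tensor M N) L).comp (tmulL M N m)) fun n c l => by
    simp [← tmul_right, right_tmul]

@[simp] theorem assocAux_tmul (M : SBimod A B) (N : SBimod B C) (L : SBimod C D) (m : M) (n : N)
    (l : L) : assocAux M N L m (tmul n l) = tmul (tmul m n) l := tensorLift_tmul _ _ n l

/-- The associator, from right to left. -/
def assocInv (M : SBimod A B) (N : SBimod B C) (L : SBimod C D) :
    tensor M (tensor N L) →ₗ[𝕜] tensor (tensor M N) L :=
  tensorLift
    { toFun := assocAux M N L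
      map_add' := fun m m' => tensor_hom_ext fun n l => by simp [add_tmul]
      map_smul' := fun c m => tensor_hom_ext fun n l => by simp [smul_tmul] } fun m b t => by
    induction t using tensor_induction with
    | h0 => simp
    | ht n l => simp [left_tmul, tmul_right]
    | hadd x y hx hy => simp only [map_add, hx, hy]

@[simp] theorem assocInv_tmul (M : SBimod A B) (N : SBimod B C) (L : SBimod C D) (m : M) (n : N)
    (l : L) : assocInv M N L (tmul m (tmul n l)) = tmul (tmul m n) l := by
  simp [assocInv]

/-- The associator. -/
def assoc (M : SBimod A B) (N : SBimod B C) (L : SBimod C D) :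
    tensor (tensor M N) L ≃ₗ[𝕜] tensor M (tensor N L) :=
  LinearEquiv.ofLinearMap (assocHom M N L) (assocInv M N L)
    (tensor_hom_ext fun m t => by
      induction t using tensor_induction with
      | h0 => simp [← tmulL_apply]
      | ht n l => simp
      | hadd x y hx hy => rw [tmul_add, map_add, map_add, hx, hy])
    (tensor_hom_ext fun t l => by
      induction t using tensor_induction with
      | h0 => simp [← tmulL_apply]
      | ht n l => simp
      | hadd x y hx hy => rw [add_tmul, map_add, map_add, hx, hy])

@[simp] theorem assoc_tmul (M : SBimod A B) (N : SBimod B C) (L : SBimod C D) (m : M) (n : N)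
    (l : L) : assoc M N L (tmul (tmul m n) l) = tmul m (tmul n l) := assocHom_tmul M N L m n l

theorem isomorphic_assoc (M : SBimod A B) (N : SBimod B C) (L : SBimod C D) :
    Isomorphic (tensor (tensor M N) L) (tensor M (tensor N L)) := by
  refine ⟨⟨(assoc M N L).toLinearMap, ?_, fun a t => ?_, fun a t => ?_⟩, (assoc M N L).bijective⟩
  · intro i t ht
    refine tensor_gr_induction (fun i j t l ht hl => ?_) ht
    refine tensor_gr_induction (f := (assoc M N L).toLinearMap ∘ₗ (tmulL (tensor M N) L).flip l)
      (G := fun i => (tensor M (tensor N L)).gr (i + j)) (fun i k m n hm hn => ?_) ht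
    change assoc M N L (tmul (tmul m n) l) ∈ _
    rw [assoc_tmul, add_assoc]
    exact tmul_mem hm (tmul_mem hn hl)
  · refine LinearMap.congr_fun (f := (assoc M N L).toLinearMap ∘ₗ (tensor (tensor M N) L).left a)
      (g := (tensor M (tensor N L)).left a ∘ₗ (assoc M N L).toLinearMap)
      (tensor_hom_ext fun t l => ?_) t
    induction t using tensor_induction with
    | h0 => simp [← tmulL_apply]
    | ht n l => simp [left_tmul]
    | hadd x y hx hy => rw [add_tmul, map_add, map_add, hx, hy]
  · refine LinearMap.congr_fun (f := (assoc M N L).toLinearMap ∘ₗ (tensor (tensor M N) L).right a)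
      (g := (tensor M (tensor N L)).right a ∘ₗ (assoc M N L).toLinearMap)
      (tensor_hom_ext fun t l => ?_) t
    induction t using tensor_induction with
    | h0 => simp [← tmulL_apply]
    | ht n l => simp [right_tmul]
    | hadd x y hx hy => rw [add_tmul, map_add, map_add, hx, hy]

theorem Invertible.of_isomorphic {M M' : SBimod A B} (hM : M.Invertible) (h : Isomorphic M M') :
    M'.Invertible := by
  obtain ⟨N, h1, h2⟩ := hM
  exact ⟨N, (h.symm.tensor_congr (.refl N)).trans h1, ((Isomorphic.refl N).tensor_congr h.symm).trans h2⟩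

theorem Invertible.tensor_prod {M : SBimod A B} {N : SBimod B C} (hM : M.Invertible)
    (hN : N.Invertible) : (tensor M N).Invertible := by
  obtain ⟨M', h1, h2⟩ := hM
  obtain ⟨N', h3, h4⟩ := hN
  refine ⟨SBimod.tensor N' M', ?_, ?_⟩
  · refine (isomorphic_assoc _ _ _).trans (((Isomorphic.refl M).tensor_congr ?_).trans h1)
    exact (isomorphic_assoc _ _ _).symm.trans ((h3.tensor_congr (.refl _)).trans (isomorphic_self_tensor _))
  · refine (isomorphic_assoc _ _ _).trans (((Isomorphic.refl N').tensor_congr ?_).trans h4)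
    exact (isomorphic_assoc _ _ _).symm.trans ((h2.tensor_congr (.refl _)).trans (isomorphic_self_tensor _))

theorem Invertible.of_inverses {M : SBimod A B} {L R : SBimod B A}
    (hL : Isomorphic (SBimod.tensor L M) (self B)) (hR : Isomorphic (SBimod.tensor M R) (self A)) :
    M.Invertible := by
  refine ⟨R, hR, ?_⟩
  have : Isomorphic R L :=
    (isomorphic_self_tensor R).symm.trans ((hL.symm.tensor_congr (.refl R)).trans
      ((isomorphic_assoc _ _ _).trans (((Isomorphic.refl L).tensor_congr hR).trans
        (isomorphic_tensor_self L))))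
  exact (this.tensor_congr (.refl M)).trans hL

end Iso

end SBimod

section Morita

variable {𝕜 : Type} [RCLike 𝕜] {A B C D : SAlg.{u} 𝕜}

namespace SBimod

/-- The pairings that exhibit `M` and `N` as mutually inverse bimodules. -/
structure Pairing (M : SBimod A B) (N : SBimod B A) where
  ε : tensor M N →ₗ[𝕜] A
  η : tensor N M →ₗ[𝕜] B
  hε : Function.Bijective ε
  hη : Function.Bijective η
  ε_left : ∀ a t, ε ((tensor M N).left a t) = a * ε t
  ε_right : ∀ a t, ε ((tensor M N).right a t) = ε t * a
  η_left : ∀ b t, η ((tensor N M).left b t) = b * η t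
  η_right : ∀ b t, η ((tensor N M).right b t) = η t * b
  ε_even : ∀ {i t}, t ∈ (tensor M N).gr i → ε t ∈ A.gr i
  η_even : ∀ {i t}, t ∈ (tensor N M).gr i → η t ∈ B.gr i

theorem Invertible.exists_pairing {M : SBimod A B} (hM : M.Invertible) :
    ∃ N : SBimod B A, Nonempty (Pairing M N) := by
  obtain ⟨N, ⟨ε, hε⟩, ⟨η, hη⟩⟩ := hM
  exact ⟨N, ⟨ε.toLin, η.toLin, hε, hη, ε.map_left, ε.map_right, η.map_left, η.map_right,
    ε.even, η.even⟩⟩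

theorem Pairing.invertible {M : SBimod A B} {N : SBimod B A} (P : Pairing M N) : M.Invertible :=
  ⟨N, ⟨⟨P.ε, P.ε_even, P.ε_left, P.ε_right⟩, P.hε⟩, ⟨⟨P.η, P.η_even, P.η_left, P.η_right⟩, P.hη⟩⟩

/-- For `m`, the map `n ⊗ m' ↦ (m, n) ▹ m'`. -/
def Pairing.evalL {M : SBimod A B} {N : SBimod B A} (P : Pairing M N) (m : M) :
    tensor N M →ₗ[𝕜] M :=
  tensorLift (M.left ∘ₗ (P.ε ∘ₗ tmulL M N m)) fun n a m' => by
    simp only [LinearMap.comp_apply, tmulL_apply, ← right_tmul, P.ε_right, M.left_mul]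

theorem Pairing.evalL_tmul {M : SBimod A B} {N : SBimod B A} (P : Pairing M N) (m m' : M)
    (n : N) : P.evalL m (tmul n m') = M.left (P.ε (tmul m n)) m' := tensorLift_tmul _ _ n m'

/-- For `m`, the map `m' ⊗ n ↦ m' ◃ ⟨n, m⟩`. -/
def Pairing.evalR {M : SBimod A B} {N : SBimod B A} (P : Pairing M N) (m : M) :
    tensor M N →ₗ[𝕜] M :=
  tensorLift (LinearMap.flip (M.right ∘ₗ (P.η ∘ₗ (tmulL N M).flip m))) fun m' b n => by
    simp only [LinearMap.flip_apply, LinearMap.comp_apply, tmulL_apply, ← left_tmul, P.η_left,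
      M.right_mul]

theorem Pairing.evalR_tmul {M : SBimod A B} {N : SBimod B A} (P : Pairing M N) (m m' : M)
    (n : N) : P.evalR m (tmul m' n) = M.right (P.η (tmul n m)) m' := tensorLift_tmul _ _ m' n

theorem Pairing.exists_ε_eq_one {M : SBimod A B} {N : SBimod B A} (P : Pairing M N) :
    ∃ (k : ℕ) (m : Fin k → M) (n : Fin k → N), P.ε (∑ i, tmul (m i) (n i)) = 1 := by
  obtain ⟨t, ht⟩ := P.hε.2 1
  obtain ⟨k, m, n, rfl⟩ := exists_sum_tmul t
  exact ⟨k, m, n, ht⟩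

theorem Pairing.exists_η_eq_one {M : SBimod A B} {N : SBimod B A} (P : Pairing M N) :
    ∃ (k : ℕ) (n : Fin k → N) (m : Fin k → M), P.η (∑ i, tmul (n i) (m i)) = 1 := by
  obtain ⟨t, ht⟩ := P.hη.2 1
  obtain ⟨k, m, n, rfl⟩ := exists_sum_tmul t
  exact ⟨k, m, n, ht⟩

theorem sum_left_eq {M : SBimod A B} {k : ℕ} {a : Fin k → A} (h : ∑ i, a i = 1) (x : M) :
    ∑ i, M.left (a i) x = x := by
  have := M.left_one x
  rw [← h, map_sum, LinearMap.sum_apply] at this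
  exact this

theorem sum_right_eq {M : SBimod A B} {k : ℕ} {a : Fin k → B} (h : ∑ i, a i = 1) (x : M) :
    ∑ i, M.right (a i) x = x := by
  have := M.right_one x
  rw [← h, map_sum, LinearMap.sum_apply] at this
  exact this

namespace Invertible

variable {M : SBimod A B}

theorem eq_zero_of_right (hM : M.Invertible) {b : B} (h : ∀ m, M.right b m = 0) : b = 0 := by
  obtain ⟨N, ⟨P⟩⟩ := hM.exists_pairing
  obtain ⟨k, n, m, h1⟩ := P.exists_η_eq_one
  have h2 := P.η_right b (∑ i, tmul (n i) (m i))
  rw [h1, map_sum] at h2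
  simp only [right_tmul, h] at h2
  have h3 : ∀ i, tmul (n i) (0 : M) = 0 := fun i => map_zero (tmulL N M (n i))
  simp only [h3, Finset.sum_const_zero, map_zero] at h2
  exact ((one_mul b).symm.trans h2.symm)

theorem right_injective (hM : M.Invertible) : Function.Injective M.right :=
  (injective_iff_map_eq_zero _).2 fun b h => hM.eq_zero_of_right fun m => by simp [h]

theorem eq_zero_of_left (hM : M.Invertible) {a : A} (h : ∀ m, M.left a m = 0) : a = 0 := by
  obtain ⟨N, ⟨P⟩⟩ := hM.exists_pairing
  obtain ⟨k, m, n, h1⟩ := P.exists_ε_eq_one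
  have h2 := P.ε_left a (∑ i, tmul (m i) (n i))
  rw [h1, map_sum] at h2
  simp only [left_tmul, h] at h2
  have h3 : ∀ i, tmul (0 : M) (n i) = 0 := fun i => map_zero ((tmulL M N).flip (n i))
  simp only [h3, Finset.sum_const_zero, map_zero] at h2
  exact ((mul_one a).symm.trans h2.symm)

theorem left_injective (hM : M.Invertible) : Function.Injective M.left :=
  (injective_iff_map_eq_zero _).2 fun b h => hM.eq_zero_of_left fun m => by simp [h]

/-- Left linear endomorphisms are right multiplications. -/
theorem exists_right (hM : M.Invertible) (f : M →ₗ[𝕜] M)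
    (hf : ∀ a m, f (M.left a m) = M.left a (f m)) : ∃ b : B, f = M.right b := by
  obtain ⟨N, ⟨P⟩⟩ := hM.exists_pairing
  obtain ⟨k, n, m, h1⟩ := P.exists_η_eq_one
  obtain ⟨l, m', n', h2⟩ := P.exists_ε_eq_one
  let F : tensor N M →ₗ[𝕜] tensor N M := tensorMap LinearMap.id f id (fun _ _ => rfl) hf
  let b : B := P.η (F (∑ i, tmul (n i) (m i)))
  have key : ∀ t, P.η (F t) = P.η t * b := fun t => by
    have e1 : t = (tensor N M).left (P.η t) (∑ i, tmul (n i) (m i)) := by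
      apply P.hη.1
      rw [P.η_left, h1]
      exact (mul_one (M := B) _).symm
    have e2 : ∀ (b : B) t, F ((tensor N M).left b t) = (tensor N M).left b (F t) := fun b t => by
      induction t using tensor_induction with
      | h0 => simp
      | ht n m => simp [F, left_tmul]
      | hadd x y hx hy => simp only [map_add, hx, hy]
    conv_lhs => rw [e1, e2, P.η_left]
  refine ⟨b, LinearMap.ext fun x => ?_⟩
  have h3 : ∀ n : N, tmul n (f x) = tmul n (M.right b x) := fun n => by
    apply P.hη.1
    have := key (tmul n x)
    rw [show F (tmul n x) = tmul n (f x) from tensorMap_tmul _ _ _ _ _ _ _] at this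
    rw [this, ← right_tmul, P.η_right]
  have h4 : ∀ y : M, ∑ i, P.evalL (m' i) (tmul (n' i) y) = y := fun y => by
    simp only [P.evalL_tmul]
    exact sum_left_eq (by rw [← h2, map_sum]) y
  rw [← h4 (f x), ← h4 (M.right b x)]
  simp only [h3]

/-- Right linear endomorphisms are left multiplications. -/
theorem exists_left (hM : M.Invertible) (f : M →ₗ[𝕜] M)
    (hf : ∀ b m, f (M.right b m) = M.right b (f m)) : ∃ a : A, f = M.left a := by
  obtain ⟨N, ⟨P⟩⟩ := hM.exists_pairing
  obtain ⟨k, m, n, h1⟩ := P.exists_ε_eq_one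
  obtain ⟨l, n', m', h2⟩ := P.exists_η_eq_one
  let F : tensor M N →ₗ[𝕜] tensor M N := tensorMap f LinearMap.id id hf (fun _ _ => rfl)
  let a : A := P.ε (F (∑ i, tmul (m i) (n i)))
  have key : ∀ t, P.ε (F t) = a * P.ε t := fun t => by
    have e1 : t = (tensor M N).right (P.ε t) (∑ i, tmul (m i) (n i)) := by
      apply P.hε.1
      rw [P.ε_right, h1]
      exact (one_mul (M := A) _).symm
    have e2 : ∀ (b : A) t, F ((tensor M N).right b t) = (tensor M N).right b (F t) := fun b t => by
      induction t using tensor_induction with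
      | h0 => simp
      | ht n m => simp [F, right_tmul]
      | hadd x y hx hy => simp only [map_add, hx, hy]
    conv_lhs => rw [e1, e2, P.ε_right]
  refine ⟨a, LinearMap.ext fun x => ?_⟩
  have h3 : ∀ n : N, tmul (f x) n = tmul (M.left a x) n := fun n => by
    apply P.hε.1
    have := key (tmul x n)
    rw [show F (tmul x n) = tmul (f x) n from tensorMap_tmul _ _ _ _ _ _ _] at this
    rw [this, ← left_tmul, P.ε_left]
  have h4 : ∀ y : M, ∑ i, P.evalR (m' i) (tmul y (n' i)) = y := fun y => by
    simp only [P.evalR_tmul]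
    exact sum_right_eq (by rw [← h2, map_sum]) y
  rw [← h4 (f x), ← h4 (M.left a x)]
  simp only [h3]

/-- Invertible bimodules are finitely generated projective on the left. -/
theorem exists_dual_left (hM : M.Invertible) : ∃ (k : ℕ) (x : Fin k → M) (l : Fin k → M →ₗ[𝕜] A),
    (∀ i a m, l i (M.left a m) = a * l i m) ∧ ∀ m, ∑ i, M.left (l i m) (x i) = m := by
  obtain ⟨N, ⟨P⟩⟩ := hM.exists_pairing
  obtain ⟨k, n, m, h1⟩ := P.exists_η_eq_one
  obtain ⟨l, m', n', h2⟩ := P.exists_ε_eq_one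
  let p : N → M →ₗ[𝕜] A := fun n => P.ε ∘ₗ (tmulL M N).flip n
  let g : M →ₗ[𝕜] M := ∑ i, M.left.flip (m i) ∘ₗ p (n i)
  have hg : ∀ x, g x = ∑ i, M.left (p (n i) x) (m i) := fun x => by
    simp [g, LinearMap.sum_apply]
  have hpl : ∀ n a m, p n (M.left a m) = a * p n m := fun n a m => P.ε_left a (tmul m n)
  have hgl : ∀ a x, g (M.left a x) = M.left a (g x) := fun a x => by
    simp only [hg, hpl, M.left_mul, map_sum]
  have key : ∀ (y : M) (n₀ : N) (x : M),
      g (M.right (P.η (tmul n₀ x)) y) = M.left (p n₀ y) x := fun y n₀ x => by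
    have e1 : tmul n₀ x = (tensor N M).left (P.η (tmul n₀ x)) (∑ i, tmul (n i) (m i)) := by
      apply P.hη.1
      rw [P.η_left, h1]
      exact (mul_one (M := B) _).symm
    have e2 : M.left (p n₀ y) x = P.evalL y (tmul n₀ x) := (P.evalL_tmul y x n₀).symm
    rw [e2]
    refine Eq.trans ?_ (congrArg (P.evalL y) e1.symm)
    rw [hg, map_sum, map_sum]
    refine Finset.sum_congr rfl fun i _ => ?_
    rw [left_tmul, P.evalL_tmul, ← tmul_right]
    rfl
  have hsurj : Function.Surjective g := fun x => by
    refine ⟨∑ i, M.right (P.η (tmul (n' i) x)) (m' i), ?_⟩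
    rw [map_sum]
    simp only [key]
    exact sum_left_eq (by rw [← h2, map_sum]; rfl) x
  have hbij : Function.Bijective g := ⟨LinearMap.injective_iff_surjective.2 hsurj, hsurj⟩
  let e := LinearEquiv.ofBijective g hbij
  refine ⟨k, m, fun i => p (n i) ∘ₗ e.symm.toLinearMap, fun i a x => ?_, fun x => ?_⟩
  · have : e.symm (M.left a x) = M.left a (e.symm x) := e.symm_apply_eq.2 (by
      change _ = g _
      rw [hgl]
      exact congrArg _ (e.apply_symm_apply x).symm)
    simp [this, hpl]
  · exact (hg _).symm.trans (e.apply_symm_apply x)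

/-- Invertible bimodules are finitely generated projective on the right. -/
theorem exists_dual_right (hM : M.Invertible) :
    ∃ (k : ℕ) (x : Fin k → M) (l : Fin k → M →ₗ[𝕜] B),
    (∀ i b m, l i (M.right b m) = l i m * b) ∧ ∀ m, ∑ i, M.right (l i m) (x i) = m := by
  obtain ⟨N, ⟨P⟩⟩ := hM.exists_pairing
  obtain ⟨k, m, n, h1⟩ := P.exists_ε_eq_one
  obtain ⟨l, n', m', h2⟩ := P.exists_η_eq_one
  let p : N → M →ₗ[𝕜] B := fun n => P.η ∘ₗ (tmulL N M) n
  let g : M →ₗ[𝕜] M := ∑ i, M.right.flip (m i) ∘ₗ p (n i)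
  have hg : ∀ x, g x = ∑ i, M.right (p (n i) x) (m i) := fun x => by
    simp [g, LinearMap.sum_apply]
  have hpl : ∀ n b m, p n (M.right b m) = p n m * b := fun n b m => P.η_right b (tmul n m)
  have hgl : ∀ b x, g (M.right b x) = M.right b (g x) := fun b x => by
    simp only [hg, hpl, M.right_mul, map_sum]
  have key : ∀ (y : M) (n₀ : N) (x : M),
      g (M.left (P.ε (tmul x n₀)) y) = M.right (p n₀ y) x := fun y n₀ x => by
    have e1 : tmul x n₀ = (tensor M N).right (P.ε (tmul x n₀)) (∑ i, tmul (m i) (n i)) := by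
      apply P.hε.1
      rw [P.ε_right, h1]
      exact (one_mul (M := A) _).symm
    have e2 : M.right (p n₀ y) x = P.evalR y (tmul x n₀) := (P.evalR_tmul y x n₀).symm
    rw [e2]
    refine Eq.trans ?_ (congrArg (P.evalR y) e1.symm)
    rw [hg, map_sum, map_sum]
    refine Finset.sum_congr rfl fun i _ => ?_
    rw [right_tmul, P.evalR_tmul, tmul_right]
    rfl
  have hsurj : Function.Surjective g := fun x => by
    refine ⟨∑ i, M.left (P.ε (tmul x (n' i))) (m' i), ?_⟩
    rw [map_sum]
    simp only [key]
    exact sum_right_eq (by rw [← h2, map_sum]; rfl) x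
  have hbij : Function.Bijective g := ⟨LinearMap.injective_iff_surjective.2 hsurj, hsurj⟩
  let e := LinearEquiv.ofBijective g hbij
  refine ⟨k, m, fun i => p (n i) ∘ₗ e.symm.toLinearMap, fun i a x => ?_, fun x => ?_⟩
  · have : e.symm (M.right a x) = M.right a (e.symm x) := e.symm_apply_eq.2 (by
      change _ = g _
      rw [hgl]
      exact congrArg _ (e.apply_symm_apply x).symm)
    simp [this, hpl]
  · exact (hg _).symm.trans (e.apply_symm_apply x)

theorem mem_zero_of_right (hM : M.Invertible) {b : B}
    (h : ∀ m, M.par (M.right b m) = M.right b (M.par m)) : b ∈ B.gr 0 := by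
  rw [SAlg.mem_zero_iff]
  refine hM.right_injective (LinearMap.ext fun m => ?_)
  rw [← M.par_par m, ← M.par_right, h]

/-- Left linear even automorphisms are right multiplications by even units. -/
theorem exists_unit (hM : M.Invertible) (f : M →ₗ[𝕜] M) (hb : Function.Bijective f)
    (hf : ∀ a m, f (M.left a m) = M.left a (f m)) (he : ∀ m, M.par (f m) = f (M.par m)) :
    ∃ u : evenUnits B, ∀ m, f m = M.right (u.1 : B) m := by
  obtain ⟨b, rfl⟩ := hM.exists_right f hf
  let e := LinearEquiv.ofBijective _ hb
  obtain ⟨c, hc⟩ := hM.exists_right e.symm.toLinearMap fun a m => by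
    refine e.symm_apply_eq.2 ?_
    change _ = M.right b (M.left a (e.symm m))
    rw [hf]
    exact congrArg _ (e.apply_symm_apply m).symm
  have hc' : ∀ m, M.right c m = e.symm m := fun m => by rw [← hc]; rfl
  have h1 : b * c = 1 := hM.right_injective (LinearMap.ext fun m => by
    rw [M.right_mul, hc', M.right_one]; exact e.symm_apply_apply m)
  have h2 : c * b = 1 := hM.right_injective (LinearMap.ext fun m => by
    rw [M.right_mul, hc', M.right_one]; exact e.apply_symm_apply m)
  exact ⟨⟨⟨b, c, h1, h2⟩, hM.mem_zero_of_right he⟩, fun m => rfl⟩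

end Invertible

theorem invertible_self (A : SAlg.{u} 𝕜) : (self A).Invertible :=
  ⟨self A, isomorphic_self_tensor _, isomorphic_self_tensor _⟩

section Semilinear

variable {A₀ B₀ : SAlg.{u} 𝕜}

/-- Invertibility is preserved by semilinear isomorphisms. -/
theorem Invertible.of_semilinear {M : SBimod A B} {M₀ : SBimod A₀ B₀} {α : A →ₗ[𝕜] A₀}
    {β : B →ₗ[𝕜] B₀} (hα : IsSAlgIso α) (hβ : IsSAlgIso β) (ψ : M →ₗ[𝕜] M₀)
    (hψ : Function.Bijective ψ) (he : ∀ i m, m ∈ M.gr i → ψ m ∈ M₀.gr i)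
    (hl : ∀ a m, ψ (M.left a m) = M₀.left (α a) (ψ m))
    (hr : ∀ b m, ψ (M.right b m) = M₀.right (β b) (ψ m)) (hM : M.Invertible) : M₀.Invertible := by
  obtain ⟨N, ⟨P⟩⟩ := hM.exists_pairing
  let ψe : M ≃ₗ[𝕜] M₀ := LinearEquiv.ofBijective ψ hψ
  let N₀ : SBimod B₀ A₀ := (N.twistL hβ.symm.toHom).twistR hα.symm.toHom
  let χ : N ≃ₗ[𝕜] N₀ := LinearEquiv.refl 𝕜 N
  have hχl : ∀ b n, χ (N.left b n) = N₀.left (β b) (χ n) := fun b n => by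
    change N.left b n = N.left (hβ.equiv.symm (hβ.equiv b)) n
    rw [LinearEquiv.symm_apply_apply]
  have hχr : ∀ a n, χ (N.right a n) = N₀.right (α a) (χ n) := fun a n => by
    change N.right a n = N.right (hα.equiv.symm (hα.equiv a)) n
    rw [LinearEquiv.symm_apply_apply]
  have hpψ : ∀ m, M₀.par (ψ m) = ψ (M.par m) := (even_iff_parity M.isCompl M₀.isCompl).1 he
  let T := tensorEquiv ψe χ hβ.equiv.toEquiv hr hχl
  let T' := tensorEquiv χ ψe hα.equiv.toEquiv hχr hl
  have hT : ∀ i t, t ∈ (tensor M₀ N₀).gr i → T.symm t ∈ (tensor M N).gr i := fun i t ht => by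
    refine tensor_gr_induction (f := T.symm.toLinearMap) (fun i j m n hm hn => ?_) ht
    obtain ⟨m, rfl⟩ := ψe.surjective m
    have e : T.symm (tmul (ψe m) n) = tmul (M := M) (N := N) m n := T.symm_apply_eq.2 (by
      exact (tensorEquiv_tmul ψe χ _ _ _ m n).symm)
    change T.symm _ ∈ _
    rw [e]
    refine tmul_mem ?_ hn
    rw [mem_gr_iff M.isCompl]
    apply hψ.1
    have := (mem_gr_iff M₀.isCompl).1 hm
    exact (hpψ m).symm.trans (this.trans (map_smul ψ _ _).symm)
  have hT' : ∀ i t, t ∈ (tensor N₀ M₀).gr i → T'.symm t ∈ (tensor N M).gr i := fun i t ht => by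
    refine tensor_gr_induction (f := T'.symm.toLinearMap) (fun i j n m hn hm => ?_) ht
    obtain ⟨m, rfl⟩ := ψe.surjective m
    have e : T'.symm (tmul n (ψe m)) = tmul (M := N) (N := M) n m := T'.symm_apply_eq.2 (by
      exact (tensorEquiv_tmul χ ψe _ _ _ n m).symm)
    change T'.symm _ ∈ _
    rw [e]
    refine tmul_mem hn ?_
    rw [mem_gr_iff M.isCompl]
    apply hψ.1
    have := (mem_gr_iff M₀.isCompl).1 hm
    exact (hpψ m).symm.trans (this.trans (map_smul ψ _ _).symm)
  have hTl : ∀ a t, T ((tensor M N).left a t) = (tensor M₀ N₀).left (α a) (T t) := fun a t => by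
    induction t using tensor_induction with
    | h0 => simp
    | ht m n => exact (congrArg (fun x => tmul x (χ n)) (hl a m))
    | hadd x y hx hy => simp only [map_add, hx, hy]
  have hTr : ∀ a t, T ((tensor M N).right a t) = (tensor M₀ N₀).right (α a) (T t) := fun a t => by
    induction t using tensor_induction with
    | h0 => simp
    | ht m n => exact (congrArg (fun x => tmul (ψe m) x) (hχr a n))
    | hadd x y hx hy => simp only [map_add, hx, hy]
  have hTl' : ∀ a t, T' ((tensor N M).left a t) = (tensor N₀ M₀).left (β a) (T' t) := fun a t => by
    induction t using tensor_induction with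
    | h0 => simp
    | ht n m => exact (congrArg (fun x => tmul x (ψe m)) (hχl a n))
    | hadd x y hx hy => simp only [map_add, hx, hy]
  have hTr' : ∀ a t, T' ((tensor N M).right a t) = (tensor N₀ M₀).right (β a) (T' t) := fun a t => by
    induction t using tensor_induction with
    | h0 => simp
    | ht n m => exact (congrArg (fun x => tmul (χ n) x) (hr a m))
    | hadd x y hx hy => simp only [map_add, hx, hy]
  have hεT : ∀ t, α (P.ε (T.symm (T t))) = α (P.ε t) := fun t => by rw [T.symm_apply_apply]
  have hηT : ∀ t, β (P.η (T'.symm (T' t))) = β (P.η t) := fun t => by rw [T'.symm_apply_apply]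
  refine Pairing.invertible (N := N₀)
    { ε := α ∘ₗ P.ε ∘ₗ T.symm.toLinearMap
      η := β ∘ₗ P.η ∘ₗ T'.symm.toLinearMap
      hε := hα.1.comp (P.hε.comp T.symm.bijective)
      hη := hβ.1.comp (P.hη.comp T'.symm.bijective)
      ε_left := fun a t => ?_
      ε_right := fun a t => ?_
      η_left := fun a t => ?_
      η_right := fun a t => ?_
      ε_even := fun {i t} ht => hα.2.2.2 _ _ (P.ε_even (hT i t ht))
      η_even := fun {i t} ht => hβ.2.2.2 _ _ (P.η_even (hT' i t ht)) }
  · obtain ⟨a, rfl⟩ := hα.1.2 a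
    obtain ⟨t, rfl⟩ := T.surjective t
    rw [← hTl]
    exact (hεT _).trans ((congrArg α (P.ε_left a t)).trans ((hα.2.2.1 _ _).trans
      (congrArg (α a * ·) (hεT t).symm)))
  · obtain ⟨a, rfl⟩ := hα.1.2 a
    obtain ⟨t, rfl⟩ := T.surjective t
    rw [← hTr]
    exact (hεT _).trans ((congrArg α (P.ε_right a t)).trans ((hα.2.2.1 _ _).trans
      (congrArg (· * α a) (hεT t).symm)))
  · obtain ⟨a, rfl⟩ := hβ.1.2 a
    obtain ⟨t, rfl⟩ := T'.surjective t
    rw [← hTl']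
    exact (hηT _).trans ((congrArg β (P.η_left a t)).trans ((hβ.2.2.1 _ _).trans
      (congrArg (β a * ·) (hηT t).symm)))
  · obtain ⟨a, rfl⟩ := hβ.1.2 a
    obtain ⟨t, rfl⟩ := T'.surjective t
    rw [← hTr']
    exact (hηT _).trans ((congrArg β (P.η_right a t)).trans ((hβ.2.2.1 _ _).trans
      (congrArg (· * β a) (hηT t).symm)))

end Semilinear

end SBimod

end Morita

section Smooth

variable {𝕜 : Type} [RCLike 𝕜] {B : Space.{u}} {b : B.pt}
  {F G H : Type u} [AddCommGroup F] [Module 𝕜 F] [AddCommGroup G] [Module 𝕜 G]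
  [AddCommGroup H] [Module 𝕜 H]

namespace Space

/-- The inverse of a linear map (zero if the map is not bijective). -/
def linInv (f : F →ₗ[𝕜] G) : G →ₗ[𝕜] F :=
  open Classical in
  if h : Function.Bijective f then (LinearEquiv.ofBijective f h).symm.toLinearMap else 0

theorem apply_linInv {f : F →ₗ[𝕜] G} (h : Function.Bijective f) (v : G) : f (linInv f v) = v := by
  rw [linInv, dif_pos h]
  exact (LinearEquiv.ofBijective f h).apply_symm_apply v

theorem linInv_apply {f : F →ₗ[𝕜] G} (h : Function.Bijective f) (v : F) : linInv f (f v) = v := by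
  rw [linInv, dif_pos h]
  exact (LinearEquiv.ofBijective f h).symm_apply_apply v

theorem SmoothLinAt.linInv [FiniteDimensional 𝕜 F] {L : B.pt → F →ₗ[𝕜] G}
    (hL : B.SmoothLinAt 𝕜 L b) (h0 : Function.Bijective (L b)) :
    B.SmoothLinAt 𝕜 (fun x => Space.linInv (L x)) b := fun v =>
  hL.of_apply h0 ((smoothVecAt_const v).congr
    ((hL.eventually_bijective h0).mono fun _ h => (apply_linInv h v).symm))

theorem SmoothLinAt.of_apply_injective [FiniteDimensional 𝕜 F] {L : B.pt → F →ₗ[𝕜] G}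
    (hL : B.SmoothLinAt 𝕜 L b) (h0 : Function.Injective (L b)) {f : B.pt → F}
    (hf : B.SmoothVecAt 𝕜 (fun x => L x (f x)) b) : B.SmoothVecAt 𝕜 f b := by
  obtain ⟨R, hR⟩ := LinearMap.exists_leftInverse_of_injective (L b) (LinearMap.ker_eq_bot.2 h0)
  refine SmoothLinAt.of_apply (L := fun x => R ∘ₗ L x) (fun v => (hL v).map R) ?_ (hf.map R)
  rw [hR]
  exact Function.bijective_id

theorem smoothVecAt_linearMap [FiniteDimensional 𝕜 F] [FiniteDimensional 𝕜 G]
    {L : B.pt → F →ₗ[𝕜] G} (h : B.SmoothLinAt 𝕜 L b) :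
    B.SmoothVecAt 𝕜 (fun x => L x) b := by
  let e := Module.finBasis 𝕜 F
  have : (fun x => L x) = fun x => ∑ i, LinearMap.toSpanSingleton 𝕜 G (L x (e i)) ∘ₗ e.coord i := by
    funext x
    refine e.ext fun j => ?_
    simp [LinearMap.sum_apply, Finsupp.single_apply, ite_smul]
  rw [this]
  refine smoothVecAt_sum _ fun i _ => ?_
  exact (h (e i)).map (LinearMap.lcomp 𝕜 G (e.coord i) ∘ₗ
    (LinearMap.ringLmapEquivSelf 𝕜 𝕜 G).symm.toLinearMap)

end Space

theorem IsTriv.comp {V : B.pt → Type u} [∀ b, AddCommGroup (V b)] [∀ b, Module 𝕜 (V b)]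
    {S : Sec B V} {ψ : ∀ b, V b →ₗ[𝕜] F} [FiniteDimensional 𝕜 F] [FiniteDimensional 𝕜 G]
    (h : IsTriv S ψ b) {K : B.pt → F →ₗ[𝕜] G}
    (hK : B.SmoothLinAt 𝕜 K b) (h0 : Function.Bijective (K b)) :
    IsTriv S (fun x => K x ∘ₗ ψ x) b := by
  filter_upwards [h, hK.eventually, hK.eventually_bijective h0] with x h1 h2 h3
  refine ⟨h3.comp h1.1, fun s => (h1.2 s).trans ⟨fun h4 => h2.apply h4, fun h4 => h2.of_apply h3 h4⟩⟩

theorem IsAlgTriv.comp {A : B.pt → SAlg.{u} 𝕜} {S : Sec B (fun b => (A b).carrier)}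
    {A₀ A₁ : SAlg.{u} 𝕜} {α : ∀ b, A b →ₗ[𝕜] A₀} (h : IsAlgTriv S α b) {K : B.pt → A₀ →ₗ[𝕜] A₁}
    (hK : B.SmoothLinAt 𝕜 K b) (h0 : ∀ᶠ x in B.nhds b, IsSAlgIso (K x)) :
    IsAlgTriv S (fun x => K x ∘ₗ α x) b :=
  ⟨h.1.comp hK (Space.self_of_nhds h0).1, (h.2.and h0).mono fun _ h => h.2.comp h.1⟩

/-- A section is smooth if its image under a faithful smooth action on smooth sections is. -/
theorem IsVBAt.smooth_of_action {V W U : B.pt → Type u} [∀ b, AddCommGroup (V b)]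
    [∀ b, Module 𝕜 (V b)] [∀ b, AddCommGroup (W b)] [∀ b, Module 𝕜 (W b)]
    [∀ b, AddCommGroup (U b)] [∀ b, Module 𝕜 (U b)]
    {S : Sec B V} {T : Sec B W} {R : Sec B U} (hS : IsVBAt 𝕜 S b) (hT : IsVBAt 𝕜 T b)
    (hR : IsVBAt 𝕜 R b) (L : ∀ b, V b →ₗ[𝕜] W b →ₗ[𝕜] U b)
    (hL : ∀ v w, S v b → T w b → R (fun x => L x (v x) (w x)) b)
    (h0 : ∀ v, (∀ w, L b v w = 0) → v = 0) {s : ∀ b, V b}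
    (hs : ∀ w, T w b → R (fun x => L x (s x) (w x)) b) : S s b := by
  obtain ⟨F, _, _, _, ψ, hψ⟩ := hS
  obtain ⟨G, _, _, _, χ, hχ⟩ := hT
  obtain ⟨H, _, _, _, ξ, hξ⟩ := hR
  let K : B.pt → F →ₗ[𝕜] G →ₗ[𝕜] H := fun x =>
    ((L x).compl₁₂ (Space.linInv (ψ x)) (Space.linInv (χ x))).compr₂ (ξ x)
  have hsec : ∀ f : F, S (fun x => Space.linInv (ψ x) f) b := fun f =>
    (hψ.congr_smooth (hψ.mono fun x hx => Space.apply_linInv hx.1 f)).2 (Space.smoothVecAt_const f)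
  have hsec' : ∀ f : G, T (fun x => Space.linInv (χ x) f) b := fun f =>
    (hχ.congr_smooth (hχ.mono fun x hx => Space.apply_linInv hx.1 f)).2 (Space.smoothVecAt_const f)
  rw [hψ.smooth_iff]
  refine Space.SmoothLinAt.of_apply_injective (L := K) (fun f => ?_) ?_ ?_
  · refine Space.smoothVecAt_linearMap fun g => ?_
    exact (hξ.smooth_iff _).1 (hL _ _ (hsec f) (hsec' g))
  · rw [injective_iff_map_eq_zero]
    intro f hf
    have h1 : Space.linInv (ψ b) f = 0 := h0 _ fun w => by
      have h2 := LinearMap.congr_fun hf (χ b w)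
      simp only [K, LinearMap.compr₂_apply, LinearMap.compl₁₂_apply,
        Space.linInv_apply hχ.bijective, LinearMap.zero_apply] at h2
      exact (injective_iff_map_eq_zero _).1 hξ.bijective.1 _ h2
    rw [← Space.apply_linInv hψ.bijective f, h1, map_zero]
  · refine Space.smoothVecAt_linearMap fun g => ?_
    refine ((hξ.smooth_iff _).1 (hs _ (hsec' g))).congr (hψ.mono fun x hx => ?_)
    simp [K, Space.linInv_apply hx.1]

end Smooth

section Semilinear

variable {𝕜 : Type} [RCLike 𝕜] {A B C D : SAlg.{u} 𝕜}

namespace SBimod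

theorem exists_semilinear {M : SBimod A B} (hM : M.Invertible) {X : Space.{u}} {x₀ : X.pt}
    {δ : X.pt → A →ₗ[𝕜] A} (hδ : X.SmoothLinAt 𝕜 δ x₀) (h0 : δ x₀ = LinearMap.id)
    (hmul : ∀ᶠ x in X.nhds x₀, (∀ a a', δ x (a * a') = δ x a * δ x a') ∧
      ∀ a, A.par (δ x a) = δ x (A.par a)) :
    ∃ ν : X.pt → M →ₗ[𝕜] M, X.SmoothLinAt 𝕜 ν x₀ ∧ ν x₀ = LinearMap.id ∧
      ∀ᶠ x in X.nhds x₀, Function.Bijective (ν x) ∧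
        (∀ a m, ν x (M.left a m) = M.left (δ x a) (ν x m)) ∧ ∀ m, M.par (ν x m) = ν x (M.par m) := by
  obtain ⟨k, y, l, hl, hy⟩ := hM.exists_dual_left
  let ν' : X.pt → M →ₗ[𝕜] M := fun x => ∑ i, M.left.flip (y i) ∘ₗ δ x ∘ₗ l i
  have hν' : ∀ x m, ν' x m = ∑ i, M.left (δ x (l i m)) (y i) := fun x m => by
    simp [ν', LinearMap.sum_apply]
  have hs' : X.SmoothLinAt 𝕜 ν' x₀ := fun m => by
    simp only [hν']
    exact Space.smoothVecAt_sum _ fun i _ => (hδ (l i m)).map (M.left.flip (y i))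
  let ν : X.pt → M →ₗ[𝕜] M := fun x => (2⁻¹ : 𝕜) • (ν' x + M.par ∘ₗ ν' x ∘ₗ M.par)
  have hν : ∀ x m, ν x m = (2⁻¹ : 𝕜) • (ν' x m + M.par (ν' x (M.par m))) := fun x m => rfl
  have hνs : X.SmoothLinAt 𝕜 ν x₀ := fun m =>
    Space.SmoothVecAt.smul (Space.smoothFunAt_const _) ((hs' m).add ((hs' (M.par m)).map M.par))
  have hν0 : ν x₀ = LinearMap.id := by
    have h1 : ∀ m, ν' x₀ m = m := fun m => by rw [hν', h0]; exact hy m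
    ext m
    rw [hν, h1, h1, par_par, ← two_smul 𝕜 m, smul_smul, inv_mul_cancel₀ two_ne_zero, one_smul]
    rfl
  refine ⟨ν, hνs, hν0, ?_⟩
  have hbij := hνs.eventually_bijective (by rw [hν0]; exact Function.bijective_id)
  filter_upwards [hmul, hbij] with x h1 h2
  have h3 : ∀ a m, ν' x (M.left a m) = M.left (δ x a) (ν' x m) := fun a m => by
    simp only [hν', hl, h1.1, M.left_mul, map_sum]
  refine ⟨h2, fun a m => ?_, fun m => ?_⟩
  · rw [hν, hν, M.par_left, h3, h3, M.par_left, h1.2,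
      show A.par (A.par a) = a from parity_parity _ a]
    simp
  · rw [hν, hν, map_smul, map_add, par_par, par_par, add_comm]

end SBimod

variable {X : Space.{u}} {x₀ : X.pt} {A₁ A₂ A₃ : X.pt → SAlg.{u} 𝕜}
  {S₁ : Sec X (fun b => (A₁ b).carrier)} {S₂ : Sec X (fun b => (A₂ b).carrier)}
  {S₃ : Sec X (fun b => (A₃ b).carrier)}

/-- The map `α' ∘ α⁻¹` between two trivializations is smooth. -/
theorem IsTriv.smoothLinAt_change {V : X.pt → Type u} [∀ b, AddCommGroup (V b)]
    [∀ b, Module 𝕜 (V b)] {S : Sec X V} {F G : Type u} [AddCommGroup F] [Module 𝕜 F]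
    [AddCommGroup G] [Module 𝕜 G] {ψ : ∀ b, V b →ₗ[𝕜] F} {χ : ∀ b, V b →ₗ[𝕜] G}
    (h : IsTriv S ψ x₀) (h' : IsTriv S χ x₀) :
    X.SmoothLinAt 𝕜 (fun x => χ x ∘ₗ Space.linInv (ψ x)) x₀ := fun v =>
  (h'.smooth_iff _).1 ((h.congr_smooth (h.mono fun _ hx => Space.apply_linInv hx.1 v)).2
    (Space.smoothVecAt_const v))

theorem linInv_isSAlgIso {f : A →ₗ[𝕜] B} (h : IsSAlgIso f) : IsSAlgIso (Space.linInv f) := by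
  rw [Space.linInv, dif_pos h.1]
  exact h.symm

/-- A bundle of invertible bimodules can be trivialized along any given local trivialization of the
algebra bundle acting on the left. -/
theorem LocBimod.exists_triv {M : ∀ b, SBimod (A₁ b) (A₂ b)} {S : Sec X (fun b => (M b).carrier)}
    (h : LocBimod S₁ S₂ M S x₀) (hM : (M x₀).Invertible) {A' : SAlg.{u} 𝕜}
    {α' : ∀ b, A₁ b →ₗ[𝕜] A'} (hα' : IsAlgTriv S₁ α' x₀) :
    ∃ (B₀ : SAlg.{u} 𝕜) (M₀ : SBimod A' B₀) (β : ∀ b, A₂ b →ₗ[𝕜] B₀) (ψ : ∀ b, M b →ₗ[𝕜] M₀),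
      IsAlgTriv S₂ β x₀ ∧ IsTriv S ψ x₀ ∧
      ∀ᶠ b in X.nhds x₀,
        (∀ (i : ZMod 2) (m : M b), m ∈ (M b).gr i → ψ b m ∈ M₀.gr i) ∧
        (∀ a m, ψ b ((M b).left a m) = M₀.left (α' b a) (ψ b m)) ∧
        (∀ a m, ψ b ((M b).right a m) = M₀.right (β b a) (ψ b m)) := by
  obtain ⟨A₀, B₀, M₀, α, β, ψ, hα, hβ, hψ, hl⟩ := h
  have hα0 := Space.self_of_nhds hα.2
  have hα'0 := Space.self_of_nhds hα'.2
  have hβ0 := Space.self_of_nhds hβ.2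
  have hl0 := Space.self_of_nhds hl
  have hM₀ : M₀.Invertible :=
    hM.of_semilinear hα0 hβ0 (ψ x₀) hψ.bijective hl0.1 hl0.2.1 hl0.2.2
  let c : A' →ₗ[𝕜] A₀ := α x₀ ∘ₗ Space.linInv (α' x₀)
  have hc : IsSAlgIso c := hα0.comp (linInv_isSAlgIso hα'0)
  let δ : X.pt → A₀ →ₗ[𝕜] A₀ := fun x => c ∘ₗ α' x ∘ₗ Space.linInv (α x)
  have hδs : X.SmoothLinAt 𝕜 δ x₀ := fun v => (hα.1.smoothLinAt_change hα'.1 v).map c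
  have hδ0 : δ x₀ = LinearMap.id := by
    ext v
    simp [δ, c, Space.linInv_apply hα'0.1, Space.apply_linInv hα0.1]
  have hδ : ∀ᶠ x in X.nhds x₀, IsSAlgIso (δ x) := by
    filter_upwards [hα.2, hα'.2] with x h1 h2
    exact hc.comp (h2.comp (linInv_isSAlgIso h1))
  obtain ⟨ν, hνs, hν0, hν⟩ := SBimod.exists_semilinear hM₀ hδs hδ0
    (hδ.mono fun x h => ⟨h.2.2.1, h.par⟩)
  have hνb0 : Function.Bijective (ν x₀) := by rw [hν0]; exact Function.bijective_id
  obtain ⟨ρ, hρ⟩ := LinearMap.exists_leftInverse_of_injective M₀.right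
    (LinearMap.ker_eq_bot.2 hM₀.right_injective)
  let κ : X.pt → B₀ →ₗ[𝕜] B₀ := fun x => ρ ∘ₗ
    (LinearMap.llcomp 𝕜 M₀ M₀ M₀ (ν x) ∘ₗ LinearMap.lcomp 𝕜 M₀ (Space.linInv (ν x))) ∘ₗ M₀.right
  have hκs : X.SmoothLinAt 𝕜 κ x₀ := fun v => by
    refine Space.SmoothVecAt.map (F := M₀ →ₗ[𝕜] M₀) (f := fun x => ν x ∘ₗ M₀.right v ∘ₗ
      Space.linInv (ν x)) ?_ ρ
    refine Space.smoothVecAt_linearMap fun m => ?_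
    exact hνs.apply ((hνs.linInv hνb0 m).map (M₀.right v))
  have hκ : ∀ᶠ x in X.nhds x₀, ∀ v m, ν x (M₀.right v m) = M₀.right (κ x v) (ν x m) := by
    filter_upwards [hν, hδ] with x h1 h2 v
    obtain ⟨b, hb⟩ := hM₀.exists_right (ν x ∘ₗ M₀.right v ∘ₗ Space.linInv (ν x)) fun a m => by
      obtain ⟨a, rfl⟩ := h2.1.2 a
      obtain ⟨m, rfl⟩ := h1.1.2 m
      simp only [LinearMap.comp_apply]
      rw [← h1.2.1, Space.linInv_apply h1.1, Space.linInv_apply h1.1, ← M₀.left_right, h1.2.1]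
    have hb' : κ x v = b := by
      change ρ (ν x ∘ₗ M₀.right v ∘ₗ Space.linInv (ν x)) = b
      rw [hb]
      exact LinearMap.congr_fun hρ b
    intro m
    rw [hb', ← hb]
    simp [Space.linInv_apply h1.1]
  have hκi : ∀ᶠ x in X.nhds x₀, IsSAlgIso (κ x) := by
    filter_upwards [hκ, hν] with x h1 h2
    have hR : ∀ {b b' : B₀}, (∀ m, M₀.right b (ν x m) = M₀.right b' (ν x m)) → b = b' := by
      intro b b' h
      refine hM₀.right_injective (LinearMap.ext fun m => ?_)
      obtain ⟨m, rfl⟩ := h2.1.2 m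
      exact h m
    have hinj : Function.Injective (κ x) := fun b b' e =>
      hM₀.right_injective (LinearMap.ext fun m => h2.1.1 (by rw [h1, h1, e]))
    refine ⟨⟨hinj, LinearMap.injective_iff_surjective.1 hinj⟩, hR fun m => ?_, fun a a' => hR fun m => ?_, ?_⟩
    · rw [← h1, M₀.right_one, M₀.right_one]
    · rw [← h1, M₀.right_mul, M₀.right_mul, h1, h1]
    · rw [even_iff_parity B₀.isCompl B₀.isCompl]
      intro b
      refine hR fun m => ?_
      change M₀.right (B₀.par (κ x b)) _ = M₀.right (κ x (B₀.par b)) _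
      have e1 : M₀.right (B₀.par b) m = M₀.par (M₀.right b (M₀.par m)) := by
        rw [M₀.par_right, M₀.par_par]
      rw [← h1, e1, ← h2.2.2, h1, M₀.par_right, h2.2.2, M₀.par_par]
  refine ⟨B₀, M₀.twistL hc.toHom, fun x => κ x ∘ₗ β x, fun x => ν x ∘ₗ ψ x, hβ.comp hκs hκi,
    hψ.comp hνs hνb0, ?_⟩
  filter_upwards [hl, hν, hκ, hα.2, hα'.2] with x h1 h2 h3 h4 h5
  refine ⟨fun i m hm => (even_iff_parity M₀.isCompl M₀.isCompl).2 h2.2.2 i _ (h1.1 i m hm),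
    fun a m => ?_, fun a m => ?_⟩
  · change ν x (ψ x _) = M₀.left (c (α' x a)) (ν x (ψ x m))
    rw [h1.2.1, h2.2.1]
    simp [δ, Space.linInv_apply h4.1]
  · change ν x (ψ x _) = M₀.right (κ x (β x a)) (ν x (ψ x m))
    rw [h1.2.2, h3]

end Semilinear

section Actions

variable {𝕜 : Type} [RCLike 𝕜] {A B C D A₁ A₂ A₃ : SAlg.{u} 𝕜}

namespace SBimod

/-- The pairing with the roles of the two bimodules exchanged. -/
def Pairing.symm {M : SBimod A B} {N : SBimod B A} (P : Pairing M N) : Pairing N M where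
  ε := P.η
  η := P.ε
  hε := P.hη
  hη := P.hε
  ε_left := P.η_left
  ε_right := P.η_right
  η_left := P.ε_left
  η_right := P.ε_right
  ε_even := P.η_even
  η_even := P.ε_even

section Contraction

variable {N : SBimod B C} {N' : SBimod C B}

/-- The contraction `k ⊗ n ↦ k ◃ (n, n')`. -/
def Pairing.contr (P : Pairing N N') (K : SBimod A B) (n' : N') : tensor K N →ₗ[𝕜] K :=
  tensorLift (LinearMap.flip (K.right ∘ₗ (P.ε ∘ₗ (tmulL N N').flip n'))) fun k b n => by
    simp only [LinearMap.flip_apply, LinearMap.comp_apply, tmulL_apply, ← left_tmul, P.ε_left,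
      K.right_mul]

theorem Pairing.contr_tmul (P : Pairing N N') (K : SBimod A B) (n' : N') (k : K) (n : N) :
    P.contr K n' (tmul k n) = K.right (P.ε (tmul n n')) k := tensorLift_tmul _ _ k n

theorem Pairing.eq_zero_of_tmul (P : Pairing N N') {K : SBimod A B} {k : K}
    (h : ∀ n : N, tmul k n = 0) : k = 0 := by
  obtain ⟨r, n, n', h1⟩ := P.exists_ε_eq_one
  have h2 : ∑ i, P.contr K (n' i) (tmul k (n i)) = k := by
    simp only [P.contr_tmul]
    exact sum_right_eq (by rw [← h1, map_sum]) k
  rw [← h2]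
  simp [h]

theorem Pairing.eq_zero_of_contr (P : Pairing N N') {K : SBimod A B} {x : tensor K N}
    (h : ∀ n' : N', P.contr K n' x = 0) : x = 0 := by
  obtain ⟨t, ht⟩ := P.hε.2 1
  have key : ∀ (x : tensor K N) (n' : N'), (tmul x n' : tensor (tensor K N) N') =
      assocInv K N N' (tmul (P.contr K n' x) t) := fun x n' => by
    induction x using tensor_induction with
    | h0 => simp [← tmulL_apply]
    | ht k n =>
      have h1 : (tensor N N').left (P.ε (tmul n n')) t = tmul n n' := P.hε.1 (by
        rw [P.ε_left, ht, mul_one])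
      rw [P.contr_tmul, tmul_right, h1, assocInv_tmul]
    | hadd x y hx hy => rw [add_tmul, map_add, add_tmul, map_add, hx, hy]
  refine P.symm.eq_zero_of_tmul fun n' => ?_
  rw [key, h]
  simp [← tmulL_apply]

/-- Right linear maps `N → K ⊗ N` are given by elements of `K`. -/
theorem Pairing.exists_tmul (P : Pairing N N') {K : SBimod A B} (f : N →ₗ[𝕜] tensor K N)
    (hf : ∀ c n, f (N.right c n) = (tensor K N).right c (f n)) : ∃ k : K, ∀ n, f n = tmul k n := by
  obtain ⟨t, ht⟩ := P.hε.2 1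
  have hc1 : ∀ c n' x, P.contr K n' ((tensor K N).right c x) = P.contr K (N'.left c n') x :=
    fun c n' x => by
      induction x using tensor_induction with
      | h0 => simp
      | ht k n => rw [right_tmul, P.contr_tmul, P.contr_tmul, tmul_right]
      | hadd x y hx hy => simp only [map_add, hx, hy]
  have hc2 : ∀ b n' x, P.contr K (N'.right b n') x = K.right b (P.contr K n' x) :=
    fun b n' x => by
      induction x using tensor_induction with
      | h0 => simp
      | ht k n => rw [P.contr_tmul, P.contr_tmul, ← right_tmul, P.ε_right, K.right_mul]
      | hadd x y hx hy => simp only [map_add, hx, hy]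
  have hc3 : ∀ n' m' x, P.contr K (n' + m') x = P.contr K n' x + P.contr K m' x :=
    fun n' m' x => by
      induction x using tensor_induction with
      | h0 => simp
      | ht k n => simp only [P.contr_tmul, tmul_add, map_add, LinearMap.add_apply]
      | hadd x y hx hy => simp only [map_add, hx, hy]; abel
  have hc4 : ∀ (r : 𝕜) n' x, P.contr K (r • n') x = r • P.contr K n' x :=
    fun r n' x => by
      induction x using tensor_induction with
      | h0 => simp
      | ht k n => simp only [P.contr_tmul, tmul_smul, map_smul, LinearMap.smul_apply]
      | hadd x y hx hy => simp only [map_add, hx, hy, smul_add]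
  let G : tensor N N' →ₗ[𝕜] K := tensorLift
    (LinearMap.mk₂ 𝕜 (fun n n' => P.contr K n' (f n)) (by simp) (by simp)
      (fun n n' m' => hc3 n' m' (f n)) (fun r n n' => hc4 r n' (f n))) fun n c n' => by
      simp only [LinearMap.mk₂_apply, hf, hc1]
  have hG : ∀ n n', G (tmul n n') = P.contr K n' (f n) := fun n n' => tensorLift_tmul _ _ n n'
  have hGr : ∀ b x, G ((tensor N N').right b x) = K.right b (G x) := fun b x => by
    induction x using tensor_induction with
    | h0 => simp
    | ht n n' => rw [right_tmul, hG, hG, hc2]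
    | hadd x y hx hy => simp only [map_add, hx, hy]
  refine ⟨G t, fun n => ?_⟩
  rw [← sub_eq_zero]
  refine P.eq_zero_of_contr fun n' => ?_
  have h1 : (tensor N N').right (P.ε (tmul n n')) t = tmul n n' := P.hε.1 (by
    rw [P.ε_right, ht, one_mul])
  rw [map_sub, P.contr_tmul, ← hGr, h1, hG, sub_self]

end Contraction

theorem isomorphic_tensor_twistR (M : SBimod A B) (φ : SAlgHom C B) :
    Isomorphic (tensor M ((self B).twistR φ)) (M.twistR φ) := by
  let f : Hom (tensor M ((self B).twistR φ)) (M.twistR φ) := homLift (L := M.twistR φ) M.right.flip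
    (fun m b n => (M.right_mul b n m).symm) (fun i j m n hm hn => M.right_mem hm hn)
    (fun a m n => (M.left_right a n m).symm) (fun a m n => M.right_mul n (φ.toAlgHom a) m)
  have hf : ∀ m (b : (self B).twistR φ), f.toLin (tmul m b) = M.right b m :=
    fun m b => homLift_tmul _ _ _ _ _ m b
  let g : M.twistR φ →ₗ[𝕜] tensor M ((self B).twistR φ) :=
    (tmulL M ((self B).twistR φ)).flip (1 : B)
  refine ⟨f, Function.bijective_iff_has_inverse.2 ⟨g, fun t => ?_, fun m => ?_⟩⟩
  · induction t using tensor_induction with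
    | h0 => simp
    | ht m b =>
      refine (congrArg g (hf m b)).trans ((tmul_right (N := (self B).twistR φ) m b (1 : B)).trans ?_)
      exact congrArg (fun x : (self B).twistR φ => tmul m x) (mul_one (M := B) b)
    | hadd x y hx hy => simp [hx, hy]
  · exact (hf m _).trans (M.right_one m)

/-- Over a Picard-surjective algebra, any two invertible bimodules differ by a twist. -/
theorem exists_isomorphic_twistR (hA : PicardSurjective A) {M T : SBimod B A} (hM : M.Invertible)
    (hT : T.Invertible) : ∃ φ : evenAut A, Isomorphic T (M.twistR (evenAut.toHom φ)) := by
  obtain ⟨N, h1, h2⟩ := hM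
  have hN : N.Invertible := ⟨M, h2, h1⟩
  obtain ⟨φ, hφ⟩ := hA (tensor N T) (hN.tensor_prod hT)
  refine ⟨φ, ?_⟩
  exact (isomorphic_self_tensor T).symm.trans ((h1.symm.tensor_congr (.refl T)).trans
    ((isomorphic_assoc _ _ _).trans (((Isomorphic.refl M).tensor_congr hφ).trans
      (isomorphic_tensor_twistR M _))))

/-- `act` is an action of `K` by maps `N → N'`, semilinear with respect to `g`, that identifies
`K ⊗ N` with `N'`. -/
structure IsAct (K : SBimod A₂ A₁) (N : SBimod A₁ A) (N' : SBimod A₂ A) (g : evenAut A)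
    (act : K →ₗ[𝕜] N →ₗ[𝕜] N') : Prop where
  bal : ∀ k a n, act (K.right a k) n = act k (N.left a n)
  left : ∀ a k n, act (K.left a k) n = N'.left a (act k n)
  right : ∀ k n c, act k (N.right c n) = N'.right (g.1 c) (act k n)
  par : ∀ k n, N'.par (act k n) = act (K.par k) (N.par n)
  bij : Function.Bijective (tensorLift act bal)

theorem mem_gr_add {K : SBimod A₂ A₁} {N : SBimod A₁ A} {N' : SBimod A₂ B}
    {act : K →ₗ[𝕜] N →ₗ[𝕜] N'} (h : ∀ k n, N'.par (act k n) = act (K.par k) (N.par n))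
    (i j : ZMod 2) (k : K) (n : N) (hk : k ∈ K.gr i) (hn : n ∈ N.gr j) :
    act k n ∈ N'.gr (i + j) := by
  rw [mem_gr_iff N'.isCompl]
  have h1 := h k n
  rw [show K.par k = _ from parity_apply K.isCompl hk,
    show N.par n = _ from parity_apply N.isCompl hn] at h1
  refine h1.trans ?_
  rw [negOne_pow_val_add]
  simp [smul_smul, mul_comm]

theorem par_tmul {K : SBimod A₂ A₁} {N : SBimod A₁ A} (k : K) (n : N) :
    (tensor K N).par (tmul k n) = tmul (K.par k) (N.par n) := by
  obtain ⟨k₀, hk₀, k₁, hk₁, rfl⟩ := exists_homogeneous K.isCompl k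
  obtain ⟨n₀, hn₀, n₁, hn₁, rfl⟩ := exists_homogeneous N.isCompl n
  have key : ∀ (i j : ZMod 2) (k : K) (n : N), k ∈ K.gr i → n ∈ N.gr j →
      (tensor K N).par (tmul k n) = tmul (K.par k) (N.par n) := fun i j k n hk hn => by
    rw [show K.par k = _ from parity_apply K.isCompl hk,
      show N.par n = _ from parity_apply N.isCompl hn,
      show (tensor K N).par _ = _ from parity_apply (tensor K N).isCompl (tmul_mem hk hn),
      negOne_pow_val_add, smul_tmul, tmul_smul, smul_smul]
  simp only [add_tmul, tmul_add, map_add, key _ _ _ _ hk₀ hn₀, key _ _ _ _ hk₀ hn₁,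
    key _ _ _ _ hk₁ hn₀, key _ _ _ _ hk₁ hn₁]

namespace IsAct

variable {K : SBimod A₂ A₁} {N : SBimod A₁ A} {N' : SBimod A₂ A} {g : evenAut A}
  {act : K →ₗ[𝕜] N →ₗ[𝕜] N'}

theorem eq_zero (h : IsAct K N N' g act) (hN : N.Invertible) {k : K} (hk : ∀ n, act k n = 0) :
    k = 0 := by
  obtain ⟨L, ⟨P⟩⟩ := hN.exists_pairing
  refine P.eq_zero_of_tmul fun n => h.bij.1 ?_
  rw [tensorLift_tmul, hk, map_zero]

theorem ext (h : IsAct K N N' g act) (hN : N.Invertible) {k k' : K}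
    (hk : ∀ n, act k n = act k' n) : k = k' := by
  rw [← sub_eq_zero]
  exact h.eq_zero hN fun n => by rw [map_sub, LinearMap.sub_apply, hk, sub_self]

theorem exists_eq (h : IsAct K N N' g act) (hN : N.Invertible) (f : N →ₗ[𝕜] N')
    (hf : ∀ n c, f (N.right c n) = N'.right (g.1 c) (f n)) : ∃ k, ∀ n, act k n = f n := by
  obtain ⟨L, ⟨P⟩⟩ := hN.exists_pairing
  let e := LinearEquiv.ofBijective _ h.bij
  have he : ∀ k n, e (tmul k n) = act k n := fun k n => tensorLift_tmul act h.bal k n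
  have her : ∀ c t, e ((tensor K N).right c t) = N'.right (g.1 c) (e t) := fun c t => by
    induction t using tensor_induction with
    | h0 => simp
    | ht k n => rw [right_tmul, he, he, h.right]
    | hadd x y hx hy => simp only [map_add, hx, hy]
  obtain ⟨k, hk⟩ := P.exists_tmul (e.symm.toLinearMap ∘ₗ f) fun c n => by
    simp only [LinearMap.comp_apply, LinearEquiv.coe_coe]
    rw [e.symm_apply_eq, her, hf, e.apply_symm_apply]
  refine ⟨k, fun n => ?_⟩
  have := hk n
  simp only [LinearMap.comp_apply, LinearEquiv.coe_coe] at this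
  rw [← he, ← this, e.apply_symm_apply]

/-- Composition of actions, up to an even unit. -/
theorem exists_mul {K₁₂ : SBimod A₂ A₁} {K₂₃ : SBimod A₃ A₂} {K₁₃ : SBimod A₃ A₁}
    {N₁ : SBimod A₁ A} {N₂ : SBimod A₂ A} {N₃ : SBimod A₃ A} {g₁₂ g₂₃ g₁₃ : evenAut A}
    {act₁₂ : K₁₂ →ₗ[𝕜] N₁ →ₗ[𝕜] N₂} {act₂₃ : K₂₃ →ₗ[𝕜] N₂ →ₗ[𝕜] N₃}
    {act₁₃ : K₁₃ →ₗ[𝕜] N₁ →ₗ[𝕜] N₃} (h₁₂ : IsAct K₁₂ N₁ N₂ g₁₂ act₁₂)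
    (h₂₃ : IsAct K₂₃ N₂ N₃ g₂₃ act₂₃) (h₁₃ : IsAct K₁₃ N₁ N₃ g₁₃ act₁₃) (hN₁ : N₁.Invertible)
    {u : evenUnits A} (hu : innerAut u * g₂₃ * g₁₂ = g₁₃) :
    ∃ f : Hom (tensor K₂₃ K₁₂) K₁₃, Function.Bijective f.toLin ∧
      ∀ k k' n, act₁₃ (f.toLin (tmul k k')) n =
        N₃.right ((u⁻¹).1 : A) (act₂₃ k (act₁₂ k' n)) := by
  have hu' : ∀ c : A, g₂₃.1 (g₁₂.1 c) * ((u⁻¹).1 : A) = ((u⁻¹).1 : A) * g₁₃.1 c := fun c => by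
    rw [← hu]
    change _ = ((u.1⁻¹ : (A : Type u)ˣ) : A) * (u.1 * (g₂₃.1 (g₁₂.1 c)) * ((u.1⁻¹ : (A : Type u)ˣ) : A))
    rw [← mul_assoc, Units.inv_mul_cancel_left]
    rfl
  have hmul : (u.1 : A) * ((u⁻¹).1 : A) = 1 := Units.mul_inv u.1
  have hmul' : ((u⁻¹).1 : A) * (u.1 : A) = 1 := Units.inv_mul u.1
  have hex : ∀ k k', ∃ l, ∀ n, act₁₃ l n = N₃.right ((u⁻¹).1 : A) (act₂₃ k (act₁₂ k' n)) :=
    fun k k' => h₁₃.exists_eq hN₁ (N₃.right ((u⁻¹).1 : A) ∘ₗ act₂₃ k ∘ₗ act₁₂ k') fun n c => by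
      simp only [LinearMap.comp_apply]
      rw [h₁₂.right, h₂₃.right, ← N₃.right_mul, ← N₃.right_mul, hu']
  choose F hF using hex
  let L : K₂₃ →ₗ[𝕜] K₁₂ →ₗ[𝕜] K₁₃ := LinearMap.mk₂ 𝕜 F
    (fun k l k' => h₁₃.ext hN₁ fun n => by simp [hF])
    (fun r k k' => h₁₃.ext hN₁ fun n => by simp [hF])
    (fun k l k' => h₁₃.ext hN₁ fun n => by simp [hF])
    (fun r k k' => h₁₃.ext hN₁ fun n => by simp [hF])
  have hL : ∀ k k' n, act₁₃ (L k k') n = N₃.right ((u⁻¹).1 : A) (act₂₃ k (act₁₂ k' n)) := hF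
  have hpu : A.par ((u⁻¹).1 : A) = ((u⁻¹).1 : A) := SAlg.mem_zero_iff.1 (u⁻¹).2
  have hLp : ∀ k k', K₁₃.par (L k k') = L (K₂₃.par k) (K₁₂.par k') := fun k k' =>
    h₁₃.ext hN₁ fun n => by
      rw [hL, ← N₁.par_par n, ← h₁₃.par, hL, N₃.par_right, hpu, h₂₃.par, h₁₂.par, N₁.par_par]
  let f : Hom (tensor K₂₃ K₁₂) K₁₃ := homLift L
    (fun k b k' => h₁₃.ext hN₁ fun n => by rw [hL, hL, h₂₃.bal, h₁₂.left])
    (mem_gr_add hLp)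
    (fun a k k' => h₁₃.ext hN₁ fun n => by
      rw [hL, h₁₃.left, hL, h₂₃.left, N₃.left_right])
    (fun a k k' => h₁₃.ext hN₁ fun n => by rw [hL, h₁₃.bal, hL, h₁₂.bal])
  have hf : ∀ k k', f.toLin (tmul k k') = L k k' := fun k k' => homLift_tmul _ _ _ _ _ k k'
  refine ⟨f, ?_, fun k k' n => by rw [hf, hL]⟩
  let e₁₂ := LinearEquiv.ofBijective _ h₁₂.bij
  let e₂₃ := LinearEquiv.ofBijective _ h₂₃.bij
  have he₁₂ : ∀ k n, e₁₂ (tmul k n) = act₁₂ k n := fun k n => tensorLift_tmul act₁₂ h₁₂.bal k n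
  have he₂₃ : ∀ k n, e₂₃ (tmul k n) = act₂₃ k n := fun k n => tensorLift_tmul act₂₃ h₂₃.bal k n
  let Φ : tensor (tensor K₂₃ K₁₂) N₁ ≃ₗ[𝕜] N₃ := (assoc K₂₃ K₁₂ N₁).trans
    ((tensorEquiv (LinearEquiv.refl 𝕜 K₂₃) e₁₂ (Equiv.refl A₂) (fun _ _ => rfl) fun b t => by
      induction t using tensor_induction with
      | h0 => simp
      | ht k n => rw [left_tmul, he₁₂, he₁₂, h₁₂.left]; rfl
      | hadd x y hx hy => simp only [map_add, hx, hy]).trans e₂₃)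
  have hΦ : ∀ k k' n, Φ (tmul (tmul k k') n) = act₂₃ k (act₁₂ k' n) := fun k k' n => by
    simp only [Φ, LinearEquiv.trans_apply, assoc_tmul]
    rfl
  have hΦr : ∀ c x, Φ ((tensor (tensor K₂₃ K₁₂) N₁).right c x) =
      N₃.right (g₂₃.1 (g₁₂.1 c)) (Φ x) := fun c x => by
    induction x using tensor_induction with
    | h0 => simp
    | ht t n =>
      rw [right_tmul]
      induction t using tensor_induction with
      | h0 => simp [← tmulL_apply]
      | ht k k' => rw [hΦ, hΦ, h₁₂.right, h₂₃.right]
      | hadd x y hx hy => simp only [add_tmul, map_add, hx, hy]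
    | hadd x y hx hy => simp only [map_add, hx, hy]
  have hfΦ : ∀ t n, act₁₃ (f.toLin t) n = N₃.right ((u⁻¹).1 : A) (Φ (tmul t n)) := fun t n => by
    induction t using tensor_induction with
    | h0 => simp [← tmulL_apply]
    | ht k k' => rw [hf, hL, hΦ]
    | hadd x y hx hy => simp only [add_tmul, map_add, LinearMap.add_apply, hx, hy]
  obtain ⟨N', ⟨P⟩⟩ := hN₁.exists_pairing
  refine ⟨(injective_iff_map_eq_zero _).2 fun t ht => P.eq_zero_of_tmul fun n => ?_, fun k => ?_⟩
  · apply Φ.injective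
    have h1 := hfΦ t n
    rw [ht, map_zero, LinearMap.zero_apply] at h1
    rw [map_zero, ← N₃.right_one (Φ _), ← hmul', N₃.right_mul, ← h1, map_zero]
  · obtain ⟨t, ht⟩ := P.exists_tmul (Φ.symm.toLinearMap ∘ₗ N₃.right (u.1 : A) ∘ₗ act₁₃ k)
      fun c n => by
        simp only [LinearMap.comp_apply, LinearEquiv.coe_coe]
        rw [Φ.symm_apply_eq, hΦr, Φ.apply_symm_apply, h₁₃.right, ← N₃.right_mul, ← N₃.right_mul]
        congr 1
        rw [← one_mul (g₁₃.1 c * _), ← hmul, mul_assoc, ← mul_assoc ((u⁻¹).1 : A), ← hu', mul_assoc,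
          hmul', mul_one]
    refine ⟨t, h₁₃.ext hN₁ fun n => ?_⟩
    have h1 := ht n
    simp only [LinearMap.comp_apply, LinearEquiv.coe_coe] at h1
    rw [hfΦ, ← h1, Φ.apply_symm_apply, ← N₃.right_mul, hmul, N₃.right_one]

end IsAct

theorem isSAlgIso_id (A : SAlg.{u} 𝕜) : IsSAlgIso (LinearMap.id : A →ₗ[𝕜] A) :=
  ⟨Function.bijective_id, rfl, fun _ _ => rfl, fun _ _ h => h⟩

theorem Invertible.twistR {M : SBimod A B} (hM : M.Invertible) {f : C →ₗ[𝕜] B} (hf : IsSAlgIso f) :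
    (M.twistR hf.toHom).Invertible := by
  refine hM.of_semilinear (M₀ := M.twistR hf.toHom) (isSAlgIso_id A) hf.symm LinearMap.id
    Function.bijective_id (fun _ _ h => h) (fun _ _ => rfl) fun b m => ?_
  change M.right b m = M.right (hf.equiv (hf.equiv.symm b)) m
  rw [hf.equiv.apply_symm_apply]

theorem Invertible.twistL {M : SBimod A B} (hM : M.Invertible) {f : C →ₗ[𝕜] A} (hf : IsSAlgIso f) :
    (M.twistL hf.toHom).Invertible := by
  refine hM.of_semilinear (M₀ := M.twistL hf.toHom) hf.symm (isSAlgIso_id B) LinearMap.id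
    Function.bijective_id (fun _ _ h => h) (fun b m => ?_) fun _ _ => rfl
  change M.left b m = M.left (hf.equiv (hf.equiv.symm b)) m
  rw [hf.equiv.apply_symm_apply]

end SBimod

end Actions

section LocalAction

variable {𝕜 : Type} [RCLike 𝕜] {A : SAlg.{u} 𝕜} {X : Space.{u}} {x₀ : X.pt}
  {A₁ A₂ : X.pt → SAlg.{u} 𝕜} {S₁ : Sec X (fun b => (A₁ b).carrier)}
  {S₂ : Sec X (fun b => (A₂ b).carrier)}

/-- Locally, a bundle `P` of invertible bimodules acts by semilinear maps between any two bundles of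
invertible bimodules with values in a Picard-surjective algebra. -/
theorem exists_action (hA : PicardSurjective A) {P : ∀ b, SBimod (A₂ b) (A₁ b)}
    {N : ∀ b, SBimod (A₁ b) A} {N' : ∀ b, SBimod (A₂ b) A} {SP : Sec X (fun b => (P b).carrier)}
    {SN : Sec X (fun b => (N b).carrier)} {SN' : Sec X (fun b => (N' b).carrier)}
    (hP : LocBimod S₂ S₁ P SP x₀)
    (hN : LocBimod (A₂ := fun _ => A) S₁ (fun s b => X.SmoothVecAt 𝕜 s b) N SN x₀)
    (hN' : LocBimod (A₂ := fun _ => A) S₂ (fun s b => X.SmoothVecAt 𝕜 s b) N' SN' x₀)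
    (hPi : (P x₀).Invertible) (hNi : (N x₀).Invertible) (hNi' : (N' x₀).Invertible) :
    ∃ (γ : ∀ b, P b →ₗ[𝕜] N b →ₗ[𝕜] N' b) (h : X.pt → evenAut A), ∀ᶠ b in X.nhds x₀,
      SBimod.IsAct (P b) (N b) (N' b) (h b) (γ b) ∧
      (∀ p n, SP p b → SN n b → SN' (fun x => γ x (p x) (n x)) b) ∧
      X.SmoothLinAt 𝕜 (fun x => ((h x).1.toLinearMap : A →ₗ[𝕜] A)) b := by
  classical
  obtain ⟨A₀', A₀, P₀, α', α, ψ, hα', hα, hψ, hPl⟩ := hP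
  obtain ⟨B₀, N₀, β, χ, hβ, hχ, hNl⟩ := hN.exists_triv hNi hα
  obtain ⟨B₀', N₀', β', χ', hβ', hχ', hNl'⟩ := hN'.exists_triv hNi' hα'
  have hα0 := Space.self_of_nhds hα.2
  have hα'0 := Space.self_of_nhds hα'.2
  have hβ0 := Space.self_of_nhds hβ.2
  have hβ'0 := Space.self_of_nhds hβ'.2
  have hPl0 := Space.self_of_nhds hPl
  have hNl0 := Space.self_of_nhds hNl
  have hNl'0 := Space.self_of_nhds hNl'
  have hP₀ : P₀.Invertible :=
    hPi.of_semilinear hα'0 hα0 (ψ x₀) hψ.bijective hPl0.1 hPl0.2.1 hPl0.2.2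
  have hN₀ : N₀.Invertible :=
    hNi.of_semilinear hα0 hβ0 (χ x₀) hχ.bijective hNl0.1 hNl0.2.1 hNl0.2.2
  have hN₀' : N₀'.Invertible :=
    hNi'.of_semilinear hα'0 hβ'0 (χ' x₀) hχ'.bijective hNl'0.1 hNl'0.2.1 hNl'0.2.2
  obtain ⟨φ, f, hf⟩ := SBimod.exists_isomorphic_twistR hA (hN₀'.twistR hβ'0)
    ((hP₀.tensor_prod hN₀).twistR hβ0)
  let f₀ : SBimod.tensor P₀ N₀ →ₗ[𝕜] N₀' := f.toLin
  have hfb : Function.Bijective f₀ := hf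
  have hfl : ∀ a t, f₀ ((SBimod.tensor P₀ N₀).left a t) = N₀'.left a (f₀ t) := f.map_left
  have hfr : ∀ c t, f₀ ((SBimod.tensor P₀ N₀).right (β x₀ c) t) =
      N₀'.right (β' x₀ (φ.1 c)) (f₀ t) := f.map_right
  have hfp : ∀ t, N₀'.par (f₀ t) = f₀ ((SBimod.tensor P₀ N₀).par t) :=
    (even_iff_parity (SBimod.tensor P₀ N₀).isCompl N₀'.isCompl).1 fun i t ht => f.even ht
  let h₀ : B₀ →ₗ[𝕜] B₀' := β' x₀ ∘ₗ φ.1.toLinearMap ∘ₗ Space.linInv (β x₀)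
  have hh₀ : IsSAlgIso h₀ := hβ'0.comp ((evenAut.isSAlgIso φ).comp (linInv_isSAlgIso hβ0))
  have hfr' : ∀ c t, f₀ ((SBimod.tensor P₀ N₀).right c t) = N₀'.right (h₀ c) (f₀ t) :=
    fun c t => by
      obtain ⟨c, rfl⟩ := hβ0.1.2 c
      rw [hfr]
      simp [h₀, Space.linInv_apply hβ0.1]
  let hl : X.pt → A →ₗ[𝕜] A := fun b => Space.linInv (β' b) ∘ₗ h₀ ∘ₗ β b
  let h : X.pt → evenAut A := fun b => if hb : IsSAlgIso (hl b) then hb.toAut else 1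
  have hhl : ∀ᶠ b in X.nhds x₀, ((h b).1.toLinearMap : A →ₗ[𝕜] A) = hl b := by
    filter_upwards [hβ.2, hβ'.2] with b h1 h2
    have h3 : IsSAlgIso (hl b) := (linInv_isSAlgIso h2).comp (hh₀.comp h1)
    ext c
    simp only [h, dif_pos h3]
    rfl
  let γ : ∀ b, P b →ₗ[𝕜] N b →ₗ[𝕜] N' b := fun b =>
    ((SBimod.tmulL P₀ N₀).compl₁₂ (ψ b) (χ b)).compr₂ (Space.linInv (χ' b) ∘ₗ f₀)
  have hγ : ∀ b p n, γ b p n = Space.linInv (χ' b) (f₀ (SBimod.tmul (ψ b p) (χ b n))) :=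
    fun b p n => rfl
  refine ⟨γ, h, ?_⟩
  filter_upwards [hψ, hχ, hχ', hPl, hNl, hNl', Space.eventually_nhds hhl,
    hα.2, Space.eventually_nhds hχ', hβ.eventually, hβ'.eventually] with
    b k5 k6 k7 k8 k9 k10 k11 k12 k13 k14 k15
  have k11' := fun c => LinearMap.congr_fun (Space.self_of_nhds k11) c
  have hχγ : ∀ p n, χ' b (γ b p n) = f₀ (SBimod.tmul (ψ b p) (χ b n)) := fun p n => by
    rw [hγ, Space.apply_linInv k7.1]
  have hψp : ∀ p, P₀.par (ψ b p) = ψ b ((P b).par p) :=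
    (even_iff_parity (P b).isCompl P₀.isCompl).1 k8.1
  have hχp : ∀ p, N₀.par (χ b p) = χ b ((N b).par p) :=
    (even_iff_parity (N b).isCompl N₀.isCompl).1 k9.1
  have hχ'p : ∀ p, N₀'.par (χ' b p) = χ' b ((N' b).par p) :=
    (even_iff_parity (N' b).isCompl N₀'.isCompl).1 k10.1
  have hbal : ∀ k a n, γ b ((P b).right a k) n = γ b k ((N b).left a n) := fun k a n => by
    rw [hγ, hγ, k8.2.2, k9.2.1, SBimod.tmul_right]
  refine ⟨⟨hbal, fun a k n => k7.1.1 ?_, fun k n c => k7.1.1 ?_, fun k n => k7.1.1 ?_, ?_⟩,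
    fun p n hp hn => ?_, fun v => ?_⟩
  · rw [hχγ, k8.2.1, k10.2.1, hχγ, ← SBimod.left_tmul, hfl]
  · rw [hχγ, k9.2.2, k10.2.2, hχγ, ← SBimod.right_tmul, hfr']
    congr 2
    have := k11' c
    change (h b).1 c = hl b c at this
    rw [this]
    exact (Space.apply_linInv (Space.self_of_nhds k15.2).1 _).symm
  · rw [hχγ, ← hχ'p, hχγ, hfp, SBimod.par_tmul, hψp, hχp]
  · let T := SBimod.tensorEquiv (M₀ := P₀) (N₀ := N₀) (LinearEquiv.ofBijective _ k5.1)
      (LinearEquiv.ofBijective _ k6.1) (LinearEquiv.ofBijective _ k12.1).toEquiv k8.2.2 k9.2.1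
    have e : SBimod.tensorLift (γ b) hbal = Space.linInv (χ' b) ∘ₗ f₀ ∘ₗ T.toLinearMap :=
      SBimod.tensor_hom_ext fun p n => by
        rw [SBimod.tensorLift_tmul]
        exact congrArg (fun t => Space.linInv (χ' b) (f₀ t))
          (SBimod.tensorEquiv_tmul (M₀ := P₀) (N₀ := N₀) (LinearEquiv.ofBijective _ k5.1)
            (LinearEquiv.ofBijective _ k6.1) (LinearEquiv.ofBijective _ k12.1).toEquiv k8.2.2 k9.2.1
            p n).symm
    rw [e]
    refine Function.Bijective.comp (g := Space.linInv (χ' b)) ?_ (hfb.comp T.bijective)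
    rw [Space.linInv, dif_pos k7.1]
    exact (LinearEquiv.ofBijective _ k7.1).symm.bijective
  · refine ((Space.self_of_nhds k13).2 _).2 ?_
    refine Space.SmoothVecAt.congr (smooth_bilin ((SBimod.tmulL P₀ N₀).compr₂ f₀)
      ((k5.2 p).1 hp) ((k6.2 n).1 hn)) (k13.mono fun x hx => ?_)
    rw [hγ, Space.apply_linInv hx.1]
    rfl
  · have h1 : X.SmoothVecAt 𝕜 (fun x => hl x v) b := by
      refine (k15.1.congr_smooth (k15.2.mono fun x hx => Space.apply_linInv hx.1 _)).2 ?_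
      exact ((k14.1.smooth_iff (fun _ => v)).1 (Space.smoothVecAt_const v)).map h₀
    exact h1.congr (k11.mono fun x hx => (LinearMap.congr_fun hx v).symm)

end LocalAction

section SemilinearRight

variable {𝕜 : Type} [RCLike 𝕜] {A B C D : SAlg.{u} 𝕜}

/-- Automorphisms of `B` near the identity lift to maps of an invertible `A`-`B`-bimodule that are
semilinear for the right action. -/
theorem SBimod.exists_semilinear_right {M : SBimod A B} (hM : M.Invertible) {X : Space.{u}} {x₀ : X.pt}
    {δ : X.pt → B →ₗ[𝕜] B} (hδ : X.SmoothLinAt 𝕜 δ x₀) (h0 : δ x₀ = LinearMap.id)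
    (hmul : ∀ᶠ x in X.nhds x₀, (∀ a a', δ x (a * a') = δ x a * δ x a') ∧
      ∀ a, B.par (δ x a) = δ x (B.par a)) :
    ∃ ν : X.pt → M →ₗ[𝕜] M, X.SmoothLinAt 𝕜 ν x₀ ∧ ν x₀ = LinearMap.id ∧
      ∀ᶠ x in X.nhds x₀, Function.Bijective (ν x) ∧
        (∀ a m, ν x (M.right a m) = M.right (δ x a) (ν x m)) ∧ ∀ m, M.par (ν x m) = ν x (M.par m) := by
  obtain ⟨k, y, l, hl, hy⟩ := hM.exists_dual_right
  let ν' : X.pt → M →ₗ[𝕜] M := fun x => ∑ i, M.right.flip (y i) ∘ₗ δ x ∘ₗ l i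
  have hν' : ∀ x m, ν' x m = ∑ i, M.right (δ x (l i m)) (y i) := fun x m => by
    simp [ν', LinearMap.sum_apply]
  have hs' : X.SmoothLinAt 𝕜 ν' x₀ := fun m => by
    simp only [hν']
    exact Space.smoothVecAt_sum _ fun i _ => (hδ (l i m)).map (M.right.flip (y i))
  let ν : X.pt → M →ₗ[𝕜] M := fun x => (2⁻¹ : 𝕜) • (ν' x + M.par ∘ₗ ν' x ∘ₗ M.par)
  have hν : ∀ x m, ν x m = (2⁻¹ : 𝕜) • (ν' x m + M.par (ν' x (M.par m))) := fun x m => rfl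
  have hνs : X.SmoothLinAt 𝕜 ν x₀ := fun m =>
    Space.SmoothVecAt.smul (Space.smoothFunAt_const _) ((hs' m).add ((hs' (M.par m)).map M.par))
  have hν0 : ν x₀ = LinearMap.id := by
    have h1 : ∀ m, ν' x₀ m = m := fun m => by rw [hν', h0]; exact hy m
    ext m
    rw [hν, h1, h1, SBimod.par_par, ← two_smul 𝕜 m, smul_smul, inv_mul_cancel₀ two_ne_zero, one_smul]
    rfl
  refine ⟨ν, hνs, hν0, ?_⟩
  have hbij := hνs.eventually_bijective (by rw [hν0]; exact Function.bijective_id)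
  filter_upwards [hmul, hbij] with x h1 h2
  have h3 : ∀ a m, ν' x (M.right a m) = M.right (δ x a) (ν' x m) := fun a m => by
    simp only [hν', hl, h1.1, M.right_mul, map_sum]
  refine ⟨h2, fun a m => ?_, fun m => ?_⟩
  · rw [hν, hν, M.par_right, h3, h3, M.par_right, h1.2,
      show B.par (B.par a) = a from parity_parity _ a]
    simp
  · rw [hν, hν, map_smul, map_add, SBimod.par_par, SBimod.par_par, add_comm]
variable {X : Space.{u}} {x₀ : X.pt} {A₁ A₂ : X.pt → SAlg.{u} 𝕜}
  {S₁ : Sec X (fun b => (A₁ b).carrier)} {S₂ : Sec X (fun b => (A₂ b).carrier)}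

/-- A bundle of invertible bimodules can be trivialized along any given local trivialization of the
algebra bundle acting on the right. -/
theorem LocBimod.exists_triv_right {M : ∀ b, SBimod (A₁ b) (A₂ b)} {S : Sec X (fun b => (M b).carrier)}
    (h : LocBimod S₁ S₂ M S x₀) (hM : (M x₀).Invertible) {B' : SAlg.{u} 𝕜}
    {β' : ∀ b, A₂ b →ₗ[𝕜] B'} (hβ' : IsAlgTriv S₂ β' x₀) :
    ∃ (A₀ : SAlg.{u} 𝕜) (M₀ : SBimod A₀ B') (α : ∀ b, A₁ b →ₗ[𝕜] A₀) (ψ : ∀ b, M b →ₗ[𝕜] M₀),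
      IsAlgTriv S₁ α x₀ ∧ IsTriv S ψ x₀ ∧
      ∀ᶠ b in X.nhds x₀,
        (∀ (i : ZMod 2) (m : M b), m ∈ (M b).gr i → ψ b m ∈ M₀.gr i) ∧
        (∀ a m, ψ b ((M b).left a m) = M₀.left (α b a) (ψ b m)) ∧
        (∀ a m, ψ b ((M b).right a m) = M₀.right (β' b a) (ψ b m)) := by
  obtain ⟨A₀, B₀, M₀, α, β, ψ, hα, hβ, hψ, hl⟩ := h
  have hα0 := Space.self_of_nhds hα.2
  have hβ'0 := Space.self_of_nhds hβ'.2
  have hβ0 := Space.self_of_nhds hβ.2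
  have hl0 := Space.self_of_nhds hl
  have hM₀ : M₀.Invertible :=
    hM.of_semilinear hα0 hβ0 (ψ x₀) hψ.bijective hl0.1 hl0.2.1 hl0.2.2
  let c : B' →ₗ[𝕜] B₀ := β x₀ ∘ₗ Space.linInv (β' x₀)
  have hc : IsSAlgIso c := hβ0.comp (linInv_isSAlgIso hβ'0)
  let δ : X.pt → B₀ →ₗ[𝕜] B₀ := fun x => c ∘ₗ β' x ∘ₗ Space.linInv (β x)
  have hδs : X.SmoothLinAt 𝕜 δ x₀ := fun v => (hβ.1.smoothLinAt_change hβ'.1 v).map c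
  have hδ0 : δ x₀ = LinearMap.id := by
    ext v
    simp [δ, c, Space.linInv_apply hβ'0.1, Space.apply_linInv hβ0.1]
  have hδ : ∀ᶠ x in X.nhds x₀, IsSAlgIso (δ x) := by
    filter_upwards [hβ.2, hβ'.2] with x h1 h2
    exact hc.comp (h2.comp (linInv_isSAlgIso h1))
  obtain ⟨ν, hνs, hν0, hν⟩ := SBimod.exists_semilinear_right hM₀ hδs hδ0
    (hδ.mono fun x h => ⟨h.2.2.1, h.par⟩)
  have hνb0 : Function.Bijective (ν x₀) := by rw [hν0]; exact Function.bijective_id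
  obtain ⟨ρ, hρ⟩ := LinearMap.exists_leftInverse_of_injective M₀.left
    (LinearMap.ker_eq_bot.2 hM₀.left_injective)
  let κ : X.pt → A₀ →ₗ[𝕜] A₀ := fun x => ρ ∘ₗ
    (LinearMap.llcomp 𝕜 M₀ M₀ M₀ (ν x) ∘ₗ LinearMap.lcomp 𝕜 M₀ (Space.linInv (ν x))) ∘ₗ M₀.left
  have hκs : X.SmoothLinAt 𝕜 κ x₀ := fun v => by
    refine Space.SmoothVecAt.map (F := M₀ →ₗ[𝕜] M₀) (f := fun x => ν x ∘ₗ M₀.left v ∘ₗ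
      Space.linInv (ν x)) ?_ ρ
    refine Space.smoothVecAt_linearMap fun m => ?_
    exact hνs.apply ((hνs.linInv hνb0 m).map (M₀.left v))
  have hκ : ∀ᶠ x in X.nhds x₀, ∀ v m, ν x (M₀.left v m) = M₀.left (κ x v) (ν x m) := by
    filter_upwards [hν, hδ] with x h1 h2 v
    obtain ⟨b, hb⟩ := hM₀.exists_left (ν x ∘ₗ M₀.left v ∘ₗ Space.linInv (ν x)) fun a m => by
      obtain ⟨a, rfl⟩ := h2.1.2 a
      obtain ⟨m, rfl⟩ := h1.1.2 m
      simp only [LinearMap.comp_apply]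
      rw [← h1.2.1, Space.linInv_apply h1.1, Space.linInv_apply h1.1, M₀.left_right, h1.2.1]
    have hb' : κ x v = b := by
      change ρ (ν x ∘ₗ M₀.left v ∘ₗ Space.linInv (ν x)) = b
      rw [hb]
      exact LinearMap.congr_fun hρ b
    intro m
    rw [hb', ← hb]
    simp [Space.linInv_apply h1.1]
  have hκi : ∀ᶠ x in X.nhds x₀, IsSAlgIso (κ x) := by
    filter_upwards [hκ, hν] with x h1 h2
    have hR : ∀ {b b' : A₀}, (∀ m, M₀.left b (ν x m) = M₀.left b' (ν x m)) → b = b' := by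
      intro b b' h
      refine hM₀.left_injective (LinearMap.ext fun m => ?_)
      obtain ⟨m, rfl⟩ := h2.1.2 m
      exact h m
    have hinj : Function.Injective (κ x) := fun b b' e =>
      hM₀.left_injective (LinearMap.ext fun m => h2.1.1 (by rw [h1, h1, e]))
    refine ⟨⟨hinj, LinearMap.injective_iff_surjective.1 hinj⟩, hR fun m => ?_, fun a a' => hR fun m => ?_, ?_⟩
    · rw [← h1, M₀.left_one, M₀.left_one]
    · rw [← h1, M₀.left_mul, M₀.left_mul, h1, h1]
    · rw [even_iff_parity A₀.isCompl A₀.isCompl]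
      intro b
      refine hR fun m => ?_
      change M₀.left (A₀.par (κ x b)) _ = M₀.left (κ x (A₀.par b)) _
      have e1 : M₀.left (A₀.par b) m = M₀.par (M₀.left b (M₀.par m)) := by
        rw [M₀.par_left, M₀.par_par]
      rw [← h1, e1, ← h2.2.2, h1, M₀.par_left, h2.2.2, M₀.par_par]
  refine ⟨A₀, M₀.twistR hc.toHom, fun x => κ x ∘ₗ α x, fun x => ν x ∘ₗ ψ x, hα.comp hκs hκi,
    hψ.comp hνs hνb0, ?_⟩
  filter_upwards [hl, hν, hκ, hβ.2, hβ'.2] with x h1 h2 h3 h4 h5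
  refine ⟨fun i m hm => (even_iff_parity M₀.isCompl M₀.isCompl).2 h2.2.2 i _ (h1.1 i m hm),
    fun a m => ?_, fun a m => ?_⟩
  · change ν x (ψ x _) = M₀.left (κ x (α x a)) (ν x (ψ x m))
    rw [h1.2.1, h3]
  · change ν x (ψ x _) = M₀.right (c (β' x a)) (ν x (ψ x m))
    rw [h1.2.2, h2.2.1]
    simp [δ, Space.linInv_apply h4.1]

end SemilinearRight

section HomBimodule

variable {𝕜 : Type} [RCLike 𝕜] {A A₁ A₂ : SAlg.{u} 𝕜}

namespace SBimod

/-- The maps `f : N → N'` with `f (n ◃ c) = f n ◃ g c`. -/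
def semilinear (N : SBimod A₁ A) (N' : SBimod A₂ A) (g : evenAut A) :
    Submodule 𝕜 (N →ₗ[𝕜] N') where
  carrier := {f | ∀ c n, f (N.right c n) = N'.right (g.1 c) (f n)}
  zero_mem' := by simp
  add_mem' := fun hf hf' c n => by simp [hf c n, hf' c n]
  smul_mem' := fun a f hf c n => by simp [hf c n]

/-- The bimodule of maps `f : N → N'` with `f (n ◃ c) = f n ◃ g c`. -/
def homBimod (N : SBimod A₁ A) (N' : SBimod A₂ A) (g : evenAut A) : SBimod A₂ A₁ where
  carrier := semilinear N N' g
  gr i :=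
    { carrier := {f | ∀ n, N'.par (f.1 n) = (-1 : 𝕜) ^ i.val • f.1 (N.par n)}
      zero_mem' := by simp
      add_mem' := fun {f f'} hf hf' n => by
        change N'.par (f.1 n + f'.1 n) = _ • (f.1 _ + f'.1 _)
        rw [map_add, hf n, hf' n, smul_add]
      smul_mem' := fun a f hf n => by
        change N'.par (a • f.1 n) = _ • a • f.1 _
        rw [map_smul, hf n, smul_comm] }
  isCompl := by
    constructor
    · rw [Submodule.disjoint_def]
      intro f h₀ h₁
      refine Subtype.ext (LinearMap.ext fun n => ?_)
      have h := (h₀ (N.par n)).symm.trans (h₁ (N.par n))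
      simp only [ZMod.val_zero, pow_zero, one_smul, ZMod.val_one, pow_one, neg_smul, N.par_par] at h
      have h2 : (2 : 𝕜) • f.1 n = 0 := by rw [two_smul]; nth_rewrite 1 [h]; simp
      exact (smul_eq_zero.1 h2).resolve_left two_ne_zero
    · rw [codisjoint_iff, eq_top_iff]
      intro f _
      have hp : N'.par ∘ₗ f.1 ∘ₗ N.par ∈ semilinear N N' g := fun c n => by
        change N'.par (f.1 (N.par _)) = N'.right _ (N'.par (f.1 (N.par n)))
        rw [N.par_right, f.2, N'.par_right, evenAut.par, show A.par (A.par c) = c from parity_parity _ c]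
      let p : semilinear N N' g := ⟨_, hp⟩
      have hpn : ∀ n, p.1 n = N'.par (f.1 (N.par n)) := fun n => rfl
      refine Submodule.mem_sup.2 ⟨(2⁻¹ : 𝕜) • (f + p), fun n => ?_, (2⁻¹ : 𝕜) • (f - p), fun n => ?_, ?_⟩
      · change N'.par ((2⁻¹ : 𝕜) • (f.1 n + p.1 n)) = _ • (2⁻¹ : 𝕜) • (f.1 _ + p.1 _)
        simp [hpn, par_par, add_comm]
      · change N'.par ((2⁻¹ : 𝕜) • (f.1 n - p.1 n)) = _ • (2⁻¹ : 𝕜) • (f.1 _ - p.1 _)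
        simp [hpn, par_par, ZMod.val_one, ← smul_neg]
      · rw [← smul_add, add_add_sub_cancel, ← two_smul 𝕜, smul_smul, inv_mul_cancel₀ two_ne_zero,
          one_smul]
  left :=
    { toFun := fun a =>
        { toFun := fun f => ⟨N'.left a ∘ₗ f.1, fun c n => by simp [f.2 c n, N'.left_right]⟩
          map_add' := fun f f' => Subtype.ext (by ext; simp)
          map_smul' := fun c f => Subtype.ext (by ext; simp) }
      map_add' := fun a a' => LinearMap.ext fun f => Subtype.ext (by ext; simp)
      map_smul' := fun c a => LinearMap.ext fun f => Subtype.ext (by ext; simp) }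
  right :=
    { toFun := fun a =>
        { toFun := fun f => ⟨f.1 ∘ₗ N.left a, fun c n => by simp [N.left_right, f.2 c (N.left a n)]⟩
          map_add' := fun f f' => Subtype.ext (by ext; simp)
          map_smul' := fun c f => Subtype.ext (by ext; simp) }
      map_add' := fun a a' => LinearMap.ext fun f => Subtype.ext (by ext; simp)
      map_smul' := fun c a => LinearMap.ext fun f => Subtype.ext (by ext; simp) }
  left_one := fun f => Subtype.ext (LinearMap.ext fun n => N'.left_one _)
  left_mul := fun a a' f => Subtype.ext (LinearMap.ext fun n => N'.left_mul _ _ _)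
  right_one := fun f => Subtype.ext (LinearMap.ext fun n => congrArg f.1 (N.left_one n))
  right_mul := fun a a' f => Subtype.ext (LinearMap.ext fun n => congrArg f.1 (N.left_mul _ _ _))
  left_right := fun a b f => rfl
  left_mem := fun {i j a f} ha hf n => by
    change N'.par (N'.left a (f.1 n)) = _ • N'.left a (f.1 (N.par n))
    rw [N'.par_left, hf n, show A₂.par a = _ from parity_apply _ ha, negOne_pow_val_add]
    simp [smul_smul, mul_comm]
  right_mem := fun {i j f a} hf ha n => by
    change N'.par (f.1 (N.left a n)) = _ • f.1 (N.left a (N.par n))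
    rw [hf, N.par_left, show A₁.par a = _ from parity_apply _ ha, negOne_pow_val_add]
    simp [smul_smul]

/-- Evaluation `Hom(N, N') × N → N'`. -/
def homEval (N : SBimod A₁ A) (N' : SBimod A₂ A) (g : evenAut A) :
    homBimod N N' g →ₗ[𝕜] N →ₗ[𝕜] N' := (semilinear N N' g).subtype

variable {N : SBimod A₁ A} {N' : SBimod A₂ A} {g : evenAut A}

theorem homBimod_ext {f f' : homBimod N N' g} (h : ∀ n, homEval N N' g f n = homEval N N' g f' n) :
    f = f' := Subtype.ext (LinearMap.ext h)

theorem homEval_right (f : homBimod N N' g) (c : A) (n : N) :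
    homEval N N' g f (N.right c n) = N'.right (g.1 c) (homEval N N' g f n) := f.2 c n

theorem par_homEval (f : homBimod N N' g) (n : N) :
    N'.par (homEval N N' g f n) = homEval N N' g ((homBimod N N' g).par f) (N.par n) := by
  obtain ⟨f₀, h₀, f₁, h₁, rfl⟩ := exists_homogeneous (homBimod N N' g).isCompl f
  have e₀ : (homBimod N N' g).par f₀ = f₀ := parity_zero _ h₀
  have e₁ : (homBimod N N' g).par f₁ = -f₁ := parity_one _ h₁
  have h₀' : N'.par (homEval N N' g f₀ n) = _ := h₀ n
  have h₁' : N'.par (homEval N N' g f₁ n) = _ := h₁ n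
  rw [map_add (homBimod N N' g).par, e₀, e₁, map_add, map_add, LinearMap.add_apply,
    LinearMap.add_apply, map_add, map_neg, LinearMap.neg_apply, h₀', h₁']
  simp [ZMod.val_one]
  rfl

theorem isAct_hom (hN : N.Invertible) : IsAct (homBimod N N' g) N N' g (homEval N N' g) := by
  have hbal : ∀ (k : homBimod N N' g) a n, homEval N N' g ((homBimod N N' g).right a k) n =
    homEval N N' g k (N.left a n) := fun _ _ _ => rfl
  refine ⟨hbal, fun _ _ _ => rfl, fun k n c => k.2 c n, par_homEval, ?_⟩
  obtain ⟨N₀, ⟨P⟩⟩ := hN.exists_pairing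
  obtain ⟨k, x, y, hxy⟩ := P.exists_η_eq_one
  let l : Fin k → N →ₗ[𝕜] A := fun i => P.η ∘ₗ tmulL N₀ N (x i)
  have hl : ∀ i c n, l i (N.right c n) = l i n * c := fun i c n => P.η_right c (tmul (x i) n)
  have hl1 : ∑ i, l i (y i) = 1 := by rw [← hxy, map_sum]; rfl
  let F : Fin k → N' → homBimod N N' g := fun i n' =>
    ⟨N'.right.flip n' ∘ₗ g.1.toLinearMap ∘ₗ l i, fun c n => by simp [hl, N'.right_mul]⟩
  have hF : ∀ i n' n, homEval N N' g (F i n') n = N'.right (g.1 (l i n)) n' := fun _ _ _ => rfl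
  let s : N' → tensor (homBimod N N' g) N := fun n' => ∑ i, tmul (F i n') (y i)
  have hs : ∀ n', tensorLift (homEval N N' g) hbal (s n') = n' := fun n' => by
    simp only [s, map_sum, tensorLift_tmul, hF]
    exact sum_right_eq (by rw [← map_sum, hl1, map_one]) n'
  have hs' : ∀ f n, s (homEval N N' g f n) = tmul f n := fun f n => by
    have h1 : ∀ i, ∃ a : A₁, N.right.flip n ∘ₗ l i = N.left a := fun i =>
      hN.exists_left _ fun b m => by simp [hl, N.right_mul]
    choose a ha using h1
    have h2 : ∀ i, F i (homEval N N' g f n) = (homBimod N N' g).right (a i) f := fun i => by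
      refine homBimod_ext fun m => ?_
      rw [hF, hbal, ← homEval_right, ← ha i]
      rfl
    simp only [s, h2, tmul_right, ← ha]
    change ∑ i, tmulL (homBimod N N' g) N f (N.right (l i (y i)) n) = _
    rw [← map_sum, sum_right_eq hl1]
    rfl
  have hadd : ∀ n' n'', s (n' + n'') = s n' + s n'' := fun n' n'' => by
    simp only [s, ← Finset.sum_add_distrib, ← add_tmul]
    refine Finset.sum_congr rfl fun i _ => congrArg (fun f => tmul f (y i)) (homBimod_ext fun n => ?_)
    rw [map_add, LinearMap.add_apply, hF, hF, hF, map_add]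
  have hst : ∀ t, s (tensorLift (homEval N N' g) hbal t) = t := fun t => by
    refine tensor_induction t ?_ (fun f n => ?_) fun x y hx hy => ?_
    · rw [map_zero]
      simpa using hadd 0 0
    · rw [tensorLift_tmul, hs']
    · rw [map_add, hadd, hx, hy]
  exact ⟨Function.LeftInverse.injective hst, fun n' => ⟨s n', hs n'⟩⟩

end SBimod

end HomBimodule

section HomBundle

variable {𝕜 : Type} [RCLike 𝕜] {A : SAlg.{u} 𝕜} {B : Space.{u}} {b₀ : B.pt}
  {A₁ A₂ A₃ : B.pt → SAlg.{u} 𝕜} {S₁ : Sec B (fun b => (A₁ b).carrier)}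
  {S₂ : Sec B (fun b => (A₂ b).carrier)} {S₃ : Sec B (fun b => (A₃ b).carrier)}

theorem isAlgTriv_const {A' : SAlg.{u} 𝕜} {K : B.pt → A →ₗ[𝕜] A'}
    (hK : B.SmoothLinAt 𝕜 K b₀) (h : ∀ᶠ b in B.nhds b₀, IsSAlgIso (K b)) :
    IsAlgTriv (A := fun _ => A) (fun s b => B.SmoothVecAt 𝕜 s b) K b₀ :=
  ⟨(isTriv_const b₀).comp hK (Space.self_of_nhds h).1, h⟩

/-- Sections of the bundle of semilinear maps are smooth if they map smooth sections to smooth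
sections. -/
def homSec {N : ∀ b, SBimod (A₁ b) A} {N' : ∀ b, SBimod (A₂ b) A}
    (SN : Sec B (fun b => (N b).carrier)) (SN' : Sec B (fun b => (N' b).carrier))
    (g : B.pt → evenAut A) : Sec B (fun b => ((N b).homBimod (N' b) (g b)).carrier) :=
  fun s b => ∀ n, SN n b → SN' (fun x => SBimod.homEval (N x) (N' x) (g x) (s x) (n x)) b

variable {N : ∀ b, SBimod (A₁ b) A} {N' : ∀ b, SBimod (A₂ b) A} {N'' : ∀ b, SBimod (A₃ b) A}
  {SN : Sec B (fun b => (N b).carrier)} {SN' : Sec B (fun b => (N' b).carrier)}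
  {SN'' : Sec B (fun b => (N'' b).carrier)}

theorem locBimod_hom {g : B.pt → evenAut A}
    (hN : LocBimod (A₂ := fun _ => A) S₁ (fun s b => B.SmoothVecAt 𝕜 s b) N SN b₀)
    (hN' : LocBimod (A₂ := fun _ => A) S₂ (fun s b => B.SmoothVecAt 𝕜 s b) N' SN' b₀)
    (hi : (N b₀).Invertible) (hi' : (N' b₀).Invertible)
    (hg : B.SmoothLinAt 𝕜 (fun b => ((g b).1.toLinearMap : A →ₗ[𝕜] A)) b₀) :
    LocBimod S₂ S₁ (fun b => (N b).homBimod (N' b) (g b)) (homSec SN SN' g) b₀ := by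
  classical
  obtain ⟨A₀, M₀, α, ψ, hα, hψ, hl⟩ := hN.exists_triv_right hi
    (isAlgTriv_const (K := fun _ => LinearMap.id) (fun v => Space.smoothVecAt_const v)
      (Filter.Eventually.of_forall fun _ => SBimod.isSAlgIso_id A))
  obtain ⟨A₀', M₀', α', ψ', hα', hψ', hl'⟩ := hN'.exists_triv_right hi'
    (isAlgTriv_const (hg.linInv (evenAut.isSAlgIso (g b₀)).1)
      (Filter.Eventually.of_forall fun b => linInv_isSAlgIso (evenAut.isSAlgIso (g b))))
  let good : B.pt → Prop := fun b => Function.Bijective (ψ b) ∧ Function.Bijective (ψ' b) ∧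
    (∀ c n, ψ b ((N b).right c n) = M₀.right c (ψ b n)) ∧
    ∀ c n, ψ' b ((N' b).right ((g b).1 c) n) = M₀'.right c (ψ' b n)
  have hgood : ∀ᶠ b in B.nhds b₀, good b := by
    filter_upwards [hψ, hψ', hl, hl'] with b h1 h2 h3 h4
    refine ⟨h1.1, h2.1, h3.2.2, fun c n => ?_⟩
    rw [h4.2.2]
    congr 1
    exact congrArg M₀'.right (Space.linInv_apply (evenAut.isSAlgIso (g b)).1 c)
  have hmem : ∀ b, good b → ∀ f : (N b).homBimod (N' b) (g b),
      ψ' b ∘ₗ SBimod.homEval (N b) (N' b) (g b) f ∘ₗ Space.linInv (ψ b) ∈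
        SBimod.semilinear M₀ M₀' 1 := fun b h f c m => by
    obtain ⟨n, rfl⟩ := h.1.2 m
    change ψ' b (SBimod.homEval (N b) (N' b) (g b) f (Space.linInv (ψ b) _)) = M₀'.right c
      (ψ' b (SBimod.homEval (N b) (N' b) (g b) f (Space.linInv (ψ b) _)))
    rw [← h.2.2.1, Space.linInv_apply h.1, Space.linInv_apply h.1, SBimod.homEval_right, h.2.2.2]
  let Ψ : ∀ b, (N b).homBimod (N' b) (g b) →ₗ[𝕜] M₀.homBimod M₀' 1 := fun b =>
    if h : good b then
      LinearMap.codRestrict (SBimod.semilinear M₀ M₀' 1)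
        (LinearMap.lcomp 𝕜 M₀' (Space.linInv (ψ b)) ∘ₗ LinearMap.llcomp 𝕜 _ _ _ (ψ' b) ∘ₗ
          SBimod.homEval (N b) (N' b) (g b)) (hmem b h)
    else 0
  have hΨ : ∀ b, good b → ∀ f n, SBimod.homEval M₀ M₀' 1 (Ψ b f) (ψ b n) =
      ψ' b (SBimod.homEval (N b) (N' b) (g b) f n) := fun b h f n => by
    have e : Ψ b = _ := dif_pos h
    rw [e]
    change ψ' b (SBimod.homEval (N b) (N' b) (g b) f (Space.linInv (ψ b) _)) = _
    rw [Space.linInv_apply h.1]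
  have hbij : ∀ b, good b → Function.Bijective (Ψ b) := fun b h => by
    constructor
    · intro f f' e
      refine SBimod.homBimod_ext fun n => h.2.1.1 ?_
      rw [← hΨ b h, ← hΨ b h, e]
    · intro F
      let f : (N b).homBimod (N' b) (g b) :=
        ⟨Space.linInv (ψ' b) ∘ₗ SBimod.homEval M₀ M₀' 1 F ∘ₗ ψ b, fun c n => by
          apply h.2.1.1
          rw [h.2.2.2]
          simp only [LinearMap.comp_apply, Space.apply_linInv h.2.1, h.2.2.1]
          exact F.2 c _⟩
      refine ⟨f, SBimod.homBimod_ext fun m => ?_⟩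
      obtain ⟨n, rfl⟩ := h.1.2 m
      rw [hΨ b h]
      exact Space.apply_linInv h.2.1 _
  refine ⟨A₀', A₀, M₀.homBimod M₀' 1, α', α, Ψ, hα', hα, ?_, ?_⟩
  · filter_upwards [Space.eventually_nhds hgood, hψ.eventually, hψ'.eventually] with b h1 h2 h3
    refine ⟨hbij b (Space.self_of_nhds h1), fun s => ⟨fun hs => ?_, fun hs n hn => ?_⟩⟩
    · obtain ⟨r, hr⟩ := LinearMap.exists_leftInverse_of_injective (SBimod.homEval M₀ M₀' 1)
        (LinearMap.ker_eq_bot.2 Subtype.val_injective)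
      have h4 : B.SmoothVecAt 𝕜 (fun x => SBimod.homEval M₀ M₀' 1 (Ψ x (s x))) b := by
        refine Space.smoothVecAt_linearMap fun m => ?_
        obtain ⟨n, hn⟩ := h2.exists_section (fun _ => m)
        refine Space.SmoothVecAt.congr ((h3.smooth_iff _).1
          (hs n ((h2.congr_smooth hn).2 (Space.smoothVecAt_const m)))) ?_
        filter_upwards [h1, hn] with x h5 h6
        rw [← h6, hΨ x h5]
      exact (h4.map r).congr (Filter.Eventually.of_forall fun x => LinearMap.congr_fun hr _)
    · rw [h3.smooth_iff]
      refine Space.SmoothVecAt.congr (smooth_bilin (SBimod.homEval M₀ M₀' 1) hs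
        ((h2.smooth_iff n).1 hn)) ?_
      filter_upwards [h1] with x h5 using hΨ x h5 _ _
  · filter_upwards [hgood, hl, hl'] with b h h1 h2
    refine ⟨?_, fun a f => SBimod.homBimod_ext fun m => ?_, fun a f => SBimod.homBimod_ext fun m => ?_⟩
    · rw [even_iff_parity (SBimod.isCompl _) (SBimod.isCompl _)]
      intro f
      refine SBimod.homBimod_ext fun m => ?_
      obtain ⟨n, rfl⟩ := h.1.2 m
      have e1 : ∀ n, M₀.par (ψ b n) = ψ b ((N b).par n) := (even_iff_parity _ _).1 h1.1
      have e2 : ∀ n, M₀'.par (ψ' b n) = ψ' b ((N' b).par n) := (even_iff_parity _ _).1 h2.1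
      change SBimod.homEval M₀ M₀' 1 ((M₀.homBimod M₀' 1).par (Ψ b f)) _ =
        SBimod.homEval M₀ M₀' 1 (Ψ b (((N b).homBimod (N' b) (g b)).par f)) _
      rw [← (N b).par_par n, ← e1, ← SBimod.par_homEval, e1, hΨ b h, hΨ b h, e2,
        SBimod.par_homEval]
    · obtain ⟨n, rfl⟩ := h.1.2 m
      rw [hΨ b h]
      change ψ' b ((N' b).left a _) = M₀'.left _ (SBimod.homEval M₀ M₀' 1 (Ψ b f) (ψ b n))
      rw [h2.2.1, hΨ b h]
      rfl
    · obtain ⟨n, rfl⟩ := h.1.2 m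
      rw [hΨ b h]
      change ψ' b (SBimod.homEval (N b) (N' b) (g b) f ((N b).left a n)) =
        SBimod.homEval M₀ M₀' 1 (Ψ b f) (M₀.left _ (ψ b n))
      rw [← h1.2.1, hΨ b h]

/-- Bundles of bimodules that act on bundles `N`, `N'`, `N''` multiply. -/
theorem exists_smooth_mul {K₁₂ : ∀ b, SBimod (A₂ b) (A₁ b)} {K₂₃ : ∀ b, SBimod (A₃ b) (A₂ b)}
    {K₁₃ : ∀ b, SBimod (A₃ b) (A₁ b)} {S₁₂ : Sec B (fun b => (K₁₂ b).carrier)}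
    {S₂₃ : Sec B (fun b => (K₂₃ b).carrier)} {S₁₃ : Sec B (fun b => (K₁₃ b).carrier)}
    (h₁₂ : ∀ b, IsVBAt 𝕜 S₁₂ b) (h₂₃ : ∀ b, IsVBAt 𝕜 S₂₃ b) (h₁₃ : ∀ b, IsVBAt 𝕜 S₁₃ b)
    (hN : ∀ b, IsVBAt 𝕜 SN b)
    (hN'' : ∀ b, LocBimod (A₂ := fun _ => A) S₃ (fun s b => B.SmoothVecAt 𝕜 s b) N'' SN'' b)
    (hi : ∀ b, (N b).Invertible)
    {g₁₂ g₂₃ g₁₃ : B.pt → evenAut A} {act₁₂ : ∀ b, K₁₂ b →ₗ[𝕜] N b →ₗ[𝕜] N' b}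
    {act₂₃ : ∀ b, K₂₃ b →ₗ[𝕜] N' b →ₗ[𝕜] N'' b} {act₁₃ : ∀ b, K₁₃ b →ₗ[𝕜] N b →ₗ[𝕜] N'' b}
    (a₁₂ : ∀ b, SBimod.IsAct (K₁₂ b) (N b) (N' b) (g₁₂ b) (act₁₂ b))
    (a₂₃ : ∀ b, SBimod.IsAct (K₂₃ b) (N' b) (N'' b) (g₂₃ b) (act₂₃ b))
    (a₁₃ : ∀ b, SBimod.IsAct (K₁₃ b) (N b) (N'' b) (g₁₃ b) (act₁₃ b))
    (s₁₂ : ∀ b k n, S₁₂ k b → SN n b → SN' (fun x => act₁₂ x (k x) (n x)) b)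
    (s₂₃ : ∀ b k n, S₂₃ k b → SN' n b → SN'' (fun x => act₂₃ x (k x) (n x)) b)
    (s₁₃ : ∀ b k n, S₁₃ k b → SN n b → SN'' (fun x => act₁₃ x (k x) (n x)) b)
    {u : B.pt → evenUnits A} (hus : ∀ b, B.SmoothVecAt 𝕜 (fun b => (((u b)⁻¹).1 : A)) b)
    (hu : ∀ b, innerAut (u b) * g₂₃ b * g₁₂ b = g₁₃ b) :
    ∃ f : ∀ b, SBimod.Hom ((K₂₃ b).tensor (K₁₂ b)) (K₁₃ b),
      IsSmoothIso (tensorSec K₂₃ K₁₂ S₂₃ S₁₂) S₁₃ f ∧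
      ∀ b k k' n, act₁₃ b ((f b).toLin (SBimod.tmul k k')) n =
        (N'' b).right (((u b)⁻¹).1 : A) (act₂₃ b k (act₁₂ b k' n)) := by
  choose f hf hfa using fun b => (a₁₂ b).exists_mul (a₂₃ b) (a₁₃ b) (hi b) (hu b)
  refine ⟨f, isSmoothIso_tensorSec h₂₃ h₁₂ h₁₃ f hf fun b x y hx hy => ?_, hfa⟩
  refine (h₁₃ b).smooth_of_action (hN b) (hN'' b).isVBAt act₁₃ (s₁₃ b)
    (fun v hv => (a₁₃ b).eq_zero (hi b) hv) fun w hw => ?_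
  simp only [hfa]
  exact (hN'' b).smooth_right (hus b) (s₂₃ b _ _ hx (s₁₂ b _ _ hy hw))

theorem smoothVecAt_inv {u : B.pt → evenUnits A} {b : B.pt}
    (h : B.SmoothVecAt 𝕜 (fun b => ((u b).1 : A)) b) :
    B.SmoothVecAt 𝕜 (fun b => (((u b)⁻¹).1 : A)) b := by
  have hL : B.SmoothLinAt 𝕜 (fun x => LinearMap.mul 𝕜 A ((u x).1 : A)) b := fun v =>
    h.map ((LinearMap.mul 𝕜 A).flip v)
  refine hL.of_apply_injective (fun v w e => ?_) ?_
  · simpa using e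
  · simpa using Space.smoothVecAt_const (1 : A)

end HomBundle

section FibreProducts

open Manifold in
/-- Local lifts along a submersion `π`: near `(y₀, π y₀)`, a smooth map `L` with `π (L (y, x)) = x` and
`L (y, π y) = y`. -/
theorem exists_lift {Y X : Mfd.{u}} {π : Y → X} (hπ : Manifold.IsSubmersion Y.I X.I ∞ π) (y₀ : Y) :
    ∃ L : Y.prod X → Y, ∃ U ∈ 𝓝 (show Y.prod X from (y₀, π y₀)),
      ContMDiffOn (Y.prod X).I Y.I ∞ L U ∧ (∀ p ∈ U, π (L p) = p.2) ∧
      ∀ y, (show Y.prod X from (y, π y)) ∈ U → L (y, π y) = y := by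
  have h := hπ.isSubmersionAt y₀
  set φ := h.domChart
  set ψ := h.codChart
  let e := h.equiv
  let T : Y × X → Y.E := fun p => e.symm (ψ.extend X.I p.2, (e (φ.extend Y.I p.1)).2)
  let L : Y × X → Y := fun p => (φ.extend Y.I).symm (T p)
  have hφ := h.domChart_mem_maximalAtlas
  have hψ := h.codChart_mem_maximalAtlas
  have hT : ContMDiffOn (Y.I.prod X.I) 𝓘(ℝ, Y.E) ∞ T (φ.source ×ˢ ψ.source) := by
    have h1 : ContMDiffOn (Y.I.prod X.I) 𝓘(ℝ, Y.E) ∞ (fun p : Y × X => φ.extend Y.I p.1)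
        (φ.source ×ˢ ψ.source) :=
      (φ.contMDiffOn_extend hφ).comp contMDiffOn_fst fun p hp => hp.1
    have h2 : ContMDiffOn (Y.I.prod X.I) 𝓘(ℝ, X.E) ∞ (fun p : Y × X => ψ.extend X.I p.2)
        (φ.source ×ˢ ψ.source) :=
      (ψ.contMDiffOn_extend hψ).comp contMDiffOn_snd fun p hp => hp.2
    have h3 : ContMDiffOn (Y.I.prod X.I) 𝓘(ℝ, h.complement) ∞
        (fun p : Y × X => (e (φ.extend Y.I p.1)).2) (φ.source ×ˢ ψ.source) :=
      ((ContinuousLinearMap.snd ℝ X.E h.complement).comp e.toContinuousLinearMap).contMDiff.comp_contMDiffOn h1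
    exact e.symm.toContinuousLinearMap.contMDiff.comp_contMDiffOn (h2.prodMk_space h3)
  have hopen : IsOpen (φ.source ×ˢ ψ.source : Set (Y × X)) := φ.open_source.prod ψ.open_source
  have hmem : ∀ y ∈ φ.source, (y, π y) ∈ (φ.source ×ˢ ψ.source : Set (Y × X)) := fun y hy =>
    ⟨hy, h.source_subset_preimage_source hy⟩
  have hTy : ∀ y ∈ φ.source, T (y, π y) = φ.extend Y.I y := fun y hy => by
    have h1 := h.writtenInCharts ((φ.extend Y.I).map_source (by rwa [φ.extend_source]))
    simp only [Function.comp_apply] at h1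
    rw [(φ.extend Y.I).left_inv (by rwa [φ.extend_source])] at h1
    simp only [T]
    rw [h1]
    exact e.symm_apply_apply _
  have htgt : IsOpen (φ.extend Y.I).target := φ.isOpen_extend_target
  refine ⟨L, (φ.source ×ˢ ψ.source) ∩ T ⁻¹' (φ.extend Y.I).target, ?_, ?_, ?_, ?_⟩
  · have : IsOpen ((φ.source ×ˢ ψ.source) ∩ T ⁻¹' (φ.extend Y.I).target) :=
      hT.continuousOn.isOpen_inter_preimage hopen htgt
    refine this.mem_nhds ⟨hmem _ h.mem_domChart_source, ?_⟩
    rw [Set.mem_preimage, hTy _ h.mem_domChart_source]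
    exact (φ.extend Y.I).map_source (by rw [φ.extend_source]; exact h.mem_domChart_source)
  · have h1 := contMDiffOn_extend_symm hφ
    rw [← φ.extend_target'] at h1
    exact h1.comp (hT.mono Set.inter_subset_left) fun p hp => hp.2
  · rintro p ⟨hp, hp'⟩
    have h1 := h.writtenInCharts hp'
    have h2 : (e (T p)).1 = ψ.extend X.I p.2 := by simp [T]
    simp only [Function.comp_apply] at h1
    refine (ψ.extend X.I).injOn ?_ ?_ (h1.trans h2)
    · rw [ψ.extend_source]
      exact h.source_subset_preimage_source (by
        have := (φ.extend Y.I).map_target hp'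
        rwa [φ.extend_source] at this)
    · rw [ψ.extend_source]; exact hp.2
  · rintro y ⟨hy, -⟩
    change (φ.extend Y.I).symm (T (y, π y)) = y
    rw [hTy _ hy.1, (φ.extend Y.I).left_inv (by rw [φ.extend_source]; exact hy.1)]

variable {X Y₁ Y₂ Y₃ : Mfd.{u}}

/-- The fibre product `Y₁ ×_X Y₂`. -/
abbrev fib12 (π₁ : Y₁ → X) (π₂ : Y₂ → X) : Space.{u} :=
  (Space.ofMfd Y₁).fibProd (Space.ofMfd Y₂) π₁ π₂

/-- The fibre product `Y₁ ×_X Y₂ ×_X Y₃`. -/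
def tri (π₁ : Y₁ → X) (π₂ : Y₂ → X) (π₃ : Y₃ → X) : Space.{u} where
  pt := {q : Y₁ × Y₂ × Y₃ // π₁ q.1 = π₂ q.2.1 ∧ π₂ q.2.1 = π₃ q.2.2}
  amb := Y₁.prod (Y₂.prod Y₃)
  j := Subtype.val
  inj := Subtype.val_injective

variable {π₁ : Y₁ → X} {π₂ : Y₂ → X} {π₃ : Y₃ → X}

/-- The three projections from `Y₁ ×_X Y₂ ×_X Y₃`. -/
abbrev tri12 (q : (tri π₁ π₂ π₃).pt) : (fib12 π₁ π₂).pt := ⟨(q.1.1, q.1.2.1), q.2.1⟩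

/-- See `tri12`. -/
abbrev tri23 (q : (tri π₁ π₂ π₃).pt) : (fib12 π₂ π₃).pt := ⟨(q.1.2.1, q.1.2.2), q.2.2⟩

/-- See `tri12`. -/
abbrev tri13 (q : (tri π₁ π₂ π₃).pt) : (fib12 π₁ π₃).pt :=
  ⟨(q.1.1, q.1.2.2), q.2.1.trans q.2.2⟩

namespace Space

variable {B : Space.{u}}

theorem smoothMapAt_tri {p : B.pt → (tri π₁ π₂ π₃).pt}
    {b : B.pt} (h1 : SmoothMapAt (C := ofMfd Y₁) (fun x => (p x).1.1) b)
    (h2 : SmoothMapAt (C := ofMfd Y₂) (fun x => (p x).1.2.1) b)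
    (h3 : SmoothMapAt (C := ofMfd Y₃) (fun x => (p x).1.2.2) b) : SmoothMapAt p b := by
  obtain ⟨F, ⟨U, hU, hF⟩, he⟩ := h1
  obtain ⟨G, ⟨V, hV, hG⟩, hge⟩ := h2
  obtain ⟨H, ⟨W, hW, hH⟩, hhe⟩ := h3
  refine ⟨fun x => (F x, G x, H x), ⟨U ∩ (V ∩ W), Filter.inter_mem hU (Filter.inter_mem hV hW),
    ?_⟩, ?_⟩
  · exact (hF.mono Set.inter_subset_left).prodMk
      ((hG.mono (Set.inter_subset_right.trans Set.inter_subset_left)).prodMk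
        (hH.mono (Set.inter_subset_right.trans Set.inter_subset_right)))
  · filter_upwards [he, hge, hhe] with b' h4 h5 h6
    exact Prod.ext h4 (Prod.ext h5 h6)

theorem smoothMapAt_tri_fst (q : (tri π₁ π₂ π₃).pt) :
    SmoothMapAt (B := tri π₁ π₂ π₃) (C := ofMfd Y₁) (fun x => x.1.1) q := by
  have h : ContMDiff (Y₁.I.prod (Y₂.I.prod Y₃.I)) Y₁.I ∞ (fun x : Y₁ × Y₂ × Y₃ => x.1) :=
    contMDiff_fst
  exact ⟨_, ⟨Set.univ, Filter.univ_mem, h.contMDiffOn⟩, Filter.Eventually.of_forall fun _ => rfl⟩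

theorem smoothMapAt_tri_snd (q : (tri π₁ π₂ π₃).pt) :
    SmoothMapAt (B := tri π₁ π₂ π₃) (C := ofMfd Y₂) (fun x => x.1.2.1) q := by
  have h : ContMDiff (Y₁.I.prod (Y₂.I.prod Y₃.I)) Y₂.I ∞ (fun x : Y₁ × Y₂ × Y₃ => x.2.1) :=
    contMDiff_fst.comp contMDiff_snd
  exact ⟨_, ⟨Set.univ, Filter.univ_mem, h.contMDiffOn⟩, Filter.Eventually.of_forall fun _ => rfl⟩

theorem smoothMapAt_tri_trd (q : (tri π₁ π₂ π₃).pt) :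
    SmoothMapAt (B := tri π₁ π₂ π₃) (C := ofMfd Y₃) (fun x => x.1.2.2) q := by
  have h : ContMDiff (Y₁.I.prod (Y₂.I.prod Y₃.I)) Y₃.I ∞ (fun x : Y₁ × Y₂ × Y₃ => x.2.2) :=
    contMDiff_snd.comp contMDiff_snd
  exact ⟨_, ⟨Set.univ, Filter.univ_mem, h.contMDiffOn⟩, Filter.Eventually.of_forall fun _ => rfl⟩

theorem smoothMapAt_tri12 (q : (tri π₁ π₂ π₃).pt) : SmoothMapAt (tri12 (π₃ := π₃)) q :=
  SmoothMapAt.mk_fibProd (smoothMapAt_tri_fst q) (smoothMapAt_tri_snd q)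

theorem smoothMapAt_tri23 (q : (tri π₁ π₂ π₃).pt) : SmoothMapAt (tri23 (π₁ := π₁)) q :=
  SmoothMapAt.mk_fibProd (smoothMapAt_tri_snd q) (smoothMapAt_tri_trd q)

theorem smoothMapAt_tri13 (q : (tri π₁ π₂ π₃).pt) : SmoothMapAt (tri13 (π₂ := π₂)) q :=
  SmoothMapAt.mk_fibProd (smoothMapAt_tri_fst q) (smoothMapAt_tri_trd q)

theorem isSubmanifold_fib12 (h₁ : ContMDiff Y₁.I X.I ∞ π₁)
    (h₂ : Manifold.IsSubmersion Y₂.I X.I ∞ π₂) : (fib12 π₁ π₂).IsSubmanifold := by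
  rintro ⟨⟨y₁, y₂⟩, hy⟩
  obtain ⟨L, U, hU, hL, hL1, hL2⟩ := exists_lift h₂ y₂
  change π₁ y₁ = π₂ y₂ at hy
  let f : Y₁ × Y₂ → Y₂ × X := fun p => (p.2, π₁ p.1)
  have hf : ContMDiff (Y₁.I.prod Y₂.I) (Y₂.I.prod X.I) ∞ f :=
    contMDiff_snd.prodMk (h₁.comp contMDiff_fst)
  refine ⟨fun p : Y₁ × Y₂ => (p.1, L (f p)), f ⁻¹' U, hf.continuous.continuousAt ?_, ?_,
    fun p hp => ?_, fun p hp => ?_⟩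
  · have : f (y₁, y₂) = (y₂, π₂ y₂) := Prod.ext rfl hy
    change U ∈ 𝓝 (f (y₁, y₂))
    rw [this]
    exact hU
  · have hL0 : ContMDiffOn (Y₂.I.prod X.I) Y₂.I ∞ (fun p : Y₂ × X => L p) U := hL
    have h : ContMDiffOn (Y₁.I.prod Y₂.I) (Y₁.I.prod Y₂.I) ∞
        (fun p : Y₁ × Y₂ => (p.1, L (f p))) (f ⁻¹' U) :=
      contMDiffOn_fst.prodMk (hL0.comp hf.contMDiffOn fun p hp => hp)
    exact h
  · exact ⟨⟨(p.1, L (f p)), (hL1 _ hp).symm⟩, rfl⟩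
  · have e : f p.1 = (p.1.2, π₂ p.1.2) := Prod.ext rfl p.2
    have hp' : (p.1.2, π₂ p.1.2) ∈ U := by rw [← e]; exact hp
    exact Prod.ext rfl ((congrArg L e).trans (hL2 _ hp'))

theorem isSubmanifold_tri (h₁ : Manifold.IsSubmersion Y₁.I X.I ∞ π₁) (h₂ : ContMDiff Y₂.I X.I ∞ π₂)
    (h₃ : Manifold.IsSubmersion Y₃.I X.I ∞ π₃) : (tri π₁ π₂ π₃).IsSubmanifold := by
  rintro ⟨⟨y₁, y₂, y₃⟩, hy, hy'⟩
  obtain ⟨L, U, hU, hL, hL1, hL2⟩ := exists_lift h₁ y₁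
  obtain ⟨L', U', hU', hL', hL1', hL2'⟩ := exists_lift h₃ y₃
  change π₁ y₁ = π₂ y₂ at hy
  change π₂ y₂ = π₃ y₃ at hy'
  let f : Y₁ × Y₂ × Y₃ → Y₁ × X := fun p => (p.1, π₂ p.2.1)
  let f' : Y₁ × Y₂ × Y₃ → Y₃ × X := fun p => (p.2.2, π₂ p.2.1)
  have hf : ContMDiff (Y₁.I.prod (Y₂.I.prod Y₃.I)) (Y₁.I.prod X.I) ∞ f :=
    contMDiff_fst.prodMk (h₂.comp (contMDiff_fst.comp contMDiff_snd))
  have hf' : ContMDiff (Y₁.I.prod (Y₂.I.prod Y₃.I)) (Y₃.I.prod X.I) ∞ f' :=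
    (contMDiff_snd.comp contMDiff_snd).prodMk (h₂.comp (contMDiff_fst.comp contMDiff_snd))
  refine ⟨fun p : Y₁ × Y₂ × Y₃ => (L (f p), p.2.1, L' (f' p)), f ⁻¹' U ∩ f' ⁻¹' U',
    Filter.inter_mem (hf.continuous.continuousAt ?_) (hf'.continuous.continuousAt ?_), ?_,
    fun p hp => ?_, fun p hp => ?_⟩
  · have : f (y₁, y₂, y₃) = (y₁, π₁ y₁) := Prod.ext rfl hy.symm
    change U ∈ 𝓝 (f (y₁, y₂, y₃))
    rw [this]
    exact hU
  · have : f' (y₁, y₂, y₃) = (y₃, π₃ y₃) := Prod.ext rfl hy'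
    change U' ∈ 𝓝 (f' (y₁, y₂, y₃))
    rw [this]
    exact hU'
  · have hL0 : ContMDiffOn (Y₁.I.prod X.I) Y₁.I ∞ (fun p : Y₁ × X => L p) U := hL
    have hL0' : ContMDiffOn (Y₃.I.prod X.I) Y₃.I ∞ (fun p : Y₃ × X => L' p) U' := hL'
    have h2 : ContMDiff (Y₁.I.prod (Y₂.I.prod Y₃.I)) Y₂.I ∞ (fun x : Y₁ × Y₂ × Y₃ => x.2.1) :=
      contMDiff_fst.comp contMDiff_snd
    have h : ContMDiffOn (Y₁.I.prod (Y₂.I.prod Y₃.I)) (Y₁.I.prod (Y₂.I.prod Y₃.I)) ∞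
        (fun p : Y₁ × Y₂ × Y₃ => (L (f p), p.2.1, L' (f' p))) (f ⁻¹' U ∩ f' ⁻¹' U') :=
      (hL0.comp hf.contMDiffOn fun p hp => hp.1).prodMk
        (h2.contMDiffOn.prodMk (hL0'.comp hf'.contMDiffOn fun p hp => hp.2))
    exact h
  · exact ⟨⟨(L (f p), p.2.1, L' (f' p)), hL1 _ hp.1, (hL1' _ hp.2).symm⟩, rfl⟩
  · have e : f p.1 = (p.1.1, π₁ p.1.1) := Prod.ext rfl p.2.1.symm
    have hp' : (p.1.1, π₁ p.1.1) ∈ U := by rw [← e]; exact hp.1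
    have e' : f' p.1 = (p.1.2.2, π₃ p.1.2.2) := Prod.ext rfl p.2.2
    have hp'' : (p.1.2.2, π₃ p.1.2.2) ∈ U' := by rw [← e']; exact hp.2
    exact Prod.ext ((congrArg L e).trans (hL2 _ hp'))
      (Prod.ext rfl ((congrArg L' e').trans (hL2' _ hp'')))

end Space

end FibreProducts

section PullMul

variable {𝕜 : Type} [RCLike 𝕜] {B T C₁ C₂ C₃ : Space.{u}} {U : C₁.pt → Type u} {V : C₂.pt → Type u}
  {W : C₃.pt → Type u} [∀ c, AddCommGroup (U c)] [∀ c, Module 𝕜 (U c)] [∀ c, AddCommGroup (V c)]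
  [∀ c, Module 𝕜 (V c)] [∀ c, AddCommGroup (W c)] [∀ c, Module 𝕜 (W c)]
  {S₁ : Sec C₁ U} {S₂ : Sec C₂ V} {S₃ : Sec C₃ W} {p : T.pt → C₁.pt} {q : T.pt → C₂.pt}
  {r : T.pt → C₃.pt}

/-- Smoothness of a bilinear operation between bundles is preserved by pullbacks. -/
theorem smooth_mul_pull {f : B.pt → T.pt} {b : B.pt} (m : ∀ t, U (p t) →ₗ[𝕜] V (q t) →ₗ[𝕜] W (r t))
    (hm : ∀ σ τ, S₁ σ (p (f b)) → S₂ τ (q (f b)) →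
      pullSec 𝕜 r S₃ (fun t => m t (σ (p t)) (τ (q t))) (f b))
    (hf : Space.SmoothMapAt f b) (hr : Space.SmoothMapAt r (f b)) (hS : IsVBAt 𝕜 S₃ (r (f b)))
    {x : ∀ b, U (p (f b))} {y : ∀ b, V (q (f b))}
    (hx : pullSec 𝕜 (fun b => p (f b)) S₁ x b) (hy : pullSec 𝕜 (fun b => q (f b)) S₂ y b) :
    pullSec 𝕜 (fun b => r (f b)) S₃ (fun b => m (f b) (x b) (y b)) b := by
  obtain ⟨k, c, σ, hc, hσ, hx⟩ := hx
  obtain ⟨l, d, τ, hd, hτ, hy⟩ := hy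
  have hVB : IsVBAt 𝕜 (pullSec 𝕜 (fun b => r (f b)) S₃) b :=
    IsVBAt.pull (f := fun b => r (f b)) hS (hr.comp hf)
  have h1 : ∀ i j, pullSec 𝕜 (fun b => r (f b)) S₃
      (fun b => m (f b) (σ i (p (f b))) (τ j (q (f b)))) b := fun i j =>
    (pullSec_comp hf _).1 (pullSec_of (hm _ _ (hσ i) (hτ j)))
  refine hVB.congr (hVB.sum Finset.univ fun i _ => hVB.sum Finset.univ fun j _ =>
    hVB.smul ((hc i).mul (hd j)) (h1 i j)) ?_
  filter_upwards [hx, hy] with b' h2 h3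
  rw [h2, h3]
  simp only [map_sum, LinearMap.sum_apply, map_smul, LinearMap.smul_apply, Finset.smul_sum, smul_smul]
  rw [Finset.sum_comm]
  refine Finset.sum_congr rfl fun i _ => Finset.sum_congr rfl fun j _ => ?_
  rw [mul_comm]

end PullMul

section Family

theorem IsSmoothIso.of_comp {𝕜 : Type} [RCLike 𝕜] {B : Space.{u}} {A₁ A₂ : B.pt → SAlg.{u} 𝕜}
    {M N L : ∀ b, SBimod (A₁ b) (A₂ b)} {S : Sec B (fun b => (M b).carrier)}
    {T : Sec B (fun b => (N b).carrier)} {R : Sec B (fun b => (L b).carrier)}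
    {l : ∀ b, SBimod.Hom (M b) (L b)} {r : ∀ b, SBimod.Hom (N b) (L b)} (hl : IsSmoothIso S R l)
    (hr : IsSmoothIso T R r) {f : ∀ b, SBimod.Hom (M b) (N b)}
    (hf : ∀ b t, (r b).toLin ((f b).toLin t) = (l b).toLin t) : IsSmoothIso S T f := by
  refine ⟨fun b => ?_, fun s b => ?_⟩
  · refine ((hr.1 b).of_comp_iff' _).1 ?_
    have : (r b).toLin ∘ (f b).toLin = (l b).toLin := funext (hf b)
    rw [this]
    exact hl.1 b
  · rw [hl.2, hr.2]
    simp only [hf]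

/-- Surjective submersions `Y i → X` with super algebra bundles `𝒜 i` and bimodule bundles `K i j`
over `Y i ×_X Y j`, with an invertible associative multiplication. -/
structure Family (𝕜 : Type) [RCLike 𝕜] (X : Mfd.{u}) (ι : Type) : Type (u + 1) where
  Y : ι → Mfd.{u}
  π : ∀ i, Y i → X
  π_surj : ∀ i, Function.Surjective (π i)
  π_subm : ∀ i, Manifold.IsSubmersion (Y i).I X.I ∞ (π i)
  𝒜 : ∀ i, AlgBundle 𝕜 (Space.ofMfd (Y i))
  K : ∀ i j, BimodBundle (fib12 (π i) (π j)) (𝒜 j) (𝒜 i) (fun p => p.1.2) (fun p => p.1.1)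
  K_inv : ∀ i, (K i i).Invertible
  μ : ∀ i j k (q : (tri (π i) (π j) (π k)).pt),
    SBimod.Hom (((K j k).fib (tri23 q)).tensor ((K i j).fib (tri12 q))) ((K i k).fib (tri13 q))
  μ_iso : ∀ i j k, IsSmoothIso
    (tensorSec (fun q => (K j k).fib (tri23 q)) (fun q => (K i j).fib (tri12 q))
      (pullSec 𝕜 tri23 (K j k).smooth) (pullSec 𝕜 tri12 (K i j).smooth))
    (pullSec 𝕜 tri13 (K i k).smooth) (μ i j k)
  μ_assoc : ∀ (i₁ i₂ i₃ i₄ : ι) (y₁ : Y i₁) (y₂ : Y i₂) (y₃ : Y i₃) (y₄ : Y i₄)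
    (h₁₂ : π i₁ y₁ = π i₂ y₂) (h₂₃ : π i₂ y₂ = π i₃ y₃) (h₃₄ : π i₃ y₃ = π i₄ y₄)
    (m₃₄ : (K i₃ i₄).fib ⟨(y₃, y₄), h₃₄⟩) (m₂₃ : (K i₂ i₃).fib ⟨(y₂, y₃), h₂₃⟩)
    (m₁₂ : (K i₁ i₂).fib ⟨(y₁, y₂), h₁₂⟩),
    (μ i₁ i₂ i₄ ⟨(y₁, y₂, y₄), h₁₂, h₂₃.trans h₃₄⟩).toLin
        (SBimod.tmul ((μ i₂ i₃ i₄ ⟨(y₂, y₃, y₄), h₂₃, h₃₄⟩).toLin (SBimod.tmul m₃₄ m₂₃)) m₁₂) =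
      (μ i₁ i₃ i₄ ⟨(y₁, y₃, y₄), h₁₂.trans h₂₃, h₃₄⟩).toLin
        (SBimod.tmul m₃₄ ((μ i₁ i₂ i₃ ⟨(y₁, y₂, y₃), h₁₂, h₂₃⟩).toLin (SBimod.tmul m₂₃ m₁₂)))

variable {𝕜 : Type} [RCLike 𝕜] {X : Mfd.{u}} {ι : Type} (F : Family.{u} 𝕜 X ι)

namespace Family

/-- The super 2-vector bundle with super algebra bundle `𝒜 i`. -/
def toTwoVB (i : ι) : TwoVB.{u} 𝕜 X where
  Y := F.Y i
  π := F.π i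
  π_surj := F.π_surj i
  π_subm := F.π_subm i
  𝒜 := F.𝒜 i
  ℳ := F.K i i
  ℳ_inv := F.K_inv i
  μ := F.μ i i i
  μ_iso := F.μ_iso i i i
  μ_assoc := F.μ_assoc i i i i

/-- The multiplication as a bilinear map. -/
def mul {i j k : ι} {y₁ : F.Y i} {y₂ : F.Y j} {y₃ : F.Y k} (h₁₂ : F.π i y₁ = F.π j y₂)
    (h₂₃ : F.π j y₂ = F.π k y₃) : (F.K j k).fib ⟨(y₂, y₃), h₂₃⟩ →ₗ[𝕜]
      (F.K i j).fib ⟨(y₁, y₂), h₁₂⟩ →ₗ[𝕜] (F.K i k).fib ⟨(y₁, y₃), h₁₂.trans h₂₃⟩ :=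
  (SBimod.tmulL _ _).compr₂ (F.μ i j k ⟨(y₁, y₂, y₃), h₁₂, h₂₃⟩).toLin

theorem mul_mul {i₁ i₂ i₃ i₄ : ι} {y₁ : F.Y i₁} {y₂ : F.Y i₂} {y₃ : F.Y i₃} {y₄ : F.Y i₄}
    (h₁₂ : F.π i₁ y₁ = F.π i₂ y₂) (h₂₃ : F.π i₂ y₂ = F.π i₃ y₃) (h₃₄ : F.π i₃ y₃ = F.π i₄ y₄)
    (m₃₄ : (F.K i₃ i₄).fib ⟨(y₃, y₄), h₃₄⟩) (m₂₃ : (F.K i₂ i₃).fib ⟨(y₂, y₃), h₂₃⟩)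
    (m₁₂ : (F.K i₁ i₂).fib ⟨(y₁, y₂), h₁₂⟩) :
    F.mul h₁₂ (h₂₃.trans h₃₄) (F.mul h₂₃ h₃₄ m₃₄ m₂₃) m₁₂ =
      F.mul (h₁₂.trans h₂₃) h₃₄ m₃₄ (F.mul h₁₂ h₂₃ m₂₃ m₁₂) :=
  F.μ_assoc _ _ _ _ _ _ _ _ h₁₂ h₂₃ h₃₄ _ _ _

theorem μ_iso_pull {B : Space.{u}} {i j k : ι} {f : B.pt → (tri (F.π i) (F.π j) (F.π k)).pt}
    (hf : ∀ b, Space.SmoothMapAt f b) :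
    IsSmoothIso
      (tensorSec (fun b => (F.K j k).fib (tri23 (f b))) (fun b => (F.K i j).fib (tri12 (f b)))
        (pullSec 𝕜 (fun b => tri23 (f b)) (F.K j k).smooth)
        (pullSec 𝕜 (fun b => tri12 (f b)) (F.K i j).smooth))
      (pullSec 𝕜 (fun b => tri13 (f b)) (F.K i k).smooth) (fun b => F.μ i j k (f b)) := by
  refine isSmoothIso_tensorSec
    (fun b => ((F.K j k).isVBAt _).pull ((Space.smoothMapAt_tri23 _).comp (hf b)))
    (fun b => ((F.K i j).isVBAt _).pull ((Space.smoothMapAt_tri12 _).comp (hf b)))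
    (fun b => ((F.K i k).isVBAt _).pull ((Space.smoothMapAt_tri13 _).comp (hf b))) _
    (fun b => (F.μ_iso i j k).1 _) fun b x y hx hy => ?_
  exact smooth_mul_pull (fun t => (SBimod.tmulL _ _).compr₂ (F.μ i j k t).toLin)
    (fun σ τ hσ hτ => ((F.μ_iso i j k).2 _ _).1 (tensorSec_tmul (pullSec_of hσ) (pullSec_of hτ)))
    (hf b) (Space.smoothMapAt_tri13 _) ((F.K i k).isVBAt _) hx hy

variable (i j : ι)

/-- Pairs of points `(y₁, y₂)`, `(y₁', y₂')` of `Y i ×_X Y j` over the same point of `X`. -/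
abbrev sq : Space.{u} := (fib12 (F.π i) (F.π j)).fibProd (fib12 (F.π i) (F.π j))
  (fun z => F.π i z.1.1) (fun z => F.π i z.1.1)

/-- The point `(y₁, y₂, y₂')` for a pair of points `(y₁, y₂)`, `(y₁', y₂')` over the same point. -/
abbrev outer (q : (F.sq i j).pt) : (tri (F.π i) (F.π j) (F.π j)).pt :=
  ⟨(q.1.1.1.1, q.1.1.1.2, q.1.2.1.2), q.1.1.2, (q.1.1.2.symm.trans q.2).trans q.1.2.2⟩

/-- The point `(y₁, y₁', y₂')` for a pair of points `(y₁, y₂)`, `(y₁', y₂')` over the same point. -/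
abbrev inner (q : (F.sq i j).pt) : (tri (F.π i) (F.π i) (F.π j)).pt :=
  ⟨(q.1.1.1.1, q.1.2.1.1, q.1.2.1.2), q.2, q.1.2.2⟩

theorem smoothMapAt_outer (q) : Space.SmoothMapAt (F.outer i j) q :=
  Space.smoothMapAt_tri ((Space.smoothMapAt_fst _).comp (Space.smoothMapAt_fst _))
    ((Space.smoothMapAt_snd _).comp (Space.smoothMapAt_fst _))
    ((Space.smoothMapAt_snd _).comp (Space.smoothMapAt_snd _))

theorem smoothMapAt_inner (q) : Space.SmoothMapAt (F.inner i j) q :=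
  Space.smoothMapAt_tri ((Space.smoothMapAt_fst _).comp (Space.smoothMapAt_fst _))
    ((Space.smoothMapAt_fst _).comp (Space.smoothMapAt_snd _))
    ((Space.smoothMapAt_snd _).comp (Space.smoothMapAt_snd _))

/-- The composition of two intertwiners. -/
def _root_.SuperTwoVect.SBimod.Hom.comp {A B : SAlg.{u} 𝕜} {M N L : SBimod A B}
    (g : SBimod.Hom N L) (f : SBimod.Hom M N) : SBimod.Hom M L :=
  ⟨g.toLin ∘ₗ f.toLin, fun h => g.even (f.even h), by simp [f.map_left, g.map_left],
    by simp [f.map_right, g.map_right]⟩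

/-- The intertwiner `K j j ⊗ K i j → K i j ⊗ K i i` that identifies the two multiplications. -/
def interchange (q : (F.sq i j).pt) :
    SBimod.Hom (((F.K j j).fib (tri23 (F.outer i j q))).tensor ((F.K i j).fib (tri12 (F.outer i j q))))
      (((F.K i j).fib (tri23 (F.inner i j q))).tensor ((F.K i i).fib (tri12 (F.inner i j q)))) :=
  SBimod.Hom.comp ((F.μ i i j (F.inner i j q)).inv ((F.μ_iso i i j).1 _))
    (F.μ i j j (F.outer i j q))

theorem interchange_eq_iff {q : (F.sq i j).pt} {t t'} :
    (F.interchange i j q).toLin t = t' ↔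
      (F.μ i j j (F.outer i j q)).toLin t = (F.μ i i j (F.inner i j q)).toLin t' := by
  constructor
  · rintro rfl
    exact (SBimod.Hom.apply_inv (F.μ i i j (F.inner i j q)) ((F.μ_iso i i j).1 _) _).symm
  · intro e
    change ((F.μ i i j (F.inner i j q)).inv ((F.μ_iso i i j).1 _)).toLin _ = _
    rw [e]
    exact SBimod.Hom.inv_apply _ _ _

theorem mul_mul_eq_sum {i j : ι} {y₁ y₁' y₁'' : F.Y i} {y₂ y₂' y₂'' : F.Y j}
    (hz : F.π i y₁ = F.π j y₂) (hz' : F.π i y₁' = F.π j y₂') (hz'' : F.π i y₁'' = F.π j y₂'')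
    (h : F.π i y₁ = F.π i y₁') (h' : F.π i y₁' = F.π i y₁'')
    (m' : (F.K j j).fib ⟨(y₂', y₂''), (hz'.symm.trans h').trans hz''⟩)
    (m : (F.K j j).fib ⟨(y₂, y₂'), (hz.symm.trans h).trans hz'⟩)
    (p : (F.K i j).fib ⟨(y₁, y₂), hz⟩) {k l : ℕ}
    (p' : Fin k → (F.K i j).fib ⟨(y₁', y₂'), hz'⟩) (n : Fin k → (F.K i i).fib ⟨(y₁, y₁'), h⟩)
    (p'' : Fin k → Fin l → (F.K i j).fib ⟨(y₁'', y₂''), hz''⟩)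
    (n' : Fin k → Fin l → (F.K i i).fib ⟨(y₁', y₁''), h'⟩)
    (h1 : F.mul hz ((hz.symm.trans h).trans hz') m p = ∑ a, F.mul h hz' (p' a) (n a))
    (h2 : ∀ a, F.mul hz' ((hz'.symm.trans h').trans hz'') m' (p' a) =
      ∑ b, F.mul h' hz'' (p'' a b) (n' a b)) :
    F.mul hz (((hz.symm.trans h).trans hz').trans ((hz'.symm.trans h').trans hz''))
      (F.mul ((hz.symm.trans h).trans hz') ((hz'.symm.trans h').trans hz'') m' m) p =
      ∑ a, ∑ b, F.mul (h.trans h') hz'' (p'' a b) (F.mul h h' (n' a b) (n a)) := by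
  rw [mul_mul, h1, map_sum]
  refine Finset.sum_congr rfl fun i _ => ?_
  simp only [← mul_mul]
  rw [h2, map_sum, LinearMap.sum_apply]

theorem interchange_mul (z z' z'' : (fib12 (F.π i) (F.π j)).pt)
    (h : F.π i z.1.1 = F.π i z'.1.1) (h' : F.π i z'.1.1 = F.π i z''.1.1)
    (m' : (F.K j j).fib ⟨(z'.1.2, z''.1.2), (z'.2.symm.trans h').trans z''.2⟩)
    (m : (F.K j j).fib ⟨(z.1.2, z'.1.2), (z.2.symm.trans h).trans z'.2⟩)
    (p : (F.K i j).fib z) (k l : ℕ)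
    (p' : Fin k → (F.K i j).fib z') (n : Fin k → (F.K i i).fib ⟨(z.1.1, z'.1.1), h⟩)
    (p'' : Fin k → Fin l → (F.K i j).fib z'')
    (n' : Fin k → Fin l → (F.K i i).fib ⟨(z'.1.1, z''.1.1), h'⟩)
    (h1 : (F.interchange i j ⟨(z, z'), h⟩).toLin (SBimod.tmul m p) =
      ∑ a, SBimod.tmul (p' a) (n a))
    (h2 : ∀ a, (F.interchange i j ⟨(z', z''), h'⟩).toLin (SBimod.tmul m' (p' a)) =
      ∑ b, SBimod.tmul (p'' a b) (n' a b)) :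
    (F.interchange i j ⟨(z, z''), h.trans h'⟩).toLin (SBimod.tmul (F.mul ((z.2.symm.trans h).trans z'.2)
        ((z'.2.symm.trans h').trans z''.2) m' m) p) =
      ∑ a, ∑ b, SBimod.tmul (p'' a b) (F.mul h h' (n' a b) (n a)) := by
  refine (F.interchange_eq_iff i j).2 (Eq.trans ?_ ((map_sum _ _ _).trans
    (Finset.sum_congr rfl fun _ _ => map_sum _ _ _)).symm)
  exact F.mul_mul_eq_sum (y₁ := z.1.1) (y₁' := z'.1.1) (y₁'' := z''.1.1) (y₂ := z.1.2)
    (y₂' := z'.1.2) (y₂'' := z''.1.2) z.2 z'.2 z''.2 h h' m' m p p' n p'' n'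
    (((F.interchange_eq_iff i j).1 h1).trans (map_sum _ _ _))
    fun a => ((F.interchange_eq_iff i j).1 (h2 a)).trans (map_sum _ _ _)

theorem mul_interchange (w v : (tri (F.π i) (F.π j) (F.π i)).pt)
    (hP : F.π i w.1.1 = F.π i v.1.1) (hQ : F.π j w.1.2.1 = F.π j v.1.2.1)
    (m : (F.K i i).fib ⟨(w.1.2.2, v.1.2.2), (w.2.2.symm.trans hQ).trans v.2.2⟩)
    (x : (F.K j i).fib (tri23 w)) (y : (F.K i j).fib (tri12 w)) (k l : ℕ)
    (x' : Fin k → (F.K j i).fib (tri23 v)) (n : Fin k → (F.K j j).fib ⟨(w.1.2.1, v.1.2.1), hQ⟩)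
    (y' : Fin k → Fin l → (F.K i j).fib (tri12 v))
    (n' : Fin k → Fin l → (F.K i i).fib ⟨(w.1.1, v.1.1), hP⟩)
    (h1 : (F.interchange j i ⟨(tri23 w, tri23 v), hQ⟩).toLin (SBimod.tmul m x) =
      ∑ a, SBimod.tmul (x' a) (n a))
    (h2 : ∀ a, (F.interchange i j ⟨(tri12 w, tri12 v), hP⟩).toLin (SBimod.tmul (n a) y) =
      ∑ b, SBimod.tmul (y' a b) (n' a b)) :
    F.mul (w.2.1.trans w.2.2) ((w.2.2.symm.trans hQ).trans v.2.2) m (F.mul w.2.1 w.2.2 x y) =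
      ∑ a, ∑ b, F.mul hP (v.2.1.trans v.2.2) (F.mul v.2.1 v.2.2 (x' a) (y' a b)) (n' a b) := by
  obtain ⟨⟨y₁, y₂, y₃⟩, hw, hw'⟩ := w
  obtain ⟨⟨y₁', y₂', y₃'⟩, hv, hv'⟩ := v
  replace h1 := (F.interchange_eq_iff j i).1 h1
  replace h2 := fun a => (F.interchange_eq_iff i j).1 (h2 a)
  simp only [map_sum] at h1 h2
  change F.mul hw' ((hw'.symm.trans hQ).trans hv') m x = ∑ a, F.mul hQ hv' (x' a) (n a) at h1
  change ∀ a, F.mul hw hQ (n a) y = ∑ b, F.mul hP hv (y' a b) (n' a b) at h2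
  change F.mul (hw.trans hw') ((hw'.symm.trans hQ).trans hv') m (F.mul hw hw' x y) =
    ∑ a, ∑ b, F.mul hP (hv.trans hv') (F.mul hv hv' (x' a) (y' a b)) (n' a b)
  rw [← mul_mul, h1, map_sum, LinearMap.sum_apply]
  refine Finset.sum_congr rfl fun a _ => ?_
  simp only [mul_mul]
  rw [h2, map_sum]

/-- The 1-morphism given by `K i j`. -/
def oneMor : OneMor (F.toTwoVB i) (F.toTwoVB j) where
  Z := fib12 (F.π i) (F.π j)
  Z_mfd := Space.isSubmanifold_fib12 (F.π_subm i).contMDiff (F.π_subm j)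
  ζ := fun z => z
  ζ_subm := ⟨fun z => Space.smoothMapAt_id z, fun z => ⟨z, rfl⟩, fun z =>
    ⟨fun z => z, Space.smoothMapAt_id z, rfl, Filter.Eventually.of_forall fun _ => rfl⟩⟩
  bim := F.K i j
  φ := F.interchange i j
  φ_iso := IsSmoothIso.of_comp (l := fun q => F.μ i j j (F.outer i j q))
    (r := fun q => F.μ i i j (F.inner i j q)) (f := F.interchange i j)
    (F.μ_iso_pull (F.smoothMapAt_outer i j)) (F.μ_iso_pull (F.smoothMapAt_inner i j)) fun _ _ => ((F.interchange_eq_iff i j).1 rfl).symm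
  φ_hom := by
    intro z z' z'' h h' m' m p k l p' n p'' n' h1 h2
    exact F.interchange_mul i j z z' z'' h h' m' m p k l p' n p'' n' h1 h2

/-- The map `Y i ×_X Y j ×_X Y i → (Y i ×_X Y j) ×_{Y j} (Y j ×_X Y i)`. -/
abbrev toComp (q : (tri (F.π i) (F.π j) (F.π i)).pt) :
    ((fib12 (F.π i) (F.π j)).fibProd (fib12 (F.π j) (F.π i)) (fun z => z.1.2)
      (fun z => z.1.1)).pt := ⟨(tri12 q, tri23 q), rfl⟩

theorem isSurjSubmersion_toComp : Space.IsSurjSubmersion (F.toComp i j) := by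
  let s : ((fib12 (F.π i) (F.π j)).fibProd (fib12 (F.π j) (F.π i)) (fun z => z.1.2)
      (fun z => z.1.1)).pt → (tri (F.π i) (F.π j) (F.π i)).pt := fun p =>
    ⟨(p.1.1.1.1, p.1.1.1.2, p.1.2.1.2), p.1.1.2, (congrArg (F.π j) p.2).trans p.1.2.2⟩
  have hs : ∀ p, F.toComp i j (s p) = p :=
    fun p => Subtype.ext (Prod.ext rfl (Subtype.ext (Prod.ext p.2 rfl)))
  refine ⟨fun z => Space.SmoothMapAt.mk_fibProd (Space.smoothMapAt_tri12 z)
    (Space.smoothMapAt_tri23 z), fun p => ⟨s p, hs p⟩, fun z => ⟨s, ?_, rfl,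
    Filter.Eventually.of_forall hs⟩⟩
  exact Space.smoothMapAt_tri ((Space.smoothMapAt_fst _).comp (Space.smoothMapAt_fst _))
    ((Space.smoothMapAt_snd _).comp (Space.smoothMapAt_fst _))
    ((Space.smoothMapAt_snd _).comp (Space.smoothMapAt_snd _))

/-- The composition of the 1-morphisms `K i j` and `K j i` is isomorphic to the identity. -/
def compIsoId : CompIsoId (F.oneMor i j) (F.oneMor j i) where
  W := tri (F.π i) (F.π j) (F.π i)
  W_mfd := Space.isSubmanifold_tri (F.π_subm i) (F.π_subm j).contMDiff (F.π_subm i)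
  ρ := F.toComp i j
  ρ_subm := F.isSurjSubmersion_toComp i j
  ψ := fun q => F.μ i j i q
  ψ_iso := F.μ_iso i j i
  ψ_comm := fun w v hP hQ m x y k l x' n y' n' h1 h2 =>
    F.mul_interchange i j w v hP hQ m x y k l x' n y' n' h1 h2

theorem isomorphic : (F.toTwoVB i).Isomorphic (F.toTwoVB j) :=
  ⟨F.oneMor i j, F.oneMor j i, ⟨F.compIsoId i j⟩, ⟨F.compIsoId j i⟩⟩

end Family

end Family

section Pullback

variable {𝕜 : Type} [RCLike 𝕜] {X : Mfd.{u}}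

theorem pullSec_comp_eq {B C D : Space.{u}} {V : C.pt → Type u} [∀ c, AddCommGroup (V c)]
    [∀ c, Module 𝕜 (V c)] {S : Sec C V} {g : B.pt → C.pt} {f : D.pt → B.pt}
    (hf : ∀ d, Space.SmoothMapAt f d) :
    pullSec 𝕜 f (pullSec 𝕜 g S) = pullSec 𝕜 (fun d => g (f d)) S :=
  funext fun s => funext fun d => propext (pullSec_comp (hf d) s)

theorem IsAlgTriv.pull_pull {B C D : Space.{u}} {A : C.pt → SAlg.{u} 𝕜}
    {S : Sec C (fun c => (A c).carrier)} {g : B.pt → C.pt} {f : D.pt → B.pt}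
    (hf : ∀ d, Space.SmoothMapAt f d) {A₀ : SAlg.{u} 𝕜} {α : ∀ d, A (g (f d)) →ₗ[𝕜] A₀} {d : D.pt}
    (h : IsAlgTriv (A := fun d => A (g (f d))) (pullSec 𝕜 (fun d => g (f d)) S) α d) :
    IsAlgTriv (A := fun d => A (g (f d))) (pullSec 𝕜 f (pullSec 𝕜 g S)) α d := by
  rw [pullSec_comp_eq hf]
  exact h

theorem isSmoothIso_self_pull {B C BL : Space.{u}} {𝒜 : AlgBundle 𝕜 BL} {A₂ : B.pt → SAlg.{u} 𝕜}
    {t : B.pt → BL.pt} {M : ∀ b, SBimod (𝒜.fib (t b)) (A₂ b)}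
    {N : ∀ b, SBimod (A₂ b) (𝒜.fib (t b))} {S : Sec B (fun b => (M b).carrier)}
    {T : Sec B (fun b => (N b).carrier)} (hS : ∀ b, IsVBAt 𝕜 S b) (hT : ∀ b, IsVBAt 𝕜 T b)
    {ε : ∀ b, SBimod.Hom ((M b).tensor (N b)) (SBimod.self (𝒜.fib (t b)))}
    (hε : IsSmoothIso (tensorSec M N S T) (pullSec 𝕜 t 𝒜.smooth) ε)
    (ht : ∀ b, Space.SmoothMapAt t b) {f : C.pt → B.pt} (hf : ∀ c, Space.SmoothMapAt f c)
    {R : Sec C (fun c => (𝒜.fib (t (f c))).carrier)}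
    (hR : R = pullSec 𝕜 (fun c => t (f c)) 𝒜.smooth) :
    IsSmoothIso (tensorSec (fun c => M (f c)) (fun c => N (f c)) (pullSec 𝕜 f S) (pullSec 𝕜 f T))
      R (fun c => ε (f c)) := by
  subst hR
  refine isSmoothIso_tensorSec (fun b => (hS _).pull (hf b)) (fun b => (hT _).pull (hf b))
    (fun b => (𝒜.isVBAt _).pull ((ht _).comp (hf b))) _ (fun b => hε.1 _) fun b x y hx hy => ?_
  let m : ∀ b, M b →ₗ[𝕜] N b →ₗ[𝕜] 𝒜.fib (t b) := fun b =>
    (SBimod.tmulL (M b) (N b)).compr₂ (ε b).toLin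
  exact smooth_mul_pull (p := fun t => t) (q := fun t => t) m
    (fun σ τ hσ hτ => (hε.2 _ _).1 (tensorSec_tmul hσ hτ)) (hf b) (ht _) (𝒜.isVBAt _) hx hy

/-- A surjective submersion `π : Y → X` together with a smooth lift `Y → V.Y` of `π`. -/
structure TwoVB.Lift (V : TwoVB.{u} 𝕜 X) : Type (u + 1) where
  Y : Mfd.{u}
  π : Y → X
  π_surj : Function.Surjective π
  π_subm : Manifold.IsSubmersion Y.I X.I ∞ π
  σ : Y → V.Y
  σ_smooth : ∀ y, Space.SmoothMapAt (B := Space.ofMfd Y) (C := Space.ofMfd V.Y) σ y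
  π_σ : ∀ y, V.π (σ y) = π y

namespace TwoVB

variable (V : TwoVB.{u} 𝕜 X)

section

variable {V} {D D₁ D₂ D₃ : V.Lift}

/-- The map `Y₁ ×_X Y₂ → V.Y ×_X V.Y`. -/
abbrev Lift.map₂ (D₁ D₂ : V.Lift) (p : (fib12 D₁.π D₂.π).pt) : (fib2 V.Y V.π).pt :=
  ⟨(D₁.σ p.1.1, D₂.σ p.1.2), ((D₁.π_σ _).trans p.2).trans (D₂.π_σ _).symm⟩

/-- The map `Y₁ ×_X Y₂ ×_X Y₃ → V.Y ×_X V.Y ×_X V.Y`. -/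
abbrev Lift.map₃ (D₁ D₂ D₃ : V.Lift) (p : (tri D₁.π D₂.π D₃.π).pt) : (fib3 V.Y V.π).pt :=
  ⟨(D₁.σ p.1.1, D₂.σ p.1.2.1, D₃.σ p.1.2.2), ((D₁.π_σ _).trans p.2.1).trans (D₂.π_σ _).symm,
    ((D₂.π_σ _).trans p.2.2).trans (D₃.π_σ _).symm⟩

theorem Lift.smoothMapAt_map₂ (p) : Space.SmoothMapAt (Lift.map₂ D₁ D₂) p :=
  Space.SmoothMapAt.mk_fibProd ((D₁.σ_smooth _).comp (Space.smoothMapAt_fst _))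
    ((D₂.σ_smooth _).comp (Space.smoothMapAt_snd _))

theorem Lift.smoothMapAt_map₃ (p) : Space.SmoothMapAt (Lift.map₃ D₁ D₂ D₃) p :=
  Space.smoothMapAt_tri (π₁ := V.π) (π₂ := V.π) (π₃ := V.π)
    ((D₁.σ_smooth _).comp (Space.smoothMapAt_tri_fst _))
    ((D₂.σ_smooth _).comp (Space.smoothMapAt_tri_snd _))
    ((D₃.σ_smooth _).comp (Space.smoothMapAt_tri_trd _))

/-- The pulled back super algebra bundle. -/
abbrev Lift.alg (D : V.Lift) : AlgBundle 𝕜 (Space.ofMfd D.Y) := V.𝒜.pull D.σ D.σ_smooth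

/-- The pulled back bimodule bundle. -/
def Lift.bimod (D₁ D₂ : V.Lift) :
    BimodBundle (fib12 D₁.π D₂.π) D₂.alg D₁.alg (fun p => p.1.2) (fun p => p.1.1) where
  fib := fun p => V.ℳ.fib (Lift.map₂ D₁ D₂ p)
  smooth := pullSec 𝕜 (Lift.map₂ D₁ D₂) V.ℳ.smooth
  locTriv := fun b₀ => by
    obtain ⟨A₀, B₀, M₀, α, β, ψ, h1, h2, h3⟩ := (V.ℳ.pull _ Lift.smoothMapAt_map₂).locTriv b₀
    exact ⟨A₀, B₀, M₀, α, β, ψ, h1.pull_pull fun c => Space.smoothMapAt_snd c,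
      h2.pull_pull fun c => Space.smoothMapAt_fst c, h3⟩

theorem Lift.bimod_invertible (D : V.Lift) : (Lift.bimod D D).Invertible := by
  obtain ⟨𝒩, ⟨ε, hε⟩, ⟨η, hη⟩⟩ := V.ℳ_inv
  let 𝒩' : BimodBundle (fib12 D.π D.π) D.alg D.alg (fun p => p.1.1) (fun p => p.1.2) :=
    { fib := fun p => 𝒩.fib (Lift.map₂ D D p)
      smooth := pullSec 𝕜 (Lift.map₂ D D) 𝒩.smooth
      locTriv := fun b₀ => by
        obtain ⟨A₀, B₀, M₀, α, β, ψ, h1, h2, h3⟩ := (𝒩.pull _ Lift.smoothMapAt_map₂).locTriv b₀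
        exact ⟨A₀, B₀, M₀, α, β, ψ, h1.pull_pull fun c => Space.smoothMapAt_fst c,
          h2.pull_pull fun c => Space.smoothMapAt_snd c, h3⟩ }
  exact ⟨𝒩', ⟨_, isSmoothIso_self_pull V.ℳ.isVBAt 𝒩.isVBAt hε Space.smoothMapAt_snd
    Lift.smoothMapAt_map₂ (pullSec_comp_eq (B := Space.ofMfd D.Y) (C := Space.ofMfd V.Y)
      (V := fun y => (V.𝒜.fib y).carrier) (g := D.σ) Space.smoothMapAt_snd)⟩,
    ⟨_, isSmoothIso_self_pull 𝒩.isVBAt V.ℳ.isVBAt hη Space.smoothMapAt_fst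
    Lift.smoothMapAt_map₂ (pullSec_comp_eq (B := Space.ofMfd D.Y) (C := Space.ofMfd V.Y)
      (V := fun y => (V.𝒜.fib y).carrier) (g := D.σ) Space.smoothMapAt_fst)⟩⟩

theorem Lift.μ_iso (D₁ D₂ D₃ : V.Lift) : IsSmoothIso
    (tensorSec (fun q : (tri D₁.π D₂.π D₃.π).pt => (Lift.bimod D₂ D₃).fib (tri23 q))
      (fun q => (Lift.bimod D₁ D₂).fib (tri12 q))
      (pullSec 𝕜 tri23 (Lift.bimod D₂ D₃).smooth) (pullSec 𝕜 tri12 (Lift.bimod D₁ D₂).smooth))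
    (pullSec 𝕜 tri13 (Lift.bimod D₁ D₃).smooth) (fun q => V.μ (Lift.map₃ D₁ D₂ D₃ q)) := by
  refine isSmoothIso_tensorSec
    (fun b => ((Lift.bimod D₂ D₃).isVBAt _).pull (Space.smoothMapAt_tri23 b))
    (fun b => ((Lift.bimod D₁ D₂).isVBAt _).pull (Space.smoothMapAt_tri12 b))
    (fun b => ((Lift.bimod D₁ D₃).isVBAt _).pull (Space.smoothMapAt_tri13 b)) _
    (fun b => V.μ_iso.1 _) fun b x y hx hy => (pullSec_comp (𝕜 := 𝕜) (V := fun p => (V.ℳ.fib p).carrier)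
      (S := V.ℳ.smooth) (g := Lift.map₂ D₁ D₃) (Space.smoothMapAt_tri13 b) _).2 ?_
  exact smooth_mul_pull (p := pr23) (q := pr12) (r := pr13)
    (fun t => (SBimod.tmulL _ _).compr₂ (V.μ t).toLin)
    (fun σ τ hσ hτ => (V.μ_iso.2 _ _).1 (tensorSec_tmul (pullSec_of hσ) (pullSec_of hτ)))
    (Lift.smoothMapAt_map₃ b) (Space.smoothMapAt_tri13 (π₁ := V.π) (π₂ := V.π) (π₃ := V.π) _)
    (V.ℳ.isVBAt _) ((pullSec_comp (𝕜 := 𝕜) (V := fun p => (V.ℳ.fib p).carrier)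
      (S := V.ℳ.smooth) (g := Lift.map₂ D₂ D₃) (Space.smoothMapAt_tri23 b) _).1 hx)
    ((pullSec_comp (𝕜 := 𝕜) (V := fun p => (V.ℳ.fib p).carrier)
      (S := V.ℳ.smooth) (g := Lift.map₂ D₁ D₂) (Space.smoothMapAt_tri12 b) _).1 hy)

/-- The identity lift. -/
def Lift.refl (V : TwoVB.{u} 𝕜 X) : V.Lift :=
  ⟨V.Y, V.π, V.π_surj, V.π_subm, fun y => y, Space.smoothMapAt_id, fun _ => rfl⟩

end

/-- The family of the pullbacks of `V` along lifts. -/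
def pullFamily {ι : Type} (D : ι → V.Lift) : Family 𝕜 X ι where
  Y := fun i => (D i).Y
  π := fun i => (D i).π
  π_surj := fun i => (D i).π_surj
  π_subm := fun i => (D i).π_subm
  𝒜 := fun i => (D i).alg
  K := fun i j => Lift.bimod (D i) (D j)
  K_inv := fun i => (D i).bimod_invertible
  μ := fun i j k q => V.μ (Lift.map₃ (D i) (D j) (D k) q)
  μ_iso := fun i j k => Lift.μ_iso (D i) (D j) (D k)
  μ_assoc := fun _ _ _ _ _ _ _ _ _ _ _ _ _ _ => V.μ_assoc _ _ _ _ _ _ _ _ _ _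

/-- The pullback of `V` along a lift. -/
def pull (D : V.Lift) : TwoVB.{u} 𝕜 X := (V.pullFamily fun _ : Unit => D).toTwoVB ()

theorem pull_isomorphic_pull (D₁ D₂ : V.Lift) : (V.pull D₁).Isomorphic (V.pull D₂) :=
  (V.pullFamily fun b : Bool => bif b then D₁ else D₂).isomorphic true false

theorem eq_of_smooth_eq {S : Sec (Space.ofMfd V.Y) (fun b => (V.𝒜.fib b).carrier)}
    {T : Sec (fib2 V.Y V.π) (fun b => (V.ℳ.fib b).carrier)} (hS : S = V.𝒜.smooth)
    (hT : T = V.ℳ.smooth) (h₁ h₂ h₃ h₄ h₅) :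
    ({ Y := V.Y, π := V.π, π_surj := V.π_surj, π_subm := h₅, 𝒜 := ⟨V.𝒜.fib, S, h₁⟩,
       ℳ := ⟨V.ℳ.fib, T, h₂⟩, ℳ_inv := h₃, μ := V.μ, μ_iso := h₄,
       μ_assoc := V.μ_assoc } : TwoVB.{u} 𝕜 X) = V := by
  subst hS hT
  rfl

theorem pull_refl : V.pull (Lift.refl V) = V :=
  V.eq_of_smooth_eq (funext fun s => funext fun y => propext (pullSec_id (V.𝒜.isVBAt y) s))
    (funext fun s => funext fun p => propext (pullSec_id (V.ℳ.isVBAt p) s)) _ _ _ _ _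

theorem isomorphic_pull (D : V.Lift) : V.Isomorphic (V.pull D) := by
  have := V.pull_isomorphic_pull (Lift.refl V) D
  rwa [pull_refl] at this

theorem isomorphic_refl : V.Isomorphic V := by
  have := V.isomorphic_pull (Lift.refl V)
  rwa [pull_refl] at this

theorem OfMoritaClass.pull {V : TwoVB.{u} 𝕜 X} {A : SAlg.{u} 𝕜} (h : V.OfMoritaClass A)
    (D : V.Lift) : (V.pull D).OfMoritaClass A := fun y => by
  obtain ⟨A₀, α, hα, hA⟩ := h (D.σ y)
  exact ⟨A₀, fun y => α (D.σ y), hα.pull (D.σ_smooth y), hA⟩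

end TwoVB

end Pullback

section Frames

variable {𝕜 : Type} [RCLike 𝕜] {X : Mfd.{u}} {A : SAlg.{u} 𝕜}

theorem pullSec_const_eq {B C : Space.{u}} {F : Type u} [AddCommGroup F] [Module 𝕜 F]
    [FiniteDimensional 𝕜 F] {f : B.pt → C.pt} (hf : ∀ b, Space.SmoothMapAt f b) :
    pullSec (V := fun _ => F) 𝕜 f (fun s b => C.SmoothVecAt 𝕜 s b) =
      fun s b => B.SmoothVecAt 𝕜 s b :=
  funext fun s => funext fun b => propext (((isTriv_const (f b)).pull (hf b)).smooth_iff s)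

theorem LocBimod.pull_const {B C : Space.{u}} {A₁ : C.pt → SAlg.{u} 𝕜}
    {S₁ : Sec C (fun b => (A₁ b).carrier)} {N : ∀ c, SBimod (A₁ c) A}
    {S : Sec C (fun b => (N b).carrier)} {f : B.pt → C.pt} (hf : ∀ b, Space.SmoothMapAt f b)
    {b : B.pt} (h : LocBimod (A₂ := fun _ => A) S₁ (fun s b => C.SmoothVecAt 𝕜 s b) N S (f b)) :
    LocBimod (A₁ := fun b => A₁ (f b)) (A₂ := fun _ => A) (pullSec 𝕜 f S₁)
      (fun s b => B.SmoothVecAt 𝕜 s b) (fun b => N (f b)) (pullSec 𝕜 f S) b := by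
  have := h.pull (hf b)
  rwa [pullSec_const_eq hf] at this

namespace Cocycle

variable (c : Cocycle A X) {B : Space.{u}} {b : B.pt} {x : B.pt → X} {i j k : B.pt → c.ι}

theorem smoothLinAt_g (hx : Space.SmoothMapAt (C := Space.ofMfd X) x b)
    (hi : ∀ᶠ b' in B.nhds b, i b' = i b) (hj : ∀ᶠ b' in B.nhds b, j b' = j b)
    (h : x b ∈ c.U (i b) ∩ c.U (j b)) :
    B.SmoothLinAt 𝕜 (fun b => ((c.g (i b) (j b) (x b)).1.toLinearMap : A →ₗ[𝕜] A)) b := by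
  intro v l
  have h1 : (Space.ofMfd X).SmoothFunAt (fun y => l ((c.g (i b) (j b) y).1 v)) (x b) :=
    Space.smoothFunAt_ofMfd.2 ⟨_, ((c.isOpen _).inter (c.isOpen _)).mem_nhds h, c.g_smooth _ _ l v⟩
  refine (h1.comp hx).congr ?_
  filter_upwards [hi, hj] with b' h2 h3
  rw [h2, h3]
  rfl

theorem smoothVecAt_a (hx : Space.SmoothMapAt (C := Space.ofMfd X) x b)
    (hi : ∀ᶠ b' in B.nhds b, i b' = i b) (hj : ∀ᶠ b' in B.nhds b, j b' = j b)
    (hk : ∀ᶠ b' in B.nhds b, k b' = k b) (h : x b ∈ c.U (i b) ∩ c.U (j b) ∩ c.U (k b)) :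
    B.SmoothVecAt 𝕜 (fun b => ((c.a (i b) (j b) (k b) (x b)).1 : A)) b := by
  intro l
  have h1 : (Space.ofMfd X).SmoothFunAt (fun y => l ((c.a (i b) (j b) (k b) y).1 : A)) (x b) :=
    Space.smoothFunAt_ofMfd.2 ⟨_, (((c.isOpen _).inter (c.isOpen _)).inter (c.isOpen _)).mem_nhds h,
      c.a_smooth _ _ _ l⟩
  refine (h1.comp hx).congr ?_
  filter_upwards [hi, hj, hk] with b' h2 h3 h4
  rw [h2, h3, h4]

end Cocycle

/-- A surjective submersion `π : Y → X` with a map to the index set of a cocycle, and a bundle of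
invertible `𝒜`-`A`-bimodules over `Y`. -/
structure Frame (c : Cocycle A X) : Type (u + 1) where
  Y : Mfd.{u}
  π : Y → X
  π_surj : Function.Surjective π
  π_subm : Manifold.IsSubmersion Y.I X.I ∞ π
  idx : Y → c.ι
  idx_loc : IsLocallyConstant idx
  mem : ∀ y, π y ∈ c.U (idx y)
  𝒜 : AlgBundle 𝕜 (Space.ofMfd Y)
  N : ∀ y, SBimod (𝒜.fib y) A
  smooth : Sec (Space.ofMfd Y) (fun y => (N y).carrier)
  loc : ∀ y, LocBimod (A₂ := fun _ => A) 𝒜.smooth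
    (fun s b => (Space.ofMfd Y).SmoothVecAt 𝕜 s b) N smooth y
  inv : ∀ y, (N y).Invertible

variable {c : Cocycle A X}

namespace Frame

variable (D D₁ D₂ D₃ : Frame c)

theorem smoothMapAt_π (y : D.Y) :
    Space.SmoothMapAt (B := Space.ofMfd D.Y) (C := Space.ofMfd X) D.π y :=
  Space.smoothMapAt_ofMfd D.π_subm.contMDiff y

theorem eventually_idx {B : Space.{u}} {f : B.pt → D.Y} {b : B.pt}
    (hf : Space.SmoothMapAt (C := Space.ofMfd D.Y) f b) :
    ∀ᶠ b' in B.nhds b, D.idx (f b') = D.idx (f b) := by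
  have h1 : ∀ᶠ y in (Space.ofMfd D.Y).nhds (f b), D.idx y = D.idx (f b) := by
    rw [Space.nhds_ofMfd]
    exact D.idx_loc.eventually_eq _
  exact hf.tendsto.eventually h1

variable {D D₁ D₂ D₃} in
theorem loc_pull {B : Space.{u}} {f : B.pt → D.Y}
    (hf : ∀ b, Space.SmoothMapAt (C := Space.ofMfd D.Y) f b) (b : B.pt) :
    LocBimod (A₁ := fun b => D.𝒜.fib (f b)) (A₂ := fun _ => A) (pullSec 𝕜 f D.𝒜.smooth)
      (fun s b => B.SmoothVecAt 𝕜 s b) (fun b => D.N (f b)) (pullSec 𝕜 f D.smooth) b :=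
  LocBimod.pull_const hf (D.loc _)

/-- The automorphism `g` at a point of `Y₁ ×_X Y₂`. -/
abbrev g (p : (fib12 D₁.π D₂.π).pt) : evenAut A :=
  c.g (D₁.idx p.1.1) (D₂.idx p.1.2) (D₁.π p.1.1)

theorem mem_inter (p : (fib12 D₁.π D₂.π).pt) :
    D₁.π p.1.1 ∈ c.U (D₁.idx p.1.1) ∩ c.U (D₂.idx p.1.2) :=
  ⟨D₁.mem _, p.2 ▸ D₂.mem p.1.2⟩

theorem smoothLinAt_g (p : (fib12 D₁.π D₂.π).pt) : (fib12 D₁.π D₂.π).SmoothLinAt 𝕜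
    (fun p => ((g D₁ D₂ p).1.toLinearMap : A →ₗ[𝕜] A)) p :=
  c.smoothLinAt_g ((D₁.smoothMapAt_π _).comp (Space.smoothMapAt_fst p))
    (D₁.eventually_idx (Space.smoothMapAt_fst p)) (D₂.eventually_idx (Space.smoothMapAt_snd p))
    (D₁.mem_inter D₂ p)

/-- A bimodule bundle over `Y₁ ×_X Y₂` which acts by `g`-semilinear maps `N₁ → N₂`. -/
structure Act : Type (u + 1) where
  K : BimodBundle (fib12 D₁.π D₂.π) D₂.𝒜 D₁.𝒜 (fun p => p.1.2) (fun p => p.1.1)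
  act : ∀ p, K.fib p →ₗ[𝕜] D₁.N p.1.1 →ₗ[𝕜] D₂.N p.1.2
  isAct : ∀ p, SBimod.IsAct (K.fib p) (D₁.N p.1.1) (D₂.N p.1.2) (g D₁ D₂ p) (act p)
  smooth : ∀ p k n, K.smooth k p →
    pullSec 𝕜 (fun p : (fib12 D₁.π D₂.π).pt => p.1.1) D₁.smooth n p →
    pullSec 𝕜 (fun p : (fib12 D₁.π D₂.π).pt => p.1.2) D₂.smooth (fun p => act p (k p) (n p)) p

/-- The bundle of all semilinear maps. -/
def homAct : Act D₁ D₂ where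
  K :=
    { fib := fun p => SBimod.homBimod (D₁.N p.1.1) (D₂.N p.1.2) (g D₁ D₂ p)
      smooth := homSec (pullSec 𝕜 (fun p : (fib12 D₁.π D₂.π).pt => p.1.1) D₁.smooth)
        (pullSec 𝕜 (fun p : (fib12 D₁.π D₂.π).pt => p.1.2) D₂.smooth) (g D₁ D₂)
      locTriv := fun p => locBimod_hom (loc_pull Space.smoothMapAt_fst p)
        (loc_pull Space.smoothMapAt_snd p) (D₁.inv _) (D₂.inv _) (D₁.smoothLinAt_g D₂ p) }
  act := fun _ => SBimod.homEval _ _ _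
  isAct := fun _ => SBimod.isAct_hom (D₁.inv _)
  smooth := fun _ _ n hk hn => hk n hn

variable {D D₁ D₂ D₃}

theorem smooth_left (B : Space.{u}) {f : B.pt → D.Y}
    (hf : ∀ b, Space.SmoothMapAt (C := Space.ofMfd D.Y) f b) (b : B.pt)
    (k : ∀ b, D.𝒜.fib (f b)) (n : ∀ b, D.N (f b)) (hk : pullSec 𝕜 f D.𝒜.smooth k b)
    (hn : pullSec 𝕜 f D.smooth n b) :
    pullSec 𝕜 f D.smooth (fun b => (D.N (f b)).left (k b) (n b)) b :=
  (loc_pull hf b).smooth_left hk hn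

theorem _root_.SuperTwoVect.SBimod.isAct_left {A₁ : SAlg.{u} 𝕜} (N : SBimod A₁ A) :
    SBimod.IsAct (SBimod.self A₁) N N 1 N.left := by
  let L : SBimod.self A₁ →ₗ[𝕜] N →ₗ[𝕜] N := N.left
  let e : SBimod.self A₁ := (1 : A₁)
  have bal : ∀ (k : SBimod.self A₁) a n, L ((SBimod.self A₁).right a k) n =
    L k (N.left a n) := fun k a n => N.left_mul _ _ _
  have key : ∀ t, SBimod.tmul e (SBimod.tensorLift L bal t) = t := fun t => by
    refine SBimod.tensor_induction t ?_ (fun m n => ?_) fun x y hx hy => ?_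
    · rw [map_zero]
      exact map_zero (SBimod.tmulL (SBimod.self A₁) N e)
    · have h : (SBimod.self A₁).right m e = m := one_mul (show A₁ from m)
      rw [SBimod.tensorLift_tmul]
      exact (SBimod.tmul_right e _ _).symm.trans (congrArg (fun m => SBimod.tmul m n) h)
    · rw [map_add, SBimod.tmul_add, hx, hy]
  exact ⟨bal, fun a k n => N.left_mul _ _ _, fun k n c => N.left_right _ _ _,
    fun k n => N.par_left _ _, Function.LeftInverse.injective key, fun n => ⟨SBimod.tmul e n,
      (SBimod.tensorLift_tmul L bal e n).trans (N.left_one n)⟩⟩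

theorem Act.invertible (K : Act D D) : K.K.Invertible := by
  let 𝒩 : BimodBundle (fib12 D.π D.π) D.𝒜 D.𝒜 (fun p => p.1.1) (fun p => p.1.2) :=
    { fib := fun p => SBimod.homBimod (D.N p.1.2) (D.N p.1.1) (g D D p)⁻¹
      smooth := homSec (pullSec 𝕜 (fun p : (fib12 D.π D.π).pt => p.1.2) D.smooth)
        (pullSec 𝕜 (fun p : (fib12 D.π D.π).pt => p.1.1) D.smooth) (fun p => (g D D p)⁻¹)
      locTriv := fun p => locBimod_hom (loc_pull Space.smoothMapAt_snd p)
        (loc_pull Space.smoothMapAt_fst p) (D.inv _) (D.inv _) (by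
          refine fun v => ((D.smoothLinAt_g D p).linInv (evenAut.isSAlgIso (g D D p)).1 v).congr ?_
          refine Filter.Eventually.of_forall fun p => ?_
          exact (evenAut.isSAlgIso (g D D p)).1.1 ((Space.apply_linInv
            (evenAut.isSAlgIso (g D D p)).1 v).trans ((g D D p).1.apply_symm_apply v).symm)) }
  have hK := fun p => K.K.isVBAt p
  have hN := fun p => 𝒩.isVBAt p
  have h1 := fun p : (fib12 D.π D.π).pt => loc_pull (D := D) Space.smoothMapAt_fst p
  have h2 := fun p : (fib12 D.π D.π).pt => loc_pull (D := D) Space.smoothMapAt_snd p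
  have hu : ∀ p : (fib12 D.π D.π).pt,
      (fib12 D.π D.π).SmoothVecAt 𝕜 (fun _ => ((1 : evenUnits A)⁻¹.1 : A)) p :=
    fun p => Space.smoothVecAt_const _
  have hi1 : innerAut (1 : evenUnits A) = 1 := by
    refine Subtype.ext (AlgEquiv.ext fun a => ?_)
    change (1 : A) * a * _ = a
    simp
  obtain ⟨ε, hε, -⟩ := exists_smooth_mul hN hK (fun p => (h2 p).isVBAt_left)
    (fun p => (h2 p).isVBAt) h2 (fun p => D.inv _)
    (fun p => SBimod.isAct_hom (D.inv p.1.2)) K.isAct (fun p => SBimod.isAct_left (D.N p.1.2))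
    (fun p k n hk hn => hk n hn) K.smooth (smooth_left _ Space.smoothMapAt_snd)
    (u := fun _ => 1) hu (fun p => by rw [hi1, one_mul, mul_inv_cancel])
  obtain ⟨η, hη, -⟩ := exists_smooth_mul hK hN (fun p => (h1 p).isVBAt_left)
    (fun p => (h1 p).isVBAt) h1 (fun p => D.inv _)
    K.isAct (fun p => SBimod.isAct_hom (D.inv p.1.2)) (fun p => SBimod.isAct_left (D.N p.1.1))
    K.smooth (fun p k n hk hn => hk n hn) (smooth_left _ Space.smoothMapAt_fst)
    (u := fun _ => 1) hu (fun p => by rw [hi1, one_mul, inv_mul_cancel])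
  exact ⟨𝒩, ⟨ε, hε⟩, ⟨η, hη⟩⟩

end Frame

end Frames

section ActFamily

variable {𝕜 : Type} [RCLike 𝕜] {X : Mfd.{u}} {A : SAlg.{u} 𝕜} {c : Cocycle A X}

namespace Frame

variable {D₁ D₂ D₃ D₄ : Frame c}

theorem Act.smooth_pull {B : Space.{u}} {f : B.pt → (fib12 D₁.π D₂.π).pt} (K : Act D₁ D₂)
    (hf : ∀ b, Space.SmoothMapAt f b) (b : B.pt) (k : ∀ b, K.K.fib (f b))
    (n : ∀ b, D₁.N (f b).1.1) (hk : pullSec 𝕜 f K.K.smooth k b)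
    (hn : pullSec 𝕜 (fun b => (f b).1.1) D₁.smooth n b) :
    pullSec 𝕜 (fun b => (f b).1.2) D₂.smooth (fun b => K.act (f b) (k b) (n b)) b :=
  smooth_mul_pull (p := fun t => t) (q := fun t : (fib12 D₁.π D₂.π).pt => t.1.1)
    (r := fun t : (fib12 D₁.π D₂.π).pt => t.1.2) K.act
    (fun _ _ hσ hτ => K.smooth _ _ _ hσ (pullSec_of hτ)) (hf b) (Space.smoothMapAt_snd _)
    (D₂.loc _).isVBAt hk hn

/-- The unit `a` at a point of `Y₁ ×_X Y₂ ×_X Y₃`. -/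
abbrev a (D₁ D₂ D₃ : Frame c) (q : (tri D₁.π D₂.π D₃.π).pt) : evenUnits A :=
  c.a (D₁.idx q.1.1) (D₂.idx q.1.2.1) (D₃.idx q.1.2.2) (D₁.π q.1.1)

theorem mem_inter₃ (q : (tri D₁.π D₂.π D₃.π).pt) :
    D₁.π q.1.1 ∈ c.U (D₁.idx q.1.1) ∩ c.U (D₂.idx q.1.2.1) ∩ c.U (D₃.idx q.1.2.2) :=
  ⟨⟨D₁.mem _, q.2.1 ▸ D₂.mem q.1.2.1⟩, (q.2.1.trans q.2.2) ▸ D₃.mem q.1.2.2⟩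

theorem cocycle_g (q : (tri D₁.π D₂.π D₃.π).pt) :
    innerAut (a D₁ D₂ D₃ q) * g D₂ D₃ (tri23 q) * g D₁ D₂ (tri12 q) = g D₁ D₃ (tri13 q) := by
  have := c.cocycle_g _ _ _ _ (mem_inter₃ q)
  change innerAut _ * c.g _ _ (D₂.π q.1.2.1) * _ = _
  rw [← q.2.1]
  exact this

theorem exists_mul (K₁₂ : Act D₁ D₂) (K₂₃ : Act D₂ D₃) (K₁₃ : Act D₁ D₃) :
    ∃ μ : ∀ q : (tri D₁.π D₂.π D₃.π).pt,
      SBimod.Hom ((K₂₃.K.fib (tri23 q)).tensor (K₁₂.K.fib (tri12 q))) (K₁₃.K.fib (tri13 q)),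
      IsSmoothIso (tensorSec (fun q => K₂₃.K.fib (tri23 q)) (fun q => K₁₂.K.fib (tri12 q))
        (pullSec 𝕜 tri23 K₂₃.K.smooth) (pullSec 𝕜 tri12 K₁₂.K.smooth))
        (pullSec 𝕜 tri13 K₁₃.K.smooth) μ ∧
      ∀ q k k' n, K₁₃.act (tri13 q) ((μ q).toLin (SBimod.tmul k k')) n =
        (D₃.N q.1.2.2).right (((a D₁ D₂ D₃ q)⁻¹).1 : A)
          (K₂₃.act (tri23 q) k (K₁₂.act (tri12 q) k' n)) := by
  refine exists_smooth_mul
    (N := fun q : (tri D₁.π D₂.π D₃.π).pt => D₁.N q.1.1) (N' := fun q => D₂.N q.1.2.1)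
    (N'' := fun q => D₃.N q.1.2.2)
    (SN := pullSec 𝕜 (fun q : (tri D₁.π D₂.π D₃.π).pt => q.1.1) D₁.smooth)
    (SN' := pullSec 𝕜 (fun q : (tri D₁.π D₂.π D₃.π).pt => q.1.2.1) D₂.smooth)
    (SN'' := pullSec 𝕜 (fun q : (tri D₁.π D₂.π D₃.π).pt => q.1.2.2) D₃.smooth)
    (act₁₂ := fun q => K₁₂.act (tri12 q)) (act₂₃ := fun q => K₂₃.act (tri23 q))
    (act₁₃ := fun q => K₁₃.act (tri13 q))
    (fun q => (K₁₂.K.isVBAt _).pull (Space.smoothMapAt_tri12 q))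
    (fun q => (K₂₃.K.isVBAt _).pull (Space.smoothMapAt_tri23 q))
    (fun q => (K₁₃.K.isVBAt _).pull (Space.smoothMapAt_tri13 q))
    (fun q => (loc_pull Space.smoothMapAt_tri_fst q).isVBAt)
    (fun q => loc_pull Space.smoothMapAt_tri_trd q) (fun q => D₁.inv _)
    (fun q => K₁₂.isAct _) (fun q => K₂₃.isAct _) (fun q => K₁₃.isAct _)
    (K₁₂.smooth_pull Space.smoothMapAt_tri12) (K₂₃.smooth_pull Space.smoothMapAt_tri23)
    (K₁₃.smooth_pull Space.smoothMapAt_tri13) (fun q => smoothVecAt_inv ?_) cocycle_g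
  exact c.smoothVecAt_a ((D₁.smoothMapAt_π _).comp (Space.smoothMapAt_tri_fst q))
    (D₁.eventually_idx (Space.smoothMapAt_tri_fst q))
    (D₂.eventually_idx (Space.smoothMapAt_tri_snd q))
    (D₃.eventually_idx (Space.smoothMapAt_tri_trd q)) (mem_inter₃ q)

/-- The multiplication of bimodule bundles that act on frames. -/
def Act.mul (K₁₂ : Act D₁ D₂) (K₂₃ : Act D₂ D₃) (K₁₃ : Act D₁ D₃)
    (q : (tri D₁.π D₂.π D₃.π).pt) :
    SBimod.Hom ((K₂₃.K.fib (tri23 q)).tensor (K₁₂.K.fib (tri12 q))) (K₁₃.K.fib (tri13 q)) :=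
  (exists_mul K₁₂ K₂₃ K₁₃).choose q

theorem Act.act_mul (K₁₂ : Act D₁ D₂) (K₂₃ : Act D₂ D₃) (K₁₃ : Act D₁ D₃) {y₁ : D₁.Y} {y₂ : D₂.Y}
    {y₃ : D₃.Y} (h₁₂ : D₁.π y₁ = D₂.π y₂) (h₂₃ : D₂.π y₂ = D₃.π y₃)
    (k : K₂₃.K.fib ⟨(y₂, y₃), h₂₃⟩) (k' : K₁₂.K.fib ⟨(y₁, y₂), h₁₂⟩) (n : D₁.N y₁) :
    K₁₃.act ⟨(y₁, y₃), h₁₂.trans h₂₃⟩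
      ((K₁₂.mul K₂₃ K₁₃ ⟨(y₁, y₂, y₃), h₁₂, h₂₃⟩).toLin (SBimod.tmul k k')) n =
        (D₃.N y₃).right (((c.a (D₁.idx y₁) (D₂.idx y₂) (D₃.idx y₃) (D₁.π y₁))⁻¹).1 : A)
          (K₂₃.act ⟨(y₂, y₃), h₂₃⟩ k (K₁₂.act ⟨(y₁, y₂), h₁₂⟩ k' n)) :=
  (exists_mul K₁₂ K₂₃ K₁₃).choose_spec.2 ⟨(y₁, y₂, y₃), h₁₂, h₂₃⟩ k k' n

theorem Act.mul_assoc (K₁₂ : Act D₁ D₂) (K₂₃ : Act D₂ D₃) (K₃₄ : Act D₃ D₄) (K₁₃ : Act D₁ D₃)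
    (K₂₄ : Act D₂ D₄) (K₁₄ : Act D₁ D₄) (y₁ : D₁.Y) (y₂ : D₂.Y) (y₃ : D₃.Y) (y₄ : D₄.Y)
    (h₁₂ : D₁.π y₁ = D₂.π y₂) (h₂₃ : D₂.π y₂ = D₃.π y₃) (h₃₄ : D₃.π y₃ = D₄.π y₄)
    (m₃₄ : K₃₄.K.fib ⟨(y₃, y₄), h₃₄⟩) (m₂₃ : K₂₃.K.fib ⟨(y₂, y₃), h₂₃⟩)
    (m₁₂ : K₁₂.K.fib ⟨(y₁, y₂), h₁₂⟩) :
    (K₁₂.mul K₂₄ K₁₄ ⟨(y₁, y₂, y₄), h₁₂, h₂₃.trans h₃₄⟩).toLin (SBimod.tmul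
      ((K₂₃.mul K₃₄ K₂₄ ⟨(y₂, y₃, y₄), h₂₃, h₃₄⟩).toLin (SBimod.tmul m₃₄ m₂₃)) m₁₂) =
    (K₁₃.mul K₃₄ K₁₄ ⟨(y₁, y₃, y₄), h₁₂.trans h₂₃, h₃₄⟩).toLin (SBimod.tmul m₃₄
      ((K₁₂.mul K₂₃ K₁₃ ⟨(y₁, y₂, y₃), h₁₂, h₂₃⟩).toLin (SBimod.tmul m₂₃ m₁₂))) := by
  refine (K₁₄.isAct ⟨(y₁, y₄), h₁₂.trans (h₂₃.trans h₃₄)⟩).ext (D₁.inv _) fun n => ?_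
  have e1 := K₁₂.act_mul K₂₄ K₁₄ h₁₂ (h₂₃.trans h₃₄)
    ((K₂₃.mul K₃₄ K₂₄ ⟨(y₂, y₃, y₄), h₂₃, h₃₄⟩).toLin (SBimod.tmul m₃₄ m₂₃)) m₁₂ n
  have e2 := K₂₃.act_mul K₃₄ K₂₄ h₂₃ h₃₄ m₃₄ m₂₃ (K₁₂.act ⟨(y₁, y₂), h₁₂⟩ m₁₂ n)
  have e3 := K₁₃.act_mul K₃₄ K₁₄ (h₁₂.trans h₂₃) h₃₄ m₃₄
    ((K₁₂.mul K₂₃ K₁₃ ⟨(y₁, y₂, y₃), h₁₂, h₂₃⟩).toLin (SBimod.tmul m₂₃ m₁₂)) n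
  have e4 := K₁₂.act_mul K₂₃ K₁₃ h₁₂ h₂₃ m₂₃ m₁₂ n
  have e5 := (K₃₄.isAct ⟨(y₃, y₄), h₃₄⟩).right m₃₄
    (K₂₃.act ⟨(y₂, y₃), h₂₃⟩ m₂₃ (K₁₂.act ⟨(y₁, y₂), h₁₂⟩ m₁₂ n))
  refine e1.trans ((congrArg _ e2).trans (Eq.trans ?_ (e3.trans (congrArg (fun z =>
    (D₄.N y₄).right _ (K₃₄.act _ m₃₄ z)) e4)).symm))
  rw [← (D₄.N y₄).right_mul]
  refine Eq.trans ?_ (congrArg _ (e5 _)).symm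
  refine Eq.trans ?_ ((D₄.N y₄).right_mul _ _ _)
  refine congrArg (fun b => (D₄.N y₄).right b _) ?_
  have hx₂ : D₂.π y₂ = D₁.π y₁ := h₁₂.symm
  have hx₃ : D₃.π y₃ = D₁.π y₁ := (h₁₂.trans h₂₃).symm
  have hx₄ : D₄.π y₄ = D₁.π y₁ := (h₁₂.trans (h₂₃.trans h₃₄)).symm
  have hc := c.cocycle_a (D₁.idx y₁) (D₂.idx y₂) (D₃.idx y₃) (D₄.idx y₄) (D₁.π y₁)
    ⟨⟨⟨D₁.mem _, hx₂ ▸ D₂.mem y₂⟩, hx₃ ▸ D₃.mem y₃⟩, hx₄ ▸ D₄.mem y₄⟩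
  change _ = (c.g _ _ (D₃.π y₃)).1 _ * _
  rw [hx₂, hx₃]
  have h := congrArg (fun u : evenUnits A => ((u⁻¹).1 : A)) hc
  simp only [mul_inv_rev] at h
  exact h.symm

end Frame

/-- The family of bundles that is given by frames and bimodule bundles acting on them. -/
def actFamily {ι : Type} (D : ι → Frame c) (K : ∀ i j, Frame.Act (D i) (D j)) :
    Family 𝕜 X ι where
  Y := fun i => (D i).Y
  π := fun i => (D i).π
  π_surj := fun i => (D i).π_surj
  π_subm := fun i => (D i).π_subm
  𝒜 := fun i => (D i).𝒜
  K := fun i j => (K i j).K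
  K_inv := fun i => (K i i).invertible
  μ := fun i j k => (K i j).mul (K j k) (K i k)
  μ_iso := fun i j k => (Frame.exists_mul (K i j) (K j k) (K i k)).choose_spec.1
  μ_assoc := fun i₁ i₂ i₃ i₄ => (K i₁ i₂).mul_assoc (K i₂ i₃) (K i₃ i₄) (K i₁ i₃) (K i₂ i₄) (K i₁ i₄)

end ActFamily

section Presentations

variable {𝕜 : Type} [RCLike 𝕜] {X : Mfd.{u}} {A : SAlg.{u} 𝕜}

/-- A presentation of a super 2-vector bundle by a cocycle: along a lift to `V.Y`, the bimodules of
`V` act by semilinear maps on a bundle of invertible bimodules, compatibly with the cocycle. -/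
structure TwoVB.Lift.Pres {V : TwoVB.{u} 𝕜 X} (D : V.Lift) (c : Cocycle A X) : Type (u + 1) where
  idx : D.Y → c.ι
  idx_loc : IsLocallyConstant idx
  mem : ∀ y, D.π y ∈ c.U (idx y)
  N : ∀ y, SBimod (D.alg.fib y) A
  smooth : Sec (Space.ofMfd D.Y) (fun y => (N y).carrier)
  loc : ∀ y, LocBimod (A₂ := fun _ => A) D.alg.smooth
    (fun s b => (Space.ofMfd D.Y).SmoothVecAt 𝕜 s b) N smooth y
  inv : ∀ y, (N y).Invertible
  act : ∀ p : (fib12 D.π D.π).pt,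
    V.ℳ.fib (TwoVB.Lift.map₂ D D p) →ₗ[𝕜] N p.1.1 →ₗ[𝕜] N p.1.2
  isAct : ∀ p : (fib12 D.π D.π).pt, SBimod.IsAct (V.ℳ.fib (TwoVB.Lift.map₂ D D p)) (N p.1.1)
    (N p.1.2) (c.g (idx p.1.1) (idx p.1.2) (D.π p.1.1)) (act p)
  smooth_act : ∀ (p : (fib12 D.π D.π).pt) k n,
    pullSec 𝕜 (TwoVB.Lift.map₂ D D) V.ℳ.smooth k p →
    pullSec 𝕜 (fun p : (fib12 D.π D.π).pt => p.1.1) smooth n p →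
    pullSec 𝕜 (fun p : (fib12 D.π D.π).pt => p.1.2) smooth (fun p => act p (k p) (n p)) p
  act_μ : ∀ (q : (tri D.π D.π D.π).pt) (k : V.ℳ.fib (TwoVB.Lift.map₂ D D (tri23 q)))
    (k' : V.ℳ.fib (TwoVB.Lift.map₂ D D (tri12 q))) (n : N q.1.1),
    act (tri13 q) ((V.μ (TwoVB.Lift.map₃ D D D q)).toLin (SBimod.tmul k k')) n =
      (N q.1.2.2).right
        (((c.a (idx q.1.1) (idx q.1.2.1) (idx q.1.2.2) (D.π q.1.1))⁻¹).1 : A)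
        (act (tri23 q) k (act (tri12 q) k' n))

namespace TwoVB

theorem eq_of_μ_eq (V : TwoVB.{u} 𝕜 X) {μ} (h : μ = V.μ) (h₁ h₂) :
    ({ Y := V.Y, π := V.π, π_surj := V.π_surj, π_subm := V.π_subm, 𝒜 := V.𝒜, ℳ := V.ℳ,
       ℳ_inv := V.ℳ_inv, μ := μ, μ_iso := h₁, μ_assoc := h₂ } : TwoVB.{u} 𝕜 X) = V := by
  subst h
  rfl

/-- The bundle `V` has a presentation by the cocycle `c`. -/
def Presented (V : TwoVB.{u} 𝕜 X) (c : Cocycle A X) : Prop := ∃ D : V.Lift, Nonempty (D.Pres c)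

namespace Lift.Pres

variable {V V' : TwoVB.{u} 𝕜 X} {D : V.Lift} {D' : V'.Lift} {c : Cocycle A X} (P : D.Pres c)


/-- The frame of a presentation. -/
abbrev frame : Frame c where
  Y := D.Y
  π := D.π
  π_surj := D.π_surj
  π_subm := D.π_subm
  idx := P.idx
  idx_loc := P.idx_loc
  mem := P.mem
  𝒜 := D.alg
  N := P.N
  smooth := P.smooth
  loc := P.loc
  inv := P.inv

/-- The action of the bimodule bundle on the frame. -/
abbrev frameAct : Frame.Act P.frame P.frame where
  K := Lift.bimod D D
  act := P.act
  isAct := P.isAct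
  smooth := P.smooth_act

theorem mul_eq (q : (tri D.π D.π D.π).pt) :
    P.frameAct.mul P.frameAct P.frameAct q = V.μ (Lift.map₃ D D D q) := by
  have h : (P.frameAct.mul P.frameAct P.frameAct q).toLin =
      (V.μ (Lift.map₃ D D D q)).toLin := by
    refine SBimod.tensor_hom_ext fun m n => ?_
    refine (P.isAct (tri13 q)).ext (P.inv _) fun x => ?_
    exact ((Frame.exists_mul P.frameAct P.frameAct P.frameAct).choose_spec.2 q m n x).trans
      (P.act_μ q m n x).symm
  have key : ∀ {B C : SAlg.{u} 𝕜} {M N : SBimod B C} (f g : SBimod.Hom M N),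
      f.toLin = g.toLin → f = g := by
    rintro B C M N ⟨f, _, _, _⟩ ⟨g, _, _, _⟩ rfl
    rfl
  exact key _ _ h

theorem isomorphic_pull (P : D.Pres c) (P' : D'.Pres c) : (V.pull D).Isomorphic (V'.pull D') := by
  let E : Bool → Frame c := fun b => bif b then P.frame else P'.frame
  let K : ∀ i j, Frame.Act (E i) (E j) := fun i j => match i, j with
    | true, true => P.frameAct
    | false, false => P'.frameAct
    | true, false => Frame.homAct _ _
    | false, true => Frame.homAct _ _
  have h := (actFamily E K).isomorphic true false
  have h1 : (actFamily E K).toTwoVB true = V.pull D :=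
    (V.pull D).eq_of_μ_eq (funext fun q => P.mul_eq q) _ _
  have h2 : (actFamily E K).toTwoVB false = V'.pull D' :=
    (V'.pull D').eq_of_μ_eq (funext fun q => P'.mul_eq q) _ _
  rwa [h1, h2] at h

end Lift.Pres

theorem Presented.isoClass_eq {V V' : TwoVB.{u} 𝕜 X} {c : Cocycle A X} (h : V.Presented c)
    (h' : V'.Presented c) (hV : V.OfMoritaClass A) (hV' : V'.OfMoritaClass A) :
    isoClass ⟨V, hV⟩ = isoClass ⟨V', hV'⟩ := by
  obtain ⟨D, ⟨P⟩⟩ := h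
  obtain ⟨D', ⟨P'⟩⟩ := h'
  have h1 : isoClass ⟨V, hV⟩ = isoClass ⟨V.pull D, hV.pull D⟩ := Quot.sound (V.isomorphic_pull D)
  have h2 : isoClass ⟨V', hV'⟩ = isoClass ⟨V'.pull D', hV'.pull D'⟩ :=
    Quot.sound (V'.isomorphic_pull D')
  have h3 : isoClass ⟨V.pull D, hV.pull D⟩ = isoClass ⟨V'.pull D', hV'.pull D'⟩ :=
    Quot.sound (P.isomorphic_pull P')
  exact h1.trans (h3.trans h2.symm)

end TwoVB

end Presentations

section Etale

namespace Mfd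

variable (X : Mfd.{u}) {Y : Type u} [TopologicalSpace Y] {f : Y → X}

/-- The charts of a space with a local homeomorphism to a manifold. -/
abbrev etaleCharted (hf : IsLocalHomeomorph f) : ChartedSpace X.H Y where
  atlas := {e | ∃ (d : OpenPartialHomeomorph Y X) (φ : OpenPartialHomeomorph X X.H),
    f = d ∧ φ ∈ atlas X.H X ∧ e = d.trans φ}
  chartAt y := (hf y).choose.trans (chartAt X.H (f y))
  mem_chart_source y := by
    have h := (hf y).choose_spec
    rw [OpenPartialHomeomorph.trans_source]
    refine ⟨h.1, ?_⟩
    rw [Set.mem_preimage, ← h.2]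
    exact mem_chart_source _ _
  chart_mem_atlas y := ⟨_, _, (hf y).choose_spec.2, chart_mem_atlas _ _, rfl⟩

theorem etale_isManifold (hf : IsLocalHomeomorph f) :
    @IsManifold ℝ _ X.E _ _ X.H _ X.I ∞ Y _ (X.etaleCharted hf) := by
  let _ := X.etaleCharted hf
  refine isManifold_of_contDiffOn _ _ _ ?_
  rintro _ _ ⟨d, φ, hd, hφ, rfl⟩ ⟨d', φ', hd', hφ', rfl⟩
  have h1 := (mem_groupoid_of_pregroupoid.1 (HasGroupoid.compatible (G := contDiffGroupoid ∞ X.I)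
    hφ hφ')).1
  have h2 : ContDiffOn ℝ ∞ (X.I ∘ (φ.symm ≫ₕ φ') ∘ X.I.symm)
    (X.I.symm ⁻¹' (φ.symm ≫ₕ φ').source ∩ Set.range X.I) := h1
  have key : ∀ z ∈ ((d ≫ₕ φ).symm ≫ₕ (d' ≫ₕ φ')).source, z ∈ (φ.symm ≫ₕ φ').source ∧
      ((d ≫ₕ φ).symm ≫ₕ (d' ≫ₕ φ')) z = (φ.symm ≫ₕ φ') z := by
    intro z hz
    simp only [OpenPartialHomeomorph.trans_symm_eq_symm_trans_symm,
      OpenPartialHomeomorph.trans_source, OpenPartialHomeomorph.symm_source, Set.mem_inter_iff,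
      Set.mem_preimage, OpenPartialHomeomorph.coe_trans, Function.comp_apply] at hz ⊢
    have e : d' (d.symm (φ.symm z)) = φ.symm z := by
      rw [← hd', hd, d.right_inv hz.1.2]
    rw [e] at hz ⊢
    exact ⟨⟨hz.1.1, hz.2.2⟩, rfl⟩
  refine h2.congr_mono (fun x hx => ?_) fun x hx => ⟨(key _ hx.1).1, hx.2⟩
  exact congrArg X.I (key _ hx.1).2

theorem etaleCharted_isSubmersion (hf : IsLocalHomeomorph f) :
    let _ := X.etaleCharted hf
    Manifold.IsSubmersion X.I X.I ∞ f := by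
  let _ := X.etaleCharted hf
  have := X.etale_isManifold hf
  refine ⟨PUnit, inferInstance, inferInstance, fun y => ?_⟩
  obtain ⟨d, hy, hd⟩ := hf y
  have hc : chartAt X.H (f y) ∈ atlas X.H X := chart_mem_atlas _ _
  refine Manifold.IsSubmersionAtOfComplement.mk_of_continuousAt hf.continuous.continuousAt
    (ContinuousLinearEquiv.prodUnique ℝ X.E PUnit).symm
    (d.trans (chartAt X.H (f y))) (chartAt X.H (f y)) ?_ (mem_chart_source _ _)
    (IsManifold.subset_maximalAtlas ⟨d, _, hd, hc, rfl⟩)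
    (IsManifold.subset_maximalAtlas hc) ?_
  · rw [OpenPartialHomeomorph.trans_source]
    refine ⟨hy, ?_⟩
    rw [Set.mem_preimage, ← hd]
    exact mem_chart_source _ _
  · intro z hz
    rw [OpenPartialHomeomorph.extend_target', OpenPartialHomeomorph.trans_target] at hz
    obtain ⟨w, ⟨hw1, hw2⟩, rfl⟩ := hz
    have e : d (d.symm ((chartAt X.H (f y)).symm w)) = (chartAt X.H (f y)).symm w := d.right_inv hw2
    rw [← hd] at e
    have e3 : chartAt X.H (f y) ((chartAt X.H (f y)).symm w) = w :=
      (chartAt X.H (f y)).right_inv hw1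
    change X.I (chartAt X.H (f y) (f (d.symm ((chartAt X.H (f y)).symm (X.I.symm (X.I w)))))) =
      X.I w
    rw [X.I.left_inv, e, e3]

theorem etaleCharted_contMDiffOn_symm (hf : IsLocalHomeomorph f) (d : OpenPartialHomeomorph Y X)
    (hd : f = d) :
    let _ := X.etaleCharted hf
    ContMDiffOn X.I X.I ∞ d.symm d.target := by
  intro _ x hx
  have := X.etale_isManifold hf
  have hc : chartAt X.H x ∈ atlas X.H X := chart_mem_atlas _ _
  have h0 : d ≫ₕ chartAt X.H x ∈ atlas X.H Y := ⟨d, _, hd, hc, rfl⟩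
  have h1 := contMDiffOn_symm_of_mem_maximalAtlas (I := X.I) (n := ∞)
    (IsManifold.subset_maximalAtlas h0)
  have h2 := contMDiffOn_of_mem_maximalAtlas (I := X.I) (n := ∞)
    (IsManifold.subset_maximalAtlas (M := X) hc)
  have h3 := h1.comp (s := d.target ∩ (chartAt X.H x).source) (h2.mono Set.inter_subset_right)
    fun z hz => by
      rw [Set.mem_preimage, OpenPartialHomeomorph.trans_target]
      exact ⟨(chartAt X.H x).map_source hz.2, by
        rw [Set.mem_preimage, (chartAt X.H x).left_inv hz.2]; exact hz.1⟩
  have h4 : ContMDiffWithinAt X.I X.I ∞ d.symm (d.target ∩ (chartAt X.H x).source) x := by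
    refine (h3 x ⟨hx, mem_chart_source _ _⟩).congr (fun z hz => ?_) ?_
    · exact (congrArg d.symm ((chartAt X.H x).left_inv hz.2)).symm
    · exact (congrArg d.symm ((chartAt X.H x).left_inv (mem_chart_source _ _))).symm
  exact (h4.contMDiffAt ((d.open_target.inter (chartAt X.H x).open_source).mem_nhds
    ⟨hx, mem_chart_source _ _⟩)).contMDiffWithinAt

theorem etaleCharted_isLocalDiffeomorph (hf : IsLocalHomeomorph f) :
    let _ := X.etaleCharted hf
    IsLocalDiffeomorph X.I X.I ∞ f := fun y => by
  obtain ⟨d, hy, hd⟩ := hf y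
  let _ := X.etaleCharted hf
  have := X.etale_isManifold hf
  have h1 : ContMDiffOn X.I X.I ∞ d d.source :=
    hd ▸ (X.etaleCharted_isSubmersion hf).contMDiff.contMDiffOn
  exact ⟨⟨d.toPartialEquiv, d.open_source, d.open_target, h1,
    X.etaleCharted_contMDiffOn_symm hf d hd⟩, hy, fun z _ => congrFun hd z⟩

/-- The manifold structure on a space with a local homeomorphism to a manifold. -/
def etale [T2Space Y] [SecondCountableTopology Y] (hf : IsLocalHomeomorph f) : Mfd.{u} where
  E := X.E
  H := X.H
  carrier := Y
  I := X.I
  charted := X.etaleCharted hf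
  isManifold := X.etale_isManifold hf

theorem isLocalHomeomorph_sigma {κ : Type u} {W : κ → Set X} (hW : ∀ k, IsOpen (W k)) :
    IsLocalHomeomorph (fun y : Σ k, W k => (y.2 : X)) := by
  refine IsLocalHomeomorph.mk _ ?_
  classical
  rintro ⟨k, x⟩
  have : Nonempty (W k) := ⟨x⟩
  have hk : Topology.IsOpenEmbedding (fun x : W k => (⟨k, x⟩ : Σ k, W k)) :=
    Topology.IsOpenEmbedding.sigmaMk (σ := fun k => W k)
  let i := hk.toOpenPartialHomeomorph
  let j := (hW k).isOpenEmbedding_subtypeVal.toOpenPartialHomeomorph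
  refine ⟨i.symm.trans j, ?_, ?_⟩
  · simp [i, j]
  · intro y hy
    have hy' : y ∈ i.target := by
      rw [OpenPartialHomeomorph.trans_source] at hy
      exact hy.1
    have := i.right_inv hy'
    change (y.2 : X) = ((i.symm y : W k) : X)
    exact (congrArg (fun y : Σ k, W k => (y.2 : X)) this).symm

/-- The disjoint union of a countable family of open subsets. -/
abbrev sigma {κ : Type u} [Countable κ] (W : κ → Set X) (hW : ∀ k, IsOpen (W k)) : Mfd.{u} :=
  X.etale (X.isLocalHomeomorph_sigma hW)

variable {X} {κ : Type u} [Countable κ] {W : κ → Set X} (hW : ∀ k, IsOpen (W k))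

/-- The projection of the disjoint union. -/
abbrev sigmaπ (y : X.sigma W hW) : X := (show Σ k, W k from y).2.1

/-- The component of a point of the disjoint union. -/
abbrev sigmaIdx (y : X.sigma W hW) : κ := (show Σ k, W k from y).1

theorem isLocallyConstant_sigmaIdx : IsLocallyConstant (sigmaIdx hW) := by
  refine (IsLocallyConstant.iff_isOpen_fiber (X := Σ k, W k)).2 fun k => ?_
  have : {y : Σ k, W k | y.1 = k} = Set.range (Sigma.mk k) := by
    ext ⟨l, x⟩
    constructor
    · rintro rfl
      exact ⟨x, rfl⟩
    · rintro ⟨z, hz⟩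
      exact (congrArg Sigma.fst hz).symm
  change IsOpen {y : Σ k, W k | y.1 = k}
  rw [this]
  exact Topology.IsOpenEmbedding.sigmaMk.isOpen_range

end Mfd

end Etale

section TwistedSelf

variable {𝕜 : Type} [RCLike 𝕜] {A A₁ A₂ : SAlg.{u} 𝕜}

namespace SBimod

/-- The bimodule `A` with the left action along `τ` and the right action along `h`. -/
def twistSelf {τ : A₁ →ₗ[𝕜] A} (hτ : IsSAlgIso τ) (h : evenAut A) : SBimod A₁ A :=
  ((self A).twistL hτ.toHom).twistR (evenAut.isSAlgIso h).toHom

theorem invertible_twistSelf {τ : A₁ →ₗ[𝕜] A} (hτ : IsSAlgIso τ) (h : evenAut A) :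
    (twistSelf hτ h).Invertible := ((invertible_self A).twistL hτ).twistR _

/-- The map `(m, n) ↦ θ(m) g(n) e`. -/
def mulMap {K : Type u} [AddCommGroup K] [Module 𝕜 K] (θ : K →ₗ[𝕜] A) (g : evenAut A)
    (e : evenUnits A) : K →ₗ[𝕜] A →ₗ[𝕜] A :=
  LinearMap.mk₂ 𝕜 (fun m n => θ m * g.1 n * (e.1 : A)) (fun _ _ _ => by simp [add_mul])
    (fun _ _ _ => by simp) (fun _ _ _ => by simp [mul_add, add_mul]) (fun _ _ _ => by simp)

variable {K : SBimod A₂ A₁} {θ : K →ₗ[𝕜] A} {τ₁ : A₁ →ₗ[𝕜] A} {τ₂ : A₂ →ₗ[𝕜] A}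
  (hτ₁ : IsSAlgIso τ₁) (hτ₂ : IsSAlgIso τ₂) {g g' h₁ h₂ : evenAut A} {e : evenUnits A}

theorem isAct_twistSelf (hθ : Function.Bijective θ) (hev : ∀ i m, m ∈ K.gr i → θ m ∈ A.gr i)
    (hl : ∀ a m, θ (K.left a m) = τ₂ a * θ m) (hr : ∀ b m, θ (K.right b m) = θ m * g.1 (τ₁ b))
    (he : innerAut e * h₂ * g' = g * h₁) :
    IsAct K (twistSelf hτ₁ h₁) (twistSelf hτ₂ h₂) g' (mulMap θ g e) := by
  let N := twistSelf hτ₁ h₁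
  let N' := twistSelf hτ₂ h₂
  let L : K →ₗ[𝕜] N →ₗ[𝕜] N' := mulMap θ g e
  have bal : ∀ k a (n : N), L (K.right a k) n = L k (N.left a n) := fun k a n => by
    change θ (K.right a k) * g.1 (show A from n) * (e.1 : A) = θ k * g.1 (τ₁ a * (show A from n)) * e.1
    rw [hr, map_mul, mul_assoc (θ k)]
  have left : ∀ a k (n : N), L (K.left a k) n = N'.left a (L k n) := fun a k n => by
    change θ (K.left a k) * g.1 (show A from n) * (e.1 : A) =
      τ₂ a * (θ k * g.1 (show A from n) * e.1)
    rw [hl, mul_assoc, mul_assoc, mul_assoc]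
  have right : ∀ k (n : N) c, L k (N.right c n) = N'.right (g'.1 c) (L k n) := fun k n c => by
    have h1 : (e.1 : A) * h₂.1 (g'.1 c) * (e⁻¹).1 = g.1 (h₁.1 c) :=
      congrArg (fun f : evenAut A => f.1 c) he
    have h2 : (e.1 : A) * h₂.1 (g'.1 c) = g.1 (h₁.1 c) * e.1 := by
      rw [← h1, mul_assoc, show ((e⁻¹).1 : A) * (e.1 : A) = 1 from Units.inv_mul e.1, mul_one]
    change θ k * g.1 ((show A from n) * h₁.1 c) * (e.1 : A) =
      θ k * g.1 (show A from n) * e.1 * h₂.1 (g'.1 c)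
    rw [map_mul, mul_assoc _ (e.1 : A), h2, mul_assoc, mul_assoc, mul_assoc]
  have par : ∀ k (n : N), N'.par (L k n) = L (K.par k) (N.par n) := fun k n => by
    have h1 : A.par (e.1 : A) = e.1 := SAlg.mem_zero_iff.1 e.2
    have h2 : ∀ k, A.par (θ k) = θ (K.par k) :=
      (even_iff_parity K.isCompl A.isCompl).1 hev
    change A.par (θ k * g.1 (show A from n) * (e.1 : A)) = θ (K.par k) * g.1 (A.par n) * e.1
    rw [A.par_mul, A.par_mul, h1, evenAut.par, h2]
  refine ⟨bal, left, right, par, ?_⟩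
  let θ' := LinearEquiv.ofBijective θ hθ
  let τ' := hτ₁.equiv
  let one : N := (1 : A)
  let R : N' →ₗ[𝕜] K := θ'.symm.toLinearMap ∘ₗ LinearMap.mulRight 𝕜 ((e⁻¹).1 : A)
  have hR : ∀ k (n : N), R (L k n) = K.right (τ'.symm n) k := fun m n => by
    refine θ'.symm_apply_eq.2 (Eq.trans ?_ (hr (τ'.symm n) m).symm)
    rw [show τ₁ (τ'.symm n) = n from τ'.apply_symm_apply n]
    change θ m * g.1 (show A from n) * (e.1 : A) * (e⁻¹).1 = _
    rw [mul_assoc _ (e.1 : A), show (e.1 : A) * (e⁻¹).1 = 1 from Units.mul_inv e.1, mul_one]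
  have key : ∀ t, tmul (R (tensorLift L bal t)) one = t := fun t => by
    refine tensor_induction t ?_ (fun m n => ?_) fun x y hx hy => ?_
    · rw [map_zero, map_zero]
      exact LinearMap.map_zero₂ (tmulL K N) one
    · rw [tensorLift_tmul, hR, tmul_right]
      refine congrArg (tmul m) ?_
      change τ₁ (τ'.symm n) * (1 : A) = n
      rw [mul_one]
      exact τ'.apply_symm_apply n
    · rw [map_add, map_add, add_tmul, hx, hy]
  have inj : Function.Injective (tensorLift L bal) := Function.LeftInverse.injective
    (g := fun n => tmul (R n) one) key
  refine ⟨inj, fun n => ⟨tmul (R n) one, ?_⟩⟩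
  refine (tensorLift_tmul L bal _ _).trans ?_
  change θ (θ'.symm _) * g.1 (1 : A) * (e.1 : A) = _
  rw [show ∀ x, θ (θ'.symm x) = x from θ'.apply_symm_apply, map_one, mul_one]
  change (show A from n) * (e⁻¹).1 * (e.1 : A) = _
  rw [mul_assoc, show ((e⁻¹).1 : A) * (e.1 : A) = 1 from Units.inv_mul e.1, mul_one]

end SBimod

end TwistedSelf

section SmoothOn

variable {𝕜 : Type} [RCLike 𝕜] {X : Mfd.{u}} {A : SAlg.{u} 𝕜} {B : Space.{u}} {b : B.pt}
  {x : B.pt → X}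

theorem SmoothAutOn.smoothLinAt {g : X → evenAut A} {U : Set X} (hg : SmoothAutOn X g U)
    (hU : U ∈ 𝓝 (x b)) (hx : Space.SmoothMapAt (C := Space.ofMfd X) x b) :
    B.SmoothLinAt 𝕜 (fun b => ((g (x b)).1.toLinearMap : A →ₗ[𝕜] A)) b := fun v l =>
  Space.SmoothFunAt.comp (C := Space.ofMfd X) (Space.smoothFunAt_ofMfd.2 ⟨_, hU, hg l v⟩) hx

theorem SmoothUnitsOn.smoothVecAt {a : X → evenUnits A} {U : Set X} (ha : SmoothUnitsOn X a U)
    (hU : U ∈ 𝓝 (x b)) (hx : Space.SmoothMapAt (C := Space.ofMfd X) x b) :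
    B.SmoothVecAt 𝕜 (fun b => ((a (x b)).1 : A)) b := fun l =>
  Space.SmoothFunAt.comp (C := Space.ofMfd X) (Space.smoothFunAt_ofMfd.2 ⟨_, hU, ha l⟩) hx

end SmoothOn

section AssociatedPres

variable {𝕜 : Type} [RCLike 𝕜] {X : Mfd.{u}} {A : SAlg.{u} 𝕜}

theorem mul_act_eq {g₁₂ g₂₃ g₁₃ h : evenAut A} {a b e₁₂ e₂₃ e₁₃ : evenUnits A}
    (hg : innerAut a * g₂₃ * g₁₂ = g₁₃) (he : a * autAct g₂₃ e₁₂ * e₂₃ = e₁₃ * autAct h b)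
    (x y n : A) : x * g₂₃.1 y * ((a⁻¹).1 : A) * g₁₃.1 n * (e₁₃.1 : A) =
      x * g₂₃.1 (y * g₁₂.1 n * (e₁₂.1 : A)) * (e₂₃.1 : A) * h.1 ((b⁻¹).1 : A) := by
  have h1 : ((a⁻¹).1 : A) * g₁₃.1 n = g₂₃.1 (g₁₂.1 n) * (a⁻¹).1 := by
    rw [← hg]
    change ((a⁻¹).1 : A) * ((a.1 : A) * g₂₃.1 (g₁₂.1 n) * ((a⁻¹).1 : A)) = _
    rw [← mul_assoc, ← mul_assoc, show ((a⁻¹).1 : A) * (a.1 : A) = 1 from Units.inv_mul a.1, one_mul]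
  have h2 : ((a⁻¹).1 : A) * e₁₃.1 = g₂₃.1 (e₁₂.1 : A) * e₂₃.1 * h.1 ((b⁻¹).1 : A) := by
    have h3 : a⁻¹ * e₁₃ = autAct g₂₃ e₁₂ * e₂₃ * (autAct h b)⁻¹ := by
      rw [inv_mul_eq_iff_eq_mul, ← mul_assoc, ← mul_assoc, he, mul_inv_cancel_right]
    have h4 := congrArg (fun u : evenUnits A => (u.1 : A)) h3
    simpa [autAct] using h4
  calc _ = x * g₂₃.1 y * (((a⁻¹).1 : A) * g₁₃.1 n) * (e₁₃.1 : A) := by simp only [mul_assoc]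
    _ = x * g₂₃.1 y * g₂₃.1 (g₁₂.1 n) * (((a⁻¹).1 : A) * e₁₃.1) := by rw [h1]; simp only [mul_assoc]
    _ = _ := by rw [h2, map_mul, map_mul]; simp only [mul_assoc]

theorem TwoVB.IsAssociatedTo.exists_pres {V : TwoVB.{u} 𝕜 X} {d c : Cocycle A X}
    (hV : V.IsAssociatedTo d) (r : d.ι → c.ι) (h : d.ι → X → evenAut A)
    (e : d.ι → d.ι → X → evenUnits A) (hU : ∀ k, d.U k ⊆ c.U (r k))
    (hh : ∀ k, SmoothAutOn X (h k) (d.U k)) (he : ∀ k l, SmoothUnitsOn X (e k l) (d.U k ∩ d.U l))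
    (h₂ : ∀ k l, ∀ x ∈ d.U k ∩ d.U l,
      innerAut (e k l x) * h l x * c.g (r k) (r l) x = d.g k l x * h k x)
    (h₃ : ∀ k l m, ∀ x ∈ d.U k ∩ d.U l ∩ d.U m,
      d.a k l m x * autAct (d.g l m x) (e k l x) * e l m x =
        e k m x * autAct (h m x) (c.a (r k) (r l) (r m) x)) : V.Presented c := by
  obtain ⟨idx, τ, θ, hidx, -, hmem, -, hτ, hθ, hev, hl, hr, hμ⟩ := hV
  have hτi : ∀ y, IsSAlgIso (τ y) := fun y => Space.self_of_nhds (hτ y).2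
  have hπ : ∀ y, Space.SmoothMapAt (B := Space.ofMfd V.Y) (C := Space.ofMfd X) V.π y :=
    Space.smoothMapAt_ofMfd V.π_subm.contMDiff
  have hev_idx : ∀ y, ∀ᶠ y' in (Space.ofMfd V.Y).nhds y, idx y' = idx y := fun y => by
    rw [Space.nhds_ofMfd]
    exact hidx.eventually_eq y
  have hhs : ∀ y, (Space.ofMfd V.Y).SmoothLinAt 𝕜
      (fun y => ((h (idx y) (V.π y)).1.toLinearMap : A →ₗ[𝕜] A)) y := fun y v => by
    refine ((hh (idx y)).smoothLinAt ((d.isOpen _).mem_nhds (hmem y)) (hπ y) v).congr ?_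
    filter_upwards [hev_idx y] with y' hy'
    rw [hy']
  have hmem₂ : ∀ p : (fib2 V.Y V.π).pt, V.π p.1.1 ∈ d.U (idx p.1.1) ∩ d.U (idx p.1.2) :=
    fun p => ⟨hmem _, p.2 ▸ hmem p.1.2⟩
  have hi1 : ∀ p : (fib2 V.Y V.π).pt, ∀ᶠ p' in (fib2 V.Y V.π).nhds p, idx p'.1.1 = idx p.1.1 :=
    fun p => (Space.smoothMapAt_fst p).tendsto.eventually (hev_idx _)
  have hi2 : ∀ p : (fib2 V.Y V.π).pt, ∀ᶠ p' in (fib2 V.Y V.π).nhds p, idx p'.1.2 = idx p.1.2 :=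
    fun p => (Space.smoothMapAt_snd p).tendsto.eventually (hev_idx _)
  have hπ₂ : ∀ p, Space.SmoothMapAt (B := fib2 V.Y V.π) (C := Space.ofMfd X)
      (fun p => V.π p.1.1) p := fun p => (hπ _).comp (Space.smoothMapAt_fst p)
  have hes : ∀ p, (fib2 V.Y V.π).SmoothVecAt 𝕜
      (fun p => ((e (idx p.1.1) (idx p.1.2) (V.π p.1.1)).1 : A)) p := fun p => by
    refine ((he (idx p.1.1) (idx p.1.2)).smoothVecAt (B := fib2 V.Y V.π) (b := p)
      (x := fun p => V.π p.1.1) (((d.isOpen _).inter (d.isOpen _)).mem_nhds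
      (hmem₂ p)) (hπ₂ p)).congr ?_
    filter_upwards [hi1 p, hi2 p] with p' h1 h2
    rw [h1, h2]
  have hgs : ∀ p, (fib2 V.Y V.π).SmoothLinAt 𝕜
      (fun p => ((d.g (idx p.1.1) (idx p.1.2) (V.π p.1.1)).1.toLinearMap : A →ₗ[𝕜] A)) p :=
    fun p => d.smoothLinAt_g (hπ₂ p) (hi1 p) (hi2 p) (hmem₂ p)
  have hN : ∀ {f : (fib2 V.Y V.π).pt → V.Y} (n : (fib2 V.Y V.π).pt → A) (p),
      Space.SmoothMapAt (C := Space.ofMfd V.Y) f p →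
      (pullSec (B := fib2 V.Y V.π) (C := Space.ofMfd V.Y) (V := fun _ => A) 𝕜 f
        (fun s y => (Space.ofMfd V.Y).SmoothVecAt 𝕜 s y) n p ↔ (fib2 V.Y V.π).SmoothVecAt 𝕜 n p) :=
    fun {f} n p hf => ((isTriv_const (B := Space.ofMfd V.Y) (f p)).pull hf).smooth_iff n
  refine ⟨Lift.refl V, ⟨{
    idx := fun y => r (idx y)
    idx_loc := hidx.comp r
    mem := fun y => hU _ (hmem y)
    N := fun y => SBimod.twistSelf (hτi y) (h (idx y) (V.π y))
    smooth := fun s y => (Space.ofMfd V.Y).SmoothVecAt (F := A) 𝕜 s y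
    loc := fun y => ⟨A, A, SBimod.self A, τ, fun y => (h (idx y) (V.π y)).1.toLinearMap,
      fun _ => (LinearMap.id : A →ₗ[𝕜] A), (hτ y).pull (Space.smoothMapAt_id y),
      isAlgTriv_const (hhs y) (Filter.Eventually.of_forall fun _ => evenAut.isSAlgIso _),
      isTriv_const y, Filter.Eventually.of_forall fun _ => ⟨fun _ _ hm => hm, fun _ _ => rfl,
        fun _ _ => rfl⟩⟩
    inv := fun y => SBimod.invertible_twistSelf _ _
    act := fun p => SBimod.mulMap (θ p) (d.g (idx p.1.1) (idx p.1.2) (V.π p.1.1))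
      (e (idx p.1.1) (idx p.1.2) (V.π p.1.1))
    isAct := fun p => ?_
    smooth_act := fun p k n hk hn => ?_
    act_μ := fun q k k' n => ?_ }⟩⟩
  · refine SBimod.isAct_twistSelf _ _ (hθ p).bijective (hev p) (hl p) (hr p) ?_
    have := h₂ _ _ _ (hmem₂ p)
    rw [show V.π p.1.2 = V.π p.1.1 from p.2.symm]
    exact this
  · have hk' : (fib2 V.Y V.π).SmoothVecAt 𝕜 (fun p => θ p (k p)) p :=
      ((hθ p).smooth_iff k).1 ((pullSec_id (V.ℳ.isVBAt p) k).1 hk)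
    have hn' := (hN n p (Space.smoothMapAt_fst p)).1 hn
    exact (hN _ p (Space.smoothMapAt_snd p)).2 (smooth_bilin (LinearMap.mul 𝕜 A)
      (smooth_bilin (LinearMap.mul 𝕜 A) hk' ((hgs p).apply hn')) (hes p))
  · have hx₂ : V.π q.1.2.1 = V.π q.1.1 := q.2.1.symm
    have hx₃ : V.π q.1.2.2 = V.π q.1.1 := (q.2.1.trans q.2.2).symm
    have hm : V.π q.1.1 ∈ d.U (idx q.1.1) ∩ d.U (idx q.1.2.1) ∩ d.U (idx q.1.2.2) :=
      ⟨⟨hmem _, hx₂ ▸ hmem q.1.2.1⟩, hx₃ ▸ hmem q.1.2.2⟩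
    have h1 := hμ q k k'
    have h2 := h₃ _ _ _ _ hm
    have h3 := d.cocycle_g _ _ _ _ hm
    change θ (pr13 q) ((V.μ q).toLin (SBimod.tmul k k')) *
        (d.g (idx q.1.1) (idx q.1.2.2) (V.π q.1.1)).1 (show A from n) *
        ((e (idx q.1.1) (idx q.1.2.2) (V.π q.1.1)).1 : A) =
      θ (pr23 q) k * (d.g (idx q.1.2.1) (idx q.1.2.2) (V.π q.1.2.1)).1
        (θ (pr12 q) k' * (d.g (idx q.1.1) (idx q.1.2.1) (V.π q.1.1)).1 (show A from n) *
          ((e (idx q.1.1) (idx q.1.2.1) (V.π q.1.1)).1 : A)) *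
        ((e (idx q.1.2.1) (idx q.1.2.2) (V.π q.1.2.1)).1 : A) *
        (h (idx q.1.2.2) (V.π q.1.2.2)).1
          (((c.a (r (idx q.1.1)) (r (idx q.1.2.1)) (r (idx q.1.2.2)) (V.π q.1.1))⁻¹).1 : A)
    rw [h1, hx₂, hx₃]
    generalize V.π q.1.1 = x at *
    exact mul_act_eq h3 h2 _ _ _

end AssociatedPres

section CocycleBundle

variable {𝕜 : Type} [RCLike 𝕜] {X : Mfd.{u}} {A : SAlg.{u} 𝕜}

/-- Evaluation of semilinear endomorphisms of `A` at `1`. -/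
def evalOne (g : evenAut A) : SBimod.homBimod (SBimod.self A) (SBimod.self A) g →ₗ[𝕜] A :=
  (SBimod.homEval (SBimod.self A) (SBimod.self A) g).flip (1 : A)

theorem homEval_eq {g : evenAut A} (f : SBimod.homBimod (SBimod.self A) (SBimod.self A) g) (n : A) :
    SBimod.homEval (SBimod.self A) (SBimod.self A) g f n = evalOne g f * g.1 n :=
  (congrArg (SBimod.homEval (SBimod.self A) (SBimod.self A) g f) (one_mul n).symm).trans
    (SBimod.homEval_right f n (1 : A))

theorem evalOne_bijective (g : evenAut A) : Function.Bijective (evalOne g) := by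
  refine ⟨fun f f' h => SBimod.homBimod_ext fun n => ?_, fun v => ?_⟩
  · exact (homEval_eq f n).trans ((congrArg (· * g.1 (show A from n)) h).trans (homEval_eq f' n).symm)
  · let F : A →ₗ[𝕜] A := LinearMap.mulLeft 𝕜 v ∘ₗ g.1.toLinearMap
    refine ⟨⟨F, fun c n => ?_⟩, ?_⟩
    · change v * g.1 ((show A from n) * c) = v * g.1 (show A from n) * g.1 c
      rw [map_mul, mul_assoc]
    · change v * g.1 1 = v
      rw [map_one, mul_one]

theorem isAlgTriv_id {B : Space.{u}} (b : B.pt) :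
    IsAlgTriv (A := fun _ => A) (fun s b => B.SmoothVecAt 𝕜 s b) (fun _ => LinearMap.id) b :=
  isAlgTriv_const (fun v => Space.smoothVecAt_const v)
    (Filter.Eventually.of_forall fun _ => SBimod.isSAlgIso_id A)

theorem isTriv_evalOne {B : Space.{u}} {g : B.pt → evenAut A} {S S' : Sec B (fun _ => A)}
    (hS : S = fun s b => B.SmoothVecAt 𝕜 s b) (hS' : S' = fun s b => B.SmoothVecAt 𝕜 s b)
    (hg : ∀ b, B.SmoothLinAt 𝕜 (fun b => ((g b).1.toLinearMap : A →ₗ[𝕜] A)) b) (b : B.pt) :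
    IsTriv (homSec (N := fun _ => SBimod.self A) (N' := fun _ => SBimod.self A) S S' g)
      (fun b => evalOne (g b)) b := by
  subst hS hS'
  refine Filter.Eventually.of_forall fun b => ⟨evalOne_bijective _, fun s => ⟨fun h => ?_,
    fun h n hn => ?_⟩⟩
  · exact h (fun _ => (1 : A)) (Space.smoothVecAt_const (1 : A))
  · have := smooth_bilin (LinearMap.mul 𝕜 A) h ((hg b).apply hn)
    exact this.congr (Filter.Eventually.of_forall fun b => (homEval_eq (s b) (n b)).symm)

theorem evalOne_mem {g : evenAut A} {i : ZMod 2}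
    {f : SBimod.homBimod (SBimod.self A) (SBimod.self A) g}
    (hf : f ∈ (SBimod.homBimod (SBimod.self A) (SBimod.self A) g).gr i) :
    evalOne g f ∈ A.gr i := by
  have h := SBimod.mem_gr_add (act := SBimod.homEval (SBimod.self A) (SBimod.self A) g)
    SBimod.par_homEval i 0 f (1 : A) hf A.one_mem
  rwa [add_zero] at h

theorem evalOne_right {g : evenAut A} (b : A)
    (f : SBimod.homBimod (SBimod.self A) (SBimod.self A) g) :
    evalOne g ((SBimod.homBimod (SBimod.self A) (SBimod.self A) g).right b f) =
      evalOne g f * g.1 b := by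
  have h := (SBimod.isAct_hom (N := SBimod.self A) (N' := SBimod.self A) (g := g)
    (SBimod.invertible_self A)).bal f b (1 : A)
  refine h.trans (Eq.trans ?_ (homEval_eq f b))
  exact congrArg (SBimod.homEval (SBimod.self A) (SBimod.self A) g f) (mul_one b)

theorem evalOne_left {g : evenAut A} (a : A)
    (f : SBimod.homBimod (SBimod.self A) (SBimod.self A) g) :
    evalOne g ((SBimod.homBimod (SBimod.self A) (SBimod.self A) g).left a f) = a * evalOne g f :=
  (SBimod.isAct_hom (N := SBimod.self A) (N' := SBimod.self A) (g := g)
    (SBimod.invertible_self A)).left a f (1 : A)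

namespace Cocycle

variable (c : Cocycle A X)

/-- The trivial frame over the disjoint union of the open sets of a cocycle. -/
def stdFrame [Countable c.ι] : Frame c where
  Y := X.sigma c.U c.isOpen
  π := Mfd.sigmaπ c.isOpen
  π_surj := fun x => (c.cover x).elim fun k hk => ⟨⟨k, x, hk⟩, rfl⟩
  π_subm := X.etaleCharted_isSubmersion (X.isLocalHomeomorph_sigma c.isOpen)
  idx := Mfd.sigmaIdx c.isOpen
  idx_loc := Mfd.isLocallyConstant_sigmaIdx c.isOpen
  mem := fun y => y.2.2
  𝒜 := AlgBundle.const _ A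
  N := fun _ => SBimod.self A
  smooth := fun s y => (Space.ofMfd _).SmoothVecAt (F := A) 𝕜 s y
  loc := fun y => ⟨A, A, SBimod.self A, fun _ => LinearMap.id, fun _ => LinearMap.id,
    fun _ => LinearMap.id, isAlgTriv_id y, isAlgTriv_id y,
    isTriv_const y, Filter.Eventually.of_forall fun _ =>
      ⟨fun _ _ hm => hm, fun _ _ => rfl, fun _ _ => rfl⟩⟩
  inv := fun _ => SBimod.invertible_self A

/-- The super 2-vector bundle of a cocycle. -/
def toTwoVB [Countable c.ι] : TwoVB.{u} 𝕜 X :=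
  (actFamily (fun _ : Unit => c.stdFrame) fun _ _ => Frame.homAct _ _).toTwoVB ()

theorem isAssociatedTo_toTwoVB [Countable c.ι] : c.toTwoVB.IsAssociatedTo c := by
  have hpull : ∀ {f : (fib12 c.stdFrame.π c.stdFrame.π).pt → c.stdFrame.Y},
      (∀ p, Space.SmoothMapAt (C := Space.ofMfd c.stdFrame.Y) f p) →
      pullSec (B := fib12 c.stdFrame.π c.stdFrame.π) (C := Space.ofMfd c.stdFrame.Y)
        (V := fun _ => A) 𝕜 f (fun s y => (Space.ofMfd c.stdFrame.Y).SmoothVecAt 𝕜 s y) =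
      fun s p => (fib12 c.stdFrame.π c.stdFrame.π).SmoothVecAt 𝕜 s p :=
    fun {f} hf => pullSec_const_eq hf
  refine ⟨c.stdFrame.idx, fun _ => LinearMap.id, fun p => evalOne (Frame.g c.stdFrame c.stdFrame p),
    c.stdFrame.idx_loc, X.etaleCharted_isLocalDiffeomorph (X.isLocalHomeomorph_sigma c.isOpen),
    c.stdFrame.mem, ?_, isAlgTriv_id, fun p => ?_, fun p i m hm => evalOne_mem hm,
    fun p a m => evalOne_left a m, fun p b m => evalOne_right b m, fun q m n => ?_⟩
  · intro k x hx
    refine ⟨⟨k, x, hx⟩, ⟨rfl, rfl⟩, ?_⟩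
    rintro ⟨l, z, hz⟩ ⟨h1, h2⟩
    change l = k at h1
    change z = x at h2
    subst h1 h2
    rfl
  · exact isTriv_evalOne (hpull (f := fun p => p.1.1) Space.smoothMapAt_fst)
      (hpull (f := fun p => p.1.2) Space.smoothMapAt_snd) (c.stdFrame.smoothLinAt_g c.stdFrame) p
  · have h := (Frame.homAct c.stdFrame c.stdFrame).act_mul (Frame.homAct c.stdFrame c.stdFrame)
      (Frame.homAct c.stdFrame c.stdFrame) q.2.1 q.2.2 m n (1 : A)
    have h1 : ∀ (g : evenAut A) (m : SBimod.homBimod (SBimod.self A) (SBimod.self A) g) (x a : A),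
        (SBimod.self A).right a (SBimod.homEval (SBimod.self A) (SBimod.self A) g m x) =
          evalOne g m * g.1 x * a := fun g m x a => congrArg (· * a) (homEval_eq m x)
    have hx : c.stdFrame.π q.1.2.1 = c.stdFrame.π q.1.1 := q.2.1.symm
    refine h.trans ((h1 _ m _ _).trans ?_)
    exact congrArg (fun x => evalOne (Frame.g c.stdFrame c.stdFrame (pr23 q)) m *
      (c.g (c.stdFrame.idx q.1.2.1) (c.stdFrame.idx q.1.2.2) x).1
        (evalOne (Frame.g c.stdFrame c.stdFrame (pr12 q)) n) *
      (((c.a (c.stdFrame.idx q.1.1) (c.stdFrame.idx q.1.2.1) (c.stdFrame.idx q.1.2.2)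
        (c.stdFrame.π q.1.1))⁻¹).1 : A)) hx

theorem ofMoritaClass_toTwoVB [Countable c.ι] : c.toTwoVB.OfMoritaClass A := fun y =>
  ⟨A, fun _ => LinearMap.id, isAlgTriv_id y, SBimod.self A, SBimod.invertible_self A⟩

end Cocycle
end CocycleBundle

section Restriction

variable {𝕜 : Type} [RCLike 𝕜] {X : Mfd.{u}} {A : SAlg.{u} 𝕜}

theorem innerAut_one : innerAut (1 : evenUnits A) = 1 := by
  refine Subtype.ext (AlgEquiv.ext fun a => ?_)
  change (1 : A) * a * ((1 : (A : Type u)ˣ)⁻¹ : (A : Type u)ˣ) = a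
  simp

theorem autAct_one (a : evenUnits A) : autAct 1 a = a := Subtype.ext (Units.ext rfl)

theorem autAct_apply_one (φ : evenAut A) : autAct φ (1 : evenUnits A) = 1 :=
  Subtype.ext (Units.ext (map_one φ.1))

theorem smoothAutOn_one (U : Set X) : SmoothAutOn X (fun _ => (1 : evenAut A)) U :=
  fun _ _ => contMDiffOn_const

theorem smoothUnitsOn_one (U : Set X) : SmoothUnitsOn X (fun _ => (1 : evenUnits A)) U :=
  fun _ => contMDiffOn_const

theorem TwoVB.IsAssociatedTo.exists_pres_restrict {V : TwoVB.{u} 𝕜 X} {d c : Cocycle A X}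
    (hV : V.IsAssociatedTo d) (r : d.ι → c.ι) (hU : ∀ k, d.U k ⊆ c.U (r k))
    (hg : ∀ k l, d.g k l = c.g (r k) (r l)) (ha : ∀ k l m, d.a k l m = c.a (r k) (r l) (r m)) :
    V.Presented c :=
  hV.exists_pres r (fun _ _ => 1) (fun _ _ _ => 1) hU (fun _ => smoothAutOn_one _)
    (fun _ _ => smoothUnitsOn_one _) (fun k l x _ => by rw [innerAut_one, hg]; simp)
    fun k l m x _ => by rw [autAct_one, autAct_apply_one, ha]; simp

namespace Cocycle

/-- The restriction of a cocycle to a refinement of its cover. -/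
abbrev restrict (c : Cocycle A X) {κ : Type u} (W : κ → Set X) (hW : ∀ k, IsOpen (W k))
    (hc : ∀ x, ∃ k, x ∈ W k) (r : κ → c.ι) (hr : ∀ k, W k ⊆ c.U (r k)) : Cocycle A X where
  ι := κ
  U := W
  isOpen := hW
  cover := hc
  g := fun k l => c.g (r k) (r l)
  a := fun k l m => c.a (r k) (r l) (r m)
  g_smooth := fun k l f b => (c.g_smooth _ _ f b).mono (Set.inter_subset_inter (hr k) (hr l))
  a_smooth := fun k l m f => (c.a_smooth _ _ _ f).mono
    (Set.inter_subset_inter (Set.inter_subset_inter (hr k) (hr l)) (hr m))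
  cocycle_g := fun k l m x hx => c.cocycle_g _ _ _ x ⟨⟨hr k hx.1.1, hr l hx.1.2⟩, hr m hx.2⟩
  cocycle_a := fun k l m n x hx => c.cocycle_a _ _ _ _ x
    ⟨⟨⟨hr k hx.1.1.1, hr l hx.1.1.2⟩, hr m hx.1.2⟩, hr n hx.2⟩

theorem Equivalent.refl (c : Cocycle A X) : c.Equivalent c :=
  ⟨c.ι, c.U, id, id, fun _ _ => 1, fun _ _ _ => 1, c.isOpen, c.cover, fun _ => subset_rfl,
    fun _ => subset_rfl, fun _ => smoothAutOn_one _, fun _ _ => smoothUnitsOn_one _,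
    fun k l x _ => by rw [innerAut_one]; simp,
    fun k l m x _ => by rw [autAct_one, autAct_apply_one]; simp⟩

end Cocycle

theorem exists_countable_subcover {κ : Type u} (W : κ → Set X) (hW : ∀ k, IsOpen (W k))
    (hc : ∀ x, ∃ k, x ∈ W k) : ∃ s : Set κ, Countable s ∧ ∀ x, ∃ k : s, x ∈ W k := by
  obtain ⟨s, hs, he⟩ := TopologicalSpace.isOpen_iUnion_countable W hW
  refine ⟨s, hs, fun x => ?_⟩
  have : x ∈ ⋃ k ∈ s, W k := he ▸ Set.mem_iUnion.2 (hc x)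
  obtain ⟨k, hk, hx⟩ := Set.mem_iUnion₂.1 this
  exact ⟨⟨k, hk⟩, hx⟩

theorem Cocycle.Equivalent.exists_twoVB {c c' : Cocycle A X} (h : c.Equivalent c') :
    ∃ V : TwoVB.{u} 𝕜 X, V.OfMoritaClass A ∧ V.Presented c ∧ V.Presented c' := by
  obtain ⟨κ, W, r, r', h, e, hW, hc, hr, hr', hh, he, h₂, h₃⟩ := h
  obtain ⟨s, hs, hsc⟩ := exists_countable_subcover W hW hc
  let d := c'.restrict (fun k : s => W k) (fun k => hW k) hsc (fun k => r' k) (fun k => hr' k)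
  have : Countable d.ι := hs
  exact ⟨d.toTwoVB, d.ofMoritaClass_toTwoVB, d.isAssociatedTo_toTwoVB.exists_pres (fun k => r k)
    (fun k => h k) (fun k l => e k l) (fun k => hr k) (fun k => hh k) (fun k l => he k l)
    (fun k l => h₂ k l) (fun k l m => h₃ k l m),
    d.isAssociatedTo_toTwoVB.exists_pres_restrict (fun k => r' k) (fun k => hr' k)
      (fun _ _ => rfl) fun _ _ _ => rfl⟩

theorem TwoVB.IsAssociatedTo.exists_pres_self {V : TwoVB.{u} 𝕜 X} {c : Cocycle A X}
    (hV : V.IsAssociatedTo c) : V.Presented c :=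
  hV.exists_pres_restrict id (fun _ => subset_rfl) (fun _ _ => rfl) fun _ _ _ => rfl

end Restriction

section CompareActions

variable {𝕜 : Type} [RCLike 𝕜] {A A₁ A₂ A₃ : SAlg.{u} 𝕜}

namespace SBimod

variable {K₁₂ : SBimod A₂ A₁} {K₂₃ : SBimod A₃ A₂} {N₁ : SBimod A₁ A} {N₂ : SBimod A₂ A}
  {N₃ : SBimod A₃ A} {g₁₂ g₂₃ : evenAut A} {act₁₂ : K₁₂ →ₗ[𝕜] N₁ →ₗ[𝕜] N₂}
  {act₂₃ : K₂₃ →ₗ[𝕜] N₂ →ₗ[𝕜] N₃}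

/-- The composite of two actions, an action of the tensor product. -/
def compAct (h₁₂ : IsAct K₁₂ N₁ N₂ g₁₂ act₁₂) (h₂₃ : IsAct K₂₃ N₂ N₃ g₂₃ act₂₃) :
    tensor K₂₃ K₁₂ →ₗ[𝕜] N₁ →ₗ[𝕜] N₃ :=
  tensorLift (LinearMap.mk₂ 𝕜 (fun k k' => act₂₃ k ∘ₗ act₁₂ k')
    (fun _ _ _ => by ext; simp) (fun _ _ _ => by ext; simp) (fun _ _ _ => by ext; simp)
    (fun _ _ _ => by ext; simp))
    fun k b k' => LinearMap.ext fun n => by simp [h₂₃.bal, h₁₂.left]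

theorem compAct_tmul (h₁₂ : IsAct K₁₂ N₁ N₂ g₁₂ act₁₂) (h₂₃ : IsAct K₂₃ N₂ N₃ g₂₃ act₂₃) (k k' n) :
    compAct h₁₂ h₂₃ (tmul k k') n = act₂₃ k (act₁₂ k' n) :=
  LinearMap.congr_fun (tensorLift_tmul _ _ k k') n

theorem IsAct.comp (h₁₂ : IsAct K₁₂ N₁ N₂ g₁₂ act₁₂) (h₂₃ : IsAct K₂₃ N₂ N₃ g₂₃ act₂₃) :
    IsAct (tensor K₂₃ K₁₂) N₁ N₃ (g₂₃ * g₁₂) (compAct h₁₂ h₂₃) := by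
  have bal : ∀ k a n, compAct h₁₂ h₂₃ ((tensor K₂₃ K₁₂).right a k) n =
      compAct h₁₂ h₂₃ k (N₁.left a n) := fun t a n => by
    induction t using tensor_induction with
    | h0 => simp
    | ht k k' => rw [right_tmul, compAct_tmul, compAct_tmul, h₁₂.bal]
    | hadd x y hx hy => simp only [map_add, LinearMap.add_apply, hx, hy]
  refine ⟨bal, fun a t n => ?_, fun t n c => ?_, fun t n => ?_, ?_⟩
  · induction t using tensor_induction with
    | h0 => simp
    | ht k k' => rw [left_tmul, compAct_tmul, compAct_tmul, h₂₃.left]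
    | hadd x y hx hy => simp only [map_add, LinearMap.add_apply, hx, hy]
  · induction t using tensor_induction with
    | h0 => simp
    | ht k k' => rw [compAct_tmul, compAct_tmul, h₁₂.right, h₂₃.right]; rfl
    | hadd x y hx hy => simp only [map_add, LinearMap.add_apply, hx, hy]
  · induction t using tensor_induction with
    | h0 => simp
    | ht k k' => rw [compAct_tmul, par_tmul, compAct_tmul, h₂₃.par, h₁₂.par]
    | hadd x y hx hy => simp only [map_add, LinearMap.add_apply, hx, hy]
  · let e₁₂ := LinearEquiv.ofBijective _ h₁₂.bij
    let e₂₃ := LinearEquiv.ofBijective _ h₂₃.bij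
    have he₁₂ : ∀ k n, e₁₂ (tmul k n) = act₁₂ k n := fun k n => tensorLift_tmul act₁₂ h₁₂.bal k n
    let Φ : tensor (tensor K₂₃ K₁₂) N₁ ≃ₗ[𝕜] N₃ := (assoc K₂₃ K₁₂ N₁).trans
      ((tensorEquiv (LinearEquiv.refl 𝕜 K₂₃) e₁₂ (Equiv.refl A₂) (fun _ _ => rfl) fun b t => by
        induction t using tensor_induction with
        | h0 => simp
        | ht k n => rw [left_tmul, he₁₂, he₁₂, h₁₂.left]; rfl
        | hadd x y hx hy => simp only [map_add, hx, hy]).trans e₂₃)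
    have hΦ : tensorLift (compAct h₁₂ h₂₃) bal = Φ.toLinearMap := tensor_hom_ext fun t n => by
      rw [tensorLift_tmul]
      induction t using tensor_induction with
      | h0 => simp [← tmulL_apply]
      | ht k k' =>
        rw [compAct_tmul]
        simp only [Φ, LinearEquiv.coe_coe, LinearEquiv.trans_apply, assoc_tmul]
        rfl
      | hadd x y hx hy => simp only [add_tmul, map_add, LinearMap.add_apply, hx, hy]
    rw [hΦ]
    exact Φ.bijective

theorem IsAct.precomp {K K' : SBimod A₂ A₁} {act : K →ₗ[𝕜] N₁ →ₗ[𝕜] N₂} (h : IsAct K N₁ N₂ g₁₂ act)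
    (f : Hom K' K) (hf : Function.Bijective f.toLin) :
    IsAct K' N₁ N₂ g₁₂ (act ∘ₗ f.toLin) := by
  have bal : ∀ k a n, (act ∘ₗ f.toLin) (K'.right a k) n = (act ∘ₗ f.toLin) k (N₁.left a n) :=
    fun k a n => by simp [f.map_right, h.bal]
  refine ⟨bal, fun a k n => by simp [f.map_left, h.left], fun k n c => by simp [h.right],
    fun k n => ?_, ?_⟩
  · have := (even_iff_parity K'.isCompl K.isCompl).1 (fun i v => f.even (i := i) (m := v)) k
    rw [LinearMap.comp_apply, h.par, LinearMap.comp_apply]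
    exact congrArg (fun z => act z (N₁.par n)) this
  · let e := LinearEquiv.ofBijective f.toLin hf
    let T := tensorEquiv (M := K') (M₀ := K) (N := N₁) (N₀ := N₁) e (LinearEquiv.refl 𝕜 N₁)
      (Equiv.refl A₁) (fun b m => f.map_right b m) fun _ _ => rfl
    have hT : tensorLift (act ∘ₗ f.toLin) bal = tensorLift act h.bal ∘ₗ T.toLinearMap :=
      tensor_hom_ext fun k n => by
        rw [tensorLift_tmul]
        exact (tensorLift_tmul act h.bal (f.toLin k) n).symm
    rw [hT]
    exact h.bij.comp T.bijective

/-- The elements `act k n` generate. -/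
theorem IsAct.induction {K : SBimod A₂ A₁} {act : K →ₗ[𝕜] N₁ →ₗ[𝕜] N₂} {g : evenAut A}
    (h : IsAct K N₁ N₂ g act) {p : N₂ → Prop} (h0 : p 0) (ht : ∀ k n, p (act k n))
    (hadd : ∀ x y, p x → p y → p (x + y)) (m : N₂) : p m := by
  obtain ⟨t, rfl⟩ := h.bij.2 m
  refine tensor_induction t (by rwa [map_zero]) (fun k n => by rw [tensorLift_tmul]; exact ht k n)
    fun x y hx hy => by rw [map_add]; exact hadd _ _ hx hy

theorem IsAct.exists_unit {K : SBimod A₂ A₁} {act act' : K →ₗ[𝕜] N₁ →ₗ[𝕜] N₂} {g g' : evenAut A}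
    (h : IsAct K N₁ N₂ g act) (h' : IsAct K N₁ N₂ g' act') (hN : N₂.Invertible) :
    ∃ e : evenUnits A, (∀ k n, act' k n = N₂.right (e.1 : A) (act k n)) ∧ g = innerAut e * g' := by
  let a := LinearEquiv.ofBijective _ h.bij
  let a' := LinearEquiv.ofBijective _ h'.bij
  have ha : ∀ k n, a (tmul k n) = act k n := fun k n => tensorLift_tmul act h.bal k n
  have ha' : ∀ k n, a' (tmul k n) = act' k n := fun k n => tensorLift_tmul act' h'.bal k n
  let f : N₂ →ₗ[𝕜] N₂ := a'.toLinearMap ∘ₗ a.symm.toLinearMap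
  have hfa : ∀ t, f (a t) = a' t := fun t => congrArg a' (a.symm_apply_apply t)
  have hf : ∀ k n, f (act k n) = act' k n := fun k n => by rw [← ha, hfa, ha']
  obtain ⟨e, he⟩ := hN.exists_unit f ((a.symm.trans a').bijective)
    (fun b m => h.induction (p := fun m => f (N₂.left b m) = N₂.left b (f m)) (by simp)
      (fun k n => by rw [← h.left, hf, hf, h'.left]) (fun x y hx hy => by simp only [map_add, hx, hy]) m)
    (h.induction (by simp) (fun k n => by rw [hf, h.par, h'.par, hf])
      fun x y hx hy => by simp only [map_add, hx, hy])
  refine ⟨e, fun k n => by rw [← hf, he], Subtype.ext (AlgEquiv.ext fun c => ?_)⟩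
  have h1 : g.1 c * (e.1 : A) = (e.1 : A) * g'.1 c := by
    refine hN.right_injective (LinearMap.ext fun m => ?_)
    refine h.induction (p := fun m => N₂.right _ m = N₂.right _ m) (by simp) (fun k n => ?_)
      (fun x y hx hy => by simp only [map_add, hx, hy]) m
    rw [N₂.right_mul, N₂.right_mul, ← h.right, ← he, ← he, hf, hf, h'.right]
  change g.1 c = (e.1 : A) * g'.1 c * ((e⁻¹).1 : A)
  rw [← h1, mul_assoc, show (e.1 : A) * ((e⁻¹).1 : A) = 1 from Units.mul_inv e.1, mul_one]

theorem exists_sum_tmul_finrank {M : SBimod A₃ A₂} {N : SBimod A₂ A₁} (t : tensor M N) :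
    ∃ (m : Fin (Module.finrank 𝕜 M) → M) (n : Fin (Module.finrank 𝕜 M) → N),
      t = ∑ i, tmul (m i) (n i) := by
  let b := Module.finBasis 𝕜 M
  suffices h : ∃ n : Fin (Module.finrank 𝕜 M) → N, t = ∑ i, tmul (b i) (n i) from ⟨b, h⟩
  refine tensor_induction t ⟨0, by simp [← tmulL_apply]⟩ (fun m n => ⟨fun i => b.repr m i • n, ?_⟩) ?_
  · conv_lhs => rw [← b.sum_repr m]
    simp only [← tmulL_apply, map_sum, map_smul, LinearMap.sum_apply, LinearMap.smul_apply]
  · rintro x y ⟨n, rfl⟩ ⟨n', rfl⟩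
    exact ⟨n + n', by simp [tmul_add, Finset.sum_add_distrib]⟩

end SBimod

section SmoothUnit

variable {B : Space.{u}} {b₀ : B.pt} {A₂ : B.pt → SAlg.{u} 𝕜} {S₂ : Sec B (fun b => (A₂ b).carrier)}
  {N : ∀ b, SBimod (A₂ b) A} {SN : Sec B (fun b => (N b).carrier)}

theorem smoothVecAt_unit
    (hN : LocBimod (A₂ := fun _ => A) S₂ (fun s b => B.SmoothVecAt 𝕜 s b) N SN b₀)
    (hi : (N b₀).Invertible) {e : B.pt → A} {T : Set (N b₀)} (hT : ⊤ ≤ Submodule.span 𝕜 T)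
    (h : ∀ v ∈ T, ∃ s : ∀ b, N b, s b₀ = v ∧ SN s b₀ ∧ SN (fun b => (N b).right (e b) (s b)) b₀) :
    B.SmoothVecAt 𝕜 e b₀ := by
  refine IsVBAt.smooth_of_action (V := fun _ => A.carrier) (W := fun b => (N b).carrier)
    (U := fun b => (N b).carrier) (isTriv_const b₀).isVBAt hN.isVBAt
    hN.isVBAt (fun b => (N b).right) (fun v w hv hw => hN.smooth_right hv hw)
    (fun v hv => hi.eq_zero_of_right hv) fun w hw => ?_
  obtain ⟨n, f, hf⟩ : ∃ (n : ℕ) (f : Fin n → T), ⊤ ≤ Submodule.span 𝕜 (Set.range fun i => (f i : N b₀)) := by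
    obtain ⟨t, ht, he⟩ := (Submodule.fg_span_iff_fg_span_finset_subset (R := 𝕜) T).1
      (IsNoetherian.noetherian _)
    refine ⟨t.card, fun i => ⟨t.equivFin.symm i, ht (t.equivFin.symm i).2⟩, ?_⟩
    rw [he] at hT
    refine hT.trans (Submodule.span_mono fun v hv => ⟨t.equivFin ⟨v, hv⟩, ?_⟩)
    simp
  choose s h1 h2 h3 using fun i => h (f i) (f i).2
  obtain ⟨c, hc, hw'⟩ := hN.isVBAt.exists_coeff h2 (by simpa only [h1] using hf) hw
  refine hN.isVBAt.congr (hN.isVBAt.sum Finset.univ fun i _ => hN.isVBAt.smul (hc i) (h3 i)) ?_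
  filter_upwards [hw'] with b hb
  rw [hb, map_sum]
  simp only [map_smul]

end SmoothUnit

end CompareActions

section Morphisms

variable {𝕜 : Type} [RCLike 𝕜] {X : Mfd.{u}} {A : SAlg.{u} 𝕜} {V V' : TwoVB.{u} 𝕜 X}

theorem TwoVB.ℳ_invertible (V : TwoVB.{u} 𝕜 X) (p : (fib2 V.Y V.π).pt) : (V.ℳ.fib p).Invertible := by
  obtain ⟨𝒩, ⟨ε, hε⟩, ⟨η, hη⟩⟩ := V.ℳ_inv
  exact ⟨𝒩.fib p, ⟨ε p, hε.1 p⟩, ⟨η p, hη.1 p⟩⟩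

theorem SBimod.isomorphic_twistL_ofEq {A₁ A₂ B : SAlg.{u} 𝕜} (h : A₁ = A₂) (M : SBimod A₂ B)
    {C : SAlg.{u} 𝕜} (L : SBimod C A₁) (hL : (L.tensor (M.twistL (SAlgHom.ofEq h))).Invertible) :
    ∃ L' : SBimod C A₂, (L'.tensor M).Invertible := by
  subst h
  refine ⟨L, hL.of_isomorphic ((SBimod.Isomorphic.refl L).tensor_congr ?_)⟩
  exact ⟨⟨LinearMap.id, fun h => h, fun _ _ => rfl, fun _ _ => rfl⟩, Function.bijective_id⟩

theorem SBimod.Invertible.of_tensor {A B C D : SAlg.{u} 𝕜} {M : SBimod A B} {L : SBimod C A}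
    {R : SBimod B D} (hL : (SBimod.tensor L M).Invertible) (hR : (SBimod.tensor M R).Invertible) :
    M.Invertible := by
  obtain ⟨L', -, h1⟩ := hL
  obtain ⟨R', h2, -⟩ := hR
  exact of_inverses (L := SBimod.tensor L' L) (R := SBimod.tensor R R')
    ((isomorphic_assoc _ _ _).trans h1) ((isomorphic_assoc _ _ _).symm.trans h2)

theorem SBimod.IsAct.hom_ext {A₁ A₂ : SAlg.{u} 𝕜} {K : SBimod A₂ A₁} {N : SBimod A₁ A}
    {N' : SBimod A₂ A} {g : evenAut A} {act : K →ₗ[𝕜] N →ₗ[𝕜] N'} (h : IsAct K N N' g act)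
    {W : Type u} [AddCommGroup W] [Module 𝕜 W] {f f' : N' →ₗ[𝕜] W}
    (hf : ∀ k n, f (act k n) = f' (act k n)) : f = f' :=
  LinearMap.ext fun v => h.induction (p := fun v => f v = f' v) (by simp) hf
    (fun x y hx hy => by rw [map_add, map_add, hx, hy]) v

theorem CompIsoId.invertible_tensor {P : OneMor V V'} {Q : OneMor V' V} (I : CompIsoId P Q)
    (w : (compZ P Q).pt) : ((Q.bim.fib w.1.2).tensor (compP P Q w)).Invertible := by
  obtain ⟨v, rfl⟩ := I.ρ_subm.2.1 w
  have h : SBimod.Isomorphic ((Q.bim.fib (I.ρ v).1.2).tensor (compP P Q (I.ρ v)))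
      (V.ℳ.fib (compζ P Q (I.ρ v))) := ⟨I.ψ v, I.ψ_iso.1 v⟩
  exact (V.ℳ_invertible _).of_isomorphic h.symm

theorem CompIsoId.invertible {P : OneMor V V'} {Q : OneMor V' V} (I : CompIsoId P Q)
    (J : CompIsoId Q P) (z : P.Z.pt) : (P.bim.fib z).Invertible := by
  obtain ⟨z₁, hz₁⟩ := Q.ζ_subm.2.1 ⟨((P.ζ z).1.2, (P.ζ z).1.1), (P.ζ z).2.symm⟩
  have e₁ : (P.ζ z).1.2 = (Q.ζ z₁).1.1 := by rw [hz₁]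
  have e₂ : (Q.ζ z₁).1.2 = (P.ζ z).1.1 := by rw [hz₁]
  obtain ⟨L, hL⟩ := SBimod.isomorphic_twistL_ofEq _ _ _ (I.invertible_tensor ⟨(z, z₁), e₁⟩)
  exact SBimod.Invertible.of_tensor hL (J.invertible_tensor ⟨(z₁, z), e₂⟩)

/-- A surjective submersion `π : Y → X` with a smooth lift to the domain of a 1-morphism. -/
structure OneMor.Lift (Q : OneMor V V') : Type (u + 1) where
  Y : Mfd.{u}
  π : Y → X
  π_surj : Function.Surjective π
  π_subm : Manifold.IsSubmersion Y.I X.I ∞ π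
  z : Y → Q.Z.pt
  z_smooth : ∀ y, Space.SmoothMapAt (B := Space.ofMfd Y) z y
  π_z : ∀ y, V.π (Q.ζ (z y)).1.1 = π y

namespace OneMor.Lift

variable {Q : OneMor V V'} (T : Q.Lift)

theorem smoothMapAt_ζ (y : T.Y) :
    Space.SmoothMapAt (B := Space.ofMfd T.Y) (fun y => Q.ζ (T.z y)) y :=
  (Q.ζ_subm.1 _).comp (T.z_smooth y)

/-- The induced lift to the source. -/
abbrev src : V.Lift where
  Y := T.Y
  π := T.π
  π_surj := T.π_surj
  π_subm := T.π_subm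
  σ := fun y => (Q.ζ (T.z y)).1.1
  σ_smooth := fun y => (Space.smoothMapAt_fst _).comp (T.smoothMapAt_ζ y)
  π_σ := T.π_z

/-- The induced lift to the target. -/
abbrev tgt : V'.Lift where
  Y := T.Y
  π := T.π
  π_surj := T.π_surj
  π_subm := T.π_subm
  σ := fun y => (Q.ζ (T.z y)).1.2
  σ_smooth := fun y => (Space.smoothMapAt_snd _).comp (T.smoothMapAt_ζ y)
  π_σ := fun y => (Q.ζ (T.z y)).2.symm.trans (T.π_z y)

/-- The induced map of fibre products. -/
abbrev zz (p : (fib12 T.π T.π).pt) : (ZZ Q.ζ).pt :=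
  ⟨(T.z p.1.1, T.z p.1.2), ((T.π_z _).trans p.2).trans (T.π_z _).symm⟩

theorem smoothMapAt_zz (p : (fib12 T.π T.π).pt) : Space.SmoothMapAt T.zz p :=
  Space.SmoothMapAt.mk_fibProd ((T.z_smooth _).comp (Space.smoothMapAt_fst _))
    ((T.z_smooth _).comp (Space.smoothMapAt_snd _))

variable {T} {c c' : Cocycle A X} (P : T.src.Pres c) (P' : T.tgt.Pres c')

/-- The unit `e` measures the failure of `γ₁` and `γ₂` to commute with the actions. -/
def Rel {p : (fib12 T.π T.π).pt}
    (γ₁ : Q.bim.fib (T.z p.1.1) →ₗ[𝕜] P.N p.1.1 →ₗ[𝕜] P'.N p.1.1)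
    (γ₂ : Q.bim.fib (T.z p.1.2) →ₗ[𝕜] P.N p.1.2 →ₗ[𝕜] P'.N p.1.2) (e : evenUnits A) : Prop :=
  ∀ (m : V'.ℳ.fib (zz2 Q.ζ (T.zz p))) (k : Q.bim.fib (T.z p.1.1)) (n : P.N p.1.1) (ι : Type)
    (_ : Fintype ι) (x : ι → Q.bim.fib (T.z p.1.2)) (y : ι → V.ℳ.fib (zz1 Q.ζ (T.zz p))),
    (Q.φ (T.zz p)).toLin (SBimod.tmul m k) = ∑ i, SBimod.tmul (x i) (y i) →
    ∑ i, γ₂ (x i) (P.act p (y i) n) = (P'.N p.1.2).right (e.1 : A) (P'.act p m (γ₁ k n))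

theorem exists_rel {p : (fib12 T.π T.π).pt}
    {γ₁ : Q.bim.fib (T.z p.1.1) →ₗ[𝕜] P.N p.1.1 →ₗ[𝕜] P'.N p.1.1}
    {γ₂ : Q.bim.fib (T.z p.1.2) →ₗ[𝕜] P.N p.1.2 →ₗ[𝕜] P'.N p.1.2} {h₁ h₂ : evenAut A}
    (hγ₁ : SBimod.IsAct (Q.bim.fib (T.z p.1.1)) (P.N p.1.1) (P'.N p.1.1) h₁ γ₁)
    (hγ₂ : SBimod.IsAct (Q.bim.fib (T.z p.1.2)) (P.N p.1.2) (P'.N p.1.2) h₂ γ₂) :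
    ∃ e : evenUnits A, Rel P P' γ₁ γ₂ e ∧
      innerAut e * h₂ * c.g (P.idx p.1.1) (P.idx p.1.2) (T.π p.1.1) =
        c'.g (P'.idx p.1.1) (P'.idx p.1.2) (T.π p.1.1) * h₁ := by
  have a := hγ₁.comp (P'.isAct p)
  have a' := ((P.isAct p).comp hγ₂).precomp (Q.φ (T.zz p)) (Q.φ_iso.1 _)
  obtain ⟨e, he, hg⟩ := a.exists_unit a' (P'.inv _)
  refine ⟨e, fun m k n ι _ x y h => ?_, by rw [mul_assoc]; exact hg.symm⟩
  have h1 := he (SBimod.tmul m k) n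
  replace h1 := h1.trans (congrArg _ (SBimod.compAct_tmul hγ₁ (P'.isAct p) m k n))
  refine Eq.trans ?_ h1
  refine Eq.trans ?_ (congrArg (fun t => SBimod.compAct (P.isAct p) hγ₂ t n) h.symm)
  simp only [map_sum, LinearMap.sum_apply]
  exact Finset.sum_congr rfl fun i _ => (SBimod.compAct_tmul _ hγ₂ _ _ _).symm

theorem rel_trans {q : (tri T.π T.π T.π).pt}
    {γ₁ : Q.bim.fib (T.z q.1.1) →ₗ[𝕜] P.N q.1.1 →ₗ[𝕜] P'.N q.1.1}
    {γ₂ : Q.bim.fib (T.z q.1.2.1) →ₗ[𝕜] P.N q.1.2.1 →ₗ[𝕜] P'.N q.1.2.1}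
    {γ₃ : Q.bim.fib (T.z q.1.2.2) →ₗ[𝕜] P.N q.1.2.2 →ₗ[𝕜] P'.N q.1.2.2} {h₁ h₃ : evenAut A}
    (hγ₁ : SBimod.IsAct (Q.bim.fib (T.z q.1.1)) (P.N q.1.1) (P'.N q.1.1) h₁ γ₁)
    (hγ₃ : SBimod.IsAct (Q.bim.fib (T.z q.1.2.2)) (P.N q.1.2.2) (P'.N q.1.2.2) h₃ γ₃)
    {e₁₂ e₂₃ e₁₃ : evenUnits A} (r₁₂ : Rel P P' (p := tri12 q) γ₁ γ₂ e₁₂)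
    (r₂₃ : Rel P P' (p := tri23 q) γ₂ γ₃ e₂₃) (r₁₃ : Rel P P' (p := tri13 q) γ₁ γ₃ e₁₃) :
    c'.a (P'.idx q.1.1) (P'.idx q.1.2.1) (P'.idx q.1.2.2) (T.π q.1.1) *
        autAct (c'.g (P'.idx q.1.2.1) (P'.idx q.1.2.2) (T.π q.1.2.1)) e₁₂ * e₂₃ =
      e₁₃ * autAct h₃ (c.a (P.idx q.1.1) (P.idx q.1.2.1) (P.idx q.1.2.2) (T.π q.1.1)) := by
  set a := c.a (P.idx q.1.1) (P.idx q.1.2.1) (P.idx q.1.2.2) (T.π q.1.1) with ha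
  set a' := c'.a (P'.idx q.1.1) (P'.idx q.1.2.1) (P'.idx q.1.2.2) (T.π q.1.1) with ha'
  set g' := c'.g (P'.idx q.1.2.1) (P'.idx q.1.2.2) (T.π q.1.2.1) with hg'
  have key : ∀ m' m k n, (P'.N q.1.2.2).right (e₁₃.1 : A) ((P'.N q.1.2.2).right ((a'⁻¹).1 : A)
        (P'.act (tri23 q) m' (P'.act (tri12 q) m (γ₁ k n)))) =
      (P'.N q.1.2.2).right (h₃.1 ((a⁻¹).1 : A)) ((P'.N q.1.2.2).right (e₂₃.1 : A)
        ((P'.N q.1.2.2).right (g'.1 (e₁₂.1 : A))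
          (P'.act (tri23 q) m' (P'.act (tri12 q) m (γ₁ k n))))) := by
    intro m' m k n
    obtain ⟨r, x, y, hxy⟩ := SBimod.exists_sum_tmul ((Q.φ (T.zz (tri12 q))).toLin (SBimod.tmul m k))
    choose x' y' hxy' using fun i => SBimod.exists_sum_tmul_finrank
      ((Q.φ (T.zz (tri23 q))).toLin (SBimod.tmul m' (x i)))
    have H := Q.φ_hom _ _ _ _ _ m' m k _ _ x y x' y' hxy hxy'
    rw [← Fintype.sum_prod_type'] at H
    have R := r₁₃ _ k n _ inferInstance _ _ H
    rw [Fintype.sum_prod_type'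
      (f := fun i j => γ₃ (x' i j) (P.act (tri13 q) (V.mul (y' i j) (y i)) n))] at R
    have L1 : ∀ i, ∑ j, γ₃ (x' i j) (P.act (tri13 q) (V.mul (y' i j) (y i)) n) =
        (P'.N q.1.2.2).right (h₃.1 ((a⁻¹).1 : A)) ((P'.N q.1.2.2).right (e₂₃.1 : A)
          (P'.act (tri23 q) m' (γ₂ (x i) (P.act (tri12 q) (y i) n)))) := by
      intro i
      rw [← r₂₃ m' (x i) (P.act (tri12 q) (y i) n) _ inferInstance _ _ (hxy' i), map_sum]
      refine Finset.sum_congr rfl fun j _ => ?_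
      rw [← hγ₃.right]
      exact congrArg _ (P.act_μ q _ _ _)
    rw [Finset.sum_congr rfl fun i _ => L1 i, ← map_sum, ← map_sum, ← map_sum,
      r₁₂ m k n _ inferInstance _ _ hxy] at R
    have R2 := congrArg ((P'.N q.1.2.2).right (e₁₃.1 : A)) (P'.act_μ q m' m (γ₁ k n))
    exact (R.trans R2).symm.trans (congrArg _ (congrArg _ ((P'.isAct (tri23 q)).right _ _ _)))
  have h : (P'.N q.1.2.2).right (((a'⁻¹).1 : A) * (e₁₃.1 : A)) =
      (P'.N q.1.2.2).right (g'.1 (e₁₂.1 : A) * (e₂₃.1 : A) * h₃.1 ((a⁻¹).1 : A)) := by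
    refine (P'.isAct (tri23 q)).hom_ext fun m' v => ?_
    refine LinearMap.congr_fun (f := (P'.N q.1.2.2).right _ ∘ₗ P'.act (tri23 q) m')
      (g := (P'.N q.1.2.2).right _ ∘ₗ P'.act (tri23 q) m')
      ((P'.isAct (tri12 q)).hom_ext fun m v => ?_) v
    refine LinearMap.congr_fun
      (f := (P'.N q.1.2.2).right _ ∘ₗ P'.act (tri23 q) m' ∘ₗ P'.act (tri12 q) m)
      (g := (P'.N q.1.2.2).right _ ∘ₗ P'.act (tri23 q) m' ∘ₗ P'.act (tri12 q) m)
      (hγ₁.hom_ext fun k n => ?_) v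
    refine ((P'.N q.1.2.2).right_mul _ _ _).trans (Eq.trans ?_
      (((P'.N q.1.2.2).right_mul _ _ _).trans
        (congrArg _ ((P'.N q.1.2.2).right_mul _ _ _))).symm)
    exact key m' m k n
  have h' := (P'.inv _).right_injective h
  have h'' : a'⁻¹ * e₁₃ = autAct g' e₁₂ * e₂₃ * autAct h₃ a⁻¹ := Subtype.ext (Units.ext h')
  have h₃' : autAct h₃ a⁻¹ = (autAct h₃ a)⁻¹ := Subtype.ext (map_inv _ a.1)
  rw [h₃', eq_mul_inv_iff_mul_eq] at h''
  rw [mul_assoc, ← h'']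
  group

end OneMor.Lift

end Morphisms

section SmoothRel

variable {𝕜 : Type} [RCLike 𝕜] {X : Mfd.{u}} {A : SAlg.{u} 𝕜} {V V' : TwoVB.{u} 𝕜 X}
  {Q : OneMor V V'} {T : Q.Lift} {c c' : Cocycle A X} (P : T.src.Pres c) (P' : T.tgt.Pres c')

namespace OneMor.Lift

theorem smoothVecAt_rel {p₀ : (fib12 T.π T.π).pt}
    {γ₁ γ₂ : ∀ y, Q.bim.fib (T.z y) →ₗ[𝕜] P.N y →ₗ[𝕜] P'.N y} {h₁ : evenAut A}
    (hγ₁ : SBimod.IsAct (Q.bim.fib (T.z p₀.1.1)) (P.N p₀.1.1) (P'.N p₀.1.1) h₁ (γ₁ p₀.1.1))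
    (hs₁ : ∀ k n, pullSec 𝕜 (B := Space.ofMfd T.Y) T.z Q.bim.smooth k p₀.1.1 →
      P.smooth n p₀.1.1 → P'.smooth (fun y => γ₁ y (k y) (n y)) p₀.1.1)
    (hs₂ : ∀ k n, pullSec 𝕜 (B := Space.ofMfd T.Y) T.z Q.bim.smooth k p₀.1.2 →
      P.smooth n p₀.1.2 → P'.smooth (fun y => γ₂ y (k y) (n y)) p₀.1.2)
    {e : (fib12 T.π T.π).pt → evenUnits A}
    (he : ∀ᶠ p in (fib12 T.π T.π).nhds p₀, Rel P P' (γ₁ p.1.1) (γ₂ p.1.2) (e p)) :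
    (fib12 T.π T.π).SmoothVecAt 𝕜 (fun p => ((e p).1 : A)) p₀ := by
  have hloc := Frame.loc_pull (D := P'.frame) (B := fib12 T.π T.π) (f := fun p => p.1.2)
    (fun b => Space.smoothMapAt_snd b) p₀
  refine smoothVecAt_unit hloc (P'.inv _)
    (T := {v | ∃ m k n, v = P'.act p₀ m (γ₁ p₀.1.1 k n)}) (fun v _ => ?_) ?_
  · refine (P'.isAct p₀).induction (p := fun v => v ∈ Submodule.span 𝕜
      {v | ∃ m k n, v = P'.act p₀ m (γ₁ p₀.1.1 k n)}) (zero_mem _) (fun m v => ?_)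
      (fun _ _ => add_mem) v
    refine hγ₁.induction (p := fun v => P'.act p₀ m v ∈ Submodule.span 𝕜
      {v | ∃ m k n, v = P'.act p₀ m (γ₁ p₀.1.1 k n)}) ?_ (fun k n => ?_)
      (fun x y hx hy => ?_) v
    · rw [map_zero]
      exact zero_mem _
    · exact Submodule.subset_span ⟨m, k, n, rfl⟩
    · rw [map_add]
      exact add_mem hx hy
  · rintro _ ⟨m, k, n, rfl⟩
    obtain ⟨σm, rfl, hm⟩ := (V'.ℳ.isVBAt _).exists_extend m
    obtain ⟨σk, rfl, hk⟩ := (Q.bim.isVBAt _).exists_extend k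
    obtain ⟨σn, rfl, hn⟩ := (P.loc _).isVBAt.exists_extend n
    refine ⟨fun p => P'.act p (σm _) (γ₁ p.1.1 (σk _) (σn _)), rfl, ?_, ?_⟩
    · refine P'.smooth_act p₀ _ _ (pullSec_of hm) ?_
      exact pullSec_of (V := fun y => (P'.N y).carrier) (f := fun p : (fib12 T.π T.π).pt => p.1.1)
        (hs₁ _ _ (pullSec_of hk) hn)
    · obtain ⟨r, x, y, hx, hy, hxy⟩ := (Q.φ_iso.2 _ (T.zz p₀)).1
        (tensorSec_tmul (pullSec_of hm) (pullSec_of hk))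
      have hsum : pullSec 𝕜 (fun p : (fib12 T.π T.π).pt => p.1.2) P'.smooth
          (fun p => ∑ i, γ₂ p.1.2 (x i (T.zz p)) (P.act p (y i (T.zz p)) (σn p.1.1))) p₀ := by
        refine IsVBAt.sum hloc.isVBAt _ fun i _ => ?_
        have hxi := (pullSec_comp (T.smoothMapAt_zz p₀) _).1 (pullSec_of (f := T.zz) (hx i))
        have hyi := (pullSec_comp (T.smoothMapAt_zz p₀) _).1 (pullSec_of (f := T.zz) (hy i))
        have hai := P.smooth_act p₀ _ _ hyi
          (pullSec_of (f := fun p : (fib12 T.π T.π).pt => p.1.1) hn)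
        refine smooth_mul_pull (T := Space.ofMfd T.Y) (p := T.z) (q := fun y => y)
          (r := fun y => y) (f := fun p : (fib12 T.π T.π).pt => p.1.2) γ₂ (fun σ τ hσ hτ => ?_)
          (Space.smoothMapAt_snd _) (Space.smoothMapAt_id _) (P'.loc _).isVBAt hxi hai
        exact (pullSec_id (P'.loc _).isVBAt _).2 (hs₂ _ _ (pullSec_of hσ) hτ)
      refine IsVBAt.congr hloc.isVBAt hsum ?_
      filter_upwards [he, (T.smoothMapAt_zz p₀).tendsto.eventually hxy] with p h1 h2
      exact h1 _ _ _ _ inferInstance _ _ h2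

end OneMor.Lift

end SmoothRel

theorem exists_local_section {Y X : Mfd.{u}} {π : Y → X}
    (hπ : Manifold.IsSubmersion Y.I X.I ∞ π) (y₀ : Y) :
    ∃ s : X → Y, s (π y₀) = y₀ ∧
      Space.SmoothMapAt (B := Space.ofMfd X) (C := Space.ofMfd Y) s (π y₀) ∧
      ∀ᶠ x in 𝓝 (π y₀), π (s x) = x := by
  obtain ⟨L, U, hU, hL, h1, h2⟩ := exists_lift hπ y₀
  have hL' : ContMDiffOn (Y.I.prod X.I) Y.I ∞ (fun p : Y × X => L p) U := hL
  have hi : ContMDiff X.I (Y.I.prod X.I) ∞ (fun x : X => ((y₀, x) : Y × X)) :=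
    contMDiff_const.prodMk contMDiff_id
  have hU' : (fun x : X => ((y₀, x) : Y × X)) ⁻¹' U ∈ 𝓝 (π y₀) :=
    hi.continuous.continuousAt hU
  refine ⟨fun x => L (y₀, x), h2 y₀ (mem_of_mem_nhds hU), ?_, ?_⟩
  · exact Space.smoothMapAt_ofMfd_of_contMDiffOn hU' (hL'.comp hi.contMDiffOn fun x hx => hx)
  · filter_upwards [hU'] with x hx
    exact h1 _ hx

section Equivalence

variable {𝕜 : Type} [RCLike 𝕜] {X : Mfd.{u}} {A : SAlg.{u} 𝕜} {V V' : TwoVB.{u} 𝕜 X}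
  {Q : OneMor V V'} {T : Q.Lift} {c c' : Cocycle A X} (P : T.src.Pres c) (P' : T.tgt.Pres c')

namespace OneMor.Lift

/-- The maps `γ` are semilinear actions of `Q` around `y`, smooth around `y`. -/
def SmoothActAt (γ : ∀ y, Q.bim.fib (T.z y) →ₗ[𝕜] P.N y →ₗ[𝕜] P'.N y) (h : T.Y → evenAut A)
    (y : T.Y) : Prop :=
  SBimod.IsAct (Q.bim.fib (T.z y)) (P.N y) (P'.N y) (h y) (γ y) ∧
  (∀ k n, pullSec 𝕜 (B := Space.ofMfd T.Y) T.z Q.bim.smooth k y →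
    P.smooth n y → P'.smooth (fun y => γ y (k y) (n y)) y) ∧
  (Space.ofMfd T.Y).SmoothLinAt 𝕜 (fun y => ((h y).1.toLinearMap : A →ₗ[𝕜] A)) y

theorem exists_smoothAct (hA : PicardSurjective A) (hQ : ∀ z, (Q.bim.fib z).Invertible) (y₀ : T.Y) :
    ∃ γ h, ∀ᶠ y in 𝓝 y₀, SmoothActAt P P' γ h y := by
  have hloc := Q.bim.locBimod_pull (C := Space.ofMfd T.Y) (f := T.z) T.z_smooth y₀
  obtain ⟨γ, h, H⟩ := exists_action (X := Space.ofMfd T.Y) (x₀ := y₀) hA hloc (P.loc y₀)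
    (P'.loc y₀) (hQ _) (P.inv _) (P'.inv _)
  exact ⟨γ, h, Space.nhds_ofMfd y₀ ▸ H⟩

theorem exists_chart (hA : PicardSurjective A) (hQ : ∀ z, (Q.bim.fib z).Invertible) (x₀ : X) :
    ∃ (W : Set X) (s : X → T.Y) (i : c.ι) (i' : c'.ι)
      (γ : ∀ y, Q.bim.fib (T.z y) →ₗ[𝕜] P.N y →ₗ[𝕜] P'.N y) (h : T.Y → evenAut A),
      IsOpen W ∧ x₀ ∈ W ∧ ∀ x ∈ W,
        Space.SmoothMapAt (B := Space.ofMfd X) (C := Space.ofMfd T.Y) s x ∧ T.π (s x) = x ∧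
        P.idx (s x) = i ∧ P'.idx (s x) = i' ∧ ∀ᶠ y in 𝓝 (s x), SmoothActAt P P' γ h y := by
  obtain ⟨y₀, rfl⟩ := T.π_surj x₀
  obtain ⟨s, hs0, hs, hπ⟩ := exists_local_section T.π_subm y₀
  obtain ⟨γ, h, H⟩ := exists_smoothAct P P' hA hQ y₀
  have hev := hs.eventually
  have ht := hs.tendsto
  rw [Space.nhds_ofMfd] at hev ht
  replace hev : ∀ᶠ x : X in 𝓝 (T.π y₀), Space.SmoothMapAt (B := Space.ofMfd X)
    (C := Space.ofMfd T.Y) s x := hev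
  have ht' : Filter.Tendsto s (𝓝 (T.π y₀)) (𝓝 y₀) := by
    have := Space.nhds_ofMfd (M := T.Y) (s (T.π y₀))
    rw [this, hs0] at ht
    exact ht
  have hall := hev.and (hπ.and ((ht'.eventually
    (P.idx_loc.eventually_eq y₀)).and ((ht'.eventually
    (P'.idx_loc.eventually_eq y₀)).and (ht'.eventually H.eventually_nhds))))
  obtain ⟨W, hW, hWo, hxW⟩ := eventually_nhds_iff.1 hall
  exact ⟨W, s, P.idx y₀, P'.idx y₀, γ, h, hWo, hxW, hW⟩

theorem equivalent (hA : PicardSurjective A) (P : T.src.Pres c) (P' : T.tgt.Pres c')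
    (hQ : ∀ z, (Q.bim.fib z).Invertible) : c.Equivalent c' := by
  classical
  choose W s i i' γ h hWo hxW H using exists_chart P P' hA hQ
  have hE : ∀ k l (p : (fib12 T.π T.π).pt), ∃ e : evenUnits A,
      SmoothActAt P P' (γ k) (h k) p.1.1 → SmoothActAt P P' (γ l) (h l) p.1.2 →
      Rel P P' (γ k p.1.1) (γ l p.1.2) e ∧
      innerAut e * h l p.1.2 * c.g (P.idx p.1.1) (P.idx p.1.2) (T.π p.1.1) =
        c'.g (P'.idx p.1.1) (P'.idx p.1.2) (T.π p.1.1) * h k p.1.1 := by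
    intro k l p
    by_cases h1 : SmoothActAt P P' (γ k) (h k) p.1.1 ∧ SmoothActAt P P' (γ l) (h l) p.1.2
    · obtain ⟨e, he⟩ := exists_rel P P' h1.1.1 h1.2.1
      exact ⟨e, fun _ _ => he⟩
    · exact ⟨1, fun h2 h3 => (h1 ⟨h2, h3⟩).elim⟩
  choose E hE using hE
  have hp : ∀ k l, ∀ x ∈ W k ∩ W l, T.π (s k x) = T.π (s l x) := fun k l x hx =>
    (H k x hx.1).2.1.trans (H l x hx.2).2.1.symm
  let e : X → X → X → evenUnits A := fun k l x =>
    if hx : T.π (s k x) = T.π (s l x) then E k l ⟨(s k x, s l x), hx⟩ else 1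
  have he : ∀ k l x (hx : x ∈ W k ∩ W l), e k l x = E k l ⟨(s k x, s l x), hp k l x hx⟩ :=
    fun k l x hx => dif_pos _
  have hact : ∀ k, ∀ x ∈ W k, SmoothActAt P P' (γ k) (h k) (s k x) :=
    fun k x hx => (H k x hx).2.2.2.2.self_of_nhds
  refine ⟨X, W, i, i', fun k x => h k (s k x), e, hWo, fun x => ⟨x, hxW x⟩, fun k x hx => ?_,
    fun k x hx => ?_, fun k l b => ?_, fun k l f => ?_, fun k l x hx => ?_, fun k l m x hx => ?_⟩
  · have := P.mem (s k x)
    rwa [show T.src.π (s k x) = x from (H k x hx).2.1, (H k x hx).2.2.1] at this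
  · have := P'.mem (s k x)
    rwa [show T.tgt.π (s k x) = x from (H k x hx).2.1, (H k x hx).2.2.2.1] at this
  · refine Space.contMDiffOn_of_smoothFunAt fun x hx => ?_
    have h1 := (hact k x hx).2.2 b
    exact Space.SmoothVecAt.comp (B := Space.ofMfd X) (C := Space.ofMfd T.Y) (p := s k) (b := x)
      h1 (H k x hx).1 l
  · refine Space.contMDiffOn_of_smoothFunAt fun x hx => ?_
    let p : X → (fib12 T.π T.π).pt := fun x' =>
      if hx : T.π (s k x') = T.π (s l x') then ⟨(s k x', s l x'), hx⟩ else ⟨(s k x, s k x), rfl⟩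
    have hmem : ∀ᶠ x' in (Space.ofMfd X).nhds x, x' ∈ W k ∩ W l := by
      rw [Space.nhds_ofMfd]
      exact ((hWo k).inter (hWo l)).mem_nhds hx
    have hpe : ∀ x' (hx' : x' ∈ W k ∩ W l), p x' = ⟨(s k x', s l x'), hp k l x' hx'⟩ :=
      fun x' hx' => dif_pos _
    have hps : Space.SmoothMapAt (B := Space.ofMfd X) p x := by
      refine Space.SmoothMapAt.mk_fibProd ((H k x hx.1).1.congr ?_) ((H l x hx.2).1.congr ?_)
      · filter_upwards [hmem] with x' hx'
        rw [hpe x' hx']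
      · filter_upwards [hmem] with x' hx'
        rw [hpe x' hx']
    have hsm : (fib12 T.π T.π).SmoothVecAt 𝕜 (fun p => ((E k l p).1 : A)) (p x) := by
      rw [hpe x hx]
      refine smoothVecAt_rel P P' (γ₁ := γ k) (γ₂ := γ l) (hact k x hx.1).1 (hact k x hx.1).2.1
        (hact l x hx.2).2.1 ?_
      have h1 := (Space.smoothMapAt_fst (B := Space.ofMfd T.Y) (C := Space.ofMfd T.Y) (f := T.π)
        (g := T.π) ⟨(s k x, s l x), hp k l x hx⟩).tendsto
      have h2 := (Space.smoothMapAt_snd (B := Space.ofMfd T.Y) (C := Space.ofMfd T.Y) (f := T.π)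
        (g := T.π) ⟨(s k x, s l x), hp k l x hx⟩).tendsto
      rw [Space.nhds_ofMfd] at h1 h2
      filter_upwards [h1.eventually (H k x hx.1).2.2.2.2, h2.eventually (H l x hx.2).2.2.2.2]
        with p h1 h2
      exact (hE k l p h1 h2).1
    refine Space.SmoothFunAt.congr ((hsm.comp hps) f) ?_
    filter_upwards [hmem] with x' hx'
    rw [hpe x' hx', he k l x' hx']
  · have := (hE k l ⟨(s k x, s l x), hp k l x hx⟩ (hact k x hx.1) (hact l x hx.2)).2
    rw [← he k l x hx] at this
    simpa only [(H k x hx.1).2.1, (H k x hx.1).2.2.1, (H k x hx.1).2.2.2.1, (H l x hx.2).2.2.1,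
      (H l x hx.2).2.2.2.1] using this
  · obtain ⟨⟨hk, hl⟩, hm⟩ := hx
    have := rel_trans P P' (q := ⟨(s k x, s l x, s m x), hp k l x ⟨hk, hl⟩, hp l m x ⟨hl, hm⟩⟩)
      (hact k x hk).1 (hact m x hm).1 (hE k l _ (hact k x hk) (hact l x hl)).1
      (hE l m _ (hact l x hl) (hact m x hm)).1 (hE k m _ (hact k x hk) (hact m x hm)).1
    rw [← he k l x ⟨hk, hl⟩, ← he l m x ⟨hl, hm⟩, ← he k m x ⟨hk, hm⟩] at this
    simpa only [(H k x hk).2.1, (H l x hl).2.1, (H k x hk).2.2.1, (H k x hk).2.2.2.1,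
      (H l x hl).2.2.1, (H l x hl).2.2.2.1, (H m x hm).2.2.1, (H m x hm).2.2.2.1] using this

end OneMor.Lift

end Equivalence

section PullPres

variable {𝕜 : Type} [RCLike 𝕜] {X : Mfd.{u}} {A : SAlg.{u} 𝕜}

theorem Mfd.smoothMapAt_sigma {κ : Type u} [Countable κ] {W : κ → Set X} (hW : ∀ k, IsOpen (W k))
    {C : Space.{u}} {f : κ → X → C.pt}
    (hf : ∀ k, ∀ x ∈ W k, Space.SmoothMapAt (B := Space.ofMfd X) (f k) x) (y : X.sigma W hW) :
    Space.SmoothMapAt (B := Space.ofMfd (X.sigma W hW))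
      (fun y => f (Mfd.sigmaIdx hW y) (Mfd.sigmaπ hW y)) y := by
  have hπ : Space.SmoothMapAt (B := Space.ofMfd (X.sigma W hW)) (C := Space.ofMfd X)
      (Mfd.sigmaπ hW) y := by
    have hs : Manifold.IsSubmersion (X.sigma W hW).I X.I ∞ (Mfd.sigmaπ hW) :=
      X.etaleCharted_isSubmersion (X.isLocalHomeomorph_sigma hW)
    exact Space.smoothMapAt_ofMfd hs.contMDiff y
  have h := Space.SmoothMapAt.comp (B := Space.ofMfd (X.sigma W hW)) (C := Space.ofMfd X)
    (g := f (Mfd.sigmaIdx hW y)) (f := Mfd.sigmaπ hW) (b := y) (hf _ _ y.2.2) hπ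
  refine h.congr ?_
  have := Space.nhds_ofMfd (M := X.sigma W hW) y
  rw [this]
  filter_upwards [(Mfd.isLocallyConstant_sigmaIdx hW).eventually_eq y] with y' hy'
  exact congrArg (fun k => f k (Mfd.sigmaπ hW y')) hy'.symm

theorem Space.SmoothMapAt.tendsto_ofMfd {M N : Mfd.{u}} {f : M → N} {x : M}
    (h : Space.SmoothMapAt (B := Space.ofMfd M) (C := Space.ofMfd N) f x) :
    Filter.Tendsto f (𝓝 x) (𝓝 (f x)) := by
  have := h.tendsto
  rw [Space.nhds_ofMfd x] at this
  exact (Space.nhds_ofMfd (f x)) ▸ this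

namespace TwoVB.Lift

variable {V : TwoVB.{u} 𝕜 X} {D : V.Lift} {c : Cocycle A X}

theorem Pres.pull (P : D.Pres c) {Y' : Mfd.{u}} (w : Y' → D.Y)
    (hw : ∀ y, Space.SmoothMapAt (B := Space.ofMfd Y') (C := Space.ofMfd D.Y) w y)
    {π' : Y' → X} {σ' : Y' → V.Y} (π_surj π_subm σ_smooth π_σ)
    (hπ : ∀ y, D.π (w y) = π' y) (hσ : ∀ y, D.σ (w y) = σ' y) :
    Nonempty (TwoVB.Lift.Pres (V := V) ⟨Y', π', π_surj, π_subm, σ', σ_smooth, π_σ⟩ c) := by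
  obtain rfl : π' = fun y => D.π (w y) := funext fun y => (hπ y).symm
  obtain rfl : σ' = fun y => D.σ (w y) := funext fun y => (hσ y).symm
  let f : (fib12 (fun y => D.π (w y)) (fun y => D.π (w y))).pt → (fib12 D.π D.π).pt :=
    fun p => ⟨(w p.1.1, w p.1.2), p.2⟩
  have hf : ∀ p, Space.SmoothMapAt f p := fun p => Space.SmoothMapAt.mk_fibProd
    (Space.SmoothMapAt.comp (C := Space.ofMfd Y') (D := Space.ofMfd D.Y) (g := w) (hw _)
      (Space.smoothMapAt_fst p))
    (Space.SmoothMapAt.comp (C := Space.ofMfd Y') (D := Space.ofMfd D.Y) (g := w) (hw _)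
      (Space.smoothMapAt_snd p))
  refine ⟨{ idx := fun y => P.idx (w y)
            idx_loc := (IsLocallyConstant.iff_eventually_eq _).2 fun y =>
              (hw y).tendsto_ofMfd.eventually (P.idx_loc.eventually_eq (w y))
            mem := fun y => P.mem _
            N := fun y => P.N (w y)
            smooth := pullSec (B := Space.ofMfd Y') 𝕜 w P.smooth
            loc := fun y => ?_
            inv := fun y => P.inv _
            act := fun p => P.act (f p)
            isAct := fun p => P.isAct (f p)
            smooth_act := fun p k n hk hn => ?_
            act_μ := fun q k k' n => P.act_μ ⟨(w q.1.1, w q.1.2.1, w q.1.2.2), q.2⟩ k k' n }⟩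
  · have h := P.frame.loc_pull (B := Space.ofMfd Y') hw y
    have e : pullSec (B := Space.ofMfd Y') 𝕜 w D.alg.smooth =
        pullSec (B := Space.ofMfd Y') 𝕜 (fun y => D.σ (w y)) V.𝒜.smooth :=
      pullSec_comp_eq (V := fun x => (V.𝒜.fib x).carrier) hw
    rw [show P.frame.𝒜.smooth = D.alg.smooth from rfl, e] at h
    exact h
  · have hk' := (pullSec_comp (V := fun x => (V.ℳ.fib x).carrier) (S := V.ℳ.smooth)
      (g := TwoVB.Lift.map₂ D D) (hf p) k).2 hk
    have hn' := (pullSec_comp (V := fun x => (P.N x).carrier) (S := P.smooth) (g := w)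
      (Space.smoothMapAt_fst p) n).1 hn
    exact (pullSec_comp (V := fun x => (P.N x).carrier) (S := P.smooth) (g := w)
      (Space.smoothMapAt_snd p) _).2 (P.frameAct.smooth_pull hf p k n hk' hn')

end TwoVB.Lift

section Common

variable {V V' : TwoVB.{u} 𝕜 X}

theorem OneMor.exists_local_lift (Q : OneMor V V') (D : V.Lift) (D' : V'.Lift) (x₀ : X) :
    ∃ (O : Set X) (u : X → D.Y) (u' : X → D'.Y) (z : X → Q.Z.pt), IsOpen O ∧ x₀ ∈ O ∧ ∀ x ∈ O,
      Space.SmoothMapAt (B := Space.ofMfd X) (C := Space.ofMfd D.Y) u x ∧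
      Space.SmoothMapAt (B := Space.ofMfd X) (C := Space.ofMfd D'.Y) u' x ∧
      Space.SmoothMapAt (B := Space.ofMfd X) z x ∧ D.π (u x) = x ∧ D'.π (u' x) = x ∧
      D.σ (u x) = (Q.ζ (z x)).1.1 ∧ D'.σ (u' x) = (Q.ζ (z x)).1.2 := by
  classical
  obtain ⟨y, rfl⟩ := D.π_surj x₀
  obtain ⟨y', hy'⟩ := D'.π_surj (D.π y)
  obtain ⟨u, hu0, hu, huπ⟩ := exists_local_section D.π_subm y
  obtain ⟨u', hu0', hu', huπ'⟩ := exists_local_section D'.π_subm y'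
  rw [hy'] at hu0' hu' huπ'
  have hb : V.π (D.σ y) = V'.π (D'.σ y') := by rw [D.π_σ, D'.π_σ, hy']
  obtain ⟨z₀, hz₀⟩ := Q.ζ_subm.2.1 ⟨(D.σ y, D'.σ y'), hb⟩
  obtain ⟨τ, hτ, -, hτζ⟩ := Q.ζ_subm.2.2 z₀
  rw [hz₀] at hτ hτζ
  let b : X → (V.Y12 V').pt := fun x =>
    if h : V.π (D.σ (u x)) = V'.π (D'.σ (u' x)) then ⟨(D.σ (u x), D'.σ (u' x)), h⟩
    else ⟨(D.σ y, D'.σ y'), hb⟩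
  have hbx : ∀ x, D.π (u x) = x → D'.π (u' x) = x → (b x).1 = (D.σ (u x), D'.σ (u' x)) := by
    intro x h1 h2
    have h : V.π (D.σ (u x)) = V'.π (D'.σ (u' x)) := by rw [D.π_σ, D'.π_σ, h1, h2]
    exact congrArg Subtype.val (dif_pos h)
  have hb0 : b (D.π y) = ⟨(D.σ y, D'.σ y'), hb⟩ := by
    refine Subtype.ext ((hbx _ (by rw [hu0]) (by rw [hu0', hy'])).trans ?_)
    rw [hu0, hu0']
    rfl
  have hbs : Space.SmoothMapAt (B := Space.ofMfd X) b (D.π y) := by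
    have h1 := Space.SmoothMapAt.comp (D := Space.ofMfd V.Y) (g := D.σ) (D.σ_smooth _) hu
    have h2 := Space.SmoothMapAt.comp (D := Space.ofMfd V'.Y) (g := D'.σ) (D'.σ_smooth _) hu'
    refine Space.SmoothMapAt.mk_fibProd (h1.congr ?_) (h2.congr ?_)
    · rw [Space.nhds_ofMfd]
      filter_upwards [huπ, huπ'] with x h1 h2
      exact (congrArg Prod.fst (hbx x h1 h2)).symm
    · rw [Space.nhds_ofMfd]
      filter_upwards [huπ, huπ'] with x h1 h2
      exact (congrArg Prod.snd (hbx x h1 h2)).symm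
  rw [← hb0] at hτ hτζ
  have hz := Space.SmoothMapAt.comp hτ hbs
  have h1 := hu.eventually
  have h2 := hu'.eventually
  have h3 := hz.eventually
  have h4 := hbs.tendsto.eventually hτζ
  rw [Space.nhds_ofMfd] at h1 h2 h3 h4
  have hall : ∀ᶠ x : X in 𝓝 (D.π y),
      Space.SmoothMapAt (B := Space.ofMfd X) (C := Space.ofMfd D.Y) u x ∧
      Space.SmoothMapAt (B := Space.ofMfd X) (C := Space.ofMfd D'.Y) u' x ∧
      Space.SmoothMapAt (B := Space.ofMfd X) (fun x => τ (b x)) x ∧ D.π (u x) = x ∧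
      D'.π (u' x) = x ∧ D.σ (u x) = (Q.ζ (τ (b x))).1.1 ∧ D'.σ (u' x) = (Q.ζ (τ (b x))).1.2 := by
    filter_upwards [h1, h2, h3, h4, huπ, huπ'] with x h1 h2 h3 h4 h5 h6
    refine ⟨h1, h2, h3, h5, h6, ?_, ?_⟩
    · exact (congrArg Prod.fst ((congrArg Subtype.val h4).trans (hbx x h5 h6))).symm
    · exact (congrArg Prod.snd ((congrArg Subtype.val h4).trans (hbx x h5 h6))).symm
  obtain ⟨O, hO, hOo, hxO⟩ := eventually_nhds_iff.1 hall
  exact ⟨O, u, u', fun x => τ (b x), hOo, hxO, hO⟩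

theorem TwoVB.Isomorphic.equivalent (hA : PicardSurjective A) (hV : V.Isomorphic V')
    {c c' : Cocycle A X} (h : V.Presented c) (h' : V'.Presented c') : c.Equivalent c' := by
  obtain ⟨Q, R, ⟨I⟩, ⟨J⟩⟩ := hV
  obtain ⟨D, ⟨P⟩⟩ := h
  obtain ⟨D', ⟨P'⟩⟩ := h'
  choose O u u' z hO hx H using Q.exists_local_lift D D'
  obtain ⟨s, hs, hsc⟩ := exists_countable_subcover O hO fun x => ⟨x, hx x⟩
  have hOs : ∀ k : s, IsOpen (O k) := fun k => hO k
  let T : Q.Lift :=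
    { Y := X.sigma (fun k : s => O k) hOs
      π := Mfd.sigmaπ hOs
      π_surj := fun x => (hsc x).elim fun k hk => ⟨⟨k, x, hk⟩, rfl⟩
      π_subm := X.etaleCharted_isSubmersion (X.isLocalHomeomorph_sigma hOs)
      z := fun y => z (Mfd.sigmaIdx (κ := s) hOs y).1 (Mfd.sigmaπ hOs y)
      z_smooth := Mfd.smoothMapAt_sigma hOs (f := fun k : s => z k) fun k x hx => (H k x hx).2.2.1
      π_z := fun y => by
        obtain ⟨-, -, -, h1, -, h2, -⟩ := H _ _ y.2.2
        exact (congrArg V.π h2.symm).trans ((D.π_σ _).trans h1) }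
  obtain ⟨PT⟩ := P.pull (fun y => u (Mfd.sigmaIdx (κ := s) hOs y).1 (Mfd.sigmaπ hOs y))
    (Mfd.smoothMapAt_sigma hOs (C := Space.ofMfd D.Y) (f := fun k : s => u k)
      fun k x hx => (H k x hx).1)
    T.src.π_surj T.src.π_subm T.src.σ_smooth T.src.π_σ
    (fun y => (H _ _ y.2.2).2.2.2.1) (fun y => (H _ _ y.2.2).2.2.2.2.2.1)
  obtain ⟨PT'⟩ := P'.pull (fun y => u' (Mfd.sigmaIdx (κ := s) hOs y).1 (Mfd.sigmaπ hOs y))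
    (Mfd.smoothMapAt_sigma hOs (C := Space.ofMfd D'.Y) (f := fun k : s => u' k)
      fun k x hx => (H k x hx).2.1)
    T.tgt.π_surj T.tgt.π_subm T.tgt.σ_smooth T.tgt.π_σ
    (fun y => (H _ _ y.2.2).2.2.2.2.1) (fun y => (H _ _ y.2.2).2.2.2.2.2.2)
  exact OneMor.Lift.equivalent (T := T) hA PT PT' (I.invertible J)

end Common

end PullPres

section Covers

variable {X : Mfd.{u}}

/-- An open cover `O` with neighbourhoods `G i j x` of the points `x` of `O i ∩ O j` has a countable
open refinement whose double intersections are contained in such neighbourhoods. -/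
theorem Mfd.exists_refinement {κ : Type u} {O : κ → Set X} (hO : ∀ i, IsOpen (O i))
    (hc : ∀ x, ∃ i, x ∈ O i) {G : κ → κ → X → Set X}
    (hG : ∀ i j, ∀ x ∈ O i ∩ O j, G i j x ∈ 𝓝 x) :
    ∃ (ι : Type u) (_ : Countable ι) (W : ι → Set X) (r : ι → κ), (∀ k, IsOpen (W k)) ∧
      (∀ x, ∃ k, x ∈ W k) ∧ (∀ k, W k ⊆ O (r k)) ∧
      ∀ k l, (W k ∩ W l).Nonempty → ∃ x ∈ O (r k) ∩ O (r l), W k ∩ W l ⊆ G (r k) (r l) x := by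
  have := Manifold.locallyCompact_of_finiteDimensional (M := X) X.I
  obtain ⟨v, hv, hvc, hvf, hvO⟩ := precise_refinement O hO (Set.iUnion_eq_univ_iff.2 hc)
  obtain ⟨w, hwc, hw, hwv⟩ := exists_iUnion_eq_closure_subset hv hvf.point_finite hvc
  have hf : LocallyFinite fun i => closure (w i) := hvf.subset hwv
  have hwO : ∀ i, closure (w i) ⊆ O i := fun i => (hwv i).trans (hvO i)
  choose ρ hρ using Set.iUnion_eq_univ_iff.1 hwc
  let S : X → Set κ := fun x => {i | x ∈ closure (w i)}
  have hS : ∀ x, (S x).Finite := hf.point_finite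
  let W : X → Set X := fun x => w (ρ x) ∩ (⋃ i : {i // i ∉ S x}, closure (w i))ᶜ ∩
    ⋂ i ∈ S x, ⋂ j ∈ S x, interior (G i j x)
  have hW : ∀ x, IsOpen (W x) := fun x =>
    ((hw _).inter ((hf.comp_injective Subtype.val_injective).isClosed_iUnion
      fun _ => isClosed_closure).isOpen_compl).inter
      ((hS x).isOpen_biInter fun i _ => (hS x).isOpen_biInter fun j _ => isOpen_interior)
  have hxW : ∀ x, x ∈ W x := by
    refine fun x => ⟨⟨hρ x, ?_⟩, ?_⟩
    · simp only [Set.mem_compl_iff, Set.mem_iUnion, not_exists]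
      exact fun i hi => i.2 hi
    · simp only [Set.mem_iInter]
      exact fun i hi j hj => mem_interior_iff_mem_nhds.2 (hG i j x ⟨hwO i hi, hwO j hj⟩)
  have hmem : ∀ x y i, y ∈ W x → y ∈ w i → i ∈ S x := by
    intro x y i hy hi
    by_contra h
    exact hy.1.2 (Set.mem_iUnion.2 ⟨⟨i, h⟩, subset_closure hi⟩)
  obtain ⟨s, hs, hsc⟩ := exists_countable_subcover W hW fun x => ⟨x, hxW x⟩
  refine ⟨s, hs, fun k => W k, fun k => ρ k, fun k => hW k, hsc,
    fun k y hy => hwO _ (subset_closure hy.1.1), ?_⟩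
  rintro k l ⟨y, hk, hl⟩
  have h1 := hmem l y _ hl hk.1.1
  have h2 := hmem l y _ hl hl.1.1
  refine ⟨l, ⟨hwO _ h1, hwO _ h2⟩, fun z hz => interior_subset ?_⟩
  have := hz.2.2
  simp only [Set.mem_iInter] at this
  exact this _ h1 _ h2

variable {κ : Type u} [Countable κ] {W : κ → Set X} (hW : ∀ k, IsOpen (W k))

theorem Mfd.exists_section_sigma {k : κ} {x₀ : X} (hx₀ : x₀ ∈ W k) :
    ∃ s : X → X.sigma W hW,
      Space.SmoothMapAt (B := Space.ofMfd X) (C := Space.ofMfd (X.sigma W hW)) s x₀ ∧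
      s x₀ = ⟨k, x₀, hx₀⟩ ∧ ∀ᶠ x in 𝓝 x₀, ∃ hx : x ∈ W k, s x = ⟨k, x, hx⟩ := by
  have hs : Manifold.IsSubmersion (X.sigma W hW).I X.I ∞ (Mfd.sigmaπ hW) :=
    X.etaleCharted_isSubmersion (X.isLocalHomeomorph_sigma hW)
  obtain ⟨s, hs0, hs, hsπ⟩ := exists_local_section hs ⟨k, x₀, hx₀⟩
  refine ⟨s, hs, hs0, ?_⟩
  have ht := hs.tendsto_ofMfd
  rw [hs0] at ht
  filter_upwards [hsπ, ht.eventually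
    ((Mfd.isLocallyConstant_sigmaIdx hW).eventually_eq ⟨k, x₀, hx₀⟩)] with x h1 h2
  generalize s x = y at h1 h2
  obtain ⟨k', x', hx'⟩ := y
  obtain rfl : k' = k := h2
  obtain rfl : x' = x := h1
  exact ⟨hx', rfl⟩

theorem exists_smooth_pair {Y : Mfd.{u}} {π : Y → X} {s t : X → Y} {x₀ : X}
    (hs : Space.SmoothMapAt (B := Space.ofMfd X) (C := Space.ofMfd Y) s x₀)
    (ht : Space.SmoothMapAt (B := Space.ofMfd X) (C := Space.ofMfd Y) t x₀)
    (h : ∀ᶠ x in 𝓝 x₀, π (s x) = π (t x)) :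
    ∃ p : X → (fib12 π π).pt, Space.SmoothMapAt (B := Space.ofMfd X) p x₀ ∧
      ∀ᶠ x in 𝓝 x₀, (p x).1 = (s x, t x) := by
  classical
  let p : X → (fib12 π π).pt := fun x =>
    if h : π (s x) = π (t x) then ⟨(s x, t x), h⟩ else ⟨(s x, s x), rfl⟩
  have hp : ∀ᶠ x in 𝓝 x₀, (p x).1 = (s x, t x) := by
    filter_upwards [h] with x hx
    exact congrArg Subtype.val (dif_pos hx)
  refine ⟨p, Space.SmoothMapAt.mk_fibProd (hs.congr ?_) (ht.congr ?_), hp⟩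
  · rw [Space.nhds_ofMfd]
    filter_upwards [hp] with x hx
    exact (congrArg Prod.fst hx).symm
  · rw [Space.nhds_ofMfd]
    filter_upwards [hp] with x hx
    exact (congrArg Prod.snd hx).symm

theorem exists_smooth_triple {Y : Mfd.{u}} {π : Y → X} {s t u : X → Y} {x₀ : X}
    (hs : Space.SmoothMapAt (B := Space.ofMfd X) (C := Space.ofMfd Y) s x₀)
    (ht : Space.SmoothMapAt (B := Space.ofMfd X) (C := Space.ofMfd Y) t x₀)
    (hu : Space.SmoothMapAt (B := Space.ofMfd X) (C := Space.ofMfd Y) u x₀)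
    (h : ∀ᶠ x in 𝓝 x₀, π (s x) = π (t x) ∧ π (t x) = π (u x)) :
    ∃ p : X → (tri π π π).pt, Space.SmoothMapAt (B := Space.ofMfd X) p x₀ ∧
      ∀ᶠ x in 𝓝 x₀, (p x).1 = (s x, t x, u x) := by
  classical
  let p : X → (tri π π π).pt := fun x =>
    if h : π (s x) = π (t x) ∧ π (t x) = π (u x) then ⟨(s x, t x, u x), h⟩
    else ⟨(s x, s x, s x), rfl, rfl⟩
  have hp : ∀ᶠ x in 𝓝 x₀, (p x).1 = (s x, t x, u x) := by
    filter_upwards [h] with x hx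
    exact congrArg Subtype.val (dif_pos hx)
  refine ⟨p, Space.smoothMapAt_tri (hs.congr ?_) (ht.congr ?_) (hu.congr ?_), hp⟩
  · rw [Space.nhds_ofMfd]
    filter_upwards [hp] with x hx
    exact (congrArg Prod.fst hx).symm
  · rw [Space.nhds_ofMfd]
    filter_upwards [hp] with x hx
    exact (congrArg (fun q => q.2.1) hx).symm
  · rw [Space.nhds_ofMfd]
    filter_upwards [hp] with x hx
    exact (congrArg (fun q => q.2.2) hx).symm

end Covers

section Representations

variable {𝕜 : Type} [RCLike 𝕜] {X : Mfd.{u}} {A : SAlg.{u} 𝕜} {V : TwoVB.{u} 𝕜 X}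

/-- A bundle of invertible bimodules over the algebra bundle of `V`, along a lift to `V.Y`. -/
structure TwoVB.Lift.ModBundle (D : V.Lift) (A : SAlg.{u} 𝕜) : Type (u + 1) where
  N : ∀ y, SBimod (D.alg.fib y) A
  smooth : Sec (Space.ofMfd D.Y) (fun y => (N y).carrier)
  loc : ∀ y, LocBimod (A₂ := fun _ => A) D.alg.smooth
    (fun s b => (Space.ofMfd D.Y).SmoothVecAt 𝕜 s b) N smooth y
  inv : ∀ y, (N y).Invertible

/-- Along a lift to `V.Y`, the bimodules of `V` act by semilinear maps on a bundle of invertible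
bimodules. -/
structure TwoVB.Lift.Rep (D : V.Lift) (A : SAlg.{u} 𝕜) : Type (u + 1) extends D.ModBundle A where
  act : ∀ p : (fib12 D.π D.π).pt,
    V.ℳ.fib (TwoVB.Lift.map₂ D D p) →ₗ[𝕜] N p.1.1 →ₗ[𝕜] N p.1.2
  g : (fib12 D.π D.π).pt → evenAut A
  isAct : ∀ p : (fib12 D.π D.π).pt, SBimod.IsAct (V.ℳ.fib (TwoVB.Lift.map₂ D D p)) (N p.1.1)
    (N p.1.2) (g p) (act p)
  smooth_act : ∀ (p : (fib12 D.π D.π).pt) k n,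
    pullSec 𝕜 (TwoVB.Lift.map₂ D D) V.ℳ.smooth k p →
    pullSec 𝕜 (fun p : (fib12 D.π D.π).pt => p.1.1) smooth n p →
    pullSec 𝕜 (fun p : (fib12 D.π D.π).pt => p.1.2) smooth (fun p => act p (k p) (n p)) p
  smooth_g : ∀ p, (fib12 D.π D.π).SmoothLinAt 𝕜
    (fun p => ((g p).1.toLinearMap : A →ₗ[𝕜] A)) p

namespace TwoVB.Lift.Rep

variable {D : V.Lift} (R : D.Rep A)

theorem smooth_act_pull {B : Space.{u}} {f : B.pt → (fib12 D.π D.π).pt}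
    {b : B.pt} (hf : Space.SmoothMapAt f b) {k : ∀ b, V.ℳ.fib (map₂ D D (f b))}
    {n : ∀ b, R.N (f b).1.1} (hk : pullSec 𝕜 (fun b => map₂ D D (f b)) V.ℳ.smooth k b)
    (hn : pullSec 𝕜 (fun b => (f b).1.1) R.smooth n b) :
    pullSec 𝕜 (fun b => (f b).1.2) R.smooth (fun b => R.act (f b) (k b) (n b)) b :=
  smooth_mul_pull (p := map₂ D D) (q := fun t : (fib12 D.π D.π).pt => t.1.1)
    (r := fun t : (fib12 D.π D.π).pt => t.1.2) R.act
    (fun _ _ hσ hτ => R.smooth_act _ _ _ (pullSec_of hσ) (pullSec_of hτ)) hf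
    (Space.smoothMapAt_snd _) (R.loc _).isVBAt hk hn

theorem exists_unit (q : (tri D.π D.π D.π).pt) : ∃ e : evenUnits A,
    (∀ (k : V.ℳ.fib (map₂ D D (tri23 q))) (k' : V.ℳ.fib (map₂ D D (tri12 q))) (n : R.N q.1.1),
      R.act (tri23 q) k (R.act (tri12 q) k' n) = (R.N q.1.2.2).right (e.1 : A)
        (R.act (tri13 q) ((V.μ (map₃ D D D q)).toLin (SBimod.tmul k k')) n)) ∧
    innerAut e * R.g (tri23 q) * R.g (tri12 q) = R.g (tri13 q) := by
  have h := (R.isAct (tri13 q)).precomp (V.μ (map₃ D D D q)) (V.μ_iso.1 _)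
  have h' := (R.isAct (tri12 q)).comp (R.isAct (tri23 q))
  obtain ⟨e, he, hg⟩ := h.exists_unit h' (R.inv _)
  refine ⟨e, fun k k' n => ?_, by rw [mul_assoc]; exact hg.symm⟩
  exact (SBimod.compAct_tmul (R.isAct (tri12 q)) (R.isAct (tri23 q)) k k' n).symm.trans
    (he (SBimod.tmul k k') n)

/-- The unit that measures the failure of the action to be multiplicative. -/
def a (q : (tri D.π D.π D.π).pt) : evenUnits A := (R.exists_unit q).choose

theorem act_act (q : (tri D.π D.π D.π).pt) (k : V.ℳ.fib (map₂ D D (tri23 q)))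
    (k' : V.ℳ.fib (map₂ D D (tri12 q))) (n : R.N q.1.1) :
    R.act (tri23 q) k (R.act (tri12 q) k' n) = (R.N q.1.2.2).right ((R.a q).1 : A)
      (R.act (tri13 q) ((V.μ (map₃ D D D q)).toLin (SBimod.tmul k k')) n) :=
  (R.exists_unit q).choose_spec.1 k k' n

theorem innerAut_a (q : (tri D.π D.π D.π).pt) :
    innerAut (R.a q) * R.g (tri23 q) * R.g (tri12 q) = R.g (tri13 q) :=
  (R.exists_unit q).choose_spec.2

theorem act_μ (q : (tri D.π D.π D.π).pt) (k : V.ℳ.fib (map₂ D D (tri23 q)))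
    (k' : V.ℳ.fib (map₂ D D (tri12 q))) (n : R.N q.1.1) :
    R.act (tri13 q) ((V.μ (map₃ D D D q)).toLin (SBimod.tmul k k')) n =
      (R.N q.1.2.2).right (((R.a q)⁻¹).1 : A) (R.act (tri23 q) k (R.act (tri12 q) k' n)) := by
  rw [R.act_act, ← (R.N q.1.2.2).right_mul]
  have : (((R.a q).1 : (A : Type u)ˣ) : A) * (((R.a q)⁻¹).1 : A) = 1 := Units.mul_inv _
  rw [this, (R.N q.1.2.2).right_one]

theorem smooth_a (q₀ : (tri D.π D.π D.π).pt) :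
    (tri D.π D.π D.π).SmoothVecAt 𝕜 (fun q => ((R.a q).1 : A)) q₀ := by
  have hloc : LocBimod (A₁ := fun q : (tri D.π D.π D.π).pt => D.alg.fib q.1.2.2)
      (A₂ := fun _ => A) (pullSec 𝕜 (fun q : (tri D.π D.π D.π).pt => q.1.2.2) D.alg.smooth)
      (fun s b => (tri D.π D.π D.π).SmoothVecAt 𝕜 s b) (fun q => R.N q.1.2.2)
      (pullSec 𝕜 (fun q : (tri D.π D.π D.π).pt => q.1.2.2) R.smooth) q₀ :=
    LocBimod.pull_const Space.smoothMapAt_tri_trd (R.loc _)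
  refine smoothVecAt_unit hloc (R.inv _) (T := {v | ∃ k k' n,
    v = R.act (tri13 q₀) ((V.μ (map₃ D D D q₀)).toLin (SBimod.tmul k k')) n}) (fun v _ => ?_) ?_
  · refine (R.isAct (tri13 q₀)).induction (p := fun v => v ∈ Submodule.span 𝕜 {v | ∃ k k' n,
      v = R.act (tri13 q₀) ((V.μ (map₃ D D D q₀)).toLin (SBimod.tmul k k')) n}) (zero_mem _)
      (fun k n => ?_) (fun _ _ => add_mem) v
    obtain ⟨t, rfl⟩ := (V.μ_iso.1 (map₃ D D D q₀)).2 k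
    refine SBimod.tensor_induction (p := fun t => R.act (tri13 q₀)
      ((V.μ (map₃ D D D q₀)).toLin t) n ∈ Submodule.span 𝕜 {v | ∃ k k' n,
        v = R.act (tri13 q₀) ((V.μ (map₃ D D D q₀)).toLin (SBimod.tmul k k')) n}) t ?_
      (fun k k' => Submodule.subset_span ⟨k, k', n, rfl⟩) (fun x y hx hy => ?_)
    · rw [map_zero, map_zero]
      exact zero_mem _
    · rw [map_add, map_add]
      exact add_mem hx hy
  · rintro _ ⟨k, k', n, rfl⟩
    obtain ⟨σk, rfl, hk⟩ := (V.ℳ.isVBAt _).exists_extend k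
    obtain ⟨σk', rfl, hk'⟩ := (V.ℳ.isVBAt _).exists_extend k'
    obtain ⟨σn, rfl, hn⟩ := (R.loc _).isVBAt.exists_extend n
    have hn' : pullSec 𝕜 (fun q : (tri D.π D.π D.π).pt => q.1.1) R.smooth
        (fun q => σn q.1.1) q₀ := pullSec_of hn
    have hks : pullSec 𝕜 (fun q : (tri D.π D.π D.π).pt => map₂ D D (tri23 q)) V.ℳ.smooth
        (fun q => σk (map₂ D D (tri23 q))) q₀ := pullSec_of hk
    have hks' : pullSec 𝕜 (fun q : (tri D.π D.π D.π).pt => map₂ D D (tri12 q)) V.ℳ.smooth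
        (fun q => σk' (map₂ D D (tri12 q))) q₀ := pullSec_of hk'
    have hμ : pullSec 𝕜 (fun q : (tri D.π D.π D.π).pt => map₂ D D (tri13 q)) V.ℳ.smooth
        (fun q => (V.μ (map₃ D D D q)).toLin (SBimod.tmul (σk (map₂ D D (tri23 q)))
          (σk' (map₂ D D (tri12 q))))) q₀ := by
      refine (pullSec_comp (V := fun x => (V.ℳ.fib x).carrier) (S := V.ℳ.smooth)
        (g := map₂ D D) (f := tri13) (Space.smoothMapAt_tri13 q₀) _).1 ?_
      refine ((Lift.μ_iso D D D).2 _ _).1 (tensorSec_tmul ?_ ?_)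
      · exact (pullSec_comp (V := fun x => (V.ℳ.fib x).carrier) (S := V.ℳ.smooth)
          (g := map₂ D D) (f := tri23) (Space.smoothMapAt_tri23 q₀) _).2 hks
      · exact (pullSec_comp (V := fun x => (V.ℳ.fib x).carrier) (S := V.ℳ.smooth)
          (g := map₂ D D) (f := tri12) (Space.smoothMapAt_tri12 q₀) _).2 hks'
    refine ⟨fun q => R.act (tri13 q) ((V.μ (map₃ D D D q)).toLin (SBimod.tmul
      (σk (map₂ D D (tri23 q))) (σk' (map₂ D D (tri12 q))))) (σn q.1.1), rfl,
      R.smooth_act_pull (f := tri13) (Space.smoothMapAt_tri13 q₀) hμ hn', ?_⟩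
    have h1 := R.smooth_act_pull (f := tri12) (Space.smoothMapAt_tri12 q₀) hks' hn'
    have h2 := R.smooth_act_pull (f := tri23) (Space.smoothMapAt_tri23 q₀) hks h1
    exact IsVBAt.congr hloc.isVBAt h2 (Filter.Eventually.of_forall fun q => R.act_act q _ _ _)

theorem a_mul (y₁ y₂ y₃ y₄ : D.Y) (h₁₂ : D.π y₁ = D.π y₂) (h₂₃ : D.π y₂ = D.π y₃)
    (h₃₄ : D.π y₃ = D.π y₄) :
    R.a ⟨(y₁, y₃, y₄), h₁₂.trans h₂₃, h₃₄⟩ *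
      autAct (R.g ⟨(y₃, y₄), h₃₄⟩) (R.a ⟨(y₁, y₂, y₃), h₁₂, h₂₃⟩) =
    R.a ⟨(y₁, y₂, y₄), h₁₂, h₂₃.trans h₃₄⟩ * R.a ⟨(y₂, y₃, y₄), h₂₃, h₃₄⟩ := by
  set q₁₂₃ : (tri D.π D.π D.π).pt := ⟨(y₁, y₂, y₃), h₁₂, h₂₃⟩
  set q₁₃₄ : (tri D.π D.π D.π).pt := ⟨(y₁, y₃, y₄), h₁₂.trans h₂₃, h₃₄⟩
  set q₁₂₄ : (tri D.π D.π D.π).pt := ⟨(y₁, y₂, y₄), h₁₂, h₂₃.trans h₃₄⟩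
  set q₂₃₄ : (tri D.π D.π D.π).pt := ⟨(y₂, y₃, y₄), h₂₃, h₃₄⟩
  set g := R.g ⟨(y₃, y₄), h₃₄⟩
  have key : ∀ k₃ k₂ k₁ n, (R.N y₄).right (((R.a q₁₃₄)⁻¹).1 : A)
      ((R.N y₄).right (g.1 (((R.a q₁₂₃)⁻¹).1 : A))
        (R.act (tri23 q₁₃₄) k₃ (R.act (tri23 q₁₂₃) k₂ (R.act (tri12 q₁₂₃) k₁ n)))) =
      (R.N y₄).right (((R.a q₁₂₄)⁻¹).1 : A) ((R.N y₄).right (((R.a q₂₃₄)⁻¹).1 : A)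
        (R.act (tri23 q₁₃₄) k₃ (R.act (tri23 q₁₂₃) k₂ (R.act (tri12 q₁₂₃) k₁ n)))) := by
    intro k₃ k₂ k₁ n
    have e1 := R.act_μ q₁₃₄ k₃ ((V.μ (map₃ D D D q₁₂₃)).toLin (SBimod.tmul k₂ k₁)) n
    have e2 := R.act_μ q₁₂₃ k₂ k₁ n
    have e3 := R.act_μ q₁₂₄ ((V.μ (map₃ D D D q₂₃₄)).toLin (SBimod.tmul k₃ k₂)) k₁ n
    have e4 := R.act_μ q₂₃₄ k₃ k₂ (R.act (tri12 q₁₂₃) k₁ n)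
    have e5 := congrArg (fun k => R.act (tri13 q₁₃₄) k n) (V.μ_assoc _ _ _ _ _ _ _ k₃ k₂ k₁)
    have e6 := (R.isAct (tri23 q₁₃₄)).right k₃
      (R.act (tri23 q₁₂₃) k₂ (R.act (tri12 q₁₂₃) k₁ n)) (((R.a q₁₂₃)⁻¹).1 : A)
    have f1 := e1.trans (congrArg _ ((congrArg _ e2).trans e6))
    exact f1.symm.trans (e5.symm.trans (e3.trans (congrArg _ e4)))
  have h : (R.N y₄).right (g.1 (((R.a q₁₂₃)⁻¹).1 : A) * (((R.a q₁₃₄)⁻¹).1 : A)) =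
      (R.N y₄).right ((((R.a q₂₃₄)⁻¹).1 : A) * (((R.a q₁₂₄)⁻¹).1 : A)) := by
    refine (R.isAct (tri23 q₁₃₄)).hom_ext fun k₃ v => ?_
    refine LinearMap.congr_fun (f := (R.N y₄).right _ ∘ₗ R.act (tri23 q₁₃₄) k₃)
      (g := (R.N y₄).right _ ∘ₗ R.act (tri23 q₁₃₄) k₃)
      ((R.isAct (tri23 q₁₂₃)).hom_ext fun k₂ v => ?_) v
    refine LinearMap.congr_fun
      (f := (R.N y₄).right _ ∘ₗ R.act (tri23 q₁₃₄) k₃ ∘ₗ R.act (tri23 q₁₂₃) k₂)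
      (g := (R.N y₄).right _ ∘ₗ R.act (tri23 q₁₃₄) k₃ ∘ₗ R.act (tri23 q₁₂₃) k₂)
      ((R.isAct (tri12 q₁₂₃)).hom_ext fun k₁ n => ?_) v
    exact ((R.N y₄).right_mul _ _ _).trans ((key k₃ k₂ k₁ n).trans
      ((R.N y₄).right_mul _ _ _).symm)
  have h' : autAct g (R.a q₁₂₃)⁻¹ * (R.a q₁₃₄)⁻¹ = (R.a q₂₃₄)⁻¹ * (R.a q₁₂₄)⁻¹ :=
    Subtype.ext (Units.ext ((R.inv _).right_injective h))
  have h₃ : autAct g (R.a q₁₂₃)⁻¹ = (autAct g (R.a q₁₂₃))⁻¹ := Subtype.ext (map_inv _ _)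
  rw [h₃, ← mul_inv_rev, ← mul_inv_rev] at h'
  exact inv_injective h'

end TwoVB.Lift.Rep

end Representations

section CocycleOfRep

variable {𝕜 : Type} [RCLike 𝕜] {X : Mfd.{u}} {A : SAlg.{u} 𝕜} {V : TwoVB.{u} 𝕜 X}

namespace TwoVB.Lift.Rep

variable {κ : Type u} [Countable κ] {W : κ → Set X} {hW : ∀ k, IsOpen (W k)}
  {π_surj : Function.Surjective (Mfd.sigmaπ hW)}
  {π_subm : Manifold.IsSubmersion (X.sigma W hW).I X.I ∞ (Mfd.sigmaπ hW)}
  {σ : X.sigma W hW → V.Y} {σ_smooth} {π_σ}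
  (R : Rep (V := V) ⟨X.sigma W hW, Mfd.sigmaπ hW, π_surj, π_subm, σ, σ_smooth, π_σ⟩ A)

open Classical in
/-- The transition automorphisms as functions on `X`. -/
def gOn (k l : κ) (x : X) : evenAut A :=
  if h : x ∈ W k ∧ x ∈ W l then R.g ⟨(⟨k, x, h.1⟩, ⟨l, x, h.2⟩), rfl⟩ else 1

open Classical in
/-- The transition units as functions on `X`. -/
def aOn (k l m : κ) (x : X) : evenUnits A :=
  if h : x ∈ W k ∧ x ∈ W l ∧ x ∈ W m then
    R.a ⟨(⟨k, x, h.1⟩, ⟨l, x, h.2.1⟩, ⟨m, x, h.2.2⟩), rfl, rfl⟩ else 1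

theorem gOn_of_mem {k l : κ} {x : X} (hk : x ∈ W k) (hl : x ∈ W l) :
    R.gOn k l x = R.g ⟨(⟨k, x, hk⟩, ⟨l, x, hl⟩), rfl⟩ := dif_pos ⟨hk, hl⟩

theorem aOn_of_mem {k l m : κ} {x : X} (hk : x ∈ W k) (hl : x ∈ W l) (hm : x ∈ W m) :
    R.aOn k l m x = R.a ⟨(⟨k, x, hk⟩, ⟨l, x, hl⟩, ⟨m, x, hm⟩), rfl, rfl⟩ := dif_pos ⟨hk, hl, hm⟩

theorem gOn_eq (p : (fib12 (Mfd.sigmaπ hW) (Mfd.sigmaπ hW)).pt) :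
    R.gOn (Mfd.sigmaIdx hW p.1.1) (Mfd.sigmaIdx hW p.1.2) (Mfd.sigmaπ hW p.1.1) = R.g p := by
  obtain ⟨⟨⟨k, x, hx⟩, ⟨l, x', hx'⟩⟩, h⟩ := p
  obtain rfl : x = x' := h
  exact R.gOn_of_mem hx hx'

theorem aOn_eq (q : (tri (Mfd.sigmaπ hW) (Mfd.sigmaπ hW) (Mfd.sigmaπ hW)).pt) :
    R.aOn (Mfd.sigmaIdx hW q.1.1) (Mfd.sigmaIdx hW q.1.2.1) (Mfd.sigmaIdx hW q.1.2.2)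
      (Mfd.sigmaπ hW q.1.1) = R.a q := by
  obtain ⟨⟨⟨k, x, hx⟩, ⟨l, x', hx'⟩, ⟨m, x'', hx''⟩⟩, h, h'⟩ := q
  obtain rfl : x = x' := h
  obtain rfl : x = x'' := h'
  exact R.aOn_of_mem hx hx' hx''

theorem smooth_gOn (k l : κ) : SmoothAutOn X (R.gOn k l) (W k ∩ W l) := by
  refine fun f b => Space.contMDiffOn_of_smoothFunAt fun x hx => ?_
  obtain ⟨s, hs, -, hs'⟩ := Mfd.exists_section_sigma hW hx.1
  obtain ⟨t, ht, -, ht'⟩ := Mfd.exists_section_sigma hW hx.2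
  obtain ⟨p, hp, hp'⟩ := exists_smooth_pair (π := Mfd.sigmaπ hW) hs ht (by
    filter_upwards [hs', ht'] with x hs ht
    obtain ⟨_, hs⟩ := hs
    obtain ⟨_, ht⟩ := ht
    rw [hs, ht])
  refine Space.SmoothFunAt.congr (((R.smooth_g (p x) b).comp hp) f) ?_
  rw [Space.nhds_ofMfd]
  filter_upwards [hp', hs', ht'] with x hp hs ht
  obtain ⟨_, hs⟩ := hs
  obtain ⟨_, ht⟩ := ht
  have h := R.gOn_eq (p x)
  rw [hp, hs, ht] at h
  exact congrArg (fun g : evenAut A => f (g.1 b)) h.symm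

theorem smooth_aOn (k l m : κ) : SmoothUnitsOn X (R.aOn k l m) (W k ∩ W l ∩ W m) := by
  refine fun f => Space.contMDiffOn_of_smoothFunAt fun x hx => ?_
  obtain ⟨s, hs, -, hs'⟩ := Mfd.exists_section_sigma hW hx.1.1
  obtain ⟨t, ht, -, ht'⟩ := Mfd.exists_section_sigma hW hx.1.2
  obtain ⟨u, hu, -, hu'⟩ := Mfd.exists_section_sigma hW hx.2
  obtain ⟨p, hp, hp'⟩ := exists_smooth_triple (π := Mfd.sigmaπ hW) hs ht hu (by
    filter_upwards [hs', ht', hu'] with x hs ht hu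
    obtain ⟨_, hs⟩ := hs
    obtain ⟨_, ht⟩ := ht
    obtain ⟨_, hu⟩ := hu
    rw [hs, ht, hu]
    exact ⟨rfl, rfl⟩)
  refine Space.SmoothFunAt.congr (((R.smooth_a (p x)).comp hp) f) ?_
  rw [Space.nhds_ofMfd]
  filter_upwards [hp', hs', ht', hu'] with x hp hs ht hu
  obtain ⟨_, hs⟩ := hs
  obtain ⟨_, ht⟩ := ht
  obtain ⟨_, hu⟩ := hu
  have h := R.aOn_eq (p x)
  rw [hp, hs, ht, hu] at h
  exact congrArg (fun a : evenUnits A => f (a.1 : A)) h.symm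

/-- The cocycle of a representation over a disjoint union of open sets. -/
def cocycle : Cocycle A X where
  ι := κ
  U := W
  isOpen := hW
  cover := fun x => (π_surj x).elim fun y hy => ⟨Mfd.sigmaIdx hW y, hy ▸ y.2.2⟩
  g := R.gOn
  a := R.aOn
  g_smooth := R.smooth_gOn
  a_smooth := R.smooth_aOn
  cocycle_g := fun k l m x hx => by
    have h := R.innerAut_a ⟨(⟨k, x, hx.1.1⟩, ⟨l, x, hx.1.2⟩, ⟨m, x, hx.2⟩), rfl, rfl⟩
    rw [R.aOn_of_mem hx.1.1 hx.1.2 hx.2, R.gOn_of_mem hx.1.2 hx.2, R.gOn_of_mem hx.1.1 hx.1.2,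
      R.gOn_of_mem hx.1.1 hx.2]
    exact h
  cocycle_a := fun k l m n x hx => by
    have h := R.a_mul ⟨k, x, hx.1.1.1⟩ ⟨l, x, hx.1.1.2⟩ ⟨m, x, hx.1.2⟩ ⟨n, x, hx.2⟩ rfl rfl rfl
    rw [R.aOn_of_mem hx.1.1.1 hx.1.2 hx.2, R.aOn_of_mem hx.1.1.1 hx.1.1.2 hx.1.2,
      R.aOn_of_mem hx.1.1.1 hx.1.1.2 hx.2, R.aOn_of_mem hx.1.1.2 hx.1.2 hx.2,
      R.gOn_of_mem hx.1.2 hx.2]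
    exact h

theorem presented_cocycle : V.Presented R.cocycle := by
  refine ⟨⟨X.sigma W hW, Mfd.sigmaπ hW, π_surj, π_subm, σ, σ_smooth, π_σ⟩, ⟨
    { idx := Mfd.sigmaIdx hW
      idx_loc := Mfd.isLocallyConstant_sigmaIdx hW
      mem := fun y => y.2.2
      N := R.N
      smooth := R.smooth
      loc := R.loc
      inv := R.inv
      act := R.act
      isAct := fun p => ?_
      smooth_act := R.smooth_act
      act_μ := fun q k k' n => ?_ }⟩⟩
  · have h : ∀ g, R.g p = g → SBimod.IsAct _ _ _ g (R.act p) := by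
      rintro _ rfl
      exact R.isAct p
    exact h _ (R.gOn_eq p).symm
  · exact (R.act_μ q k k' n).trans (congrArg (fun a : evenUnits A =>
      (R.N q.1.2.2).right ((a⁻¹).1 : A) (R.act (tri23 q) k (R.act (tri12 q) k' n)))
      (R.aOn_eq q).symm)

end TwoVB.Lift.Rep

end CocycleOfRep

section TwistedFamily

variable {𝕜 : Type} [RCLike 𝕜] {κ : Type u}

open Classical in
/-- The identity of a member of a family of bimodules, extended by zero. -/
def castMap {A : SAlg.{u} 𝕜} {A₀ : κ → SAlg.{u} 𝕜} (M₀ : ∀ k, SBimod (A₀ k) A) (k l : κ) :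
    M₀ l →ₗ[𝕜] M₀ k :=
  if h : l = k then h ▸ LinearMap.id else 0

theorem castMap_self {A : SAlg.{u} 𝕜} {A₀ : κ → SAlg.{u} 𝕜} (M₀ : ∀ k, SBimod (A₀ k) A) (k : κ) :
    castMap M₀ k k = LinearMap.id := dif_pos rfl

theorem locBimod_twistL {B : Space.{u}} {A : SAlg.{u} 𝕜} {A₁ : B.pt → SAlg.{u} 𝕜}
    {S₁ : Sec B (fun b => (A₁ b).carrier)} {i : B.pt → κ}
    (hi : ∀ b, ∀ᶠ b' in B.nhds b, i b' = i b) {A₀ : κ → SAlg.{u} 𝕜} (M₀ : ∀ k, SBimod (A₀ k) A)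
    {α : ∀ k b, A₁ b →ₗ[𝕜] A₀ k} (hα : ∀ b, IsAlgTriv S₁ (α (i b)) b)
    (hiso : ∀ b, IsSAlgIso (α (i b) b)) (b : B.pt) :
    LocBimod (A₂ := fun _ => A) S₁ (fun s b => B.SmoothVecAt 𝕜 s b)
      (fun b => (M₀ (i b)).twistL (hiso b).toHom)
      (fun n b => B.SmoothVecAt (F := M₀ (i b)) 𝕜
        (fun b' => castMap M₀ (i b) (i b') (n b')) b) b := by
  refine ⟨A₀ (i b), A, M₀ (i b), α (i b), fun _ => LinearMap.id,
    fun b' => castMap M₀ (i b) (i b'), hα b, isAlgTriv_id b, ?_, ?_⟩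
  · filter_upwards [hi b] with b' hb'
    constructor
    · rw [← hb', castMap_self]
      exact Function.bijective_id
    · intro s
      have key : ∀ k, k = i b → (B.SmoothVecAt (F := M₀ k) 𝕜
          (fun b'' => castMap M₀ k (i b'') (s b'')) b' ↔
          B.SmoothVecAt (F := M₀ (i b)) 𝕜
          (fun b'' => castMap M₀ (i b) (i b'') (s b'')) b') := by
        rintro _ rfl
        rfl
      exact key _ hb'
  · filter_upwards [hi b] with b' hb'
    have key : ∀ k, i b' = k →
        (∀ (j : ZMod 2) (m : M₀ (i b')), m ∈ (M₀ (i b')).gr j →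
          castMap M₀ k (i b') m ∈ (M₀ k).gr j) ∧
        (∀ (a : A₁ b') (m : M₀ (i b')), castMap M₀ k (i b')
            ((M₀ (i b')).left (α (i b') b' a) m) =
          (M₀ k).left (α k b' a) (castMap M₀ k (i b') m)) ∧
        (∀ (a : A) (m : M₀ (i b')), castMap M₀ k (i b')
            ((M₀ (i b')).right a m) =
          (M₀ k).right a (castMap M₀ k (i b') m)) := by
      rintro _ rfl
      rw [castMap_self]
      exact ⟨fun _ _ h => h, fun _ _ => rfl, fun _ _ => rfl⟩
    exact key _ hb'

end TwistedFamily

section ExistsModBundle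

variable {𝕜 : Type} [RCLike 𝕜] {X : Mfd.{u}} {A : SAlg.{u} 𝕜} {V : TwoVB.{u} 𝕜 X}

theorem TwoVB.OfMoritaClass.exists_local_section (hV : V.OfMoritaClass A) (x₀ : X) :
    ∃ (O : Set X) (s : X → V.Y) (A₀ : SAlg.{u} 𝕜) (α : ∀ y, V.𝒜.fib y →ₗ[𝕜] A₀)
      (M₀ : SBimod A₀ A), IsOpen O ∧ x₀ ∈ O ∧ M₀.Invertible ∧ ∀ x ∈ O,
      Space.SmoothMapAt (B := Space.ofMfd X) (C := Space.ofMfd V.Y) s x ∧ V.π (s x) = x ∧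
      IsAlgTriv V.𝒜.smooth α (s x) := by
  obtain ⟨y, rfl⟩ := V.π_surj x₀
  obtain ⟨s, hs0, hs, hsπ⟩ := SuperTwoVect.exists_local_section V.π_subm y
  obtain ⟨A₀, α, hα, M₀, hM₀⟩ := hV y
  have h1 := hs.eventually
  rw [Space.nhds_ofMfd] at h1
  have h2 := hα.eventually
  have h2' : ∀ᶠ y' : V.Y in 𝓝 y, IsAlgTriv V.𝒜.smooth α y' := Space.nhds_ofMfd y ▸ h2
  have ht := hs.tendsto_ofMfd
  rw [hs0] at ht
  have hall : ∀ᶠ x : X in 𝓝 (V.π y),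
      Space.SmoothMapAt (B := Space.ofMfd X) (C := Space.ofMfd V.Y) s x ∧ V.π (s x) = x ∧
      IsAlgTriv V.𝒜.smooth α (s x) := by
    filter_upwards [h1, hsπ, ht.eventually h2'] with x h1 h2 h3
    exact ⟨h1, h2, h3⟩
  obtain ⟨O, hO, hOo, hxO⟩ := eventually_nhds_iff.1 hall
  exact ⟨O, s, A₀, α, M₀, hOo, hxO, hM₀, hO⟩

theorem TwoVB.OfMoritaClass.exists_modBundle (hV : V.OfMoritaClass A) :
    ∃ (κ : Type u) (_ : Countable κ) (O : κ → Set X) (hO : ∀ k, IsOpen (O k))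
      (π_surj : Function.Surjective (Mfd.sigmaπ hO))
      (π_subm : Manifold.IsSubmersion (X.sigma O hO).I X.I ∞ (Mfd.sigmaπ hO))
      (σ : X.sigma O hO → V.Y) (σ_smooth : _) (π_σ : _), Nonempty (TwoVB.Lift.ModBundle (V := V)
        ⟨X.sigma O hO, Mfd.sigmaπ hO, π_surj, π_subm, σ, σ_smooth, π_σ⟩ A) := by
  choose O s A₀ α M₀ hO hxO hM₀ H using hV.exists_local_section
  obtain ⟨S, hS, hSc⟩ := exists_countable_subcover O hO fun x => ⟨x, hxO x⟩
  have hOs : ∀ k : S, IsOpen (O k) := fun k => hO k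
  let σ : X.sigma (fun k : S => O k) hOs → V.Y :=
    fun y => s (Mfd.sigmaIdx (κ := S) hOs y).1 (Mfd.sigmaπ hOs y)
  have hσ : ∀ y, Space.SmoothMapAt (B := Space.ofMfd (X.sigma (fun k : S => O k) hOs))
      (C := Space.ofMfd V.Y) σ y :=
    Mfd.smoothMapAt_sigma hOs (C := Space.ofMfd V.Y) (f := fun k : S => s k)
      fun k x hx => (H k x hx).1
  have hα : ∀ y, IsAlgTriv V.𝒜.smooth (α (Mfd.sigmaIdx (κ := S) hOs y).1) (σ y) :=
    fun y => (H _ _ y.2.2).2.2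
  refine ⟨S, hS, fun k => O k, hOs, fun x => (hSc x).elim fun k hk => ⟨⟨k, x, hk⟩, rfl⟩,
    X.etaleCharted_isSubmersion (X.isLocalHomeomorph_sigma hOs), σ, hσ,
    fun y => (H _ _ y.2.2).2.1, ⟨
    { N := fun y => (M₀ (Mfd.sigmaIdx (κ := S) hOs y).1).twistL
        (Space.self_of_nhds (hα y).2).toHom
      smooth := _
      loc := locBimod_twistL (B := Space.ofMfd (X.sigma (fun k : S => O k) hOs))
        (i := Mfd.sigmaIdx (κ := S) hOs) (fun y => ?_) (fun k : S => M₀ k)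
        (α := fun k y => α k (σ y)) (fun y => (hα y).pull (hσ y)) _
      inv := fun y => (hM₀ _).twistL _ }⟩⟩
  have h := Space.nhds_ofMfd (M := X.sigma (fun k : S => O k) hOs) y
  rw [h]
  exact (Mfd.isLocallyConstant_sigmaIdx hOs).eventually_eq y

end ExistsModBundle

section ExistsRep

variable {𝕜 : Type} [RCLike 𝕜] {X : Mfd.{u}} {A : SAlg.{u} 𝕜} {V : TwoVB.{u} 𝕜 X}

theorem Mfd.smoothMapAt_sigma_map {κ ι : Type u} [Countable κ] [Countable ι] {O : κ → Set X}
    (hO : ∀ k, IsOpen (O k)) {W : ι → Set X} (hW : ∀ k, IsOpen (W k)) {r : ι → κ}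
    (hr : ∀ k, W k ⊆ O (r k)) (y : X.sigma W hW) :
    Space.SmoothMapAt (B := Space.ofMfd (X.sigma W hW)) (C := Space.ofMfd (X.sigma O hO))
      (fun y : X.sigma W hW => (⟨r y.1, y.2.1, hr _ y.2.2⟩ : X.sigma O hO)) y := by
  obtain ⟨s, hs, -, hs'⟩ := Mfd.exists_section_sigma hO (hr _ y.2.2)
  have hm : Manifold.IsSubmersion (X.sigma W hW).I X.I ∞ (Mfd.sigmaπ hW) :=
    X.etaleCharted_isSubmersion (X.isLocalHomeomorph_sigma hW)
  have hπ : Space.SmoothMapAt (B := Space.ofMfd (X.sigma W hW)) (C := Space.ofMfd X)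
      (Mfd.sigmaπ hW) y := Space.smoothMapAt_ofMfd hm.contMDiff y
  refine (Space.SmoothMapAt.comp (B := Space.ofMfd (X.sigma W hW)) (C := Space.ofMfd X)
    (D := Space.ofMfd (X.sigma O hO)) (g := s) (f := Mfd.sigmaπ hW) (b := y) hs hπ).congr ?_
  have := Space.nhds_ofMfd (M := X.sigma W hW) y
  rw [this]
  filter_upwards [hπ.tendsto_ofMfd.eventually hs',
    (Mfd.isLocallyConstant_sigmaIdx hW).eventually_eq y] with y' h1 h2
  obtain ⟨k, x⟩ := y
  obtain ⟨k', x', hx'⟩ := y'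
  obtain rfl : k' = k := h2
  exact h1.elim fun _ h => h

namespace TwoVB.Lift.ModBundle

variable {D : V.Lift} (M : D.ModBundle A)

/-- The maps `γ` are a smooth semilinear action at `p`. -/
def SmoothActAt (γ : ∀ p : (fib12 D.π D.π).pt, V.ℳ.fib (map₂ D D p) →ₗ[𝕜] M.N p.1.1 →ₗ[𝕜] M.N p.1.2)
    (g : (fib12 D.π D.π).pt → evenAut A) (p : (fib12 D.π D.π).pt) : Prop :=
  SBimod.IsAct (V.ℳ.fib (map₂ D D p)) (M.N p.1.1) (M.N p.1.2) (g p) (γ p) ∧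
  (∀ k n, pullSec 𝕜 (map₂ D D) V.ℳ.smooth k p →
    pullSec 𝕜 (fun p : (fib12 D.π D.π).pt => p.1.1) M.smooth n p →
    pullSec 𝕜 (fun p : (fib12 D.π D.π).pt => p.1.2) M.smooth (fun p => γ p (k p) (n p)) p) ∧
  (fib12 D.π D.π).SmoothLinAt 𝕜 (fun p => ((g p).1.toLinearMap : A →ₗ[𝕜] A)) p

theorem exists_smoothAct (hA : PicardSurjective A) (p₀ : (fib12 D.π D.π).pt) :
    ∃ γ g, ∀ᶠ p in (fib12 D.π D.π).nhds p₀, M.SmoothActAt γ g p := by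
  have h1 := V.ℳ.locBimod_pull (f := map₂ D D) smoothMapAt_map₂ p₀
  have h2 := LocBimod.pull_const (f := fun p : (fib12 D.π D.π).pt => p.1.1)
    Space.smoothMapAt_fst (M.loc p₀.1.1)
  have h3 := LocBimod.pull_const (f := fun p : (fib12 D.π D.π).pt => p.1.2)
    Space.smoothMapAt_snd (M.loc p₀.1.2)
  have e2 : pullSec 𝕜 (fun p : (fib12 D.π D.π).pt => p.1.1) D.alg.smooth =
      pullSec 𝕜 (fun p : (fib12 D.π D.π).pt => D.σ p.1.1) V.𝒜.smooth :=
    pullSec_comp_eq (V := fun x => (V.𝒜.fib x).carrier) Space.smoothMapAt_fst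
  have e3 : pullSec 𝕜 (fun p : (fib12 D.π D.π).pt => p.1.2) D.alg.smooth =
      pullSec 𝕜 (fun p : (fib12 D.π D.π).pt => D.σ p.1.2) V.𝒜.smooth :=
    pullSec_comp_eq (V := fun x => (V.𝒜.fib x).carrier) Space.smoothMapAt_snd
  rw [e2] at h2
  rw [e3] at h3
  exact exists_action hA h1 h2 h3 (V.ℳ_invertible _) (M.inv _) (M.inv _)

section Sigma

variable {κ : Type u} [Countable κ] {O : κ → Set X} {hO : ∀ k, IsOpen (O k)}
  {π_surj : Function.Surjective (Mfd.sigmaπ hO)}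
  {π_subm : Manifold.IsSubmersion (X.sigma O hO).I X.I ∞ (Mfd.sigmaπ hO)}
  {σ : X.sigma O hO → V.Y} {σ_smooth} {π_σ}
  (M : ModBundle (V := V) ⟨X.sigma O hO, Mfd.sigmaπ hO, π_surj, π_subm, σ, σ_smooth, π_σ⟩ A)

/-- There is a smooth semilinear action over the part of `O i ∩ O j` that lies in `G`. -/
def HasActOn (i j : κ) (G : Set X) : Prop :=
  ∃ γ g, ∀ p : (fib12 (Mfd.sigmaπ hO) (Mfd.sigmaπ hO)).pt, Mfd.sigmaIdx hO p.1.1 = i →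
    Mfd.sigmaIdx hO p.1.2 = j → Mfd.sigmaπ hO p.1.1 ∈ G → M.SmoothActAt γ g p

variable {M} in
theorem HasActOn.mono {i j : κ} {G G' : Set X} (h : M.HasActOn i j G) (hG : G' ⊆ G) :
    M.HasActOn i j G' := by
  obtain ⟨γ, g, h⟩ := h
  exact ⟨γ, g, fun p h1 h2 h3 => h p h1 h2 (hG h3)⟩

theorem hasActOn_empty (i j : κ) : M.HasActOn i j ∅ :=
  ⟨fun _ => 0, fun _ => 1, fun _ _ _ h => h.elim⟩

theorem exists_hasActOn (hA : PicardSurjective A) {i j : κ} {x : X} (hx : x ∈ O i ∩ O j) :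
    ∃ G ∈ 𝓝 x, M.HasActOn i j G := by
  obtain ⟨γ, g, h⟩ := M.exists_smoothAct hA ⟨(⟨i, x, hx.1⟩, ⟨j, x, hx.2⟩), rfl⟩
  obtain ⟨s, hs, hs0, hs'⟩ := Mfd.exists_section_sigma hO hx.1
  obtain ⟨t, ht, ht0, ht'⟩ := Mfd.exists_section_sigma hO hx.2
  obtain ⟨p, hp, hp'⟩ := exists_smooth_pair (π := Mfd.sigmaπ hO) hs ht (by
    filter_upwards [hs', ht'] with x hs ht
    obtain ⟨_, hs⟩ := hs
    obtain ⟨_, ht⟩ := ht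
    rw [hs, ht])
  have hp0 : p x = ⟨(⟨i, x, hx.1⟩, ⟨j, x, hx.2⟩), rfl⟩ := by
    refine Subtype.ext (hp'.self_of_nhds.trans ?_)
    rw [hs0, ht0]
    rfl
  rw [← hp0] at h
  have hev := hp.tendsto.eventually h
  rw [Space.nhds_ofMfd] at hev
  refine ⟨_, hev.and (hp'.and (hs'.and ht')), γ, g, fun q h1 h2 h3 => ?_⟩
  obtain ⟨h3, h4, ⟨_, h5⟩, ⟨_, h6⟩⟩ := h3
  have hq : q = p (Mfd.sigmaπ hO q.1.1) := by
    refine Subtype.ext (Eq.trans ?_ h4.symm)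
    rw [h5, h6]
    obtain ⟨⟨⟨k, x, hx⟩, ⟨l, x', hx'⟩⟩, hxx⟩ := q
    obtain rfl : k = i := h1
    obtain rfl : l = j := h2
    obtain rfl : x = x' := hxx
    rfl
  rw [hq]
  exact h3

theorem exists_rep {ι : Type u} [Countable ι] {W : ι → Set X} (hW : ∀ k, IsOpen (W k))
    (hc : ∀ x, ∃ k, x ∈ W k) {r : ι → κ} (hr : ∀ k, W k ⊆ O (r k))
    (hact : ∀ k l, M.HasActOn (r k) (r l) (W k ∩ W l)) :
    ∃ c : Cocycle A X, Countable c.ι ∧ V.Presented c := by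
  choose γ g H using hact
  let w : X.sigma W hW → X.sigma O hO := fun y => ⟨r y.1, y.2.1, hr _ y.2.2⟩
  have hw : ∀ y, Space.SmoothMapAt (B := Space.ofMfd (X.sigma W hW))
      (C := Space.ofMfd (X.sigma O hO)) w y := Mfd.smoothMapAt_sigma_map hO hW hr
  let D₀ : V.Lift := ⟨X.sigma O hO, Mfd.sigmaπ hO, π_surj, π_subm, σ, σ_smooth, π_σ⟩
  let D : V.Lift :=
    { Y := X.sigma W hW
      π := Mfd.sigmaπ hW
      π_surj := fun x => (hc x).elim fun k hk => ⟨⟨k, x, hk⟩, rfl⟩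
      π_subm := X.etaleCharted_isSubmersion (X.isLocalHomeomorph_sigma hW)
      σ := fun y => σ (w y)
      σ_smooth := fun y => Space.SmoothMapAt.comp (C := Space.ofMfd (X.sigma O hO)) (σ_smooth _)
        (hw y)
      π_σ := fun y => π_σ _ }
  let ww : (fib12 D.π D.π).pt → (fib12 D₀.π D₀.π).pt := fun p => ⟨(w p.1.1, w p.1.2), p.2⟩
  have hww : ∀ p, Space.SmoothMapAt ww p := fun p => Space.SmoothMapAt.mk_fibProd
    (Space.SmoothMapAt.comp (C := Space.ofMfd D.Y) (D := Space.ofMfd D₀.Y) (g := w) (hw _)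
      (Space.smoothMapAt_fst p))
    (Space.SmoothMapAt.comp (C := Space.ofMfd D.Y) (D := Space.ofMfd D₀.Y) (g := w) (hw _)
      (Space.smoothMapAt_snd p))
  have hgood : ∀ p : (fib12 D.π D.π).pt, M.SmoothActAt
      (γ (Mfd.sigmaIdx hW p.1.1) (Mfd.sigmaIdx hW p.1.2))
      (g (Mfd.sigmaIdx hW p.1.1) (Mfd.sigmaIdx hW p.1.2)) (ww p) := by
    intro p
    refine H _ _ (ww p) rfl rfl ⟨p.1.1.2.2, ?_⟩
    have h : Mfd.sigmaπ hW p.1.1 = Mfd.sigmaπ hW p.1.2 := p.2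
    exact (congrArg (· ∈ W (Mfd.sigmaIdx hW p.1.2)) h).mpr p.1.2.2.2
  have hidx : ∀ p : (fib12 D.π D.π).pt, ∀ᶠ p' in (fib12 D.π D.π).nhds p,
      Mfd.sigmaIdx hW p'.1.1 = Mfd.sigmaIdx hW p.1.1 ∧
      Mfd.sigmaIdx hW p'.1.2 = Mfd.sigmaIdx hW p.1.2 := by
    intro p
    have h1 := (Space.smoothMapAt_fst p).tendsto
    have h2 := (Space.smoothMapAt_snd p).tendsto
    have e1 := Space.nhds_ofMfd (M := D.Y) p.1.1
    have e2 := Space.nhds_ofMfd (M := D.Y) p.1.2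
    rw [e1] at h1
    rw [e2] at h2
    exact (h1.eventually ((Mfd.isLocallyConstant_sigmaIdx hW).eventually_eq _)).and
      (h2.eventually ((Mfd.isLocallyConstant_sigmaIdx hW).eventually_eq _))
  have hloc : ∀ y, LocBimod (A₂ := fun _ => A) D.alg.smooth
      (fun s b => (Space.ofMfd D.Y).SmoothVecAt 𝕜 s b) (fun y => M.N (w y))
      (pullSec (B := Space.ofMfd D.Y) 𝕜 w M.smooth) y := by
    intro y
    have h := LocBimod.pull_const (B := Space.ofMfd D.Y) (C := Space.ofMfd D₀.Y) (A₁ := D₀.alg.fib)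
      (S₁ := D₀.alg.smooth) (N := M.N) (S := M.smooth) (f := w) (b := y) hw (M.loc (w y))
    have e : pullSec (B := Space.ofMfd D.Y) 𝕜 w D₀.alg.smooth =
        pullSec (B := Space.ofMfd D.Y) 𝕜 (fun y => σ (w y)) V.𝒜.smooth :=
      pullSec_comp_eq (V := fun x => (V.𝒜.fib x).carrier) hw
    exact (congrArg (fun S => LocBimod (B := Space.ofMfd D.Y) (A₁ := fun y => V.𝒜.fib (σ (w y)))
      (A₂ := fun _ => A) S (fun s b => (Space.ofMfd D.Y).SmoothVecAt 𝕜 s b) (fun y => M.N (w y))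
      (pullSec (B := Space.ofMfd D.Y) 𝕜 w M.smooth) y) e).mp h
  let R : D.Rep A :=
    { N := fun y => M.N (w y)
      smooth := pullSec (B := Space.ofMfd D.Y) 𝕜 w M.smooth
      loc := hloc
      inv := fun y => M.inv _
      act := fun p => γ (Mfd.sigmaIdx hW p.1.1) (Mfd.sigmaIdx hW p.1.2) (ww p)
      g := fun p => g (Mfd.sigmaIdx hW p.1.1) (Mfd.sigmaIdx hW p.1.2) (ww p)
      isAct := fun p => (hgood p).1
      smooth_act := fun p k n hk hn => by
        have hn' := (pullSec_comp (𝕜 := 𝕜) (V := fun x => (M.N x).carrier) (S := M.smooth) (g := w)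
          (Space.smoothMapAt_fst p) n).1 hn
        refine (pullSec_comp (𝕜 := 𝕜) (V := fun x => (M.N x).carrier) (S := M.smooth) (g := w)
          (Space.smoothMapAt_snd p) _).2 ?_
        have h := smooth_mul_pull (p := map₂ D₀ D₀)
          (q := fun t : (fib12 D₀.π D₀.π).pt => t.1.1) (r := fun t : (fib12 D₀.π D₀.π).pt => t.1.2)
          (γ (Mfd.sigmaIdx hW p.1.1) (Mfd.sigmaIdx hW p.1.2))
          (fun _ _ hσ hτ => (hgood p).2.1 _ _ (pullSec_of hσ) (pullSec_of hτ)) (hww p)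
          (Space.smoothMapAt_snd _) (M.loc _).isVBAt hk hn'
        refine IsVBAt.congr (IsVBAt.pull (f := fun p : (fib12 D.π D.π).pt => w p.1.2)
          (M.loc _).isVBAt (Space.SmoothMapAt.comp (C := Space.ofMfd D.Y) (D := Space.ofMfd D₀.Y)
            (g := w) (hw _) (Space.smoothMapAt_snd p))) h ?_
        filter_upwards [hidx p] with p' hp'
        exact congrArg₂ (fun i j => γ i j (ww p') (k p') (n p')) hp'.1.symm hp'.2.symm
      smooth_g := fun p v => by
        refine (((hgood p).2.2 v).comp (hww p)).congr ?_
        filter_upwards [hidx p] with p' hp'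
        exact congrArg₂ (fun i j => (g i j (ww p')).1 v) hp'.1.symm hp'.2.symm }
  exact ⟨R.cocycle, inferInstanceAs (Countable ι), R.presented_cocycle⟩

end Sigma

end TwoVB.Lift.ModBundle

theorem TwoVB.OfMoritaClass.exists_presented (hA : PicardSurjective A) (hV : V.OfMoritaClass A) :
    ∃ c : Cocycle A X, Countable c.ι ∧ V.Presented c := by
  obtain ⟨κ, _, O, hO, π_surj, π_subm, σ, σ_smooth, π_σ, ⟨M⟩⟩ := hV.exists_modBundle
  have h : ∀ i j x, ∃ G : Set X, x ∈ O i ∩ O j → G ∈ 𝓝 x ∧ M.HasActOn i j G := by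
    intro i j x
    by_cases hx : x ∈ O i ∩ O j
    · obtain ⟨G, hG, h⟩ := M.exists_hasActOn hA hx
      exact ⟨G, fun _ => ⟨hG, h⟩⟩
    · exact ⟨∅, fun h => (hx h).elim⟩
  choose G hG using h
  obtain ⟨ι, _, W, r, hW, hc, hr, h⟩ := Mfd.exists_refinement hO
    (fun x => (π_surj x).elim fun y hy => ⟨Mfd.sigmaIdx hO y, hy ▸ y.2.2⟩)
    fun i j x hx => (hG i j x hx).1
  refine M.exists_rep hW hc hr fun k l => ?_
  obtain he | he := (W k ∩ W l).eq_empty_or_nonempty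
  · rw [he]
    exact M.hasActOn_empty _ _
  · obtain ⟨x, hx, hs⟩ := h k l he
    exact (hG _ _ x hx).2.mono hs

end ExistsRep

section Classification

variable {𝕜 : Type} [RCLike 𝕜] {A : SAlg.{u} 𝕜} {X : Mfd.{u}}

/-- The Čech class of a cocycle that presents a super 2-vector bundle. -/
def classify (hA : PicardSurjective A) : IsoClasses A X → CechH1 X A :=
  Quot.lift (fun V => cechClass (V.2.exists_presented hA).choose) fun V W h =>
    Quot.sound (h.equivalent hA (V.2.exists_presented hA).choose_spec.2
      (W.2.exists_presented hA).choose_spec.2)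

theorem classify_isoClass (hA : PicardSurjective A)
    (V : {V : TwoVB.{u} 𝕜 X // V.OfMoritaClass A}) {c : Cocycle A X} (h : V.1.Presented c) :
    classify hA (isoClass V) = cechClass c :=
  Quot.sound (V.1.isomorphic_refl.equivalent hA (V.2.exists_presented hA).choose_spec.2 h)

theorem isoClass_eq_of_cechClass_eq {V V' : TwoVB.{u} 𝕜 X} {c c' : Cocycle A X}
    (h : V.Presented c) (h' : V'.Presented c') (hV : V.OfMoritaClass A) (hV' : V'.OfMoritaClass A)
    (hc : cechClass c = cechClass c') : isoClass ⟨V, hV⟩ = isoClass ⟨V', hV'⟩ := by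
  replace hc := Quot.eqvGen_exact hc
  induction hc generalizing V V' with
  | rel c c' hc =>
    obtain ⟨W, hW, h1, h2⟩ := hc.exists_twoVB
    exact (h.isoClass_eq h1 hV hW).trans (h2.isoClass_eq h' hW hV')
  | refl c => exact h.isoClass_eq h' hV hV'
  | symm c c' _ ih => exact (ih h' h hV' hV).symm
  | trans c d c' _ _ ih ih' =>
    obtain ⟨W, hW, h1, _⟩ := (Cocycle.Equivalent.refl d).exists_twoVB
    exact (ih h h1 hV hW).trans (ih' h1 h' hW hV')

theorem classify_bijective (hA : PicardSurjective A) :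
    Function.Bijective (classify hA (X := X)) := by
  constructor
  · rintro ⟨V⟩ ⟨W⟩ h
    exact isoClass_eq_of_cechClass_eq (V.2.exists_presented hA).choose_spec.2
      (W.2.exists_presented hA).choose_spec.2 V.2 W.2 h
  · rintro ⟨c⟩
    obtain ⟨W, hW, h, _⟩ := (Cocycle.Equivalent.refl c).exists_twoVB
    exact ⟨isoClass ⟨W, hW⟩, classify_isoClass hA ⟨W, hW⟩ h⟩

/-- Isomorphism classes of super 2-vector bundles of Morita class `A` are classified by the
Čech cohomology with values in `AUT(A)`. -/
def classifyEquiv (hA : PicardSurjective A) : IsoClasses A X ≃ CechH1 X A :=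
  Equiv.ofBijective _ (classify_bijective hA)

theorem exists_countable_cechClass (hA : PicardSurjective A) (x : CechH1 X A) :
    ∃ c : Cocycle A X, Countable c.ι ∧ cechClass c = x := by
  obtain ⟨⟨V⟩, rfl⟩ := (classify_bijective hA).surjective x
  exact ⟨_, (V.2.exists_presented hA).choose_spec.1, rfl⟩

end Classification

end SuperTwoVect

end

theorem mainTheorem1 {𝕜 : Type} [RCLike 𝕜] (A : SuperTwoVect.SAlg.{u} 𝕜)
    (hPic : SuperTwoVect.PicardSurjective A) (hHH : Subsingleton (SuperTwoVect.HH1 A))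
    (X : SuperTwoVect.Mfd.{u}) :
    ∃! e : SuperTwoVect.CechH1 X A ≃ SuperTwoVect.IsoClasses A X,
      ∀ c : SuperTwoVect.Cocycle A X, Countable c.ι →
        (∃ V : {V : SuperTwoVect.TwoVB.{u} 𝕜 X // V.OfMoritaClass A}, V.1.IsAssociatedTo c) ∧
        ∀ V : {V : SuperTwoVect.TwoVB.{u} 𝕜 X // V.OfMoritaClass A},
          V.1.IsAssociatedTo c →
            e (SuperTwoVect.cechClass c) = SuperTwoVect.isoClass V := by
  refine ⟨(SuperTwoVect.classifyEquiv hPic).symm, fun c hc => ⟨⟨⟨c.toTwoVB, c.ofMoritaClass_toTwoVB⟩,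
    c.isAssociatedTo_toTwoVB⟩, fun V hV => ?_⟩, fun e he => ?_⟩
  · rw [Equiv.symm_apply_eq]
    exact (SuperTwoVect.classify_isoClass hPic V hV.exists_pres_self).symm
  · ext x
    obtain ⟨c, hc, rfl⟩ := SuperTwoVect.exists_countable_cechClass hPic x
    rw [(he c hc).2 ⟨c.toTwoVB, c.ofMoritaClass_toTwoVB⟩ c.isAssociatedTo_toTwoVB,
      Equiv.eq_symm_apply]
    exact SuperTwoVect.classify_isoClass hPic ⟨c.toTwoVB, c.ofMoritaClass_toTwoVB⟩
      c.isAssociatedTo_toTwoVB.exists_pres_self
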